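/- **Notation.** Let $G$ be a finite group, $\overline{\mathbf Q}$ the algebraic closure of $\mathbf Q$ in $\mathbf C$, $\Omega=\mathrm{Gal}(\overline{\mathbf Q}/\mathbf Q)$, $\widehat{\mathbf Z}=\prod_p\mathbf Z_p$, and $J_f=(\widehat{\mathbf Z}\otimes_{\mathbf Z}\overline{\mathbf Q})^\times$ the group of finite ideles of $\overline{\mathbf Q}$ (the direct limit of the finite idele groups of the number fields in $\overline{\mathbf Q}$). Let $R_G$ be the group of complex virtual characters of $G$ and $R_G^s$ the subgroup generated by the characters of symplectic representations, i.e. of those which carry a non-degenerate $G$-invariant alternating form. For $x\in\widehat{\mathbf Z}[G]^\times$ let $\mathrm{Det}(x)\in\mathrm{Hom}_\Omega(R_G,J_f)$ be given by $\mathrm{Det}(x)(\psi)=\det T(x)$ if $\psi$ is the character of $T$, and use the same formula for invertible matrices over group rings; $\mathrm{Det}^s(\widehat{\mathbf Z}[G]^\times)$ is the group of restrictions of the $\mathrm{Det}(x)$ to $R_G^s$. Let $\mathrm{Hom}_\Omega^+(R_G^s,\overline{\mathbf Q}^\times)$ be the group of Galois equivariant homomorphisms with totally positive values, and put $\Delta^s(f)=f\times|f|$.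 Define $$\mathrm H^s(\mathbf Z[G])=\frac{\mathrm{Hom}_\Omega(R_G^s,J_f)\times\mathrm{Hom}(R_G^s,\mathbf R^\times)}{\mathrm{Im}(\Delta^s)\cdot(\mathrm{Det}^s(\widehat{\mathbf Z}[G]^\times)\times1)},\qquad \mathrm A^s(\mathbf Z[G])=\frac{\mathrm{Hom}_\Omega(R_G^s,J_f)\times\mathrm{Hom}(R_G^s,\mathbf R_{>0})}{\mathrm{Im}(\Delta^s)\cdot(\mathrm{Det}^s(\widehat{\mathbf Z}[G]^\times)\times1)} .$$ There is a natural map $\mathrm A^s(\mathbf Z[G])\to\mathrm H^s(\mathbf Z[G])$, through which classes of $\mathrm A^s(\mathbf Z[G])$ are regarded as classes of $\mathrm H^s(\mathbf Z[G])$. The signature group $\mathrm S_\infty(\mathbf Z[G])$ is the image of $1\times\mathrm{Hom}(R_G^s,\pm1)$ in $\mathrm H^s(\mathbf Z[G])$. Let $P^\bullet$ be a perfect $\mathbf Z[G]$-complex, i.e. a bounded complex of finitely generated locally free $\mathbf Z[G]$-modules, and let $\sigma^{\rm ev},\sigma^{\rm odd}$ be $G$-invariant real-valued symmetric bilinear forms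 on $\mathrm H^{\rm ev}(P^\bullet_{\mathbf Q})=\bigoplus_{i\text{ even}}\mathrm H^i(P^\bullet_{\mathbf Q})$ and $\mathrm H^{\rm odd}(P^\bullet_{\mathbf Q})=\bigoplus_{i\text{ odd}}\mathrm H^i(P^\bullet_{\mathbf Q})$, whose extensions to $\mathbf R\otimes_{\mathbf Q}\mathrm H^{\rm ev}$ and $\mathbf R\otimes_{\mathbf Q}\mathrm H^{\rm odd}$ are non-degenerate. Choose $\mathbf Z_p[G]$-bases $\{a_p^{ij}\}_j$ of $\mathbf Z_p\otimes P^i$ for all primes $p$, $\mathbf Q[G]$-bases $\{a_0^{ij}\}_j$ of $\mathbf Q\otimes P^i$, and let $\lambda^i_p$ be the matrix over $\mathbf Q_p[G]$ with $\lambda^i_pa_p^{ij}=a_0^{ij}$. For a complex representation $W$ let $r_G(a\otimes w)=\sum_{g}ga\otimes gw$ and let $\xi:\det((P^\bullet\otimes W)^G)\cong\det((\mathrm H^\bullet(P^\bullet)\otimes W)^G)$ be the canonical isomorphism, where $\det(C^\bullet)=\bigotimes_i(\wedge^{\rm top}C^i)^{(-1)^i}$. *Hermitian class.* Let $\{W_m\}$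 be symplectic representations of $G$ whose characters $\theta_m$ form a $\mathbf Z$-basis of $R_G^s$; let $\kappa_m$ be a non-degenerate $G$-invariant alternating form on $W_m$ and $\{w_{mn}\}_n$ a hyperbolic basis $u_1,u_1',u_2,u_2',\dots$ of $W_m$ for $\kappa_m$ (that is, $\kappa_m(u_k,u_l')=\delta_{kl}$ and $\kappa_m(u_k,u_l)=\kappa_m(u_k',u_l')=0$). For a non-degenerate alternating form $h$ on $E$, $\mathrm{Pf}_h:\wedge^{\rm top}E\to\mathbf C$ is the linear map with value $1$ on the exterior product of a hyperbolic basis. Write $\mathrm{Pf}_{(\sigma\otimes\kappa_m)^G}=\mathrm{Pf}_{(\sigma^{\rm ev}\otimes\kappa_m)^G}\otimes\mathrm{Pf}_{(\sigma^{\rm odd}\otimes\kappa_m)^G}^{-1}$. Then $\chi^s_{\rm H}(P^\bullet,\sigma)\in\mathrm H^s(\mathbf Z[G])$ is the class represented by $$\theta_m\longmapsto\prod_{p<\infty}\prod_i\mathrm{Det}(\lambda^i_p)(\theta_m)^{(-1)^i}\times\mathrm{Pf}_{(\sigma\otimes\kappa_m)^G}\Big(\xi_m\big(\textstyle\bigotimes_i(\wedge_{jn}r_G(a_0^{ij}\otimes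 w_{mn}))^{(-1)^i}\big)\Big).$$ *Arakelov class.* Let $V_r$ be the simple two-sided ideals of $\mathbf C[G]$, with irreducible characters $\chi_r$, and let $\{v_{rs}\}_s$ be an orthonormal basis of $V_r$ for the restriction $\nu_r$ of the hermitian form $\nu(\sum l_gg,\sum m_gg)=|G|\sum_gl_g\overline{m_g}$. For metrics $h=\{h_r\}$ on the lines $\det((\mathrm H^\bullet(P^\bullet)\otimes V_r)^G)$, the class $\chi_{\rm A}^s(P^\bullet,h)\in\mathrm A^s(\mathbf Z[G])$ is represented by the restriction to $R_G^s$ of the homomorphism on $R_G$ with $$\overline\chi_r\longmapsto\prod_{p<\infty}\prod_i\mathrm{Det}(\lambda^i_p)(\overline\chi_r)^{(-1)^i}\times h_r\Big(\xi_r\big(\textstyle\bigotimes_i(\wedge_{js}r_G(a_0^{ij}\otimes v_{rs}))^{(-1)^i}\big)\Big)^{1/\chi_r(1)} .$$ The forms $\sigma$ induce metrics $h_\sigma=\{h_r\}$: $h_r$ is the norm (the square root of the quadratic form) attached to the positive definite hermitian form $|\det((\sigma^{\rm ev}\otimes\nu_r)^G)|\otimes|\det((\sigma^{\rm odd}\otimes\nu_r)^G)|^{-1}$.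 *Signatures.* A non-degenerate $G$-invariant symmetric form $\tau$ on a finite dimensional $\mathbf R[G]$-module $M$ admits $G$-decompositions $M=M^+\oplus M^-$ with $\tau$ positive definite on $M^+$ and negative definite on $M^-$; put $n_m^-(\tau)=\dim_{\mathbf C}(M^-\otimes_{\mathbf R}W_m)^G$. Let $n_m^-(\sigma)=n_m^-(\sigma^{\rm ev})-n_m^-(\sigma^{\rm odd})$, for the forms extended to $\mathrm H^{\rm ev}(P^\bullet_{\mathbf R})$ and $\mathrm H^{\rm odd}(P^\bullet_{\mathbf R})$. **Theorem.** The classes $\chi^s_{\rm H}(P^\bullet,\sigma)$ and $\chi^s_{\rm A}(P^\bullet,h_\sigma)$ are well defined, i.e. they exist and are independent of all choices of bases and of forms $\kappa_m$; the decompositions used to define $n_m^-(\sigma^{\rm ev})$ and $n_m^-(\sigma^{\rm odd})$ exist; and $$\chi^s_{\rm H}(P^\bullet,\sigma)\cdot\chi^s_{\rm A}(P^\bullet,h_\sigma)^{-1}\in\mathrm S_\infty(\mathbf Z[G]).$$ This class is represented by $1\times s$ for a homomorphism $s:R_G^s\to\{\pm1\}$ such that $s(\theta_m)=(\sqrt{-1})^{\,n_m^-(\sigma)}$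 for all $m$ and for any choice of the decompositions. -/

import Mathlib

open scoped TensorProduct DirectSum ComplexConjugate

namespace HermClass

noncomputable section

/-! ### Coefficients -/

/-- The algebraic closure of `ℚ` inside `ℂ`. -/
abbrev Qbar : Type := algebraicClosure ℚ ℂ

/-- The absolute Galois group of `ℚ`. -/
abbrev Omega : Type := Qbar ≃ₐ[ℚ] Qbar

/-- `Ẑ = ∏_p ℤ_p`. -/
abbrev Zhat : Type := (p : Nat.Primes) → @PadicInt p ⟨p.2⟩

/-- `Ẑ ⊗ Q̄`. For a number field `E` the ring `Ẑ ⊗ E` is the ring of finite adeles of `E`, so that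
`Ẑ ⊗ Q̄` is the direct limit of the rings of finite adeles of the number fields `E ⊆ Q̄`. -/
def AQbar : Type := Zhat ⊗[ℤ] Qbar

instance : CommRing AQbar := inferInstanceAs (CommRing (Zhat ⊗[ℤ] Qbar))

/-- The finite ideles of `Q̄`. -/
abbrev Jf : Type := AQbarˣ

/-- `Ẑ ⊗ ℚ`, the finite adeles of `ℚ`. -/
def AQ : Type := Zhat ⊗[ℤ] ℚ

instance : CommRing AQ := inferInstanceAs (CommRing (Zhat ⊗[ℤ] ℚ))

/-- `Ẑ ⊗ ℂ`, an overring of `Ẑ ⊗ Q̄`, in which determinants of complex matrix representations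
are computed. -/
def AC : Type := Zhat ⊗[ℤ] ℂ

instance : CommRing AC := inferInstanceAs (CommRing (Zhat ⊗[ℤ] ℂ))

/-- The inclusion `Ẑ ⊗ Q̄ → Ẑ ⊗ ℂ`. -/
def inclC : AQbar →+* AC :=
  (Algebra.TensorProduct.map (AlgHom.id ℤ Zhat) (algebraMap Qbar ℂ).toIntAlgHom).toRingHom

/-- The inclusion `Ẑ ⊗ ℚ → Ẑ ⊗ ℂ`. -/
def inclQ : AQ →+* AC :=
  (Algebra.TensorProduct.map (AlgHom.id ℤ Zhat) (algebraMap ℚ ℂ).toIntAlgHom).toRingHom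

/-- The inclusion `Ẑ → Ẑ ⊗ ℂ`. -/
def inclZ : Zhat →+* AC :=
  (Algebra.TensorProduct.includeLeft : Zhat →ₐ[ℤ] Zhat ⊗[ℤ] ℂ).toRingHom

/-- The inclusion `Q̄ → Ẑ ⊗ Q̄`. -/
def diagQbar : Qbar →+* AQbar :=
  (Algebra.TensorProduct.includeRight : Qbar →ₐ[ℤ] Zhat ⊗[ℤ] Qbar).toRingHom

/-- The Galois action on `Ẑ ⊗ Q̄`, through the second factor. -/
def galA (ω : Omega) : AQbar →+* AQbar :=
  (Algebra.TensorProduct.map (AlgHom.id ℤ Zhat)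
    ((ω : Qbar ≃+* Qbar).toRingHom).toIntAlgHom).toRingHom

/-- The Galois action on the finite ideles of `Q̄`. -/
def galJ (ω : Omega) : Jf →* Jf := Units.map (galA ω : AQbar →* AQbar)

/-- The Galois action on `Q̄ˣ`. -/
def galQ (ω : Omega) : Qbarˣ →* Qbarˣ :=
  Units.map (((ω : Qbar ≃+* Qbar).toRingHom : Qbar →+* Qbar) : Qbar →* Qbar)

lemma galJ_diag (ω : Omega) (z : Qbarˣ) :
    galJ ω (Units.map (diagQbar : Qbar →* AQbar) z)
      = Units.map (diagQbar : Qbar →* AQbar) (galQ ω z) := by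
  refine Units.ext ?_
  change Algebra.TensorProduct.map (AlgHom.id ℤ Zhat) _ ((1 : Zhat) ⊗ₜ[ℤ] (z : Qbar)) = _
  rw [Algebra.TensorProduct.map_tmul]
  rfl

/-! ### Character groups -/

section Characters

variable (G : Type*) [Group G]

/-- The functions on `G` that are the character of a finite dimensional complex representation. -/
def IsChar (χ : G → ℂ) : Prop :=
  ∃ (n : ℕ) (T : G →* Matrix (Fin n) (Fin n) ℂ), ∀ g, χ g = (T g).trace

/-- The functions on `G` that are the character of a symplectic complex representation, that is
of a representation which preserves a non-degenerate alternating form. -/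
def IsSympChar (χ : G → ℂ) : Prop :=
  ∃ (n : ℕ) (T : G →* Matrix (Fin n) (Fin n) ℂ) (J : Matrix (Fin n) (Fin n) ℂ),
    J.transpose = -J ∧ IsUnit J.det ∧ (∀ g, (T g).transpose * J * T g = J) ∧
    ∀ g, χ g = (T g).trace

/-- The group `R_G` of virtual characters. -/
def RG : AddSubgroup (G → ℂ) := AddSubgroup.closure {χ | IsChar G χ}

/-- The group `R_G^s` of virtual symplectic characters. -/
def RGs : AddSubgroup (G → ℂ) := AddSubgroup.closure {χ | IsSympChar G χ}

lemma RGs_le_RG : RGs G ≤ RG G :=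
  AddSubgroup.closure_mono fun _ ⟨n, T, _, _, _, _, h⟩ => ⟨n, T, h⟩

variable {G}

/-- `χ' = ω ∘ χ` (characters take values in `Q̄`). -/
def IsGalConj (ω : Omega) (χ χ' : G → ℂ) : Prop :=
  ∀ g, ∃ z : Qbar, (z : ℂ) = χ g ∧ ((ω z : Qbar) : ℂ) = χ' g

/-- `Hom_Ω(A, J_f)` for a group `A` of virtual characters. -/
def HomOmega (A : AddSubgroup (G → ℂ)) : Subgroup (Multiplicative A →* Jf) where
  carrier := {f | ∀ (ω : Omega) (χ χ' : A), IsGalConj ω (χ : G → ℂ) χ' →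
    f (.ofAdd χ') = galJ ω (f (.ofAdd χ))}
  one_mem' := by intro ω χ χ' _; simp
  mul_mem' := by intro f f' hf hf' ω χ χ' h; simp [hf ω χ χ' h, hf' ω χ χ' h]
  inv_mem' := by intro f hf ω χ χ' h; simp [hf ω χ χ' h]

/-- `Hom_Ω⁺(A, Q̄ˣ)` for a group `A` of virtual characters: the Galois equivariant homomorphisms
all of whose values are totally positive, i.e. have positive real conjugates. -/
def HomOmegaPlus (A : AddSubgroup (G → ℂ)) : Subgroup (Multiplicative A →* Qbarˣ) where
  carrier := {f | (∀ (ω : Omega) (χ χ' : A), IsGalConj ω (χ : G → ℂ) χ' →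
      f (.ofAdd χ') = galQ ω (f (.ofAdd χ))) ∧
    ∀ (ω : Omega) (χ : A), ∃ r : ℝ, 0 < r ∧ ((galQ ω (f (.ofAdd χ)) : Qbar) : ℂ) = r}
  one_mem' := ⟨by intro ω χ χ' _; simp, fun ω χ => ⟨1, one_pos, by simp⟩⟩
  mul_mem' := by
    rintro f f' ⟨hf, pf⟩ ⟨hf', pf'⟩
    refine ⟨fun ω χ χ' h => by simp [hf ω χ χ' h, hf' ω χ χ' h], fun ω χ => ?_⟩
    obtain ⟨r, hr, e⟩ := pf ω χ
    obtain ⟨r', hr', e'⟩ := pf' ω χ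
    exact ⟨r * r', mul_pos hr hr', by simp [e, e']⟩
  inv_mem' := by
    rintro f ⟨hf, pf⟩
    refine ⟨fun ω χ χ' h => by simp [hf ω χ χ' h], fun ω χ => ?_⟩
    obtain ⟨r, hr, e⟩ := pf ω χ
    refine ⟨r⁻¹, inv_pos.mpr hr, ?_⟩
    rw [MonoidHom.inv_apply, map_inv, Units.val_inv_eq_inv_val]
    push_cast
    rw [e]

/-- Restriction of character functions from `R_G` to `R_G^s`. -/
def inclR : Multiplicative (RGs G) →* Multiplicative (RG G) :=
  AddMonoidHom.toMultiplicative (AddSubgroup.inclusion (RGs_le_RG G))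

/-- Restriction `Hom_Ω(R_G, J_f) → Hom_Ω(R_G^s, J_f)`. -/
def restrictHom : HomOmega (RG G) →* HomOmega (RGs G) where
  toFun f := ⟨(f : Multiplicative (RG G) →* Jf).comp inclR, fun ω χ χ' h =>
    f.2 ω (AddSubgroup.inclusion (RGs_le_RG G) χ) (AddSubgroup.inclusion (RGs_le_RG G) χ') h⟩
  map_one' := rfl
  map_mul' _ _ := rfl

/-! ### Class groups -/

/-- The inclusion `ℂ → Ẑ ⊗ ℂ`. -/
def diagC : ℂ →+* AC :=
  (Algebra.TensorProduct.includeRight : ℂ →ₐ[ℤ] Zhat ⊗[ℤ] ℂ).toRingHom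

/-- The ring homomorphism `x = ∑ x_g g ↦ T(x) = ∑ φ(x_g) T(g)` from a group ring `k[G]` to matrices
over `Ẑ ⊗ ℂ`, for a complex representation `T` and a ring homomorphism `φ : k → Ẑ ⊗ ℂ`. -/
def evalRep {k : Type*} [CommRing k] (φ : k →+* AC) {n : ℕ} (T : G →* Matrix (Fin n) (Fin n) ℂ) :
    MonoidAlgebra k G →+* Matrix (Fin n) (Fin n) AC :=
  MonoidAlgebra.liftNCRingHom ((Matrix.scalar (Fin n)).comp φ)
    ((diagC.mapMatrix : Matrix (Fin n) (Fin n) ℂ →+* Matrix (Fin n) (Fin n) AC).toMonoidHom.comp T)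
    (fun _ _ => Matrix.scalar_commute _ (fun r => Commute.all _ r) _)

/-- `Det(Ẑ[G]ˣ)`, as a subgroup of `Hom_Ω(R_G, J_f)`: the functions `Det(x)` whose value at the
character of a representation `T` is `det T(x)`. -/
def DetZhat : Subgroup (HomOmega (RG G)) where
  carrier := {f | ∃ x : (MonoidAlgebra Zhat G)ˣ, ∀ (n : ℕ) (T : G →* Matrix (Fin n) (Fin n) ℂ)
    (ψ : RG G), (∀ g, (ψ : G → ℂ) g = (T g).trace) →
    inclC ((f.1 (.ofAdd ψ) : Jf) : AQbar) = (evalRep inclZ T (x : MonoidAlgebra Zhat G)).det}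
  one_mem' := ⟨1, fun n T ψ h => by simp⟩
  mul_mem' := by
    rintro f f' ⟨x, hx⟩ ⟨x', hx'⟩
    exact ⟨x * x', fun n T ψ h => by simp [← hx n T ψ h, ← hx' n T ψ h]⟩
  inv_mem' := by
    rintro f ⟨x, hx⟩
    refine ⟨x⁻¹, fun n T ψ h => ?_⟩
    have h1 : (evalRep inclZ T (x : MonoidAlgebra Zhat G)).det *
        (evalRep inclZ T ((x⁻¹ : (MonoidAlgebra Zhat G)ˣ) : MonoidAlgebra Zhat G)).det = 1 := by
      rw [← Matrix.det_mul, ← map_mul, Units.mul_inv, map_one, Matrix.det_one]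
    have h2 : inclC ((f.1 (.ofAdd ψ) : Jf) : AQbar) *
        inclC ((((f⁻¹ : HomOmega (RG G)).1 (.ofAdd ψ)) : Jf) : AQbar) = 1 := by
      rw [← map_mul, ← Units.val_mul]
      simp
    rw [hx n T ψ h] at h2
    exact left_inv_eq_right_inv (by rw [mul_comm]; exact h2) h1

/-- `Det^s(Ẑ[G]ˣ)`, the restriction of `Det(Ẑ[G]ˣ)` to `R_G^s`. -/
def DetZhatS : Subgroup (HomOmega (RGs G)) := DetZhat.map restrictHom

/-- The absolute value `Q̄ˣ → ℝ_{>0}` given by the inclusion `Q̄ ⊆ ℂ`. -/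
def absQbar : Qbarˣ →* Units.posSubgroup ℝ where
  toFun z := ⟨Units.mk0 ‖((z : Qbar) : ℂ)‖ (by simp), by simp [Units.mem_posSubgroup]⟩
  map_one' := by ext; simp
  map_mul' z z' := by ext; simp

/-- `Hom_Ω⁺(R_G^s, Q̄ˣ) → Hom_Ω(R_G^s, J_f)`, induced by the diagonal inclusion. -/
def toHomOmega : HomOmegaPlus (RGs G) →* HomOmega (RGs G) where
  toFun f := ⟨(Units.map (diagQbar : Qbar →* AQbar)).comp f.1, fun ω χ χ' h => by
    rw [MonoidHom.comp_apply, MonoidHom.comp_apply, f.2.1 ω χ χ' h, galJ_diag]⟩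
  map_one' := by ext; simp
  map_mul' f f' := by ext; simp

/-- `Hom_Ω⁺(R_G^s, Q̄ˣ) → Hom(R_G^s, ℝ_{>0})`, `f ↦ |f|`. -/
def toHomPos : HomOmegaPlus (RGs G) →* (Multiplicative (RGs G) →* Units.posSubgroup ℝ) where
  toFun f := absQbar.comp f.1
  map_one' := by ext; simp
  map_mul' f f' := by ext; simp

/-- The inclusion `Hom(R_G^s, ℝ_{>0}) → Hom(R_G^s, ℝˣ)`. -/
def posToReal : (Multiplicative (RGs G) →* Units.posSubgroup ℝ) →*
    (Multiplicative (RGs G) →* ℝˣ) where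
  toFun f := (Units.posSubgroup ℝ).subtype.comp f
  map_one' := rfl
  map_mul' _ _ := rfl

variable (G)

/-- The numerator `Hom_Ω(R_G^s, J_f) × Hom(R_G^s, ℝ_{>0})` of the symplectic Arakelov
class group. -/
def NumA : Type _ := HomOmega (RGs G) × (Multiplicative (RGs G) →* Units.posSubgroup ℝ)

instance : CommGroup (NumA G) := inferInstanceAs (CommGroup (HomOmega (RGs G) × (Multiplicative (RGs G) →* Units.posSubgroup ℝ)))

/-- The denominator `Im(Δ^s) · (Det^s(Ẑ[G]ˣ) × 1)` of the symplectic Arakelov class group, where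
`Δ^s(f) = f × |f|`. -/
def DenA : Subgroup (NumA G) :=
  (MonoidHom.prod toHomOmega toHomPos : _ →* NumA G).range ⊔
    (DetZhatS.prod ⊥ : Subgroup (HomOmega (RGs G) × _))

/-- The group `A^s(ℤ[G])` of symplectic Arakelov classes. -/
abbrev ArakelovClassGroup : Type _ := NumA G ⧸ DenA G

/-- The numerator `Hom_Ω(R_G^s, J_f) × Hom(R_G^s, ℝˣ)` of the symplectic hermitian class group. -/
def NumH : Type _ := HomOmega (RGs G) × (Multiplicative (RGs G) →* ℝˣ)

instance : CommGroup (NumH G) := inferInstanceAs (CommGroup (HomOmega (RGs G) × (Multiplicative (RGs G) →* ℝˣ)))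

/-- The denominator `Im(Δ^s) · (Det^s(Ẑ[G]ˣ) × 1)` of the symplectic hermitian class group. -/
def DenH : Subgroup (NumH G) :=
  (MonoidHom.prod toHomOmega (posToReal.comp toHomPos) : _ →* NumH G).range ⊔
    (DetZhatS.prod ⊥ : Subgroup (HomOmega (RGs G) × _))

/-- The group `H^s(ℤ[G])` of symplectic hermitian classes. -/
abbrev HermitianClassGroup : Type _ := NumH G ⧸ DenH G

lemma DenA_le : DenA G ≤ (DenH G).comap ((MonoidHom.id _).prodMap posToReal) := by
  refine sup_le ?_ ?_
  · rintro _ ⟨f, rfl⟩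
    exact Subgroup.mem_sup_left ⟨f, rfl⟩
  · rintro ⟨f, r⟩ ⟨hf, hr⟩
    refine Subgroup.mem_sup_right ⟨hf, ?_⟩
    have hr' : r = 1 := hr
    subst hr'
    exact map_one posToReal

/-- The natural map `A^s(ℤ[G]) → H^s(ℤ[G])`. -/
def arakelovToHermitian : ArakelovClassGroup G →* HermitianClassGroup G :=
  QuotientGroup.map (DenA G) (DenH G) ((MonoidHom.id _).prodMap posToReal) (DenA_le G)

variable {G}

/-- The class in `A^s(ℤ[G])` represented by `f₁ × f₂`. -/
def arakelovClass (f₁ : HomOmega (RGs G)) (f₂ : Multiplicative (RGs G) →* Units.posSubgroup ℝ) :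
    ArakelovClassGroup G :=
  QuotientGroup.mk' (DenA G) (show NumA G from (f₁, f₂))

/-- The class in `H^s(ℤ[G])` represented by `f₁ × f₂`. -/
def hermitianClass (f₁ : HomOmega (RGs G)) (f₂ : Multiplicative (RGs G) →* ℝˣ) :
    HermitianClassGroup G :=
  QuotientGroup.mk' (DenH G) (show NumH G from (f₁, f₂))

/-- A sign character function `R_G^s → {±1}`, regarded as a function with values in `ℝˣ`. -/
def signReal : (Multiplicative (RGs G) →* ℤˣ) →* (Multiplicative (RGs G) →* ℝˣ) where
  toFun s := (Units.map (Int.castRingHom ℝ : ℤ →* ℝ)).comp s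
  map_one' := MonoidHom.comp_one _
  map_mul' _ _ := MonoidHom.comp_mul _ _ _

/-- The homomorphism `Hom(R_G^s, ±1) → H^s(ℤ[G])` sending `s` to the class of `1 × s`. -/
def signatureClass : (Multiplicative (RGs G) →* ℤˣ) →* HermitianClassGroup G where
  toFun s := hermitianClass 1 (signReal s)
  map_one' := by
    rw [map_one]
    exact map_one (QuotientGroup.mk' (DenH G))
  map_mul' s s' := by
    rw [map_mul, hermitianClass, hermitianClass, hermitianClass,
      ← map_mul (QuotientGroup.mk' (DenH G))]
    refine congrArg _ (Prod.ext ?_ rfl)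
    exact (one_mul 1).symm

variable (G) in
/-- The signature group `S_∞(ℤ[G]) = 1 × Hom(R_G^s, ±1)`, as a subgroup of `H^s(ℤ[G])`. -/
def SInf : Subgroup (HermitianClassGroup G) := (signatureClass : (Multiplicative (RGs G) →* ℤˣ) →* HermitianClassGroup G).range

end Characters

/-! ### Representations on tensor products -/

section Reps

variable {G : Type*} [Group G]

/-- Extension of scalars of an integral representation. -/
def baseChangeRep (k : Type*) [CommRing k] {M : Type*} [AddCommGroup M]
    (ρ : Representation ℤ G M) : Representation k G (k ⊗[ℤ] M) where
  toFun g := (ρ g).baseChange k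
  map_one' := by rw [map_one]; exact LinearMap.baseChange_id
  map_mul' g h := by rw [map_mul]; exact LinearMap.baseChange_comp _ _

variable {W M N : Type*} [AddCommGroup W] [Module ℂ W] [AddCommGroup M] [Module ℝ M]
  [AddCommGroup N] [Module ℝ N]

/-- The diagonal action of `G` on `W ⊗_ℝ M`, for a complex representation `W` and a real
representation `M`. -/
def tens (ρ : Representation ℂ G W) (a : Representation ℝ G M) :
    Representation ℂ G (W ⊗[ℝ] M) where
  toFun g := TensorProduct.AlgebraTensorModule.map (ρ g) (a g)
  map_one' := by
    rw [map_one, map_one]; exact TensorProduct.AlgebraTensorModule.map_id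
  map_mul' g h := by
    rw [map_mul, map_mul]; exact TensorProduct.AlgebraTensorModule.map_comp _ _ _ _

/-- The complex vector space `(M ⊗_ℝ W)^G`. -/
abbrev inv (ρ : Representation ℂ G W) (a : Representation ℝ G M) : Submodule ℂ (W ⊗[ℝ] M) :=
  (tens ρ a).invariants

/-- The map `(M ⊗ W)^G → (N ⊗ W)^G` induced by a `G`-equivariant map `M → N`. -/
def invMap (ρ : Representation ℂ G W) {a : Representation ℝ G M} {b : Representation ℝ G N}
    (φ : M →ₗ[ℝ] N) (h : ∀ g x, φ (a g x) = b g (φ x)) : inv ρ a →ₗ[ℂ] inv ρ b :=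
  (TensorProduct.AlgebraTensorModule.map LinearMap.id φ).restrict (by
    intro x hx g
    have e : (tens ρ b g) ∘ₗ TensorProduct.AlgebraTensorModule.map LinearMap.id φ
        = TensorProduct.AlgebraTensorModule.map (LinearMap.id : W →ₗ[ℂ] W) φ ∘ₗ tens ρ a g := by
      ext w m
      simp [tens, h]
    have := LinearMap.congr_fun e x
    simp only [LinearMap.comp_apply] at this
    rw [this, hx g])

/-- The form `κ ⊗ σ` on `(M ⊗ W)^G`, for a complex bilinear form `κ` on `W` and a real bilinear
form `σ` on `M`. -/
def tensForm (ρ : Representation ℂ G W) (a : Representation ℝ G M)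
    (κ : LinearMap.BilinForm ℂ W) (σ : LinearMap.BilinForm ℝ M) :
    LinearMap.BilinForm ℂ (inv ρ a) :=
  LinearMap.BilinForm.restrict (LinearMap.BilinForm.tmul κ σ) (inv ρ a)

/-- A sesquilinear form, regarded as a real bilinear map. -/
def realify (ν : W →ₗ[ℂ] W →ₗ⋆[ℂ] ℂ) : LinearMap.BilinMap ℝ W ℂ :=
  LinearMap.mk₂ ℝ (fun x y => ν x y) (by simp) (by
      intro r x y
      rw [← Complex.coe_smul r x]; simp) (by simp) (by
      intro r x y
      rw [← Complex.coe_smul r y, map_smulₛₗ, Complex.conj_ofReal, Complex.coe_smul])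

/-- The hermitian form `ν ⊗ σ` on `M ⊗ W`, with
`(ν ⊗ σ)(w ⊗ x, w' ⊗ x') = σ(x, x') ν(w, w')`, for a hermitian form `ν` on `W` and a real
symmetric bilinear form `σ` on `M`. -/
def tensHerm (ν : W →ₗ[ℂ] W →ₗ⋆[ℂ] ℂ) (σ : LinearMap.BilinForm ℝ M) (x y : W ⊗[ℝ] M) : ℂ :=
  TensorProduct.rid ℝ ℂ (LinearMap.BilinMap.tmul (realify ν) σ x y)

/-- `e` is a hyperbolic basis `u_1, u_1', u_2, u_2', …` for `h`: here `u_i = e (i, 0)` and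
`u_i' = e (i, 1)`. -/
structure IsHyperbolic {X E : Type*} [DecidableEq X] [AddCommGroup E] [Module ℂ E]
    (h : LinearMap.BilinForm ℂ E) (e : Module.Basis (X × Fin 2) ℂ E) : Prop where
  alt : h.IsAlt
  zero_zero : ∀ i j, h (e (i, 0)) (e (j, 0)) = 0
  one_one : ∀ i j, h (e (i, 1)) (e (j, 1)) = 0
  zero_one : ∀ i j, h (e (i, 0)) (e (j, 1)) = if i = j then 1 else 0

end Reps

/-! ### Perfect complexes and their cohomology -/

section Complexes

open CategoryTheory

universe u v

variable {G : Type v} [Group G]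

/-- The action of `G` on `k ⊗ M`, for a `ℤ[G]`-module `M`. -/
def termRep (k : Type*) [CommRing k] (M : ModuleCat.{u} (MonoidAlgebra ℤ G)) :
    Representation k G (k ⊗[ℤ] M) :=
  baseChangeRep k (Representation.ofModule' (M : Type u))

/-- `a` is a `k[G]`-basis of the `k[G]`-module `k ⊗ M`, i.e. the elements `g a_j` form a `k`-basis
of `k ⊗ M`. -/
def IsGroupRingBasis (k : Type*) [CommRing k] (M : ModuleCat.{u} (MonoidAlgebra ℤ G)) {q : ℕ}
    (a : Fin q → k ⊗[ℤ] M) : Prop :=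
  LinearIndependent k (fun x : G × Fin q => termRep k M x.1 (a x.2)) ∧
    Submodule.span k (Set.range fun x : G × Fin q => termRep k M x.1 (a x.2)) = ⊤

/-- A finitely generated locally free `ℤ[G]`-module: `ℤ_p ⊗ M` is free over `ℤ_p[G]`, of the same
rank for all primes `p`, and `ℚ ⊗ M` is free over `ℚ[G]`. (As `Ẑ[G] = ∏_p ℤ_p[G]`, and as
`Ẑ ⊗ M = ∏_p ℤ_p ⊗ M` for finitely generated `M`, a `Ẑ[G]`-basis of `Ẑ ⊗ M` with `q` elements is
the same thing as a `ℤ_p[G]`-basis of `ℤ_p ⊗ M` with `q` elements for each prime `p`.) -/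
def IsLocallyFree (M : ModuleCat.{u} (MonoidAlgebra ℤ G)) : Prop :=
  Module.Finite (MonoidAlgebra ℤ G) M ∧
    ∃ q : ℕ, (∃ a : Fin q → Zhat ⊗[ℤ] M, IsGroupRingBasis Zhat M a) ∧
      ∃ a : Fin q → ℚ ⊗[ℤ] M, IsGroupRingBasis ℚ M a

/-- A perfect `ℤ[G]`-complex: a bounded complex of finitely generated locally free
`ℤ[G]`-modules. -/
def IsPerfect (P : CochainComplex (ModuleCat.{u} (MonoidAlgebra ℤ G)) ℤ) : Prop :=
  (∃ N : ℤ, ∀ i : ℤ, N < |i| → Subsingleton (P.X i)) ∧ ∀ i, IsLocallyFree (P.X i)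

variable (P : CochainComplex (ModuleCat.{u} (MonoidAlgebra ℤ G)) ℤ)

/-- The differentials of `P_ℝ = ℝ ⊗ P`. -/
def diff (i j : ℤ) : ℝ ⊗[ℤ] P.X i →ₗ[ℝ] ℝ ⊗[ℤ] P.X j :=
  ((P.d i j).hom.toAddMonoidHom.toIntLinearMap).baseChange ℝ

lemma diff_comm (i j : ℤ) (g : G) (x : ℝ ⊗[ℤ] P.X i) :
    diff P i j (termRep ℝ (P.X i) g x) = termRep ℝ (P.X j) g (diff P i j x) := by
  induction x with
  | zero => simp
  | add x y hx hy => simp only [map_add, hx, hy]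
  | tmul r x =>
    simp only [diff, termRep, baseChangeRep, MonoidHom.coe_mk, OneHom.coe_mk,
      LinearMap.baseChange_tmul]
    congr 1
    exact (P.d i j).hom.map_smul _ _

/-- The cocycles of `P_ℝ`. -/
def cocycles (i : ℤ) : Submodule ℝ (ℝ ⊗[ℤ] P.X i) := LinearMap.ker (diff P i (i + 1))

/-- The coboundaries of `P_ℝ`. -/
def coboundaries (i : ℤ) : Submodule ℝ (ℝ ⊗[ℤ] P.X i) := LinearMap.range (diff P (i - 1) i)

/-- The action of `G` on the cocycles of `P_ℝ`. -/
def cocyclesRep (i : ℤ) : Representation ℝ G (cocycles P i) :=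
  (termRep ℝ (P.X i)).subrepresentation (cocycles P i) (by
    intro g x hx
    rw [Submodule.mem_comap, cocycles, LinearMap.mem_ker, diff_comm, LinearMap.mem_ker.mp hx,
      map_zero])

/-- The cohomology group `H^i(P_ℝ) = ℝ ⊗ H^i(P_ℚ)`. -/
def coh (i : ℤ) : Type u := cocycles P i ⧸ (coboundaries P i).submoduleOf (cocycles P i)

instance (i : ℤ) : AddCommGroup (coh P i) :=
  inferInstanceAs (AddCommGroup (cocycles P i ⧸ (coboundaries P i).submoduleOf (cocycles P i)))

instance (i : ℤ) : Module ℝ (coh P i) :=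
  inferInstanceAs (Module ℝ (cocycles P i ⧸ (coboundaries P i).submoduleOf (cocycles P i)))

/-- The action of `G` on `H^i(P_ℝ)`. -/
def cohRep (i : ℤ) : Representation ℝ G (coh P i) :=
  (cocyclesRep P i).quotient _ (by
    rintro g ⟨_, hx⟩ ⟨y, rfl⟩
    exact ⟨termRep ℝ (P.X (i - 1)) g y, diff_comm P (i - 1) i g y⟩)

/-- The class of a cocycle. -/
def cohMk (i : ℤ) : cocycles P i →ₗ[ℝ] coh P i :=
  ((coboundaries P i).submoduleOf (cocycles P i)).mkQ

/-- The direct sum of the cohomology groups `H^i(P_ℝ)` over all `i` with the property `p`; this is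
`H^ev` for `p = Even` and `H^odd` for `p = Odd`. -/
abbrev cohSum (p : ℤ → Prop) : Type u := ⨁ i : {i : ℤ // p i}, coh P i

/-- The action of `G` on the direct sum of cohomology groups. -/
def cohSumRep (p : ℤ → Prop) : Representation ℝ G (cohSum P p) :=
  Representation.directSum fun i : {i : ℤ // p i} => cohRep P i

/-- The map sending a cocycle to its class, as an element of the direct sum of the cohomology
groups. -/
def toCohSum (p : ℤ → Prop) (i : {i : ℤ // p i}) : cocycles P i →ₗ[ℝ] cohSum P p :=
  DirectSum.lof ℝ {i : ℤ // p i} (fun i => coh P i) i ∘ₗ cohMk P i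

lemma toCohSum_comm (p : ℤ → Prop) (i : {i : ℤ // p i}) (g : G) (x : cocycles P i) :
    toCohSum P p i (cocyclesRep P i g x) = cohSumRep P p g (toCohSum P p i x) := by
  change DirectSum.lof ℝ {i : ℤ // p i} (fun i => coh P i) i (cohMk P i (cocyclesRep P i g x)) =
    DirectSum.lmap (fun i : {i : ℤ // p i} => cohRep P i g)
      (DirectSum.lof ℝ {i : ℤ // p i} (fun i => coh P i) i (cohMk P i x))
  rw [DirectSum.lmap_lof]
  rfl

/-- Non-degenerate `G`-invariant real-valued symmetric forms `σ^ev` and `σ^odd` on the even and odd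
rational cohomology `H^ev(P_ℚ)`, `H^odd(P_ℚ)`, extended bilinearly to `H^ev(P_ℝ)`, `H^odd(P_ℝ)`. -/
structure SymForms where
  /-- the form on the even cohomology -/
  ev : LinearMap.BilinForm ℝ (cohSum P Even)
  /-- the form on the odd cohomology -/
  odd : LinearMap.BilinForm ℝ (cohSum P Odd)
  ev_symm : ev.IsSymm
  odd_symm : odd.IsSymm
  ev_nondeg : ev.Nondegenerate
  odd_nondeg : odd.Nondegenerate
  ev_inv : ∀ g x y, ev (cohSumRep P Even g x) (cohSumRep P Even g y) = ev x y
  odd_inv : ∀ g x y, odd (cohSumRep P Odd g x) (cohSumRep P Odd g y) = odd x y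

/-! ### Local bases -/

/-- The inclusion `Ẑ → Ẑ ⊗ ℚ`. -/
def zhatToAQ : Zhat →+* AQ :=
  (Algebra.TensorProduct.includeLeft : Zhat →ₐ[ℤ] Zhat ⊗[ℤ] ℚ).toRingHom

/-- The inclusion `ℚ → Ẑ ⊗ ℚ`. -/
def ratToAQ : ℚ →+* AQ :=
  (Algebra.TensorProduct.includeRight : ℚ →ₐ[ℤ] Zhat ⊗[ℤ] ℚ).toRingHom

/-- The map `k ⊗ M → l ⊗ M` induced by a ring homomorphism `k → l`. -/
def changeCoeff {k l : Type*} [CommRing k] [CommRing l] (f : k →+* l) (M : Type*) [AddCommGroup M] :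
    k ⊗[ℤ] M →ₗ[ℤ] l ⊗[ℤ] M :=
  (f.toAddMonoidHom.toIntLinearMap).rTensor M

/-- A choice, for all `i`, of bases `a^i_j` of `Ẑ ⊗ P^i` over `Ẑ[G]` (that is, bases `a^{ij}_p` of
`ℤ_p ⊗ P^i` over `ℤ_p[G]` for all primes `p`) and `a₀^i_j` of `ℚ ⊗ P^i` over `ℚ[G]`, together with
the matrices `λ^i` with `λ^i a^i = a₀^i`. -/
structure LocalBases [Fintype G] where
  /-- the rank of `P^i` -/
  q : ℤ → ℕ
  /-- the basis of `Ẑ ⊗ P^i` -/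
  a : ∀ i, Fin (q i) → Zhat ⊗[ℤ] P.X i
  /-- the basis of `ℚ ⊗ P^i` -/
  a₀ : ∀ i, Fin (q i) → ℚ ⊗[ℤ] P.X i
  a_basis : ∀ i, IsGroupRingBasis Zhat (P.X i) (a i)
  a₀_basis : ∀ i, IsGroupRingBasis ℚ (P.X i) (a₀ i)
  /-- the base change matrices, with entries in the group ring of `G` over the finite adeles -/
  lam : ∀ i, Matrix (Fin (q i)) (Fin (q i)) (MonoidAlgebra AQ G)
  lam_spec : ∀ i j, changeCoeff ratToAQ (P.X i) (a₀ i j) =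
    ∑ k, ∑ g, (lam i j k).coeff g •
      termRep AQ (P.X i) g (changeCoeff zhatToAQ (P.X i) (a i k))

/-- The determinant `det T(λ)` in `Ẑ ⊗ ℂ` of a square matrix `λ` over the group ring of `G` over
the finite adeles of `ℚ`, where `T(λ)` is the block matrix `(T(λ_{jk}))_{j,k}`. -/
def detRep {n q : ℕ} (T : G →* Matrix (Fin n) (Fin n) ℂ)
    (lam : Matrix (Fin q) (Fin q) (MonoidAlgebra AQ G)) : AC :=
  (Matrix.of fun x y : Fin q × Fin n => evalRep inclQ T (lam x.1 y.1) x.2 y.2).det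

variable {P}

/-- `c = ∏_i Det(λ^i)(ψ)^{(-1)^i}` in `J_f`, for the character `ψ` of a complex representation. -/
def IsFinitePart [Fintype G] (L : LocalBases P) (ψ : G → ℂ) (c : Jf) : Prop :=
  ∃ (n : ℕ) (T : G →* Matrix (Fin n) (Fin n) ℂ) (D : ℤ → Jf),
    (∀ g, ψ g = (T g).trace) ∧ (∀ i, inclC (D i : AQbar) = detRep T (L.lam i)) ∧
    c = ∏ᶠ i : ℤ, D i ^ (i.negOnePow : ℤ)

/-! ### The determinant of the complex `(P ⊗ W)^G` -/

section Det

variable {W : Type*} [AddCommGroup W] [Module ℂ W] (ρ : Representation ℂ G W)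

variable (P) in
/-- The differential of the complex `(P ⊗ W)^G`. -/
def diffW (i j : ℤ) : inv ρ (termRep ℝ (P.X i)) →ₗ[ℂ] inv ρ (termRep ℝ (P.X j)) :=
  invMap ρ (diff P i j) (diff_comm P i j)

variable (P) in
/-- The inclusion of the (cocycles of `P` ⊗ `W`)`^G` in `(P^i ⊗ W)^G`. -/
def cocyclesW (i : ℤ) : inv ρ (cocyclesRep P i) →ₗ[ℂ] inv ρ (termRep ℝ (P.X i)) :=
  invMap ρ (cocycles P i).subtype fun _ _ => rfl

variable (P) in
/-- The class in `(H ⊗ W)^G` of a cocycle, where `H` is a direct sum of cohomology groups. -/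
def classW (p : ℤ → Prop) (i : {i : ℤ // p i}) :
    inv ρ (cocyclesRep P i) →ₗ[ℂ] inv ρ (cohSumRep P p) :=
  invMap ρ (toCohSum P p i) (toCohSum_comm P p i)

/-- `r_G(a ⊗ w) = ∑_g g a ⊗ g w`, an element of `(P^i ⊗ W)^G`. -/
def rG [Fintype G] (i : ℤ) (a : ℚ ⊗[ℤ] P.X i) (w : W) : inv ρ (termRep ℝ (P.X i)) :=
  ⟨∑ g, tens ρ (termRep ℝ (P.X i)) g
      (w ⊗ₜ[ℝ] changeCoeff (algebraMap ℚ ℝ) (P.X i) a), fun h => by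
    rw [map_sum]
    refine Fintype.sum_equiv (Equiv.mulLeft h) _ _ fun g => ?_
    rw [Equiv.coe_mulLeft, map_mul]
    rfl⟩

variable (P) in
/-- Bases of the terms of the complex `C^• = (P^• ⊗ W)^G` adapted to decompositions
`C^i = B^i ⊕ H^i ⊕ U^i`, where `B^i` is the space of coboundaries, `B^i ⊕ H^i` the space of
cocycles, and where `U^i` is mapped isomorphically to `B^{i+1}`: the basis `c^i` of `C^i`
consists of the images `∂ u^{i-1}` of the given basis of `U^{i-1}`, of cocycles `z^i` whose classes
form a basis of the cohomology, and of a basis `u^i` of `U^i`. All bases are indexed by products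
with a fixed finite set `F`; for `F = Fin 2` this means that the basis elements come in pairs, so
that all spaces have even dimension and the order of the pairs is immaterial for exterior products.

The canonical isomorphism `ξ : det C^• ≅ det H^•(C^•)` is the one which maps
`⊗_i (∧ c^i)^{(-1)^i}` to `⊗_i (∧ z^i)^{(-1)^i}`. -/
structure Splitting (F : Type) where
  /-- the number of elements (or pairs) in the basis of `U^i` -/
  nU : ℤ → ℕ
  /-- the number of elements (or pairs) in the basis of `H^i` -/
  nH : ℤ → ℕ
  /-- the basis of `U^i` -/
  u : ∀ i, Fin (nU i) × F → inv ρ (termRep ℝ (P.X i))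
  /-- the basis of `H^i` -/
  z : ∀ i, Fin (nH i) × F → inv ρ (cocyclesRep P i)
  /-- the basis of `C^i` -/
  c : ∀ i, Module.Basis ((Fin (nU (i - 1)) ⊕ Fin (nH i) ⊕ Fin (nU i)) × F) ℂ
    (inv ρ (termRep ℝ (P.X i)))
  c_B : ∀ i j f, c i (.inl j, f) = diffW P ρ (i - 1) i (u (i - 1) (j, f))
  c_H : ∀ i j f, c i (.inr (.inl j), f) = cocyclesW P ρ i (z i (j, f))
  c_U : ∀ i j f, c i (.inr (.inr j), f) = u i (j, f)

variable {ρ}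

/-- The family of the classes of the elements `z^i`, for `i` with the property `p`, in the order
given by a bijection of the index set with `Fin N`. -/
def Splitting.classes {F : Type} (S : Splitting P ρ F) (p : ℤ → Prop) {N : ℕ}
    (τ : Fin N ≃ Σ i : {i : ℤ // p i}, Fin (S.nH i)) (x : Fin N × F) : inv ρ (cohSumRep P p) :=
  classW P ρ p (τ x.1).1 (S.z (τ x.1).1 ((τ x.1).2, x.2))

/-- The scalar `δ` with `∧ b^i = δ · ∧ c^i`, where `b^i` is the family of all
`r_G(a₀^i_j ⊗ w_n)`. -/
def Splitting.delta [Fintype G] {F : Type} [Fintype F] [DecidableEq F] (S : Splitting P ρ F)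
    (L : LocalBases P) {n : ℕ} (w : Fin n × F → W) (i : ℤ)
    (ε : Fin (S.nU (i - 1)) ⊕ Fin (S.nH i) ⊕ Fin (S.nU i) ≃ Fin (L.q i) × Fin n) : ℂ :=
  (S.c i).det fun x => rG ρ i (L.a₀ i (ε x.1).1) (w ((ε x.1).2, x.2))

end Det

/-! ### The hermitian Euler characteristic -/

section Hermitian

variable [Fintype G]

/-- A complex representation is symplectic if it supports a non-degenerate `G`-invariant
alternating form. -/
def IsSymplectic {W : Type*} [AddCommGroup W] [Module ℂ W] (ρ : Representation ℂ G W) : Prop :=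
  ∃ κ : LinearMap.BilinForm ℂ W, κ.IsAlt ∧ κ.Nondegenerate ∧
    ∀ g x y, κ (ρ g x) (ρ g y) = κ x y

/-- `r` is the value `Pf_{(σ ⊗ κ)^G}(ξ(⊗_i (∧_{jn} r_G(a₀^i_j ⊗ w_n))^{(-1)^i}))` for some
non-degenerate `G`-invariant alternating form `κ` on the symplectic representation `W` and some
hyperbolic basis `w` of `W`. Here `Pf_h(∧ v) = det_e(v)` for a hyperbolic basis `e` of `h`. -/
def IsPfaffianValue (σ : SymForms P) (L : LocalBases P) {W : Type*} [AddCommGroup W] [Module ℂ W]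
    (ρ : Representation ℂ G W) (r : ℂ) : Prop :=
  ∃ (κ : LinearMap.BilinForm ℂ W) (_ : ∀ g x y, κ (ρ g x) (ρ g y) = κ x y)
    (n : ℕ) (w : Module.Basis (Fin n × Fin 2) ℂ W) (_ : IsHyperbolic κ w)
    (S : Splitting P ρ (Fin 2))
    (ε : ∀ i, Fin (S.nU (i - 1)) ⊕ Fin (S.nH i) ⊕ Fin (S.nU i) ≃ Fin (L.q i) × Fin n)
    (N₀ N₁ : ℕ)
    (τ₀ : Fin N₀ ≃ Σ i : {i : ℤ // Even i}, Fin (S.nH i))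
    (τ₁ : Fin N₁ ≃ Σ i : {i : ℤ // Odd i}, Fin (S.nH i))
    (e₀ : Module.Basis (Fin N₀ × Fin 2) ℂ (inv ρ (cohSumRep P Even)))
    (e₁ : Module.Basis (Fin N₁ × Fin 2) ℂ (inv ρ (cohSumRep P Odd))),
    IsHyperbolic (tensForm ρ (cohSumRep P Even) κ σ.ev) e₀ ∧
    IsHyperbolic (tensForm ρ (cohSumRep P Odd) κ σ.odd) e₁ ∧
    r = (∏ᶠ i : ℤ, S.delta L w i (ε i) ^ (i.negOnePow : ℤ)) *
      (e₀.det (S.classes Even τ₀) * (e₁.det (S.classes Odd τ₁))⁻¹)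

/-- `x` is the hermitian Euler characteristic `χ_H^s(P, σ)`: it is represented by the character
function which maps the character `θ_m` of `W_m` to
`∏_i Det(λ^i)(θ_m)^{(-1)^i} × Pf_{(σ ⊗ κ_m)^G}(ξ_m(⊗_i (∧_{jn} r_G(a₀^i_j ⊗ w_{mn}))^{(-1)^i}))`,
for some choice of bases. -/
def IsHermitianEuler (σ : SymForms P) {I : Type*} {W : I → Type*} [∀ m, AddCommGroup (W m)]
    [∀ m, Module ℂ (W m)] (ρ : ∀ m, Representation ℂ G (W m)) (θ : Module.Basis I ℤ (RGs G))
    (x : HermitianClassGroup G) : Prop :=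
  ∃ (L : LocalBases P) (f₁ : HomOmega (RGs G)) (f₂ : Multiplicative (RGs G) →* ℝˣ),
    (∀ m, IsFinitePart L (θ m : G → ℂ) (f₁.1 (.ofAdd (θ m))) ∧
      IsPfaffianValue σ L (ρ m) (((f₂ (.ofAdd (θ m)) : ℝˣ) : ℝ) : ℂ)) ∧
    x = hermitianClass f₁ f₂

end Hermitian

/-! ### The Arakelov Euler characteristic -/

section Arakelov

variable [Fintype G]

/-- The action of `G` by left multiplication on a left ideal of `ℂ[G]`. -/
abbrev idealRep (V : Ideal (MonoidAlgebra ℂ G)) : Representation ℂ G V :=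
  Representation.ofModule' V

/-- The hermitian form `ν(∑ l_g g, ∑ m_g g) = |G| ∑ l_g conj(m_g)`, restricted to a left ideal. -/
def nuForm (V : Ideal (MonoidAlgebra ℂ G)) : V →ₗ[ℂ] V →ₗ⋆[ℂ] ℂ :=
  LinearMap.mk₂'ₛₗ (RingHom.id ℂ) (starRingEnd ℂ)
    (fun x y => (Fintype.card G : ℂ) * ∑ g, (x : MonoidAlgebra ℂ G).coeff g *
      conj ((y : MonoidAlgebra ℂ G).coeff g))
    (by intro x x' y; simp [add_mul, Finset.sum_add_distrib, mul_add])
    (by intro c x y; simp [Finset.mul_sum, mul_assoc, mul_left_comm])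
    (by intro x y y'; simp [Finset.sum_add_distrib, mul_add])
    (by intro c x y; simp [Finset.mul_sum, mul_left_comm])

variable (P) in
/-- Metrics on the equivariant determinant of cohomology: for each two-sided ideal `V` of `ℂ[G]`
the function which maps a pair of bases `(v, w)` of `(H^ev ⊗ V)^G` and `(H^odd ⊗ V)^G` to the length
of the element `(∧ v) ⊗ (∧ w)^{-1}` of the line `det((H^• ⊗ V)^G)`. -/
def DetMetrics : Type _ :=
  ∀ (V : TwoSidedIdeal (MonoidAlgebra ℂ G)) (N₀ N₁ : ℕ),
    (Fin N₀ → inv (idealRep V.asIdeal) (cohSumRep P Even)) →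
    (Fin N₁ → inv (idealRep V.asIdeal) (cohSumRep P Odd)) → ℝ

/-- The metrics `h_σ` attached to the symmetric forms `σ`: the metric on `det((H^• ⊗ V)^G)` is
given by the positive definite form `|det (σ^ev ⊗ ν)^G| ⊗ |det (σ^odd ⊗ ν)^G|^{-1}`, whose value
on `(∧ v) ⊗ (∧ w)^{-1}` is the quotient of the absolute values of the Gram determinants of `v`
and `w`. -/
def SymForms.metrics (σ : SymForms P) : DetMetrics P := fun V _ _ v w =>
  √(‖(Matrix.of fun i j => tensHerm (nuForm V.asIdeal) σ.ev (v i) (v j)).det‖ /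
    ‖(Matrix.of fun i j => tensHerm (nuForm V.asIdeal) σ.odd (w i) (w j)).det‖)

/-- `r` is the length `h(ξ(⊗_i (∧_{js} r_G(a₀^i_j ⊗ v_s))^{(-1)^i}))` for some orthonormal basis
`v` of the two-sided ideal `V` of `ℂ[G]` with respect to the hermitian form `ν`. -/
def IsMetricValue (h : DetMetrics P) (L : LocalBases P) (V : TwoSidedIdeal (MonoidAlgebra ℂ G))
    (r : ℝ) : Prop :=
  ∃ (n : ℕ) (v : Module.Basis (Fin n × Unit) ℂ V.asIdeal)
    (_ : ∀ s t, nuForm V.asIdeal (v s) (v t) = if s = t then 1 else 0)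
    (S : Splitting P (idealRep V.asIdeal) Unit)
    (ε : ∀ i, Fin (S.nU (i - 1)) ⊕ Fin (S.nH i) ⊕ Fin (S.nU i) ≃ Fin (L.q i) × Fin n)
    (N₀ N₁ : ℕ)
    (τ₀ : Fin N₀ ≃ Σ i : {i : ℤ // Even i}, Fin (S.nH i))
    (τ₁ : Fin N₁ ≃ Σ i : {i : ℤ // Odd i}, Fin (S.nH i)),
    r = (∏ᶠ i : ℤ, ‖S.delta L v i (ε i)‖ ^ (i.negOnePow : ℤ)) *
      h V N₀ N₁ (fun x => S.classes Even τ₀ (x, ())) (fun x => S.classes Odd τ₁ (x, ()))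

/-- `y` is the symplectic Arakelov Euler characteristic `χ_A^s(P, h)`: it is represented by the
restriction to `R_G^s` of the homomorphism on `R_G` which, for each simple two-sided ideal `V_r` of
`ℂ[G]` with irreducible character `χ_r` (the character of any simple left ideal contained in
`V_r`), maps the complex conjugate of `χ_r` to
`∏_i Det(λ^i)(conj χ_r)^{(-1)^i} × h_r(ξ_r(⊗_i (∧_{js} r_G(a₀^i_j ⊗ v_{rs}))^{(-1)^i}))^{1/χ_r(1)}`,
for some choice of bases. -/
def IsArakelovEuler (h : DetMetrics P) (y : ArakelovClassGroup G) : Prop :=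
  ∃ (L : LocalBases P) (f₁ : HomOmega (RG G))
    (f₂ : Multiplicative (RG G) →* Units.posSubgroup ℝ),
    (∀ (V : TwoSidedIdeal (MonoidAlgebra ℂ G)) (S : Ideal (MonoidAlgebra ℂ G)) (ψ : RG G),
      IsAtom V → IsAtom S → S ≤ V.asIdeal →
      (∀ g, (ψ : G → ℂ) g = conj (LinearMap.trace ℂ S (idealRep S g))) →
      IsFinitePart L (ψ : G → ℂ) (f₁.1 (.ofAdd ψ)) ∧
      ∃ r : ℝ, IsMetricValue h L V r ∧
        ((f₂ (.ofAdd ψ) : ℝˣ) : ℝ) = r ^ ((1 : ℝ) / Module.finrank ℂ S)) ∧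
    y = arakelovClass (restrictHom f₁) (f₂.comp inclR)

end Arakelov

/-! ### Signatures -/

section Signature

variable {M : Type*} [AddCommGroup M] [Module ℝ M]

/-- A `G`-decomposition `M = M⁺ ⊕ M⁻` such that `σ` is positive definite on `M⁺` and negative
definite on `M⁻`. -/
structure SignDecomposition (a : Representation ℝ G M) (σ : LinearMap.BilinForm ℝ M) where
  /-- the summand `M⁺` -/
  pos : Submodule ℝ M
  /-- the summand `M⁻` -/
  neg : Submodule ℝ M
  pos_stable : ∀ g, pos ≤ pos.comap (a g)
  neg_stable : ∀ g, neg ≤ neg.comap (a g)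
  isCompl : IsCompl pos neg
  pos_def : ∀ x ∈ pos, x ≠ 0 → 0 < σ x x
  neg_def : ∀ x ∈ neg, x ≠ 0 → σ x x < 0

/-- `n⁻(σ) = dim (M⁻ ⊗ W)^G`. -/
def SignDecomposition.nMinus {a : Representation ℝ G M} {σ : LinearMap.BilinForm ℝ M}
    (D : SignDecomposition a σ) {W : Type*} [AddCommGroup W] [Module ℂ W]
    (ρ : Representation ℂ G W) : ℕ :=
  Module.finrank ℂ (inv ρ (a.subrepresentation D.neg D.neg_stable))

end Signature

end Complexes

end

end HermClass

open HermClass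

namespace HermClass

noncomputable section

/-! ### Quaternionic structures and hermitian forms -/

section Quaternionic

open Module

/-- A family of pairs `(v, J v)`. -/
def IsAdapted {E X : Type*} (J : E → E) (e : X × Fin 2 → E) : Prop :=
  ∀ x, e (x, 1) = J (e (x, 0))

/-- A positive definite hermitian form, linear in the first variable. -/
structure IsHermPos {E : Type*} [AddCommGroup E] [Module ℂ E] (η : E →ₗ[ℂ] E →ₗ⋆[ℂ] ℂ) : Prop where
  symm : ∀ x y, η y x = conj (η x y)
  pos : ∀ x, x ≠ 0 → 0 < (η x x).re

/-- An orthonormal family for a sesquilinear form. -/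
def IsOrthon {E X : Type*} [AddCommGroup E] [Module ℂ E] (η : E →ₗ[ℂ] E →ₗ⋆[ℂ] ℂ)
    (e : X → E) : Prop :=
  (∀ x, η (e x) (e x) = 1) ∧ ∀ x y, x ≠ y → η (e x) (e y) = 0

lemma IsOrthon.linearIndependent {E X : Type*} [AddCommGroup E] [Module ℂ E]
    {η : E →ₗ[ℂ] E →ₗ⋆[ℂ] ℂ} {e : X → E} (h : IsOrthon η e) : LinearIndependent ℂ e := by
  rw [linearIndependent_iff']
  intro s a ha i hi
  have := congrArg (fun x => η x (e i)) ha
  simp only [map_sum, map_smul, LinearMap.sum_apply, LinearMap.smul_apply, map_zero,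
    LinearMap.zero_apply] at this
  rw [Finset.sum_eq_single i (fun j _ hj => by rw [h.2 _ _ hj, smul_zero])
    (fun hi' => absurd hi hi'), h.1] at this
  simpa using this

lemma IsHermPos.self_eq {E : Type*} [AddCommGroup E] [Module ℂ E] {η : E →ₗ[ℂ] E →ₗ⋆[ℂ] ℂ}
    (h : IsHermPos η) (x : E) : η x x = ((η x x).re : ℂ) :=
  (Complex.conj_eq_iff_re.mp (h.symm x x).symm).symm

lemma IsHermPos.exists_normalize {E : Type*} [AddCommGroup E] [Module ℂ E]
    {η : E →ₗ[ℂ] E →ₗ⋆[ℂ] ℂ} (h : IsHermPos η) {v : E} (hv : v ≠ 0) :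
    ∃ r : ℝ, η ((r : ℂ) • v) ((r : ℂ) • v) = 1 := by
  refine ⟨(√(η v v).re)⁻¹, ?_⟩
  rw [LinearMap.map_smulₛₗ, LinearMap.map_smul, LinearMap.smul_apply, h.self_eq v,
    Complex.conj_ofReal, smul_eq_mul, smul_eq_mul]
  norm_cast
  have := h.pos v hv
  rw [← mul_assoc, ← mul_inv, Real.mul_self_sqrt this.le, inv_mul_cancel₀ this.ne']

/-- The joint kernel of fewer than `dim E` functionals is non-zero. -/
lemma exists_ne_zero_orthogonal {E X : Type*} [AddCommGroup E] [Module ℂ E] [FiniteDimensional ℂ E]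
    [Fintype X] (η : E →ₗ[ℂ] E →ₗ⋆[ℂ] ℂ) (e : X → E) (hX : Fintype.card X < finrank ℂ E) :
    ∃ v, v ≠ 0 ∧ ∀ i, η v (e i) = 0 := by
  let F : E →ₗ[ℂ] (X → ℂ) :=
    { toFun := fun x i => η x (e i)
      map_add' := fun x y => by ext; simp
      map_smul' := fun c x => by ext; simp }
  have : LinearMap.ker F ≠ ⊥ := LinearMap.ker_ne_bot_of_finrank_lt (by simpa using hX)
  obtain ⟨v, hv, hv0⟩ := (Submodule.ne_bot_iff _).mp this
  exact ⟨v, hv0, fun i => congrFun hv i⟩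

theorem IsHermPos.exists_orthon_basis {E : Type*} [AddCommGroup E] [Module ℂ E]
    [FiniteDimensional ℂ E] {η : E →ₗ[ℂ] E →ₗ⋆[ℂ] ℂ} (h : IsHermPos η) :
    ∃ e : Basis (Fin (finrank ℂ E)) ℂ E, IsOrthon η e := by
  have key : ∀ n : ℕ, n ≤ finrank ℂ E → ∃ e : Fin n → E, IsOrthon η e := by
    intro n
    induction n with
    | zero => exact fun _ => ⟨Fin.elim0, fun x => x.elim0, fun x => x.elim0⟩
    | succ n ih =>
      intro hn
      obtain ⟨e, he⟩ := ih (by omega)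
      obtain ⟨v, hv, hve⟩ := exists_ne_zero_orthogonal η e (by simpa using hn)
      obtain ⟨r, hr⟩ := h.exists_normalize hv
      have h1 : ∀ i, η ((r : ℂ) • v) (e i) = 0 := fun i => by simp [hve i]
      have h2 : ∀ i, η (e i) ((r : ℂ) • v) = 0 := fun i => by rw [h.symm, h1, map_zero]
      refine ⟨Fin.cons ((r : ℂ) • v) e, fun x => ?_, fun x y => ?_⟩
      · refine Fin.cases ?_ (fun i => ?_) x
        · exact hr
        · exact he.1 i
      · refine Fin.cases ?_ (fun i => ?_) x <;> refine Fin.cases ?_ (fun j => ?_) y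
        · exact fun h => absurd rfl h
        · exact fun _ => h1 j
        · exact fun _ => h2 i
        · exact fun hij => he.2 i j (fun h => hij (by rw [h]))
  obtain ⟨e, he⟩ := key _ le_rfl
  exact ⟨basisOfLinearIndependentOfCardEqFinrank' _ he.linearIndependent (by simp), by simpa using he⟩

variable {E : Type*} [AddCommGroup E] [Module ℂ E] {J : E →ₛₗ[starRingEnd ℂ] E}

lemma IsHermPos.J_orth {η : E →ₗ[ℂ] E →ₗ⋆[ℂ] ℂ} (h : IsHermPos η) (hJ : ∀ x, J (J x) = -x)
    (hη : ∀ x y, η (J x) (J y) = conj (η x y)) (x : E) : η x (J x) = 0 := by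
  have h1 : η x (J x) = - η x (J x) := by
    conv_lhs => rw [← Complex.conj_conj (η x (J x)), ← hη, hJ, map_neg, map_neg, ← h.symm]
  exact self_eq_neg.mp h1

theorem IsHermPos.exists_adapted_basis [FiniteDimensional ℂ E] {η : E →ₗ[ℂ] E →ₗ⋆[ℂ] ℂ}
    (h : IsHermPos η) (hJ : ∀ x, J (J x) = -x) (hη : ∀ x y, η (J x) (J y) = conj (η x y)) :
    ∃ (n : ℕ) (e : Basis (Fin n × Fin 2) ℂ E), IsOrthon η e ∧ IsAdapted J e := by
  have step : ∀ (n : ℕ) (e : Fin n × Fin 2 → E), IsOrthon η e → IsAdapted J e →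
      2 * n < finrank ℂ E → ∃ e : Fin (n + 1) × Fin 2 → E, IsOrthon η e ∧ IsAdapted J e := by
    intro n e he hea hn
    obtain ⟨v, hv, hve⟩ := exists_ne_zero_orthogonal η e (by simpa [mul_comm] using hn)
    obtain ⟨r, hr⟩ := h.exists_normalize hv
    set w := (r : ℂ) • v with hw
    have hwJ : η w (J w) = 0 := h.J_orth hJ hη w
    have hJw : η (J w) w = 0 := by rw [h.symm, hwJ, map_zero]
    have hr' : η (J w) (J w) = 1 := by rw [hη, hr, map_one]
    have h1 : ∀ i, η w (e i) = 0 := fun i => by simp [hw, hve i]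
    have h3 : ∀ i, η (J w) (e i) = 0 := by
      rintro ⟨k, j⟩
      fin_cases j
      · have : e (k, 0) = - J (e (k, 1)) := by rw [hea, hJ, neg_neg]
        simp [this, hη, h1]
      · change η (J w) (e (k, 1)) = 0
        rw [hea, hη, h1, map_zero]
    have h2 : ∀ i, η (e i) w = 0 := fun i => by rw [h.symm, h1, map_zero]
    have h4 : ∀ i, η (e i) (J w) = 0 := fun i => by rw [h.symm, h3, map_zero]
    refine ⟨fun x => Fin.cons (α := fun _ => E) (if x.2 = 0 then w else J w)
      (fun i => e (i, x.2)) x.1, ⟨?_, ?_⟩, ?_⟩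
    · rintro ⟨x, k⟩
      refine Fin.cases ?_ (fun i => ?_) x
      · fin_cases k
        · simpa using hr
        · simpa using hr'
      · simpa using he.1 (i, k)
    · rintro ⟨x, k⟩ ⟨y, l⟩
      refine Fin.cases ?_ (fun i => ?_) x <;> refine Fin.cases ?_ (fun j => ?_) y
      · fin_cases k <;> fin_cases l <;> simp [hwJ, hJw]
      · intro _
        fin_cases k <;> simp [h1, h3]
      · intro _
        fin_cases l <;> simp [h2, h4]
      · intro hij
        simpa using he.2 (i, k) (j, l) (fun h => hij (by
          simp only [Prod.mk.injEq] at h; rw [h.1, h.2]))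
    · intro x
      refine Fin.cases ?_ (fun i => ?_) x
      · simp
      · simpa using hea i
  have key : ∀ n : ℕ, 2 * n ≤ finrank ℂ E →
      ∃ e : Fin n × Fin 2 → E, IsOrthon η e ∧ IsAdapted J e := by
    intro n
    induction n with
    | zero => exact fun _ => ⟨fun x => x.1.elim0, ⟨fun x => x.1.elim0, fun x => x.1.elim0⟩,
        fun x => x.elim0⟩
    | succ n ih =>
      intro hn
      obtain ⟨e, he, hea⟩ := ih (by omega)
      exact step n e he hea (by omega)
  obtain ⟨e, he, hea⟩ := key (finrank ℂ E / 2) (by omega)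
  have hcard : 2 * (finrank ℂ E / 2) = finrank ℂ E := by
    by_contra hne
    obtain ⟨e', he', -⟩ := step _ e he hea (by omega)
    have := he'.linearIndependent.fintype_card_le_finrank
    simp at this
    omega
  exact ⟨_, basisOfLinearIndependentOfCardEqFinrank' _ he.linearIndependent
    (by simp; omega), by simpa using he, by simpa using hea⟩

/-- A hermitian form in which a given basis is orthonormal. -/
lemma exists_hermPos (E : Type*) [AddCommGroup E] [Module ℂ E] [FiniteDimensional ℂ E] :
    ∃ η : E →ₗ[ℂ] E →ₗ⋆[ℂ] ℂ, IsHermPos η := by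
  let b := finBasis ℂ E
  refine ⟨LinearMap.mk₂'ₛₗ (RingHom.id ℂ) (starRingEnd ℂ)
    (fun x y => ∑ i, b.repr x i * conj (b.repr y i)) ?_ ?_ ?_ ?_, ?_, ?_⟩
  · intro x y z; simp [add_mul, Finset.sum_add_distrib]
  · intro c x y; simp [Finset.mul_sum, mul_assoc]
  · intro x y z; simp [mul_add, Finset.sum_add_distrib]
  · intro c x y; simp [Finset.mul_sum, mul_left_comm]
  · intro x y; simp [mul_comm]
  · intro x hx
    simp only [LinearMap.mk₂'ₛₗ_apply, Complex.mul_conj, Complex.re_sum, Complex.ofReal_re]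
    refine Finset.sum_pos' (fun _ _ => Complex.normSq_nonneg _) ?_
    by_contra hcon
    push Not at hcon
    refine hx (b.ext_elem fun i => ?_)
    simpa using Complex.normSq_eq_zero.mp (le_antisymm (hcon i (Finset.mem_univ i)) (Complex.normSq_nonneg _))

theorem exists_adapted_basis [FiniteDimensional ℂ E] (hJ : ∀ x, J (J x) = -x) :
    ∃ (n : ℕ) (e : Basis (Fin n × Fin 2) ℂ E), IsAdapted J e := by
  obtain ⟨η, hη⟩ := exists_hermPos E
  let η' : E →ₗ[ℂ] E →ₗ⋆[ℂ] ℂ := LinearMap.mk₂'ₛₗ (RingHom.id ℂ) (starRingEnd ℂ)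
    (fun x y => η x y + conj (η (J x) (J y)))
    (by intro x y z; simp; ring) (by intro c x y; simp; ring) (by intro x y z; simp; ring)
    (by intro c x y; simp; ring)
  have h' : IsHermPos η' := by
    refine ⟨fun x y => ?_, fun x hx => ?_⟩
    · simp only [η', LinearMap.mk₂'ₛₗ_apply, map_add]
      rw [hη.symm x y, hη.symm (J x) (J y)]
    · have hJx : J x ≠ 0 := fun h => hx (by rw [← neg_neg x, ← hJ x, h, map_zero, neg_zero])
      simpa [η'] using add_pos (hη.pos x hx) (hη.pos _ hJx)
  obtain ⟨n, e, -, he⟩ := h'.exists_adapted_basis hJ (fun x y => by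
    simp [η', hJ, add_comm])
  exact ⟨n, e, he⟩

lemma linearIndependent_pair_J (hJ : ∀ x, J (J x) = -x) {v : E} (hv : v ≠ 0) :
    LinearIndependent ℂ ![v, J v] := by
  rw [LinearIndependent.pair_iff]
  intro s t hst
  have h2 : conj s • J v - conj t • v = 0 := by
    have := congrArg J hst
    simpa [map_smulₛₗ, hJ, sub_eq_add_neg] using this
  have h3 : ((Complex.normSq s + Complex.normSq t : ℝ) : ℂ) • v = 0 := by
    have : conj s • (s • v + t • J v) - t • (conj s • J v - conj t • v) = 0 := by
      rw [hst, h2, smul_zero, smul_zero, sub_zero]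
    rw [← this, Complex.ofReal_add, ← Complex.mul_conj, ← Complex.mul_conj]
    module
  have h4 := (smul_eq_zero.mp h3).resolve_right hv
  norm_cast at h4
  have := Complex.normSq_nonneg s
  have := Complex.normSq_nonneg t
  exact ⟨Complex.normSq_eq_zero.mp (by linarith), Complex.normSq_eq_zero.mp (by linarith)⟩

universe u in
lemma det_eq_nonneg_aux (n : ℕ) : ∀ (E : Type u) [AddCommGroup E] [Module ℂ E]
    [FiniteDimensional ℂ E], finrank ℂ E = n → ∀ (J : E →ₛₗ[starRingEnd ℂ] E)
    (_ : ∀ x, J (J x) = -x) (f : E →ₗ[ℂ] E) (_ : ∀ x, f (J x) = J (f x)),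
    ∃ r : ℝ, 0 ≤ r ∧ LinearMap.det f = r := by
  induction n using Nat.strong_induction_on with
  | _ n ih =>
    intro E _ _ _ hn J hJ f hf
    rcases subsingleton_or_nontrivial E with _ | _
    · exact ⟨1, zero_le_one, by simp [LinearMap.det_eq_one_of_subsingleton]⟩
    obtain ⟨c, hc⟩ := Module.End.exists_eigenvalue f
    obtain ⟨v, hv⟩ := hc.exists_hasEigenvector
    have hfv : f v = c • v := hv.apply_eq_smul
    have hfJ : f (J v) = conj c • J v := by rw [hf, hfv, map_smulₛₗ]
    have hli := linearIndependent_pair_J hJ hv.2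
    set P := Submodule.span ℂ (Set.range ![v, J v]) with hP
    have hmem : ∀ i, ![v, J v] i ∈ P := fun i => Submodule.subset_span ⟨i, rfl⟩
    have hPf : P ≤ P.comap f := by
      rw [hP, Submodule.span_le]
      rintro _ ⟨i, rfl⟩
      fin_cases i
      · exact (congrArg (· ∈ P) hfv).mpr (P.smul_mem _ (hmem 0))
      · exact (congrArg (· ∈ P) hfJ).mpr (P.smul_mem _ (hmem 1))
    have hPJ : P ≤ P.comap J := by
      rw [hP, Submodule.span_le]
      rintro _ ⟨i, rfl⟩
      fin_cases i
      · exact hmem 1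
      · exact (congrArg (· ∈ P) (hJ v)).mpr (P.neg_mem (hmem 0))
    let b := Basis.span hli
    have hb : ∀ i, (b i : E) = ![v, J v] i := fun i => congrArg Subtype.val (Basis.span_apply hli i)
    have hdet1 : LinearMap.det (f.restrict hPf) = (Complex.normSq c : ℂ) := by
      have : LinearMap.toMatrix b b (f.restrict hPf) = Matrix.diagonal ![c, conj c] := by
        have e0 : f.restrict hPf (b 0) = c • b 0 := Subtype.ext (by
          rw [LinearMap.coe_restrict_apply, Submodule.coe_smul, hb]; exact hfv)
        have e1 : f.restrict hPf (b 1) = conj c • b 1 := Subtype.ext (by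
          rw [LinearMap.coe_restrict_apply, Submodule.coe_smul, hb]; exact hfJ)
        ext i j
        rw [LinearMap.toMatrix_apply]
        fin_cases j
        · change b.repr (f.restrict hPf (b 0)) i = _
          rw [e0]
          fin_cases i <;> simp
        · change b.repr (f.restrict hPf (b 1)) i = _
          rw [e1]
          fin_cases i <;> simp
      rw [← LinearMap.det_toMatrix b, this, Matrix.det_diagonal, Fin.prod_univ_two,
        ← Complex.mul_conj]
      rfl
    have hPpos : 0 < finrank ℂ P := by
      rw [finrank_span_eq_card hli]; simp
    have hlt : finrank ℂ (E ⧸ P) < n := by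
      have := Submodule.finrank_quotient_add_finrank P
      omega
    obtain ⟨r, hr, hr'⟩ := ih _ hlt (E ⧸ P) rfl (Submodule.mapQ P P J hPJ)
      (by rintro ⟨x⟩; exact congrArg (Submodule.Quotient.mk (p := P)) (hJ x))
      (Submodule.mapQ P P f hPf)
      (by rintro ⟨x⟩; exact congrArg (Submodule.Quotient.mk (p := P)) (hf x))
    refine ⟨Complex.normSq c * r, mul_nonneg (Complex.normSq_nonneg _) hr, ?_⟩
    rw [LinearMap.det_eq_det_mul_det P f hPf, hdet1, hr']
    push_cast; rfl

/-- A linear map which commutes with a quaternionic structure has non-negative determinant. -/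
theorem det_eq_nonneg [FiniteDimensional ℂ E] (hJ : ∀ x, J (J x) = -x) (f : E →ₗ[ℂ] E)
    (hf : ∀ x, f (J x) = J (f x)) : ∃ r : ℝ, 0 ≤ r ∧ LinearMap.det f = r :=
  det_eq_nonneg_aux _ E rfl J hJ f hf

theorem adapted_det_pos {X : Type*} [Fintype X] [DecidableEq X] (hJ : ∀ x, J (J x) = -x)
    (b c : Basis (X × Fin 2) ℂ E) (hb : IsAdapted J b) (hc : IsAdapted J c) :
    ∃ r : ℝ, 0 < r ∧ b.det c = r := by
  have : FiniteDimensional ℂ E := Module.Finite.of_basis b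
  let f : E ≃ₗ[ℂ] E := b.equiv c (Equiv.refl _)
  have hfb : ∀ x, f (b x) = c x := fun x => by simp [f]
  have hf : ∀ x, (f : E →ₗ[ℂ] E) (J x) = J (f x) := by
    have : ((f : E →ₗ[ℂ] E).comp J : E →ₛₗ[starRingEnd ℂ] E) = J.comp (f : E →ₗ[ℂ] E) := by
      refine b.ext ?_
      rintro ⟨x, k⟩
      fin_cases k
      · change f (J (b (x, 0))) = J (f (b (x, 0)))
        rw [hfb, ← hb, ← hc, hfb]
      · change f (J (b (x, 1))) = J (f (b (x, 1)))
        rw [hfb, hb, hc, hJ, hJ, map_neg, hfb]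
    exact fun x => LinearMap.congr_fun this x
  obtain ⟨r, hr, hr'⟩ := det_eq_nonneg hJ (f : E →ₗ[ℂ] E) hf
  have hdet : b.det c = LinearMap.det (f : E →ₗ[ℂ] E) := by
    rw [← LinearMap.det_toMatrix b, Basis.det_apply]
    congr 1
    ext i j
    rw [LinearMap.toMatrix_apply, Basis.toMatrix_apply]
    exact congrArg (fun z => b.repr z i) (hfb j).symm
  refine ⟨r, lt_of_le_of_ne hr fun h => ?_, hdet.trans hr'⟩
  have h1 : LinearMap.det (f : E →ₗ[ℂ] E) ≠ 0 := (LinearEquiv.isUnit_det' f).ne_zero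
  rw [hr', ← h] at h1
  simp at h1

end Quaternionic

/-! ### Hyperbolic bases -/

section Hyperbolic

open Module Matrix
open scoped ComplexOrder

lemma IsHyperbolic.gram {X E : Type*} [DecidableEq X] [AddCommGroup E] [Module ℂ E]
    {h : LinearMap.BilinForm ℂ E} {e : Basis (X × Fin 2) ℂ E} (he : IsHyperbolic h e)
    (x y : X × Fin 2) : h (e x) (e y) = if x.1 = y.1 then ![![0, 1], ![-1, 0]] x.2 y.2 else 0 := by
  obtain ⟨i, k⟩ := x
  obtain ⟨j, l⟩ := y
  fin_cases k <;> fin_cases l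
  · simpa using he.zero_zero i j
  · simpa using he.zero_one i j
  · have := LinearMap.IsAlt.neg he.alt (e (i, 1)) (e (j, 0))
    rw [he.zero_one] at this
    have h2 : h (e (i, 1)) (e (j, 0)) = -(if j = i then 1 else 0) := by rw [← this, neg_neg]
    simpa [eq_comm, neg_eq_iff_eq_neg, apply_ite] using h2
  · simpa using he.one_one i j

variable {X : Type*} [Fintype X] [DecidableEq X]

/-- The antilinear map `v ↦ Ω (conj v)`, for the standard symplectic matrix `Ω`. -/
def stdJ (X : Type*) : ((X × Fin 2) → ℂ) →ₛₗ[starRingEnd ℂ] ((X × Fin 2) → ℂ) where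
  toFun v x := if x.2 = 0 then conj (v (x.1, 1)) else - conj (v (x.1, 0))
  map_add' v w := by
    ext x
    by_cases h : x.2 = 0
    · simp [h]
    · simp [h]; ring
  map_smul' c v := by
    ext x
    by_cases h : x.2 = 0 <;> simp [h]

/-- The standard symplectic matrix. -/
def stdOmega (X : Type*) [DecidableEq X] : Matrix (X × Fin 2) (X × Fin 2) ℂ :=
  Matrix.of fun x y => if x.1 = y.1 then ![![0, 1], ![-1, 0]] x.2 y.2 else 0

lemma stdJ_apply (v : (X × Fin 2) → ℂ) : stdJ X v = stdOmega X *ᵥ (star v) := by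
  ext ⟨i, k⟩
  rw [mulVec, dotProduct, Fintype.sum_prod_type, Finset.sum_eq_single i]
  · fin_cases k <;> simp [stdJ, stdOmega, Fin.sum_univ_two]
  · intro j _ hj
    simp [stdOmega, Ne.symm hj]
  · simp

omit [Fintype X] [DecidableEq X] in
lemma stdJ_stdJ (v : (X × Fin 2) → ℂ) : stdJ X (stdJ X v) = -v := by
  ext ⟨i, k⟩
  fin_cases k <;> simp [stdJ]

lemma stdOmega_mul_self : stdOmega X * stdOmega X = -1 := by
  rw [← Matrix.toLin'.injective.eq_iff]
  ext v
  simp only [LinearMap.comp_apply, LinearMap.single_apply]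
  have h := stdJ_stdJ (X := X) (star (Pi.single v (1 : ℂ)))
  rw [stdJ_apply, stdJ_apply] at h
  have hs : star (stdOmega X *ᵥ star (star (Pi.single v (1 : ℂ)))) =
      stdOmega X *ᵥ (star (Pi.single v (1 : ℂ))) := by
    rw [star_star, star_mulVec]
    have h1 : (stdOmega X)ᴴ = (stdOmega X)ᵀ := by
      ext x y
      simp only [conjTranspose_apply, transpose_apply, stdOmega, of_apply]
      split_ifs
      · obtain ⟨_, k⟩ := x; obtain ⟨_, l⟩ := y
        fin_cases k <;> fin_cases l <;> simp
      · simp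
    rw [h1, vecMul_transpose]
  rw [hs] at h
  have h2 : star (Pi.single v (1 : ℂ)) = (Pi.single v (1 : ℂ) : (X × Fin 2) → ℂ) := by
    ext y; by_cases h : y = v
    · subst h; simp
    · simp [h]
  rw [h2] at h
  simpa [Matrix.mulVec_mulVec] using congrFun h _

omit [Fintype X] in
lemma stdOmega_conjTranspose : (stdOmega X)ᴴ = (stdOmega X)ᵀ := by
  ext x y
  simp only [conjTranspose_apply, transpose_apply, stdOmega, of_apply]
  split_ifs
  · obtain ⟨_, k⟩ := x; obtain ⟨_, l⟩ := y
    fin_cases k <;> fin_cases l <;> simp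
  · simp

/-- Symplectic matrices have determinant `1`. -/
theorem det_eq_one_of_symplectic {S : Matrix (X × Fin 2) (X × Fin 2) ℂ}
    (hS : Sᵀ * stdOmega X * S = stdOmega X) : S.det = 1 := by
  set Ω := stdOmega X with hΩ
  have hΩ2 : Ω * Ω = -1 := stdOmega_mul_self
  have hdΩ : Ω.det ≠ 0 := by
    intro h0
    have := congrArg Matrix.det hΩ2
    rw [det_mul, h0, zero_mul, Matrix.det_neg, det_one, mul_one] at this
    exact pow_ne_zero _ (by norm_num) this.symm
  have hsq : S.det * S.det = 1 := by
    have := congrArg Matrix.det hS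
    rw [det_mul, det_mul, det_transpose] at this
    have h2 : Ω.det * (S.det * S.det) = Ω.det * 1 := by linear_combination this
    exact mul_left_cancel₀ hdΩ h2
  have hSd : S.det ≠ 0 := fun h => by simp [h] at hsq
  have hSu : IsUnit S.det := hSd.isUnit
  have hSHu : IsUnit (Sᴴ).det := by
    rw [det_conjTranspose]; exact hSu.star
  -- `J (S v) = S⁻ᴴ (J v)`
  have hc : Sᴴ * Ω * S.map star = Ω := by
    have := congrArg (fun M : Matrix (X × Fin 2) (X × Fin 2) ℂ => M.map star) hS
    have hΩs : Ω.map star = Ω := by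
      have := stdOmega_conjTranspose (X := X)
      ext x y
      exact congrFun (congrFun this y) x
    have hm : ∀ M N : Matrix (X × Fin 2) (X × Fin 2) ℂ,
        (M * N).map star = M.map star * N.map star := fun M N =>
      Matrix.map_mul (f := starRingEnd ℂ)
    simp only [hm, hΩs] at this
    exact this
  have hJS : ∀ v, stdJ X (S *ᵥ v) = (Sᴴ)⁻¹ *ᵥ stdJ X v := by
    intro v
    have hsv : star (S *ᵥ v) = S.map star *ᵥ star v := by
      ext x
      simp [mulVec, dotProduct]
    rw [stdJ_apply, stdJ_apply, hsv, mulVec_mulVec, mulVec_mulVec]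
    congr 1
    rw [← hΩ]
    conv_rhs => rw [← hc, ← mul_assoc, ← mul_assoc, nonsing_inv_mul _ hSHu, one_mul]
  have hJS' : ∀ v, stdJ X ((Sᴴ)⁻¹ *ᵥ v) = S *ᵥ stdJ X v := by
    intro v
    have h1 := hJS (stdJ X v)
    rw [stdJ_stdJ, mulVec_neg] at h1
    have h2 := congrArg (stdJ X) h1
    rw [stdJ_stdJ, map_neg] at h2
    exact (neg_injective h2).symm
  obtain ⟨r, hr, hr'⟩ := det_eq_nonneg (J := stdJ X) stdJ_stdJ
    (Matrix.toLin' (S + (Sᴴ)⁻¹)) (fun v => by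
      rw [toLin'_apply, toLin'_apply, add_mulVec, add_mulVec, map_add, hJS, hJS', add_comm])
  rw [LinearMap.det_toLin'] at hr'
  have hpd : (Sᴴ * S + 1).PosDef :=
    PosDef.posSemidef_add (posSemidef_conjTranspose_mul_self S) PosDef.one
  have hdp := hpd.det_pos
  have hfac : (Sᴴ * S + 1).det = star S.det * r := by
    rw [← hr', ← det_conjTranspose, ← det_mul, mul_add, mul_nonsing_inv _ hSHu]
  rw [hfac] at hdp
  rcases mul_self_eq_one_iff.mp hsq with h | h
  · exact h
  · rw [h] at hdp
    exfalso
    have : (0 : ℝ) < -r := by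
      have h3 : (0 : ℂ) < ((-r : ℝ) : ℂ) := by simpa using hdp
      exact_mod_cast h3
    linarith

theorem IsHyperbolic.det_eq_one {E : Type*} [AddCommGroup E] [Module ℂ E]
    {h : LinearMap.BilinForm ℂ E} {e e' : Basis (X × Fin 2) ℂ E} (he : IsHyperbolic h e)
    (he' : IsHyperbolic h e') : e.det e' = 1 := by
  rw [Basis.det_apply]
  refine det_eq_one_of_symplectic ?_
  have h1 : LinearMap.BilinForm.toMatrix e h = stdOmega X := by
    ext x y; rw [LinearMap.BilinForm.toMatrix_apply, he.gram]; rfl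
  have h2 : LinearMap.BilinForm.toMatrix e' h = stdOmega X := by
    ext x y; rw [LinearMap.BilinForm.toMatrix_apply, he'.gram]; rfl
  rw [← h1, LinearMap.BilinForm.toMatrix_mul_basis_toMatrix, h1, h2]

end Hyperbolic

end

end HermClass

namespace HermClass

noncomputable section

/-! ### Square roots of positive operators -/

section Sqrt

open Module RCLike

theorem exists_commuting_sqrt {𝕜 V : Type*} [RCLike 𝕜] [AddCommGroup V] [Module 𝕜 V]
    [FiniteDimensional 𝕜 V] (c : InnerProductSpace.Core 𝕜 V) (A : V →ₗ[𝕜] V)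
    (hA : ∀ x y, c.inner (A x) y = c.inner x (A y))
    (hpos : ∀ x, x ≠ 0 → 0 < re (c.inner (A x) x)) :
    ∃ C : V →ₗ[𝕜] V, (∀ x, C (C x) = A x) ∧ (∀ x y, c.inner (C x) y = c.inner x (C y)) ∧
      (∀ x, x ≠ 0 → 0 < re (c.inner (C x) x)) ∧
      ∀ T : V →+ V, (∀ (r : ℝ) x, T ((r : 𝕜) • x) = (r : 𝕜) • T x) →
        (∀ x, T (A x) = A (T x)) → ∀ x, T (C x) = C (T x) := by
  let _ : NormedAddCommGroup V := c.toNormedAddCommGroup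
  let _ : InnerProductSpace 𝕜 V := InnerProductSpace.ofCore c.toCore
  have hA' : A.IsSymmetric := hA
  have hpos' : ∀ x, x ≠ 0 → 0 < re (inner 𝕜 (A x) x) := hpos
  let b := hA'.eigenvectorBasis rfl
  let l := hA'.eigenvalues rfl
  have hAb : ∀ i, A (b i) = (l i : 𝕜) • b i := hA'.apply_eigenvectorBasis rfl
  have hl : ∀ i, 0 < l i := by
    intro i
    have h1 := hpos' (b i) (b.orthonormal.ne_zero i)
    rw [hAb, inner_smul_left, b.inner_eq_one] at h1
    simpa using h1
  let C : V →ₗ[𝕜] V := b.toBasis.constr 𝕜 fun i => ((√(l i) : ℝ) : 𝕜) • b i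
  have hCb : ∀ i, C (b i) = ((√(l i) : ℝ) : 𝕜) • b i := fun i => by
    rw [← b.coe_toBasis]
    exact b.toBasis.constr_basis 𝕜 _ i
  have hsum : ∀ x, ∑ i, b.toBasis.repr x i • b i = x := fun x => by
    simpa using b.toBasis.sum_repr x
  have hCC : ∀ x, C (C x) = A x := by
    intro x
    conv_lhs => rw [← hsum x]
    conv_rhs => rw [← hsum x]
    simp only [map_sum, map_smul, hCb, hAb, smul_smul]
    refine Finset.sum_congr rfl fun i _ => ?_
    rw [mul_assoc, ← RCLike.ofReal_mul, Real.mul_self_sqrt (hl i).le]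
  have hCeig : ∀ (r : ℝ) x, A x = (r : 𝕜) • x → C x = ((√r : ℝ) : 𝕜) • x := by
    intro r x hx
    have h1 : ∀ i, b.toBasis.repr x i * (l i : 𝕜) = b.toBasis.repr x i * (r : 𝕜) := by
      intro i
      have h2 : A x = ∑ i, (b.toBasis.repr x i * (l i : 𝕜)) • b.toBasis i := by
        conv_lhs => rw [← hsum x]
        simp [map_sum, hAb, smul_smul]
      have h3 := congrArg (fun y => b.toBasis.repr y i) (h2.symm.trans hx)
      simp only [map_smul, Finsupp.smul_apply, smul_eq_mul] at h3
      rw [Basis.repr_sum_self] at h3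
      rw [h3, mul_comm]
    conv_lhs => rw [← hsum x]
    conv_rhs => rw [← hsum x]
    rw [map_sum, Finset.smul_sum]
    refine Finset.sum_congr rfl fun i _ => ?_
    rw [map_smul, hCb, smul_smul, smul_smul]
    by_cases h0 : b.toBasis.repr x i = 0
    · simp [h0]
    · have := mul_left_cancel₀ h0 (h1 i)
      rw [RCLike.ofReal_inj.mp this, mul_comm]
  have hin : ∀ x y, inner 𝕜 (C x) y = ∑ i, ((√(l i) : ℝ) : 𝕜) * (inner 𝕜 x (b i) * inner 𝕜 (b i) y) := by
    intro x y
    conv_lhs => rw [← b.sum_repr' x]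
    rw [map_sum, sum_inner]
    refine Finset.sum_congr rfl fun i _ => ?_
    rw [map_smul, hCb, inner_smul_left, inner_smul_left, inner_conj_symm, conj_ofReal]
    ring
  have hsym : ∀ x y, inner 𝕜 (C x) y = inner 𝕜 x (C y) := by
    intro x y
    rw [← inner_conj_symm x (C y), hin, hin, map_sum]
    refine Finset.sum_congr rfl fun i _ => ?_
    rw [map_mul, map_mul, inner_conj_symm, inner_conj_symm, conj_ofReal]
    ring
  refine ⟨C, hCC, hsym, ?_, ?_⟩
  · intro x hx
    change 0 < re (inner 𝕜 (C x) x)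
    rw [hin, map_sum]
    have hterm : ∀ i, re (((√(l i) : ℝ) : 𝕜) * (inner 𝕜 x (b i) * inner 𝕜 (b i) x)) =
        √(l i) * ‖inner 𝕜 (b i) x‖ ^ 2 := by
      intro i
      rw [← inner_conj_symm x (b i), RCLike.conj_mul, ← RCLike.ofReal_pow, ← RCLike.ofReal_mul,
        RCLike.ofReal_re]
    simp only [hterm]
    refine Finset.sum_pos' (fun i _ => by positivity) ?_
    by_contra hcon
    push Not at hcon
    refine hx (b.toBasis.ext_elem fun i => ?_)
    have h4 := hcon i (Finset.mem_univ i)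
    have h5 : 0 < √(l i) := Real.sqrt_pos.mpr (hl i)
    have h6 : ‖inner 𝕜 (b i) x‖ ^ 2 ≤ 0 := by
      by_contra h7
      push Not at h7
      exact absurd h4 (not_le.mpr (mul_pos h5 h7))
    have h7 : inner 𝕜 (b i) x = 0 := by
      simpa using le_antisymm h6 (by positivity)
    simpa [OrthonormalBasis.repr_apply_apply] using h7
  · intro T hT hTA x
    have h1 : ∀ y r, A y = ((r : ℝ) : 𝕜) • y → T (C y) = C (T y) := by
      intro y r hy
      rw [hCeig r y hy, hT, hCeig r (T y) (by rw [← hTA, hy, hT])]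
    conv_lhs => rw [← hsum x]
    conv_rhs => rw [← hsum x]
    simp only [map_sum]
    refine Finset.sum_congr rfl fun i _ => h1 _ (l i) ?_
    rw [map_smul, hAb, smul_comm]

end Sqrt

/-! ### Invariant forms -/

section Invariant

open Module

variable {G : Type*} [Group G] [Fintype G]

/-- The inner product given by a positive definite hermitian form. -/
abbrev IsHermPos.core {E : Type*} [AddCommGroup E] [Module ℂ E] {η : E →ₗ[ℂ] E →ₗ⋆[ℂ] ℂ}
    (h : IsHermPos η) : InnerProductSpace.Core ℂ E where
  inner x y := η y x
  conj_inner_symm x y := (h.symm x y).symm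
  re_inner_nonneg x := by
    by_cases hx : x = 0
    · simp [hx]
    · exact (h.pos x hx).le
  add_left x y z := by simp
  smul_left x y r := by simp
  definite x hx := by
    by_contra h0
    have := h.pos x h0
    simp [hx] at this

/-- The inner product given by a positive definite symmetric form. -/
abbrev bilinCore {E : Type*} [AddCommGroup E] [Module ℝ E] {t : LinearMap.BilinForm ℝ E}
    (hs : t.IsSymm) (hp : ∀ x, x ≠ 0 → 0 < t x x) : InnerProductSpace.Core ℝ E where
  inner x y := t x y
  conj_inner_symm x y := by simpa using hs.eq y x
  re_inner_nonneg x := by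
    by_cases hx : x = 0
    · simp [hx]
    · exact (hp x hx).le
  add_left x y z := by simp
  smul_left x y r := by simp
  definite x hx := by
    by_contra h0
    exact (hp x h0).ne' hx

theorem exists_invariant_hermPos {W : Type*} [AddCommGroup W] [Module ℂ W] [FiniteDimensional ℂ W]
    (ρ : Representation ℂ G W) :
    ∃ ν : W →ₗ[ℂ] W →ₗ⋆[ℂ] ℂ, IsHermPos ν ∧ ∀ g x y, ν (ρ g x) (ρ g y) = ν x y := by
  obtain ⟨η, hη⟩ := exists_hermPos W
  refine ⟨LinearMap.mk₂'ₛₗ (RingHom.id ℂ) (starRingEnd ℂ) (fun x y => ∑ g, η (ρ g x) (ρ g y))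
    (by intro x y z; simp [Finset.sum_add_distrib]) (by intro c x y; simp [Finset.mul_sum])
    (by intro x y z; simp [Finset.sum_add_distrib]) (by intro c x y; simp [Finset.mul_sum]),
    ⟨fun x y => ?_, fun x hx => ?_⟩, fun h x y => ?_⟩
  · simp only [LinearMap.mk₂'ₛₗ_apply, map_sum]
    exact Finset.sum_congr rfl fun g _ => hη.symm _ _
  · simp only [LinearMap.mk₂'ₛₗ_apply, Complex.re_sum]
    refine Finset.sum_pos (fun g _ => hη.pos _ fun h0 => hx ?_) Finset.univ_nonempty
    have : ρ g⁻¹ (ρ g x) = x := by rw [← Module.End.mul_apply, ← map_mul]; simp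
    rw [← this, h0, map_zero]
  · simp only [LinearMap.mk₂'ₛₗ_apply]
    refine Fintype.sum_equiv (Equiv.mulRight h) _ _ fun g => ?_
    simp [map_mul]

theorem exists_invariant_posDef {M : Type*} [AddCommGroup M] [Module ℝ M] [FiniteDimensional ℝ M]
    (a : Representation ℝ G M) :
    ∃ t : LinearMap.BilinForm ℝ M, t.IsSymm ∧ (∀ x, x ≠ 0 → 0 < t x x) ∧
      ∀ g x y, t (a g x) (a g y) = t x y := by
  let b := finBasis ℝ M
  refine ⟨LinearMap.mk₂ ℝ (fun x y => ∑ g, ∑ i, b.repr (a g x) i * b.repr (a g y) i)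
    (by intro x y z; simp [add_mul, Finset.sum_add_distrib])
    (by intro c x y; simp [Finset.mul_sum, mul_assoc])
    (by intro x y z; simp [mul_add, Finset.sum_add_distrib])
    (by intro c x y; simp [Finset.mul_sum, mul_left_comm]), ⟨fun x y => ?_⟩, fun x hx => ?_,
    fun h x y => ?_⟩
  · simp [LinearMap.mk₂_apply, mul_comm]
  · simp only [LinearMap.mk₂_apply]
    refine Finset.sum_pos (fun g _ => ?_) Finset.univ_nonempty
    refine Finset.sum_pos' (fun _ _ => mul_self_nonneg _) ?_
    by_contra hcon
    push Not at hcon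
    have h0 : a g x = 0 := b.ext_elem fun i => by
      simpa using le_antisymm (hcon i (Finset.mem_univ i)) (mul_self_nonneg _)
    have : a g⁻¹ (a g x) = x := by rw [← Module.End.mul_apply, ← map_mul]; simp
    exact hx (by rw [← this, h0, map_zero])
  · simp only [LinearMap.mk₂_apply]
    refine Fintype.sum_equiv (Equiv.mulRight h) _ _ fun g => ?_
    simp [map_mul]

theorem signDecomposition_nonempty {M : Type*} [AddCommGroup M] [Module ℝ M]
    [FiniteDimensional ℝ M] (a : Representation ℝ G M) (σ : LinearMap.BilinForm ℝ M)
    (hs : σ.IsSymm) (hn : σ.Nondegenerate) (hinv : ∀ g x y, σ (a g x) (a g y) = σ x y) :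
    Nonempty (SignDecomposition a σ) := by
  obtain ⟨t, ts, tp, ti⟩ := exists_invariant_posDef a
  have tn : t.Nondegenerate := by
    have h1 : ∀ x, (∀ y, t x y = 0) → x = 0 := fun x hx => by
      by_contra h0
      exact (tp x h0).ne' (hx x)
    exact ⟨h1, fun x hx => h1 x fun y => by rw [ts.eq, hx]⟩
  let A := LinearMap.BilinForm.symmCompOfNondegenerate σ t tn
  have hA : ∀ x y, t (A x) y = σ x y := fun x y =>
    LinearMap.BilinForm.symmCompOfNondegenerate_left_apply σ tn y x
  have ext_t : ∀ x y, (∀ z, t x z = t y z) → x = y := fun x y h =>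
    sub_eq_zero.mp (tn.1 _ fun z => by simp [h z])
  have hAsym : ∀ x y, t (A x) y = t x (A y) := fun x y => by
    rw [hA, hs.eq, ← hA, ts.eq]
  have hAinj : ∀ x, A x = 0 → x = 0 := fun x hx => hn.1 x fun y => by rw [← hA, hx]; simp
  have hAG : ∀ g x, a g (A x) = A (a g x) := by
    intro g x
    refine ext_t _ _ fun z => ?_
    have h1 : a g (a g⁻¹ z) = z := by rw [← Module.End.mul_apply, ← map_mul]; simp
    rw [← h1, ti, hA, hA, hinv]
  obtain ⟨C, hCC, hCs, hCp, hCT⟩ := exists_commuting_sqrt (bilinCore ts tp) (A ∘ₗ A)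
    (fun x y => by
      change t (A (A x)) y = t x (A (A y))
      rw [hAsym, hAsym])
    (fun x hx => by
      change 0 < t (A (A x)) x
      rw [hAsym]
      exact tp _ fun h => hx (hAinj x h))
  have hCp' : ∀ x, x ≠ 0 → 0 < t (C x) x := hCp
  have hCG : ∀ g x, a g (C x) = C (a g x) := fun g =>
    hCT (a g : M →ₗ[ℝ] M).toAddMonoidHom (fun r x => by simp) (fun x => by
      simp [hAG])
  have hCA : ∀ x, A (C x) = C (A x) :=
    hCT A.toAddMonoidHom (fun r x => by simp) (fun x => by simp)
  have hCinj : ∀ x, C x = 0 → x = 0 := fun x hx => by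
    by_contra h0
    have := hCp' x h0
    simp [hx] at this
  let Ce := LinearEquiv.ofInjectiveEndo C
    ((injective_iff_map_eq_zero C).mpr hCinj)
  have hCe : ∀ x, C (Ce.symm x) = x := fun x => Ce.apply_symm_apply x
  refine ⟨⟨LinearMap.ker (A - C), LinearMap.ker (A + C), ?_, ?_, ?_, ?_, ?_⟩⟩
  · intro g x hx
    simp only [Submodule.mem_comap, LinearMap.mem_ker, LinearMap.sub_apply] at hx ⊢
    rw [← hAG, ← hCG, ← map_sub, hx, map_zero]
  · intro g x hx
    simp only [Submodule.mem_comap, LinearMap.mem_ker, LinearMap.add_apply] at hx ⊢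
    rw [← hAG, ← hCG, ← map_add, hx, map_zero]
  · constructor
    · rw [Submodule.disjoint_def]
      intro x h1 h2
      simp only [LinearMap.mem_ker, LinearMap.sub_apply, LinearMap.add_apply] at h1 h2
      refine hCinj x ?_
      have : (2 : ℝ) • C x = 0 := by
        rw [sub_eq_zero.mp h1] at h2
        rw [two_smul, h2]
      simpa using this
    · rw [codisjoint_iff, eq_top_iff]
      intro x _
      refine Submodule.mem_sup.mpr ⟨(2 : ℝ)⁻¹ • (x + A (Ce.symm x)), ?_,
        (2 : ℝ)⁻¹ • (x - A (Ce.symm x)), ?_, ?_⟩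
      · have h1 : C (A (Ce.symm x)) = A x := by rw [← hCA, hCe]
        have h2 : A (A (Ce.symm x)) = C x := by
          have := hCC (Ce.symm x)
          rw [hCe] at this
          exact this.symm
        simp [LinearMap.mem_ker, h1, h2, add_comm]
      · have h1 : C (A (Ce.symm x)) = A x := by rw [← hCA, hCe]
        have h2 : A (A (Ce.symm x)) = C x := by
          have := hCC (Ce.symm x)
          rw [hCe] at this
          exact this.symm
        simp [LinearMap.mem_ker, h1, h2]
      · rw [← smul_add]
        have : x + A (Ce.symm x) + (x - A (Ce.symm x)) = (2 : ℝ) • x := by rw [two_smul]; abel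
        rw [this, smul_smul]; norm_num
  · intro x hx h0
    have : A x = C x := sub_eq_zero.mp hx
    rw [← hA, this]
    exact hCp' x h0
  · intro x hx h0
    have : A x = - C x := eq_neg_of_add_eq_zero_left hx
    rw [← hA, this, map_neg, LinearMap.neg_apply, neg_lt_zero]
    exact hCp' x h0

omit [Fintype G] in
/-- Invariant positive definite hermitian forms are equivalent under equivariant automorphisms. -/
theorem exists_equivariant_isometry {W : Type*} [AddCommGroup W] [Module ℂ W]
    [FiniteDimensional ℂ W] (ρ : Representation ℂ G W) {ν ν' : W →ₗ[ℂ] W →ₗ⋆[ℂ] ℂ}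
    (h : IsHermPos ν) (h' : IsHermPos ν') (hi : ∀ g x y, ν (ρ g x) (ρ g y) = ν x y)
    (hi' : ∀ g x y, ν' (ρ g x) (ρ g y) = ν' x y) :
    ∃ C : W ≃ₗ[ℂ] W, (∀ g x, C (ρ g x) = ρ g (C x)) ∧ ∀ x y, ν (C x) (C y) = ν' x y := by
  obtain ⟨o, ho⟩ := h.exists_orthon_basis
  have hexp : ∀ x, x = ∑ i, ν x (o i) • o i := by
    intro x
    have h1 : ∀ i, ν x (o i) = o.repr x i := by
      intro i
      conv_lhs => rw [← o.sum_repr x]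
      simp only [map_sum, map_smul, LinearMap.sum_apply, LinearMap.smul_apply]
      rw [Finset.sum_eq_single i (fun j _ hj => by rw [ho.2 _ _ hj, smul_zero])
        (fun h => absurd (Finset.mem_univ i) h), ho.1, smul_eq_mul, mul_one]
    simp only [h1, o.sum_repr]
  let A : W →ₗ[ℂ] W := ∑ i, (ν'.flip (o i)).smulRight (o i)
  have hA0 : ∀ x, A x = ∑ i, ν' x (o i) • o i := fun x => by simp [A]
  have hA : ∀ x y, ν (A x) y = ν' x y := by
    intro x y
    conv_rhs => rw [hexp y]
    rw [hA0]
    simp only [map_sum, map_smul, LinearMap.sum_apply, LinearMap.smul_apply, LinearMap.map_smulₛₗ]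
    refine Finset.sum_congr rfl fun i _ => ?_
    rw [← h.symm, smul_eq_mul, smul_eq_mul, mul_comm]
  have ext_ν : ∀ x y, (∀ z, ν x z = ν y z) → x = y := fun x y hxy => by
    by_contra hne
    have := h.pos (x - y) (sub_ne_zero.mpr hne)
    simp [hxy] at this
  have hAG : ∀ g x, ρ g (A x) = A (ρ g x) := by
    intro g x
    refine ext_ν _ _ fun z => ?_
    have h1 : ρ g (ρ g⁻¹ z) = z := by rw [← Module.End.mul_apply, ← map_mul]; simp
    rw [← h1, hi, hA, hA, hi']
  obtain ⟨C, hCC, hCs, hCp, hCT⟩ := exists_commuting_sqrt h.core A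
    (fun x y => by
      change ν y (A x) = ν (A y) x
      rw [h.symm, hA, hA, ← h'.symm])
    (fun x hx => by
      change 0 < (ν x (A x)).re
      rw [h.symm, hA, Complex.conj_re]
      exact h'.pos x hx)
  have hCs' : ∀ x y, ν y (C x) = ν (C y) x := hCs
  have hCp' : ∀ x, x ≠ 0 → 0 < (ν x (C x)).re := hCp
  have hCinj : ∀ x, C x = 0 → x = 0 := fun x hx => by
    by_contra h0
    have := hCp' x h0
    simp [hx] at this
  refine ⟨LinearEquiv.ofInjectiveEndo C ((injective_iff_map_eq_zero C).mpr hCinj), ?_, ?_⟩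
  · intro g x
    exact (hCT (ρ g : W →ₗ[ℂ] W).toAddMonoidHom (fun r x => by simp) (fun x => by
      simp [hAG]) x).symm
  · intro x y
    change ν (C x) (C y) = ν' x y
    rw [hCs', hCC, hA]

/-- A symplectic representation of a finite group carries an invariant quaternionic structure. -/
theorem exists_quaternionic {W : Type*} [AddCommGroup W] [Module ℂ W]
    [FiniteDimensional ℂ W] (ρ : Representation ℂ G W) (κ : LinearMap.BilinForm ℂ W)
    (halt : κ.IsAlt) (hn : ∀ y, (∀ x, κ x y = 0) → y = 0)
    (hinv : ∀ g x y, κ (ρ g x) (ρ g y) = κ x y) :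
    ∃ (J : W →ₛₗ[starRingEnd ℂ] W) (ν : W →ₗ[ℂ] W →ₗ⋆[ℂ] ℂ), (∀ x, J (J x) = -x) ∧
      (∀ g x, J (ρ g x) = ρ g (J x)) ∧ IsHermPos ν ∧ ∀ x y, ν x y = κ x (J y) := by
  obtain ⟨ν, h, hi⟩ := exists_invariant_hermPos ρ
  obtain ⟨o, ho⟩ := h.exists_orthon_basis
  have hexp : ∀ x, x = ∑ i, ν x (o i) • o i := by
    intro x
    have h1 : ∀ i, ν x (o i) = o.repr x i := by
      intro i
      conv_lhs => rw [← o.sum_repr x]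
      simp only [map_sum, map_smul, LinearMap.sum_apply, LinearMap.smul_apply]
      rw [Finset.sum_eq_single i (fun j _ hj => by rw [ho.2 _ _ hj, smul_zero])
        (fun h => absurd (Finset.mem_univ i) h), ho.1, smul_eq_mul, mul_one]
    simp only [h1, o.sum_repr]
  let K : W →ₛₗ[starRingEnd ℂ] W :=
    { toFun := fun y => ∑ i, conj (κ (o i) y) • o i
      map_add' := fun x y => by simp [add_smul, Finset.sum_add_distrib]
      map_smul' := fun c x => by simp [Finset.smul_sum, smul_smul] }
  have hK : ∀ x y, ν x (K y) = κ x y := by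
    intro x y
    conv_rhs => rw [hexp x]
    change ν x (∑ i, conj (κ (o i) y) • o i) = _
    simp only [map_sum, map_smul, LinearMap.sum_apply, LinearMap.smul_apply, LinearMap.map_smulₛₗ,
      Complex.conj_conj]
    exact Finset.sum_congr rfl fun i _ => mul_comm _ _
  have ext_ν : ∀ x y, (∀ z, ν z x = ν z y) → x = y := fun x y hxy => by
    by_contra hne
    have := h.pos (x - y) (sub_ne_zero.mpr hne)
    simp [hxy] at this
  have hKG : ∀ g x, K (ρ g x) = ρ g (K x) := by
    intro g x
    refine ext_ν _ _ fun z => ?_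
    have h1 : ρ g (ρ g⁻¹ z) = z := by rw [← Module.End.mul_apply, ← map_mul]; simp
    rw [← h1, hi, hK, hK, hinv]
  have hKinj : ∀ x, K x = 0 → x = 0 := fun x hx => hn x fun y => by rw [← hK, hx, map_zero]
  have hsk : ∀ x y, ν x (K y) = - ν y (K x) := fun x y => by
    rw [hK, hK, LinearMap.BilinForm.IsAlt.neg_eq halt]
  let A : W →ₗ[ℂ] W := -(K.comp K)
  have hAapp : ∀ x, A x = - K (K x) := fun _ => rfl
  have hA : ∀ x y, ν x (A y) = ν (K y) (K x) := fun x y => by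
    rw [hAapp, map_neg, hsk, neg_neg]
  obtain ⟨C, hCC, hCs, hCp, hCT⟩ := exists_commuting_sqrt h.core A
    (fun x y => by
      change ν y (A x) = ν (A y) x
      rw [h.symm x (A y), hA, hA, ← h.symm])
    (fun x hx => by
      change 0 < (ν x (A x)).re
      rw [hA]
      exact h.pos _ fun h0 => hx (hKinj x h0))
  have hCs' : ∀ x y, ν y (C x) = ν (C y) x := hCs
  have hCp' : ∀ x, x ≠ 0 → 0 < (ν x (C x)).re := hCp
  have hCinj : ∀ x, C x = 0 → x = 0 := fun x hx => by
    by_contra h0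
    have := hCp' x h0
    simp [hx] at this
  let Ce := LinearEquiv.ofInjectiveEndo C ((injective_iff_map_eq_zero C).mpr hCinj)
  have hCe : ∀ x, C (Ce.symm x) = x := fun x => Ce.apply_symm_apply x
  have hCe' : ∀ x, Ce.symm (C x) = x := fun x => Ce.symm_apply_apply x
  have hCG : ∀ g x, ρ g (C x) = C (ρ g x) := fun g =>
    hCT (ρ g : W →ₗ[ℂ] W).toAddMonoidHom (fun r x => by simp) (fun x => by
      simp [hAapp, hKG])
  have hCK : ∀ x, K (C x) = C (K x) :=
    hCT K.toAddMonoidHom (fun r x => by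
      change K ((r : ℂ) • x) = (r : ℂ) • K x
      rw [LinearMap.map_smulₛₗ, Complex.conj_ofReal]) (fun x => by simp [hAapp])
  have hCKs : ∀ x, K (Ce.symm x) = Ce.symm (K x) := fun x => by
    rw [← hCe' (K (Ce.symm x)), ← hCK, hCe]
  let J : W →ₛₗ[starRingEnd ℂ] W := -(Ce.symm : W →ₗ[ℂ] W).comp K
  have hJ : ∀ x, J x = - Ce.symm (K x) := fun _ => rfl
  have hCn : ∀ x, Ce.symm (-C x) = -x := fun x => by rw [_root_.map_neg Ce.symm, hCe']
  have hform : ∀ x y, κ x (J y) = ν x (C y) := by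
    intro x y
    have h1 : K (K y) = - C (C y) := by rw [hCC, hAapp, neg_neg]
    rw [← hK, hJ, map_neg K, hCKs, h1, hCn, neg_neg]
  refine ⟨J, LinearMap.mk₂'ₛₗ (RingHom.id ℂ) (starRingEnd ℂ) (fun x y => κ x (J y))
    (by intro x y z; simp) (by intro c x y; simp) (by intro x y z; simp)
    (by intro c x y; simp), ?_, ?_, ⟨?_, ?_⟩, fun x y => rfl⟩
  · intro x
    have h1 : K (K x) = - C (C x) := by rw [hCC, hAapp, neg_neg]
    rw [hJ, hJ, map_neg K, hCKs, h1, hCn, _root_.map_neg Ce.symm, _root_.map_neg Ce.symm, hCe', neg_neg]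
  · intro g x
    have h1 : ρ g (K x) = C (ρ g (Ce.symm (K x))) := by rw [← hCG, hCe]
    rw [hJ, hJ, hKG, h1, hCe', map_neg (ρ g)]
  · intro x y
    simp only [LinearMap.mk₂'ₛₗ_apply]
    rw [hform, hform, ← h.symm, hCs']
  · intro x hx
    simp only [LinearMap.mk₂'ₛₗ_apply]
    rw [hform]
    exact hCp' x hx

end Invariant

end

end HermClass

namespace HermClass

noncomputable section

/-! ### Volumes -/

section Volume

open Module

variable {E F : Type*} [AddCommGroup E] [Module ℂ E] [AddCommGroup F] [Module ℂ F]
  {ι κ μ : Type*}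

/-- The absolute value of the determinant of the change of basis from `c` to `b`, for bases which
may have different index types. -/
def vol (c : Basis ι ℂ E) (b : Basis κ ℂ E) : ℝ :=
  ‖LinearMap.det ((c.equiv b (c.indexEquiv b) : E ≃ₗ[ℂ] E) : E →ₗ[ℂ] E)‖

lemma det_basis_equiv [Fintype ι] [DecidableEq ι] (c : Basis ι ℂ E) (b : Basis κ ℂ E)
    (e : ι ≃ κ) : LinearMap.det ((c.equiv b e : E ≃ₗ[ℂ] E) : E →ₗ[ℂ] E) = c.det (b ∘ e) := by
  rw [← LinearMap.det_toMatrix c, Basis.det_apply]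
  congr 1
  ext i j
  rw [LinearMap.toMatrix_apply, Basis.toMatrix_apply]
  simp

lemma norm_det_comp_perm [Fintype ι] [DecidableEq ι] (c : Basis ι ℂ E) (v : ι → E)
    (π : Equiv.Perm ι) : ‖c.det (v ∘ π)‖ = ‖c.det v‖ := by
  rw [AlternatingMap.map_perm]
  rcases Int.units_eq_one_or (Equiv.Perm.sign π) with h | h <;> simp [h]

lemma vol_eq_det [Fintype ι] [DecidableEq ι] (c : Basis ι ℂ E) (b : Basis κ ℂ E) (e : ι ≃ κ) :
    vol c b = ‖c.det (b ∘ e)‖ := by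
  rw [vol, det_basis_equiv, ← norm_det_comp_perm c (b ∘ e) ((c.indexEquiv b).trans e.symm)]
  congr 2
  ext i
  simp

lemma vol_eq [Finite ι] (c : Basis ι ℂ E) (b : Basis κ ℂ E) (e : ι ≃ κ) :
    vol c b = ‖LinearMap.det ((c.equiv b e : E ≃ₗ[ℂ] E) : E →ₗ[ℂ] E)‖ := by
  classical
  have := Fintype.ofFinite ι
  rw [vol_eq_det c b e, det_basis_equiv]

lemma vol_pos (c : Basis ι ℂ E) (b : Basis κ ℂ E) : 0 < vol c b :=
  norm_pos_iff.mpr (LinearEquiv.isUnit_det' _).ne_zero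

lemma vol_trans [Finite ι] (a : Basis ι ℂ E) (b : Basis κ ℂ E) (c : Basis μ ℂ E) :
    vol a b * vol b c = vol a c := by
  have : Finite κ := Finite.of_equiv _ (a.indexEquiv b)
  rw [vol_eq a c ((a.indexEquiv b).trans (b.indexEquiv c)), vol, vol, mul_comm, ← norm_mul,
    ← LinearMap.det_comp]
  congr 2
  refine a.ext fun i => ?_
  simp

lemma vol_self [Finite ι] (c : Basis ι ℂ E) : vol c c = 1 := by
  have h := vol_trans c c c
  exact mul_left_cancel₀ (vol_pos c c).ne' (h.trans (mul_one _).symm)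

lemma vol_reindex_right [Finite ι] (c : Basis ι ℂ E) (b : Basis κ ℂ E) (e : κ ≃ μ) :
    vol c (b.reindex e) = vol c b := by
  rw [vol_eq c _ ((c.indexEquiv b).trans e), vol]
  congr 2
  refine c.ext fun i => ?_
  simp

lemma vol_symm [Finite ι] (c : Basis ι ℂ E) (b : Basis κ ℂ E) : vol b c = (vol c b)⁻¹ :=
  eq_inv_of_mul_eq_one_right ((vol_trans c b c).trans (vol_self c))

lemma vol_reindex_left [Finite ι] (c : Basis ι ℂ E) (b : Basis κ ℂ E) (e : ι ≃ μ) :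
    vol (c.reindex e) b = vol c b := by
  have : Finite κ := Finite.of_equiv _ (c.indexEquiv b)
  rw [vol_symm b, vol_reindex_right, ← vol_symm b]

lemma vol_map [Finite ι] (c : Basis ι ℂ E) (b : Basis κ ℂ E) (f : E ≃ₗ[ℂ] F) :
    vol (c.map f) (b.map f) = vol c b := by
  rw [vol_eq _ _ (c.indexEquiv b), vol, ← LinearMap.det_conj _ f]
  congr 2

lemma vol_prod {ι' κ' : Type*} [Finite ι] [Finite ι'] (c : Basis ι ℂ E) (b : Basis κ ℂ E)
    (c' : Basis ι' ℂ F) (b' : Basis κ' ℂ F) :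
    vol (c.prod c') (b.prod b') = vol c b * vol c' b' := by
  have := Module.Finite.of_basis c
  have := Module.Finite.of_basis c'
  rw [vol_eq _ _ ((c.indexEquiv b).sumCongr (c'.indexEquiv b')), vol, vol, ← norm_mul,
    ← LinearMap.det_prodMap]
  congr 2
  refine (c.prod c').ext ?_
  rintro (i | i)
  · rw [LinearEquiv.coe_coe, Basis.equiv_apply]; simp
  · rw [LinearEquiv.coe_coe, Basis.equiv_apply]; simp

/-- The absolute value of the Gram determinant. -/
def gr [Fintype ι] [DecidableEq ι] (η : E →ₗ[ℂ] E →ₗ⋆[ℂ] ℂ) (v : ι → E) : ℝ :=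
  ‖(Matrix.of fun i j => η (v i) (v j)).det‖

lemma gr_comp_equiv [Fintype ι] [DecidableEq ι] [Fintype κ] [DecidableEq κ]
    (η : E →ₗ[ℂ] E →ₗ⋆[ℂ] ℂ) (v : ι → E) (e : κ ≃ ι) : gr η (v ∘ e) = gr η v := by
  rw [gr, gr, ← Matrix.det_submatrix_equiv_self e]
  rfl

lemma gr_family [Fintype ι] [DecidableEq ι] (η : E →ₗ[ℂ] E →ₗ⋆[ℂ] ℂ) (b : Basis ι ℂ E)
    (v : ι → E) : gr η v = ‖b.det v‖ ^ 2 * gr η b := by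
  have h : (Matrix.of fun i j => η (v i) (v j)) =
      (b.toMatrix v).transpose * (Matrix.of fun i j => η (b i) (b j)) *
        (b.toMatrix v).map (starRingEnd ℂ) := by
    ext i j
    simp only [Matrix.of_apply, Matrix.mul_apply, Matrix.transpose_apply, Matrix.map_apply,
      Basis.toMatrix_apply]
    conv_lhs => rw [← b.sum_repr (v i), ← b.sum_repr (v j)]
    simp only [map_sum, LinearMap.sum_apply, map_smul, LinearMap.smul_apply, LinearMap.map_smulₛₗ,
      Finset.sum_mul, smul_eq_mul, Finset.mul_sum]
    refine Finset.sum_congr rfl fun k _ => Finset.sum_congr rfl fun l _ => by ring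
  have h2 : ((b.toMatrix v).map (starRingEnd ℂ)).det = conj (b.toMatrix v).det :=
    (RingHom.map_det (starRingEnd ℂ) _).symm
  rw [gr, h, Matrix.det_mul, Matrix.det_mul, Matrix.det_transpose, h2, norm_mul, norm_mul,
    RCLike.norm_conj, Basis.det_apply, gr]
  ring

lemma gr_basis [Fintype ι] [DecidableEq ι] [Fintype κ] [DecidableEq κ]
    (η : E →ₗ[ℂ] E →ₗ⋆[ℂ] ℂ) (b : Basis ι ℂ E) (c : Basis κ ℂ E) :
    gr η c = vol b c ^ 2 * gr η b := by
  rw [vol_eq_det b c (b.indexEquiv c), ← gr_family, gr_comp_equiv]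

lemma IsOrthon.gr [Fintype ι] [DecidableEq ι] {η : E →ₗ[ℂ] E →ₗ⋆[ℂ] ℂ} {v : ι → E}
    (h : IsOrthon η v) : gr η v = 1 := by
  have : (Matrix.of fun i j => η (v i) (v j)) = 1 := by
    ext i j
    by_cases hij : i = j
    · subst hij; simp [h.1]
    · simp [hij, h.2 _ _ hij]
  rw [HermClass.gr, this, Matrix.det_one, norm_one]

lemma IsOrthon.vol_eq_one [Finite ι] [Finite κ] {η : E →ₗ[ℂ] E →ₗ⋆[ℂ] ℂ} {b : Basis ι ℂ E}
    {c : Basis κ ℂ E} (hb : IsOrthon η b) (hc : IsOrthon η c) : vol b c = 1 := by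
  classical
  have := Fintype.ofFinite ι
  have := Fintype.ofFinite κ
  have h := gr_basis η b c
  rw [hb.gr, hc.gr, mul_one] at h
  have := vol_pos b c
  nlinarith

lemma gr_ne_zero [Fintype ι] [DecidableEq ι] {η : E →ₗ[ℂ] E →ₗ⋆[ℂ] ℂ} (b : Basis ι ℂ E)
    (h : ∀ x, (∀ y, η x y = 0) → x = 0) : gr η b ≠ 0 := by
  intro h0
  rw [gr, norm_eq_zero] at h0
  obtain ⟨v, hv, hv0⟩ := Matrix.exists_vecMul_eq_zero_iff.mpr h0
  refine hv ?_
  have h1 : ∑ i, v i • b i = 0 := by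
    refine h _ fun y => ?_
    rw [← b.sum_repr y, map_sum]
    refine Finset.sum_eq_zero fun j _ => ?_
    rw [LinearMap.map_smulₛₗ]
    have := congrFun hv0 j
    simp only [Matrix.vecMul, dotProduct, Matrix.of_apply, Pi.zero_apply] at this
    simp [this]
  ext i
  exact Fintype.linearIndependent_iff.mp b.linearIndependent v h1 i

end Volume

/-! ### Invariants of tensor products -/

section TensorInv

open Module

variable {G : Type*} [Group G] {W W' M N Q : Type*} [AddCommGroup W] [Module ℂ W]
  [AddCommGroup W'] [Module ℂ W'] [AddCommGroup M] [Module ℝ M] [AddCommGroup N] [Module ℝ N]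
  [AddCommGroup Q] [Module ℝ Q]
  (ρ : Representation ℂ G W) (ρ' : Representation ℂ G W')

lemma finite_tensor (W M : Type*) [AddCommGroup W] [Module ℂ W] [AddCommGroup M] [Module ℝ M]
    [FiniteDimensional ℂ W] [FiniteDimensional ℝ M] : FiniteDimensional ℂ (W ⊗[ℝ] M) :=
  Module.Finite.of_basis ((finBasis ℂ W).tensorProduct (finBasis ℝ M))

instance [FiniteDimensional ℂ W] [FiniteDimensional ℝ M] (a : Representation ℝ G M) :
    FiniteDimensional ℂ (inv ρ a) :=
  have := finite_tensor W M
  inferInstance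

variable {ρ ρ'} in
/-- The map `(M ⊗ W)^G → (M ⊗ W')^G` induced by an equivariant map `W → W'`. -/
def mapW (Φ : W →ₗ[ℂ] W') (h : ∀ g x, Φ (ρ g x) = ρ' g (Φ x)) (a : Representation ℝ G M) :
    inv ρ a →ₗ[ℂ] inv ρ' a :=
  (TensorProduct.AlgebraTensorModule.map Φ LinearMap.id).restrict (by
    intro x hx g
    have e : (tens ρ' a g) ∘ₗ TensorProduct.AlgebraTensorModule.map Φ LinearMap.id
        = TensorProduct.AlgebraTensorModule.map Φ (LinearMap.id : M →ₗ[ℝ] M) ∘ₗ tens ρ a g := by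
      ext w m
      simp [tens, h]
    have := LinearMap.congr_fun e x
    simp only [LinearMap.comp_apply] at this
    rw [this, hx g])

variable {ρ ρ'}

lemma mapW_coe (Φ : W →ₗ[ℂ] W') (h : ∀ g x, Φ (ρ g x) = ρ' g (Φ x)) (a : Representation ℝ G M)
    (x : inv ρ a) : ((mapW Φ h a x : inv ρ' a) : W' ⊗[ℝ] M) =
      TensorProduct.AlgebraTensorModule.map Φ LinearMap.id (x : W ⊗[ℝ] M) := rfl

lemma invMap_coe {a : Representation ℝ G M} {b : Representation ℝ G N}
    (φ : M →ₗ[ℝ] N) (h : ∀ g x, φ (a g x) = b g (φ x)) (x : inv ρ a) :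
    ((invMap ρ φ h x : inv ρ b) : W ⊗[ℝ] N) =
      TensorProduct.AlgebraTensorModule.map (LinearMap.id : W →ₗ[ℂ] W) φ (x : W ⊗[ℝ] M) := rfl

lemma map_id_eq_lTensor (φ : M →ₗ[ℝ] N) (x : W ⊗[ℝ] M) :
    TensorProduct.AlgebraTensorModule.map (LinearMap.id : W →ₗ[ℂ] W) φ x =
      LinearMap.lTensor W φ x := rfl

lemma mapW_invMap (Φ : W →ₗ[ℂ] W') (h : ∀ g x, Φ (ρ g x) = ρ' g (Φ x))
    {a : Representation ℝ G M} {b : Representation ℝ G N}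
    (φ : M →ₗ[ℝ] N) (hφ : ∀ g x, φ (a g x) = b g (φ x)) (x : inv ρ a) :
    mapW Φ h b (invMap ρ φ hφ x) = invMap ρ' φ hφ (mapW Φ h a x) := by
  refine Subtype.ext ?_
  rw [mapW_coe, invMap_coe, invMap_coe, mapW_coe]
  generalize (x : W ⊗[ℝ] M) = y
  induction y with
  | zero => simp
  | add x y hx hy => simp only [map_add, hx, hy]
  | tmul w m => simp

section Exact

variable [Fintype G] {a : Representation ℝ G M} {b : Representation ℝ G N}
  {c : Representation ℝ G Q}

/-- Averaging over the group. -/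
def avg (ρ : Representation ℂ G W) (a : Representation ℝ G M) (x : W ⊗[ℝ] M) : inv ρ a :=
  ⟨(Fintype.card G : ℂ)⁻¹ • ∑ g, tens ρ a g x, fun h => by
    rw [map_smul, map_sum]
    congr 1
    refine Fintype.sum_equiv (Equiv.mulLeft h) _ _ fun g => ?_
    rw [Equiv.coe_mulLeft, map_mul]
    rfl⟩

lemma avg_coe (x : inv ρ a) : avg ρ a (x : W ⊗[ℝ] M) = x := by
  refine Subtype.ext ?_
  have h : ∀ g, tens ρ a g (x : W ⊗[ℝ] M) = x := fun g => x.2 g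
  simp only [avg, h, Finset.sum_const, Finset.card_univ]
  rw [← Nat.cast_smul_eq_nsmul ℂ, smul_smul, inv_mul_cancel₀ (by simp), one_smul]

lemma invMap_avg (φ : M →ₗ[ℝ] N) (h : ∀ g x, φ (a g x) = b g (φ x)) (x : W ⊗[ℝ] M) :
    invMap ρ φ h (avg ρ a x) = avg ρ b (LinearMap.lTensor W φ x) := by
  refine Subtype.ext ?_
  rw [invMap_coe]
  simp only [avg, map_smul, map_sum]
  congr 1
  refine Finset.sum_congr rfl fun g _ => ?_
  rw [← map_id_eq_lTensor]
  induction x with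
  | zero => simp
  | add x y hx hy => simp only [map_add, hx, hy]
  | tmul w m => simp [tens, h]

lemma invMap_surjective (φ : M →ₗ[ℝ] N) (h : ∀ g x, φ (a g x) = b g (φ x))
    (hφ : Function.Surjective φ) : Function.Surjective (invMap ρ φ h) := by
  intro y
  obtain ⟨x, hx⟩ := LinearMap.lTensor_surjective W hφ (y : W ⊗[ℝ] N)
  exact ⟨avg ρ a x, by rw [invMap_avg, hx, avg_coe]⟩

omit [Fintype G] in
lemma invMap_injective (φ : M →ₗ[ℝ] N) (h : ∀ g x, φ (a g x) = b g (φ x))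
    (hφ : Function.Injective φ) : Function.Injective (invMap ρ φ h) := by
  intro x y hxy
  have := congrArg Subtype.val hxy
  rw [invMap_coe, invMap_coe, map_id_eq_lTensor, map_id_eq_lTensor] at this
  exact Subtype.ext (Module.Flat.lTensor_preserves_injective_linearMap φ hφ this)

lemma invMap_exact (φ : M →ₗ[ℝ] N) (h : ∀ g x, φ (a g x) = b g (φ x)) (ψ : N →ₗ[ℝ] Q)
    (h' : ∀ g x, ψ (b g x) = c g (ψ x)) (hex : Function.Exact φ ψ) :
    Function.Exact (invMap ρ φ h) (invMap ρ ψ h') := by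
  have hT := Module.Flat.lTensor_exact W hex
  intro y
  constructor
  · intro hy
    have h1 := congrArg Subtype.val hy
    rw [invMap_coe, map_id_eq_lTensor] at h1
    obtain ⟨x, hx⟩ := (hT _).mp h1
    exact ⟨avg ρ a x, by rw [invMap_avg, hx, avg_coe]⟩
  · rintro ⟨x, rfl⟩
    refine Subtype.ext ?_
    rw [invMap_coe, invMap_coe, map_id_eq_lTensor, map_id_eq_lTensor]
    exact hT.apply_apply_eq_zero _

end Exact

/-! ### Hermitian forms on invariants -/

section Herm

lemma tensHerm_tmul (ν : W →ₗ[ℂ] W →ₗ⋆[ℂ] ℂ) (σ : LinearMap.BilinForm ℝ M) (w w' : W) (x x' : M) :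
    tensHerm ν σ (w ⊗ₜ x) (w' ⊗ₜ x') = σ x x' • ν w w' := by
  simp [tensHerm, LinearMap.BilinMap.tmul, realify]

lemma tensHerm_add_left (ν : W →ₗ[ℂ] W →ₗ⋆[ℂ] ℂ) (σ : LinearMap.BilinForm ℝ M) (x y z : W ⊗[ℝ] M) :
    tensHerm ν σ (x + y) z = tensHerm ν σ x z + tensHerm ν σ y z := by
  simp [tensHerm]

lemma tensHerm_add_right (ν : W →ₗ[ℂ] W →ₗ⋆[ℂ] ℂ) (σ : LinearMap.BilinForm ℝ M)
    (x y z : W ⊗[ℝ] M) : tensHerm ν σ x (y + z) = tensHerm ν σ x y + tensHerm ν σ x z := by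
  simp [tensHerm]

lemma tensHerm_zero_left (ν : W →ₗ[ℂ] W →ₗ⋆[ℂ] ℂ) (σ : LinearMap.BilinForm ℝ M)
    (z : W ⊗[ℝ] M) : tensHerm ν σ 0 z = 0 := by
  simp [tensHerm]

lemma tensHerm_zero_right (ν : W →ₗ[ℂ] W →ₗ⋆[ℂ] ℂ) (σ : LinearMap.BilinForm ℝ M)
    (z : W ⊗[ℝ] M) : tensHerm ν σ z 0 = 0 := by
  simp [tensHerm]

lemma tensor_induction₂ {X Y : Type*} [AddCommGroup X] [Module ℝ X] [AddCommGroup Y] [Module ℝ Y]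
    {p : W ⊗[ℝ] M → X ⊗[ℝ] Y → Prop} (h0 : ∀ y, p 0 y) (h0' : ∀ x, p x 0)
    (ha : ∀ x x' y, p x y → p x' y → p (x + x') y) (ha' : ∀ x y y', p x y → p x y' → p x (y + y'))
    (ht : ∀ w m w' m', p (w ⊗ₜ m) (w' ⊗ₜ m')) (x : W ⊗[ℝ] M) (y : X ⊗[ℝ] Y) : p x y := by
  induction x with
  | zero => exact h0 y
  | add x x' hx hx' => exact ha _ _ _ hx hx'
  | tmul w m =>
    induction y with
    | zero => exact h0' _
    | add y y' hy hy' => exact ha' _ _ _ hy hy'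
    | tmul w' m' => exact ht _ _ _ _

lemma tensHerm_smul_left (ν : W →ₗ[ℂ] W →ₗ⋆[ℂ] ℂ) (σ : LinearMap.BilinForm ℝ M) (c : ℂ)
    (x y : W ⊗[ℝ] M) : tensHerm ν σ (c • x) y = c * tensHerm ν σ x y := by
  refine tensor_induction₂ (p := fun x y => tensHerm ν σ (c • x) y = c * tensHerm ν σ x y)
    (fun y => ?_) (fun x => ?_) (fun x x' y h h' => ?_) (fun x y y' h h' => ?_)
    (fun w m w' m' => ?_) x y
  · simp [tensHerm_zero_left]
  · simp [tensHerm_zero_right]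
  · rw [smul_add, tensHerm_add_left, tensHerm_add_left, h, h', mul_add]
  · rw [tensHerm_add_right, tensHerm_add_right, h, h', mul_add]
  · rw [TensorProduct.smul_tmul', tensHerm_tmul, tensHerm_tmul]
    simp [mul_left_comm]

lemma tensHerm_smul_right (ν : W →ₗ[ℂ] W →ₗ⋆[ℂ] ℂ) (σ : LinearMap.BilinForm ℝ M) (c : ℂ)
    (x y : W ⊗[ℝ] M) : tensHerm ν σ x (c • y) = conj c * tensHerm ν σ x y := by
  refine tensor_induction₂ (p := fun x y => tensHerm ν σ x (c • y) = conj c * tensHerm ν σ x y)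
    (fun y => ?_) (fun x => ?_) (fun x x' y h h' => ?_) (fun x y y' h h' => ?_)
    (fun w m w' m' => ?_) x y
  · simp [tensHerm_zero_left]
  · simp [tensHerm_zero_right]
  · rw [tensHerm_add_left, tensHerm_add_left, h, h', mul_add]
  · rw [smul_add, tensHerm_add_right, tensHerm_add_right, h, h', mul_add]
  · rw [TensorProduct.smul_tmul', tensHerm_tmul, tensHerm_tmul]
    simp [mul_left_comm]

/-- The hermitian form `ν ⊗ σ` on `(M ⊗ W)^G`. -/
def hermInv (ρ : Representation ℂ G W) (a : Representation ℝ G M) (ν : W →ₗ[ℂ] W →ₗ⋆[ℂ] ℂ)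
    (σ : LinearMap.BilinForm ℝ M) : inv ρ a →ₗ[ℂ] inv ρ a →ₗ⋆[ℂ] ℂ :=
  LinearMap.mk₂'ₛₗ (RingHom.id ℂ) (starRingEnd ℂ) (fun x y => tensHerm ν σ x y)
    (fun _ _ _ => tensHerm_add_left ν σ _ _ _) (fun c _ _ => tensHerm_smul_left ν σ c _ _)
    (fun _ _ _ => tensHerm_add_right ν σ _ _ _) (fun c _ _ => tensHerm_smul_right ν σ c _ _)

lemma hermInv_apply (a : Representation ℝ G M) (ν : W →ₗ[ℂ] W →ₗ⋆[ℂ] ℂ)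
    (σ : LinearMap.BilinForm ℝ M) (x y : inv ρ a) :
    hermInv ρ a ν σ x y = tensHerm ν σ (x : W ⊗[ℝ] M) y := rfl

lemma tensHerm_mapW (ν : W →ₗ[ℂ] W →ₗ⋆[ℂ] ℂ) {W₁ W₂ : Type*} [AddCommGroup W₁] [Module ℂ W₁]
    [AddCommGroup W₂] [Module ℂ W₂] (f : W₁ →ₗ[ℂ] W) (g : W₂ →ₗ[ℂ] W)
    (σ : LinearMap.BilinForm ℝ M) (x : W₁ ⊗[ℝ] M) (y : W₂ ⊗[ℝ] M) (h0 : ∀ w w', ν (f w) (g w') = 0) :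
    tensHerm ν σ (TensorProduct.AlgebraTensorModule.map f LinearMap.id x)
      (TensorProduct.AlgebraTensorModule.map g LinearMap.id y) = 0 := by
  refine tensor_induction₂ (p := fun x y => tensHerm ν σ (TensorProduct.AlgebraTensorModule.map f
      LinearMap.id x) (TensorProduct.AlgebraTensorModule.map g LinearMap.id y) = 0)
    (fun y => ?_) (fun x => ?_) (fun x x' y h h' => ?_) (fun x y y' h h' => ?_)
    (fun w m w' m' => ?_) x y
  · rw [map_zero, tensHerm_zero_left]
  · rw [map_zero, tensHerm_zero_right]
  · rw [map_add, tensHerm_add_left, h, h', add_zero]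
  · rw [map_add, tensHerm_add_right, h, h', add_zero]
  · simp [tensHerm_tmul, h0]

lemma tensHerm_isometry (ν : W →ₗ[ℂ] W →ₗ⋆[ℂ] ℂ) (ν' : W' →ₗ[ℂ] W' →ₗ⋆[ℂ] ℂ) (f : W →ₗ[ℂ] W')
    (hf : ∀ x y, ν' (f x) (f y) = ν x y) (σ : LinearMap.BilinForm ℝ M) (x y : W ⊗[ℝ] M) :
    tensHerm ν' σ (TensorProduct.AlgebraTensorModule.map f LinearMap.id x)
      (TensorProduct.AlgebraTensorModule.map f LinearMap.id y) = tensHerm ν σ x y := by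
  refine tensor_induction₂ (p := fun x y => tensHerm ν' σ (TensorProduct.AlgebraTensorModule.map f
      LinearMap.id x) (TensorProduct.AlgebraTensorModule.map f LinearMap.id y) = tensHerm ν σ x y)
    (fun y => ?_) (fun x => ?_) (fun x x' y h h' => ?_) (fun x y y' h h' => ?_)
    (fun w m w' m' => ?_) x y
  · rw [map_zero, tensHerm_zero_left, tensHerm_zero_left]
  · rw [map_zero, tensHerm_zero_right, tensHerm_zero_right]
  · rw [map_add, tensHerm_add_left, h, h', tensHerm_add_left]
  · rw [map_add, tensHerm_add_right, h, h', tensHerm_add_right]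
  · simp [tensHerm_tmul, hf]

lemma tensHerm_symm {ν : W →ₗ[ℂ] W →ₗ⋆[ℂ] ℂ} (hν : IsHermPos ν) {σ : LinearMap.BilinForm ℝ M}
    (hσ : σ.IsSymm) (x y : W ⊗[ℝ] M) : tensHerm ν σ y x = conj (tensHerm ν σ x y) := by
  refine tensor_induction₂ (p := fun x y => tensHerm ν σ y x = conj (tensHerm ν σ x y))
    (fun y => ?_) (fun x => ?_) (fun x x' y h h' => ?_) (fun x y y' h h' => ?_)
    (fun w m w' m' => ?_) x y
  · rw [tensHerm_zero_left, tensHerm_zero_right, map_zero]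
  · rw [tensHerm_zero_left, tensHerm_zero_right, map_zero]
  · rw [tensHerm_add_right, h, h', tensHerm_add_left, map_add]
  · rw [tensHerm_add_left, h, h', tensHerm_add_right, map_add]
  · rw [tensHerm_tmul, tensHerm_tmul, hσ.eq, hν.symm]; simp

lemma tensHerm_invariant {ν : W →ₗ[ℂ] W →ₗ⋆[ℂ] ℂ} (hν : ∀ g x y, ν (ρ g x) (ρ g y) = ν x y)
    {σ : LinearMap.BilinForm ℝ M} {a : Representation ℝ G M}
    (hσ : ∀ g x y, σ (a g x) (a g y) = σ x y) (g : G) (x y : W ⊗[ℝ] M) :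
    tensHerm ν σ (tens ρ a g x) (tens ρ a g y) = tensHerm ν σ x y := by
  refine tensor_induction₂ (p := fun x y => tensHerm ν σ (tens ρ a g x) (tens ρ a g y) =
      tensHerm ν σ x y)
    (fun y => ?_) (fun x => ?_) (fun x x' y h h' => ?_) (fun x y y' h h' => ?_)
    (fun w m w' m' => ?_) x y
  · rw [map_zero, tensHerm_zero_left, tensHerm_zero_left]
  · rw [map_zero, tensHerm_zero_right, tensHerm_zero_right]
  · rw [map_add, tensHerm_add_left, h, h', tensHerm_add_left]
  · rw [map_add, tensHerm_add_right, h, h', tensHerm_add_right]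
  · simp [tens, tensHerm_tmul, hν, hσ]

lemma tensor_eq_sum {ι : Type*} [Fintype ι] (b : Basis ι ℝ M) (x : W ⊗[ℝ] M) :
    ∃ w : ι → W, x = ∑ i, w i ⊗ₜ[ℝ] b i := by
  induction x with
  | zero => exact ⟨0, by simp⟩
  | add x y hx hy =>
    obtain ⟨w, rfl⟩ := hx
    obtain ⟨w', rfl⟩ := hy
    exact ⟨w + w', by simp [TensorProduct.add_tmul, Finset.sum_add_distrib]⟩
  | tmul w m =>
    refine ⟨fun i => b.repr m i • w, ?_⟩
    conv_lhs => rw [← b.sum_repr m]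
    rw [TensorProduct.tmul_sum]
    exact Finset.sum_congr rfl fun i _ => by rw [TensorProduct.smul_tmul]

lemma tensHerm_sum_right {ι : Type*} (s : Finset ι) (ν : W →ₗ[ℂ] W →ₗ⋆[ℂ] ℂ)
    (σ : LinearMap.BilinForm ℝ M) (x : W ⊗[ℝ] M) (y : ι → W ⊗[ℝ] M) :
    tensHerm ν σ x (∑ i ∈ s, y i) = ∑ i ∈ s, tensHerm ν σ x (y i) := by
  simp [tensHerm, map_sum]

lemma tensHerm_sum_left {ι : Type*} (s : Finset ι) (ν : W →ₗ[ℂ] W →ₗ⋆[ℂ] ℂ)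
    (σ : LinearMap.BilinForm ℝ M) (x : W ⊗[ℝ] M) (y : ι → W ⊗[ℝ] M) :
    tensHerm ν σ (∑ i ∈ s, y i) x = ∑ i ∈ s, tensHerm ν σ (y i) x := by
  simp [tensHerm, map_sum, LinearMap.sum_apply]

/-- The tensor product of positive definite forms is positive definite. -/
lemma tensHerm_pos [FiniteDimensional ℝ M] {ν : W →ₗ[ℂ] W →ₗ⋆[ℂ] ℂ} (hν : IsHermPos ν)
    {σ : LinearMap.BilinForm ℝ M} (hs : σ.IsSymm) (hp : ∀ x, x ≠ 0 → 0 < σ x x) {x : W ⊗[ℝ] M}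
    (hx : x ≠ 0) : 0 < (tensHerm ν σ x x).re := by
  obtain ⟨b, hb⟩ : ∃ b : Basis (Fin (finrank ℝ M)) ℝ M, ∀ i j, i ≠ j → σ (b i) (b j) = 0 := by
    obtain ⟨v, hv⟩ := LinearMap.BilinForm.exists_orthogonal_basis (B := σ) (LinearMap.BilinForm.isSymm_iff.mp hs)
    exact ⟨v, fun i j hij => hv hij⟩
  obtain ⟨w, rfl⟩ := tensor_eq_sum b x
  have h1 : tensHerm ν σ (∑ i, w i ⊗ₜ[ℝ] b i) (∑ i, w i ⊗ₜ[ℝ] b i) =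
      ∑ i, σ (b i) (b i) • ν (w i) (w i) := by
    rw [tensHerm_sum_left]
    refine Finset.sum_congr rfl fun i _ => ?_
    rw [tensHerm_sum_right, Finset.sum_eq_single i]
    · rw [tensHerm_tmul]
    · intro j _ hj
      rw [tensHerm_tmul, hb i j (Ne.symm hj), zero_smul]
    · simp
  rw [h1, Complex.re_sum]
  have hnn : ∀ i, 0 ≤ (σ (b i) (b i) • ν (w i) (w i)).re := fun i => by
    rw [Complex.smul_re]
    refine smul_nonneg (hp _ (b.ne_zero i)).le ?_
    by_cases h0 : w i = 0
    · simp [h0]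
    · exact (hν.pos _ h0).le
  refine Finset.sum_pos' (fun i _ => hnn i) ?_
  by_contra hcon
  push Not at hcon
  refine hx (Finset.sum_eq_zero fun i _ => ?_)
  have h0 : w i = 0 := by
    by_contra h0
    have h2 := hcon i (Finset.mem_univ i)
    rw [Complex.smul_re, smul_eq_mul] at h2
    exact absurd h2 (not_le.mpr (mul_pos (hp _ (b.ne_zero i)) (hν.pos _ h0)))
  rw [h0, TensorProduct.zero_tmul]

lemma tensHerm_nondeg [FiniteDimensional ℝ M] {ν : W →ₗ[ℂ] W →ₗ⋆[ℂ] ℂ} (hν : IsHermPos ν)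
    {σ : LinearMap.BilinForm ℝ M} (hn : σ.Nondegenerate) {x : W ⊗[ℝ] M}
    (hx : ∀ y, tensHerm ν σ x y = 0) : x = 0 := by
  classical
  let b := finBasis ℝ M
  obtain ⟨w, rfl⟩ := tensor_eq_sum b x
  refine Finset.sum_eq_zero fun i _ => ?_
  obtain ⟨y, hy⟩ : ∃ y, ∀ x, σ x y = b.coord i x := by
    have := (σ.flip).toDual (LinearMap.BilinForm.nondegenerate_flip_iff.mpr hn) |>.surjective (b.coord i)
    obtain ⟨y, hy⟩ := this
    exact ⟨y, fun x => LinearMap.congr_fun hy x⟩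
  have h0 : w i = 0 := by
    by_contra h0
    have h1 := hx (w i ⊗ₜ y)
    rw [tensHerm_sum_left, Finset.sum_eq_single i] at h1
    · rw [tensHerm_tmul, hy] at h1
      have := hν.pos _ h0
      simp at h1
      rw [h1] at this
      simp at this
    · intro j _ hj
      rw [tensHerm_tmul, hy]
      simp [Finsupp.single_eq_of_ne hj.symm]
    · simp
  rw [h0, TensorProduct.zero_tmul]

lemma hermInv_nondeg [Fintype G] [FiniteDimensional ℝ M] {ν : W →ₗ[ℂ] W →ₗ⋆[ℂ] ℂ} (hν : IsHermPos ν)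
    (hνi : ∀ g x y, ν (ρ g x) (ρ g y) = ν x y) {σ : LinearMap.BilinForm ℝ M}
    {a : Representation ℝ G M} (hn : σ.Nondegenerate)
    (hσi : ∀ g x y, σ (a g x) (a g y) = σ x y) (x : inv ρ a)
    (hx : ∀ y, hermInv ρ a ν σ x y = 0) : x = 0 := by
  refine Subtype.ext (tensHerm_nondeg hν hn fun y => ?_)
  have h1 := hx (avg ρ a y)
  rw [hermInv_apply] at h1
  simp only [avg] at h1
  rw [tensHerm_smul_right, tensHerm_sum_right] at h1
  have h2 : ∀ g, tensHerm ν σ (x : W ⊗[ℝ] M) (tens ρ a g y) = tensHerm ν σ (x : W ⊗[ℝ] M) y := by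
    intro g
    conv_lhs => rw [← x.2 g]
    exact tensHerm_invariant hνi hσi g _ _
  simp only [h2, Finset.sum_const, Finset.card_univ, nsmul_eq_mul] at h1
  simpa using h1

end Herm

/-! ### Quaternionic structures on invariants -/

section Quat

variable (J : W →ₛₗ[starRingEnd ℂ] W)

/-- `J ⊗ 1` on `W ⊗ M`. -/
def tensJ (M : Type*) [AddCommGroup M] [Module ℝ M] : W ⊗[ℝ] M →ₛₗ[starRingEnd ℂ] W ⊗[ℝ] M :=
  { toFun := LinearMap.rTensor M
      ({ toFun := J, map_add' := J.map_add, map_smul' := fun r x => by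
          change J ((r : ℂ) • x) = (r : ℂ) • J x
          rw [LinearMap.map_smulₛₗ, Complex.conj_ofReal] } : W →ₗ[ℝ] W)
    map_add' := fun x y => map_add _ x y
    map_smul' := fun c x => by
      induction x with
      | zero => simp
      | add x y hx hy => simp only [smul_add, map_add, hx, hy]
      | tmul w m =>
        simp only [TensorProduct.smul_tmul', LinearMap.rTensor_tmul, LinearMap.coe_mk,
          AddHom.coe_mk, LinearMap.map_smulₛₗ] }

lemma tensJ_tmul (w : W) (m : M) : tensJ J M (w ⊗ₜ m) = J w ⊗ₜ m := rfl

variable {J}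

lemma tensJ_tens (hJ : ∀ g x, J (ρ g x) = ρ g (J x)) (a : Representation ℝ G M) (g : G)
    (x : W ⊗[ℝ] M) : tensJ J M (tens ρ a g x) = tens ρ a g (tensJ J M x) := by
  induction x with
  | zero => simp
  | add x y hx hy => simp only [map_add, hx, hy]
  | tmul w m => simp [tens, tensJ_tmul, hJ]

/-- `J ⊗ 1` on `(M ⊗ W)^G`. -/
def invJ (hJ : ∀ g x, J (ρ g x) = ρ g (J x)) (a : Representation ℝ G M) :
    inv ρ a →ₛₗ[starRingEnd ℂ] inv ρ a where
  toFun x := ⟨tensJ J M x, fun g => by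
    rw [← tensJ_tens hJ, x.2 g]⟩
  map_add' x y := Subtype.ext (map_add (tensJ J M) _ _)
  map_smul' c x := Subtype.ext ((tensJ J M).map_smulₛₗ _ _)

lemma invJ_coe (hJ : ∀ g x, J (ρ g x) = ρ g (J x)) (a : Representation ℝ G M) (x : inv ρ a) :
    ((invJ hJ a x : inv ρ a) : W ⊗[ℝ] M) = tensJ J M (x : W ⊗[ℝ] M) := rfl

lemma tensJ_tensJ (hJ2 : ∀ x, J (J x) = -x) (x : W ⊗[ℝ] M) : tensJ J M (tensJ J M x) = -x := by
  induction x with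
  | zero => simp
  | add x y hx hy => simp only [map_add, hx, hy, neg_add]
  | tmul w m => rw [tensJ_tmul, tensJ_tmul, hJ2, TensorProduct.neg_tmul]

lemma invJ_invJ (hJ2 : ∀ x, J (J x) = -x) (hJ : ∀ g x, J (ρ g x) = ρ g (J x))
    (a : Representation ℝ G M) (x : inv ρ a) : invJ hJ a (invJ hJ a x) = -x :=
  Subtype.ext (tensJ_tensJ hJ2 _)

lemma invJ_invMap (hJ : ∀ g x, J (ρ g x) = ρ g (J x)) {a : Representation ℝ G M}
    {b : Representation ℝ G N} (φ : M →ₗ[ℝ] N) (h : ∀ g x, φ (a g x) = b g (φ x)) (x : inv ρ a) :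
    invJ hJ b (invMap ρ φ h x) = invMap ρ φ h (invJ hJ a x) := by
  refine Subtype.ext ?_
  rw [invJ_coe, invMap_coe, invMap_coe, invJ_coe]
  generalize (x : W ⊗[ℝ] M) = y
  induction y with
  | zero => simp
  | add x y hx hy => simp only [map_add, hx, hy]
  | tmul w m => simp [tensJ_tmul]

lemma tensHerm_tensJ {ν : W →ₗ[ℂ] W →ₗ⋆[ℂ] ℂ} (hν : ∀ x y, ν (J x) (J y) = conj (ν x y))
    (σ : LinearMap.BilinForm ℝ M) (x y : W ⊗[ℝ] M) :
    tensHerm ν σ (tensJ J M x) (tensJ J M y) = conj (tensHerm ν σ x y) := by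
  refine tensor_induction₂ (p := fun x y => tensHerm ν σ (tensJ J M x) (tensJ J M y) =
      conj (tensHerm ν σ x y))
    (fun y => ?_) (fun x => ?_) (fun x x' y h h' => ?_) (fun x y y' h h' => ?_)
    (fun w m w' m' => ?_) x y
  · rw [map_zero, tensHerm_zero_left, tensHerm_zero_left, map_zero]
  · rw [map_zero, tensHerm_zero_right, tensHerm_zero_right, map_zero]
  · rw [map_add, tensHerm_add_left, h, h', tensHerm_add_left, map_add]
  · rw [map_add, tensHerm_add_right, h, h', tensHerm_add_right, map_add]
  · simp [tensJ_tmul, tensHerm_tmul, hν]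

lemma tensHerm_eq_tmul {ν : W →ₗ[ℂ] W →ₗ⋆[ℂ] ℂ} {κ : LinearMap.BilinForm ℂ W}
    (hν : ∀ x y, ν x y = κ x (J y)) (σ : LinearMap.BilinForm ℝ M) (x y : W ⊗[ℝ] M) :
    tensHerm ν σ x y = LinearMap.BilinForm.tmul κ σ x (tensJ J M y) := by
  refine tensor_induction₂ (p := fun x y => tensHerm ν σ x y =
      LinearMap.BilinForm.tmul κ σ x (tensJ J M y))
    (fun y => ?_) (fun x => ?_) (fun x x' y h h' => ?_) (fun x y y' h h' => ?_)
    (fun w m w' m' => ?_) x y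
  · rw [tensHerm_zero_left, map_zero, LinearMap.zero_apply]
  · rw [tensHerm_zero_right, map_zero, map_zero]
  · rw [tensHerm_add_left, h, h', map_add, LinearMap.add_apply]
  · rw [tensHerm_add_right, h, h', map_add, map_add]
  · rw [tensHerm_tmul, tensJ_tmul, hν]
    exact (LinearMap.BilinForm.tensorDistrib_tmul ℝ ℂ κ σ w m (J w') m').symm

end Quat

/-! ### Bases of invariants of free modules -/

section Free

variable [Fintype G]

/-- `∑_g g w ⊗ g m`. -/
def sumOrbit (ρ : Representation ℂ G W) (a : Representation ℝ G M) (m : M) (w : W) : inv ρ a :=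
  ⟨∑ g, tens ρ a g (w ⊗ₜ[ℝ] m), fun h => by
    rw [map_sum]
    refine Fintype.sum_equiv (Equiv.mulLeft h) _ _ fun g => ?_
    rw [Equiv.coe_mulLeft, map_mul]
    rfl⟩

lemma sumOrbit_coe (a : Representation ℝ G M) (m : M) (w : W) :
    ((sumOrbit ρ a m w : inv ρ a) : W ⊗[ℝ] M) = ∑ g, ρ g w ⊗ₜ[ℝ] a g m := rfl

lemma mapW_sumOrbit (Φ : W →ₗ[ℂ] W') (h : ∀ g x, Φ (ρ g x) = ρ' g (Φ x)) (a : Representation ℝ G M)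
    (m : M) (w : W) : mapW Φ h a (sumOrbit ρ a m w) = sumOrbit ρ' a m (Φ w) := by
  refine Subtype.ext ?_
  rw [mapW_coe, sumOrbit_coe, sumOrbit_coe, map_sum]
  simp [h]

lemma invJ_sumOrbit {J : W →ₛₗ[starRingEnd ℂ] W} (hJ : ∀ g x, J (ρ g x) = ρ g (J x))
    (a : Representation ℝ G M) (m : M) (w : W) :
    invJ hJ a (sumOrbit ρ a m w) = sumOrbit ρ a m (J w) := by
  refine Subtype.ext ?_
  rw [invJ_coe, sumOrbit_coe, sumOrbit_coe, map_sum]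
  simp [tensJ_tmul, hJ]

lemma sumOrbit_smul_left (a : Representation ℝ G M) (h : G) (m : M) (w : W) :
    sumOrbit ρ a (a h m) w = sumOrbit ρ a m (ρ h⁻¹ w) := by
  refine Subtype.ext ?_
  rw [sumOrbit_coe, sumOrbit_coe]
  refine Fintype.sum_equiv (Equiv.mulRight h) _ _ fun g => ?_
  simp [map_mul]

/-- `∑_j ∑_g g y_j ⊗ g m_j`, as a linear map of `y`. -/
def sumOrbits (ρ : Representation ℂ G W) (a : Representation ℝ G M) {X : Type*} [Fintype X]
    (m : X → M) : (X → W) →ₗ[ℂ] inv ρ a where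
  toFun y := ∑ j, sumOrbit ρ a (m j) (y j)
  map_add' y y' := by
    rw [← Finset.sum_add_distrib]
    refine Finset.sum_congr rfl fun j _ => Subtype.ext ?_
    rw [Submodule.coe_add, sumOrbit_coe, sumOrbit_coe, sumOrbit_coe]
    simp [TensorProduct.add_tmul, Finset.sum_add_distrib]
  map_smul' c y := by
    rw [Finset.smul_sum]
    refine Finset.sum_congr rfl fun j _ => Subtype.ext ?_
    rw [Submodule.coe_smul, sumOrbit_coe, sumOrbit_coe]
    simp [TensorProduct.smul_tmul', Finset.smul_sum]

variable {X : Type*} [Fintype X]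

lemma sumOrbits_coe (a : Representation ℝ G M) (m : X → M) (y : X → W) :
    ((sumOrbits ρ a m y : inv ρ a) : W ⊗[ℝ] M) = ∑ j, ∑ g, ρ g (y j) ⊗ₜ[ℝ] a g (m j) := by
  change ((∑ j, sumOrbit ρ a (m j) (y j) : inv ρ a) : W ⊗[ℝ] M) = _
  rw [AddSubmonoidClass.coe_finsetSum]
  rfl

/-- The coordinate map `W ⊗ M → W` given by a linear form on `M`. -/
def tensCoord (W : Type*) [AddCommGroup W] [Module ℂ W] (f : M →ₗ[ℝ] ℝ) : W ⊗[ℝ] M →ₗ[ℝ] W :=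
  (TensorProduct.rid ℝ W).toLinearMap ∘ₗ LinearMap.lTensor W f

lemma tensCoord_tmul (f : M →ₗ[ℝ] ℝ) (w : W) (m : M) : tensCoord W f (w ⊗ₜ m) = f m • w := by
  simp [tensCoord]

lemma sumOrbits_bijective (a : Representation ℝ G M) (m : X → M) (b : Basis (G × X) ℝ M)
    (hb : ∀ x, b x = a x.1 (m x.2)) : Function.Bijective (sumOrbits ρ a m) := by
  classical
  constructor
  · rw [injective_iff_map_eq_zero]
    intro y hy
    ext j
    have h1 := congrArg (fun x : inv ρ a => tensCoord W (b.coord (1, j)) (x : W ⊗[ℝ] M)) hy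
    simp only [sumOrbits_coe, map_sum, tensCoord_tmul, Submodule.coe_zero, map_zero] at h1
    rw [Finset.sum_eq_single j, Finset.sum_eq_single 1] at h1
    · have : b.coord (1, j) (a 1 (m j)) = 1 := by
        rw [← hb (1, j)]; simp
      rw [this] at h1
      simpa using h1
    · intro g _ hg
      have : b.coord (1, j) (a g (m j)) = 0 := by
        rw [← hb (g, j)]; simp [hg]
      rw [this, zero_smul]
    · simp
    · intro k _ hk
      refine Finset.sum_eq_zero fun g _ => ?_
      have : b.coord (1, j) (a g (m k)) = 0 := by
        rw [← hb (g, k)]; simp [hk]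
      rw [this, zero_smul]
    · simp
  · intro x
    obtain ⟨w, hw⟩ := tensor_eq_sum b (x : W ⊗[ℝ] M)
    have hc : ∀ p, tensCoord W (b.coord p) (∑ i, w i ⊗ₜ[ℝ] b i) = w p := by
      intro p
      simp only [map_sum, tensCoord_tmul]
      rw [Finset.sum_eq_single p]
      · simp
      · intro q _ hq
        simp [hq]
      · simp
    have hinv : ∀ g j, w (g, j) = ρ g (w (1, j)) := by
      intro g j
      have h1 := x.2 g
      rw [hw] at h1
      have h2 := congrArg (tensCoord W (b.coord (g, j))) h1
      rw [hc, map_sum, map_sum] at h2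
      rw [← h2, Finset.sum_eq_single (1, j)]
      · have h3 : tens ρ a g (w (1, j) ⊗ₜ[ℝ] b (1, j)) = ρ g (w (1, j)) ⊗ₜ[ℝ] b (g, j) := by
          rw [hb, hb]; simp [tens]
        rw [h3, tensCoord_tmul]; simp
      · rintro ⟨h, k⟩ _ hk
        have h3 : tens ρ a g (w (h, k) ⊗ₜ[ℝ] b (h, k)) = ρ g (w (h, k)) ⊗ₜ[ℝ] b (g * h, k) := by
          rw [hb, hb]; simp [tens]
        rw [h3, tensCoord_tmul]
        have : (g * h, k) ≠ (g, j) := by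
          intro h4
          simp only [Prod.mk.injEq, mul_eq_left] at h4
          exact hk (by rw [h4.1, h4.2])
        simp [this]
      · simp
    refine ⟨fun j => w (1, j), Subtype.ext ?_⟩
    rw [sumOrbits_coe, hw, Fintype.sum_prod_type, Finset.sum_comm]
    refine Finset.sum_congr rfl fun g _ => Finset.sum_congr rfl fun j _ => ?_
    rw [hb, ← hinv]

/-- The equivalence `W^X ≃ (M ⊗ W)^G` given by an `ℝ[G]`-basis of `M`. -/
def orbitEquiv (ρ : Representation ℂ G W) (a : Representation ℝ G M) (m : X → M)
    (b : Basis (G × X) ℝ M) (hb : ∀ x, b x = a x.1 (m x.2)) : (X → W) ≃ₗ[ℂ] inv ρ a :=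
  LinearEquiv.ofBijective (sumOrbits ρ a m) (sumOrbits_bijective a m b hb)

/-- The basis of `W^X` given by a basis of `W`. -/
def piBasis (X : Type*) [Fintype X] [DecidableEq X] {ι : Type*} (w : Basis ι ℂ W) :
    Basis (X × ι) ℂ (X → W) :=
  (Pi.basis fun _ : X => w).reindex (Equiv.sigmaEquivProd X ι)

lemma piBasis_apply [DecidableEq X] {ι : Type*} (w : Basis ι ℂ W) (x : X × ι) :
    piBasis X w x = Pi.single x.1 (w x.2) := by
  simp [piBasis]

lemma orbitEquiv_piBasis [DecidableEq X] {ι : Type*} (w : Basis ι ℂ W) (a : Representation ℝ G M)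
    (m : X → M) (b : Basis (G × X) ℝ M) (hb : ∀ x, b x = a x.1 (m x.2)) (x : X × ι) :
    orbitEquiv ρ a m b hb (piBasis X w x) = sumOrbit ρ a (m x.1) (w x.2) := by
  rw [piBasis_apply]
  change ∑ j, sumOrbit ρ a (m j) ((Pi.single x.1 (w x.2) : X → W) j) = _
  rw [Finset.sum_eq_single x.1]
  · simp
  · intro j _ hj
    refine Subtype.ext ?_
    rw [sumOrbit_coe]
    simp [hj]
  · simp

end Free

end TensorInv

end

end HermClass

namespace HermClass

noncomputable section

/-! ### Base change of group ring bases -/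

section BaseChange

open Module

universe u v

variable {G : Type v} [Group G]

lemma changeCoeff_tmul {k l : Type*} [CommRing k] [CommRing l] (f : k →+* l) {M : Type*}
    [AddCommGroup M] (c : k) (m : M) : changeCoeff f M (c ⊗ₜ m) = f c ⊗ₜ m := rfl

lemma changeCoeff_smul {k l : Type*} [CommRing k] [CommRing l] (f : k →+* l) {M : Type*}
    [AddCommGroup M] (c : k) (x : k ⊗[ℤ] M) : changeCoeff f M (c • x) = f c • changeCoeff f M x := by
  induction x with
  | zero => simp
  | add x y hx hy => simp only [smul_add, map_add, hx, hy]
  | tmul a m => simp [TensorProduct.smul_tmul', changeCoeff_tmul]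

lemma termRep_tmul (k : Type*) [CommRing k] (M : ModuleCat.{u} (MonoidAlgebra ℤ G)) (g : G) (c : k)
    (m : M) : termRep k M g (c ⊗ₜ m) = c ⊗ₜ ((Representation.ofModule' (M : Type u) : Representation ℤ G M) g m) := rfl

lemma changeCoeff_termRep {k l : Type*} [CommRing k] [CommRing l] (f : k →+* l)
    (M : ModuleCat.{u} (MonoidAlgebra ℤ G)) (g : G) (x : k ⊗[ℤ] M) :
    changeCoeff f M (termRep k M g x) = termRep l M g (changeCoeff f M x) := by
  induction x with
  | zero => simp
  | add x y hx hy => simp only [map_add, hx, hy]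
  | tmul a m => rw [termRep_tmul, changeCoeff_tmul, changeCoeff_tmul, termRep_tmul]

/-- The `k`-basis `g a_j` of `k ⊗ M` attached to a `k[G]`-basis. -/
def IsGroupRingBasis.basis {k : Type*} [CommRing k] {M : ModuleCat.{u} (MonoidAlgebra ℤ G)}
    {q : ℕ} {a : Fin q → k ⊗[ℤ] M} (h : IsGroupRingBasis k M a) : Basis (G × Fin q) k (k ⊗[ℤ] M) :=
  Basis.mk h.1 h.2.ge

lemma IsGroupRingBasis.basis_apply {k : Type*} [CommRing k] {M : ModuleCat.{u} (MonoidAlgebra ℤ G)}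
    {q : ℕ} {a : Fin q → k ⊗[ℤ] M} (h : IsGroupRingBasis k M a) (x : G × Fin q) :
    h.basis x = termRep k M x.1 (a x.2) := by
  simp [IsGroupRingBasis.basis]

lemma IsGroupRingBasis.of_basis {k : Type*} [CommRing k] {M : ModuleCat.{u} (MonoidAlgebra ℤ G)}
    {q : ℕ} {a : Fin q → k ⊗[ℤ] M} (b : Basis (G × Fin q) k (k ⊗[ℤ] M))
    (h : ∀ x, b x = termRep k M x.1 (a x.2)) : IsGroupRingBasis k M a := by
  have e : (fun x : G × Fin q => termRep k M x.1 (a x.2)) = b := funext fun x => (h x).symm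
  rw [IsGroupRingBasis, e]
  exact ⟨b.linearIndependent, b.span_eq⟩

/-- The `l`-basis of `l ⊗ M` induced by a `k`-basis of `k ⊗ M`. -/
lemma exists_changeCoeff_basis {k l : Type*} [CommRing k] [CommRing l] (f : k →+* l) {M : Type*}
    [AddCommGroup M] {ι : Type*} (b : Basis ι k (k ⊗[ℤ] M)) :
    ∃ b' : Basis ι l (l ⊗[ℤ] M), ∀ i, b' i = changeCoeff f M (b i) := by
  let := f.toAlgebra
  refine ⟨(b.baseChange l).map (TensorProduct.AlgebraTensorModule.cancelBaseChange ℤ k l l M),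
    fun i => ?_⟩
  rw [Basis.map_apply, Basis.baseChange_apply]
  generalize b i = x
  induction x with
  | zero => simp
  | add x y hx hy => simp only [TensorProduct.tmul_add, map_add, hx, hy]
  | tmul a m =>
    rw [TensorProduct.AlgebraTensorModule.cancelBaseChange_tmul, changeCoeff_tmul,
      Algebra.smul_def, mul_one]
    rfl

lemma IsGroupRingBasis.changeCoeff {k l : Type*} [CommRing k] [CommRing l] (f : k →+* l)
    {M : ModuleCat.{u} (MonoidAlgebra ℤ G)} {q : ℕ} {a : Fin q → k ⊗[ℤ] M}
    (h : IsGroupRingBasis k M a) : IsGroupRingBasis l M fun j => changeCoeff f M (a j) := by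
  obtain ⟨b, hb⟩ := exists_changeCoeff_basis f h.basis
  exact .of_basis b fun x => by rw [hb, h.basis_apply, changeCoeff_termRep]

end BaseChange

/-! ### Cocycles and cohomology -/

section Cohomology

open Module CategoryTheory

universe u v

variable {G : Type v} [Group G] {P : CochainComplex (ModuleCat.{u} (MonoidAlgebra ℤ G)) ℤ}
  {W : Type*} [AddCommGroup W] [Module ℂ W] {ρ : Representation ℂ G W}

lemma diff_diff (i j k : ℤ) (x : ℝ ⊗[ℤ] P.X i) : diff P j k (diff P i j x) = 0 := by
  induction x with
  | zero => simp
  | add x y hx hy => simp only [map_add, hx, hy, add_zero]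
  | tmul r x =>
    have h : (P.d j k).hom ((P.d i j).hom x) = 0 := by
      rw [← LinearMap.comp_apply, ← ModuleCat.hom_comp, P.d_comp_d]; rfl
    simp only [diff, LinearMap.baseChange_tmul]
    change r ⊗ₜ[ℤ] ((P.d j k).hom ((P.d i j).hom x)) = 0
    rw [h, TensorProduct.tmul_zero]

variable (P) in
/-- The differential, as a map to the cocycles. -/
def toCocycles (i : ℤ) : ℝ ⊗[ℤ] P.X (i - 1) →ₗ[ℝ] cocycles P i :=
  (diff P (i - 1) i).codRestrict _ fun x => LinearMap.mem_ker.mpr (diff_diff _ _ _ x)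

variable (P ρ) in
/-- The map from cocycles to cohomology, on invariants of the tensor product with `W`. -/
def cohW (i : ℤ) : inv ρ (cocyclesRep P i) →ₗ[ℂ] inv ρ (cohRep P i) :=
  invMap ρ (cohMk P i) fun _ _ => rfl

lemma lof_cohSumRep (p : ℤ → Prop) (i : {i : ℤ // p i}) (g : G) (x : coh P i) :
    DirectSum.lof ℝ {i : ℤ // p i} (fun i => coh P i) i (cohRep P i g x) =
      cohSumRep P p g (DirectSum.lof ℝ {i : ℤ // p i} (fun i => coh P i) i x) :=
  (DirectSum.lmap_lof (fun i : {i : ℤ // p i} => cohRep P i g) i x).symm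

variable (P ρ) in
/-- The inclusion `(H^i ⊗ W)^G → (H ⊗ W)^G`. -/
def lofW (p : ℤ → Prop) (i : {i : ℤ // p i}) :
    inv ρ (cohRep P i) →ₗ[ℂ] inv ρ (cohSumRep P p) :=
  invMap ρ (DirectSum.lof ℝ {i : ℤ // p i} (fun i => coh P i) i) (lof_cohSumRep p i)

lemma component_cohSumRep (p : ℤ → Prop) (i : {i : ℤ // p i}) (g : G) (x : cohSum P p) :
    DirectSum.component ℝ {i : ℤ // p i} (fun i => coh P i) i (cohSumRep P p g x) =
      cohRep P i g (DirectSum.component ℝ {i : ℤ // p i} (fun i => coh P i) i x) :=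
  DirectSum.lmap_apply (fun i : {i : ℤ // p i} => cohRep P i g) x i

variable (P ρ) in
/-- The projection `(H ⊗ W)^G → (H^i ⊗ W)^G`. -/
def componentW (p : ℤ → Prop) (i : {i : ℤ // p i}) :
    inv ρ (cohSumRep P p) →ₗ[ℂ] inv ρ (cohRep P i) :=
  invMap ρ (DirectSum.component ℝ {i : ℤ // p i} (fun i => coh P i) i) (component_cohSumRep p i)

lemma invMap_invMap {M N Q : Type*} [AddCommGroup M] [Module ℝ M] [AddCommGroup N] [Module ℝ N]
    [AddCommGroup Q] [Module ℝ Q] {a : Representation ℝ G M} {b : Representation ℝ G N}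
    {c : Representation ℝ G Q} (φ : M →ₗ[ℝ] N) (h : ∀ g x, φ (a g x) = b g (φ x)) (ψ : N →ₗ[ℝ] Q)
    (h' : ∀ g x, ψ (b g x) = c g (ψ x)) (χ : M →ₗ[ℝ] Q) (h'' : ∀ g x, χ (a g x) = c g (χ x))
    (e : ψ ∘ₗ φ = χ) (x : inv ρ a) : invMap ρ ψ h' (invMap ρ φ h x) = invMap ρ χ h'' x := by
  subst e
  refine Subtype.ext ?_
  rw [invMap_coe, invMap_coe, invMap_coe]
  simp only [map_id_eq_lTensor, LinearMap.lTensor_comp, LinearMap.comp_apply]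

lemma invMap_zero {M N : Type*} [AddCommGroup M] [Module ℝ M] [AddCommGroup N] [Module ℝ N]
    {a : Representation ℝ G M} {b : Representation ℝ G N} (φ : M →ₗ[ℝ] N)
    (h : ∀ g x, φ (a g x) = b g (φ x)) (e : φ = 0) (x : inv ρ a) : invMap ρ φ h x = 0 := by
  subst e
  refine Subtype.ext ?_
  rw [invMap_coe, map_id_eq_lTensor]
  simp

lemma invMap_id {M : Type*} [AddCommGroup M] [Module ℝ M]
    {a : Representation ℝ G M} (φ : M →ₗ[ℝ] M)
    (h : ∀ g x, φ (a g x) = a g (φ x)) (e : φ = LinearMap.id) (x : inv ρ a) :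
    invMap ρ φ h x = x := by
  subst e
  refine Subtype.ext ?_
  rw [invMap_coe, map_id_eq_lTensor]
  simp

lemma lofW_cohW (p : ℤ → Prop) (i : {i : ℤ // p i}) (x : inv ρ (cocyclesRep P i)) :
    lofW P ρ p i (cohW P ρ i x) = classW P ρ p i x :=
  invMap_invMap _ _ _ _ _ _ rfl x

lemma component_comp_lof_self (p : ℤ → Prop) (i : {i : ℤ // p i}) :
    DirectSum.component ℝ {i : ℤ // p i} (fun i => coh P i) i ∘ₗ
      DirectSum.lof ℝ {i : ℤ // p i} (fun i => coh P i) i = LinearMap.id :=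
  LinearMap.ext fun y => DirectSum.component.lof_self (R := ℝ) (M := fun i : {i : ℤ // p i} => coh P i) i y

lemma componentW_lofW_self (p : ℤ → Prop) (i : {i : ℤ // p i}) (x : inv ρ (cohRep P i)) :
    componentW P ρ p i (lofW P ρ p i x) = x := by
  have h : ∀ (g : G) (x : coh P i), (LinearMap.id : coh P i →ₗ[ℝ] coh P i) (cohRep P i g x) =
      cohRep P i g ((LinearMap.id : coh P i →ₗ[ℝ] coh P i) x) := fun g x => rfl
  refine Eq.trans ?_ (invMap_id (ρ := ρ) (LinearMap.id : coh P i →ₗ[ℝ] coh P i) h rfl x)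
  exact invMap_invMap _ (lof_cohSumRep p i) _ (component_cohSumRep p i) _ h
    (component_comp_lof_self p i) x

lemma component_comp_lof_of_ne (p : ℤ → Prop) (i j : {i : ℤ // p i}) (hij : i ≠ j) :
    DirectSum.component ℝ {i : ℤ // p i} (fun i => coh P i) j ∘ₗ
      DirectSum.lof ℝ {i : ℤ // p i} (fun i => coh P i) i = 0 := by
  ext y
  exact DirectSum.of_eq_of_ne (β := fun i : {i : ℤ // p i} => coh P i) i j y hij.symm

lemma componentW_lofW_of_ne (p : ℤ → Prop) (i j : {i : ℤ // p i}) (hij : i ≠ j)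
    (x : inv ρ (cohRep P i)) : componentW P ρ p j (lofW P ρ p i x) = 0 := by
  have h : ∀ (g : G) (x : coh P i), (0 : coh P i →ₗ[ℝ] coh P j) (cohRep P i g x) =
      cohRep P j g ((0 : coh P i →ₗ[ℝ] coh P j) x) := fun g x => by
    rw [LinearMap.zero_apply, LinearMap.zero_apply, map_zero]
  rw [← invMap_zero (ρ := ρ) (0 : coh P i →ₗ[ℝ] coh P j) h rfl x]
  exact invMap_invMap _ (lof_cohSumRep p i) _ (component_cohSumRep p j) _ h
    (component_comp_lof_of_ne p i j hij) x

variable [Fintype G]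

lemma cohW_surjective (i : ℤ) : Function.Surjective (cohW P ρ i) :=
  invMap_surjective _ _ (Submodule.mkQ_surjective _)

omit [Fintype G] in
lemma cocyclesW_injective (i : ℤ) : Function.Injective (cocyclesW P ρ i) :=
  invMap_injective _ _ Subtype.val_injective

lemma diffW_cocyclesW_exact (i : ℤ) :
    Function.Exact (cocyclesW P ρ i) (diffW P ρ i (i + 1)) :=
  invMap_exact _ _ _ _ (LinearMap.exact_subtype_ker_map _)

lemma cohW_eq_zero_iff (i : ℤ) (x : inv ρ (cocyclesRep P i)) :
    cohW P ρ i x = 0 ↔ ∃ y, diffW P ρ (i - 1) i y = cocyclesW P ρ i x := by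
  have hex : Function.Exact (toCocycles P i) (cohMk P i) := by
    intro z
    refine (Submodule.Quotient.mk_eq_zero _).trans ?_
    constructor
    · rintro ⟨y, hy⟩
      exact ⟨y, Subtype.ext hy⟩
    · rintro ⟨y, rfl⟩
      exact ⟨y, rfl⟩
  have hc : ∀ g y, toCocycles P i (termRep ℝ (P.X (i - 1)) g y) =
      cocyclesRep P i g (toCocycles P i y) := fun g y => Subtype.ext (diff_comm P _ _ g y)
  have h := invMap_exact (ρ := ρ) (toCocycles P i) hc (c := cohRep P i) (cohMk P i) (fun _ _ => rfl) hex x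
  have h2 : ∀ y, cocyclesW P ρ i (invMap ρ (toCocycles P i) hc y) = diffW P ρ (i - 1) i y :=
    fun y => invMap_invMap _ _ _ _ _ _ rfl y
  refine h.trans ⟨?_, ?_⟩
  · rintro ⟨y, rfl⟩
    exact ⟨y, (h2 y).symm⟩
  · rintro ⟨y, hy⟩
    exact ⟨y, cocyclesW_injective i ((h2 y).trans hy)⟩

lemma avg_add {M : Type*} [AddCommGroup M] [Module ℝ M] {a : Representation ℝ G M}
    (x y : W ⊗[ℝ] M) : avg ρ a (x + y) = avg ρ a x + avg ρ a y := by
  refine Subtype.ext ?_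
  simp only [avg, map_add, Finset.sum_add_distrib, smul_add]
  rfl

lemma avg_zero {M : Type*} [AddCommGroup M] [Module ℝ M] {a : Representation ℝ G M} :
    avg ρ a 0 = 0 := by
  refine Subtype.ext ?_
  simp [avg]

lemma iSup_range_lofW (p : ℤ → Prop) : ⨆ i, LinearMap.range (lofW P ρ p i) = ⊤ := by
  classical
  rw [eq_top_iff]
  rintro x -
  rw [← avg_coe x]
  generalize (x : W ⊗[ℝ] cohSum P p) = y
  induction y with
  | zero => rw [avg_zero]; exact zero_mem _
  | add x y hx hy => rw [avg_add]; exact add_mem hx hy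
  | tmul w m =>
    induction m using DirectSum.induction_on with
    | zero => rw [TensorProduct.tmul_zero, avg_zero]; exact zero_mem _
    | add x y hx hy => rw [TensorProduct.tmul_add, avg_add]; exact add_mem hx hy
    | of i m =>
      refine Submodule.mem_iSup_of_mem i ⟨avg ρ _ (w ⊗ₜ m), ?_⟩
      rw [lofW, invMap_avg]
      rfl

lemma IsPerfect.finite (hP : IsPerfect P) (i : ℤ) : FiniteDimensional ℝ (ℝ ⊗[ℤ] P.X i) := by
  obtain ⟨-, q, -, a, ha⟩ := hP.2 i
  exact Module.Finite.of_basis (ha.changeCoeff (algebraMap ℚ ℝ)).basis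

omit [Fintype G] in
lemma subsingleton_inv {M : Type*} [AddCommGroup M] [Module ℝ M] [Subsingleton M]
    (a : Representation ℝ G M) : Subsingleton (inv ρ a) := by
  have : Subsingleton (W ⊗[ℝ] M) := inferInstance
  infer_instance

omit [Fintype G] in
lemma subsingleton_coh {i : ℤ} [Subsingleton (P.X i)] : Subsingleton (coh P i) :=
  (Submodule.mkQ_surjective ((coboundaries P i).submoduleOf (cocycles P i))).subsingleton

lemma IsPerfect.finite_coh (hP : IsPerfect P) (i : ℤ) : FiniteDimensional ℝ (coh P i) := by
  have := hP.finite i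
  exact inferInstanceAs
    (FiniteDimensional ℝ (cocycles P i ⧸ (coboundaries P i).submoduleOf (cocycles P i)))

lemma IsPerfect.finite_cohSum (hP : IsPerfect P) (p : ℤ → Prop) :
    FiniteDimensional ℝ (cohSum P p) := by
  classical
  obtain ⟨N, hN⟩ := hP.1
  have := hP.finite_coh
  have hfin : Finite {i : {i : ℤ // p i} // |(i : ℤ)| ≤ N} := by
    have : Finite (Set.Icc (-N) N) := inferInstance
    exact Finite.of_injective (fun i => (⟨i.1.1, abs_le.mp i.2⟩ : Set.Icc (-N) N))
      fun i j h => Subtype.ext (Subtype.ext (congrArg (fun x : Set.Icc (-N) N => (x : ℤ)) h))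
  have := Fintype.ofFinite {i : {i : ℤ // p i} // |(i : ℤ)| ≤ N}
  refine Module.Finite.of_surjective
    (∑ i : {i : {i : ℤ // p i} // |(i : ℤ)| ≤ N},
      DirectSum.lof ℝ {i : ℤ // p i} (fun i => coh P i) i.1 ∘ₗ
        LinearMap.proj (φ := fun i : {i : {i : ℤ // p i} // |(i : ℤ)| ≤ N} => coh P i.1) i) ?_
  rw [← LinearMap.range_eq_top, eq_top_iff]
  rintro x -
  induction x using DirectSum.induction_on with
  | zero => exact zero_mem _
  | add x y hx hy => exact add_mem hx hy
  | of i m =>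
    by_cases hi : |(i : ℤ)| ≤ N
    · refine ⟨Pi.single ⟨i, hi⟩ m, ?_⟩
      rw [LinearMap.sum_apply, Finset.sum_eq_single ⟨i, hi⟩]
      · simp; rfl
      · intro j _ hj
        simp [Pi.single_eq_of_ne hj]
      · simp
    · have := hN i (not_le.mp hi)
      have := subsingleton_coh (P := P) (i := i)
      rw [Subsingleton.elim m 0, map_zero]
      exact zero_mem _

end Cohomology

end

end HermClass

namespace HermClass

noncomputable section

/-! ### Determinants and filtrations -/

section Filtered

open Module

variable {C Z H Q R : Type*} [AddCommGroup C] [Module ℂ C] [AddCommGroup Z] [Module ℂ Z]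
  [AddCommGroup H] [Module ℂ H] [AddCommGroup Q] [Module ℂ Q] [AddCommGroup R] [Module ℂ R]
  {α β γ α' β' γ' : Type*}

lemma repr_quotient {q : C →ₗ[ℂ] Q} {c : Basis (α ⊕ β ⊕ γ) ℂ C} {y : Basis γ ℂ Q}
    (hα : ∀ a, q (c (.inl a)) = 0) (hβ : ∀ b, q (c (.inr (.inl b))) = 0)
    (hγ : ∀ k, q (c (.inr (.inr k))) = y k) (w : C) (k : γ) :
    c.repr w (.inr (.inr k)) = y.repr (q w) k := by
  have : Finsupp.lapply (.inr (.inr k)) ∘ₗ c.repr.toLinearMap =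
      Finsupp.lapply k ∘ₗ y.repr.toLinearMap ∘ₗ q := by
    refine c.ext ?_
    rintro (a | b | l)
    · simp [hα]
    · simp [hβ]
    · classical simp [hγ, Finsupp.single_apply]
  exact LinearMap.congr_fun this w

lemma linearIndependent_mk_ker {ι : Type*} (d : C →ₗ[ℂ] Q) (u : ι → C)
    (h : LinearIndependent ℂ fun k => d (u k)) :
    LinearIndependent ℂ fun k => (Submodule.Quotient.mk (u k) : C ⧸ LinearMap.ker d) :=
  LinearIndependent.of_comp ((LinearMap.ker d).liftQ d le_rfl) h

lemma span_mk_ker (d : C →ₗ[ℂ] Q) (c : Basis (α ⊕ β ⊕ γ) ℂ C) (hα : ∀ a, d (c (.inl a)) = 0)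
    (hβ : ∀ b, d (c (.inr (.inl b))) = 0) (u : γ → C) (hγ : ∀ k, c (.inr (.inr k)) = u k) :
    ⊤ ≤ Submodule.span ℂ
      (Set.range fun k => (Submodule.Quotient.mk (u k) : C ⧸ LinearMap.ker d)) := by
  have h : Submodule.map (LinearMap.ker d).mkQ ⊤ = ⊤ := by
    rw [Submodule.map_top, Submodule.range_mkQ]
  rw [← h, ← c.span_eq, Submodule.map_span, Submodule.span_le]
  rintro _ ⟨_, ⟨(a | b | k), rfl⟩, rfl⟩
  · rw [Submodule.mkQ_apply, (Submodule.Quotient.mk_eq_zero _).mpr (hα a)]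
    exact zero_mem _
  · rw [Submodule.mkQ_apply, (Submodule.Quotient.mk_eq_zero _).mpr (hβ b)]
    exact zero_mem _
  · rw [hγ]
    exact Submodule.subset_span ⟨k, rfl⟩

lemma exists_sub_sum_eq [Fintype α] [Fintype β] [Fintype γ] (m : Z →ₗ[ℂ] C) (d : R →ₗ[ℂ] C)
    (c : Basis (α ⊕ β ⊕ γ) ℂ C) (u : α → R) (z : β → Z) (hα : ∀ a, c (.inl a) = d (u a))
    (hβ : ∀ b, c (.inr (.inl b)) = m (z b)) (x : Z)
    (hγ : ∀ k, c.repr (m x) (.inr (.inr k)) = 0) :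
    ∃ y, d y = m (x - ∑ k, c.repr (m x) (.inr (.inl k)) • z k) := by
  refine ⟨∑ k, c.repr (m x) (.inl k) • u k, ?_⟩
  rw [map_sub, map_sum, map_sum, eq_sub_iff_add_eq]
  conv_rhs => rw [← c.sum_repr (m x)]
  rw [Fintype.sum_sum_type, Fintype.sum_sum_type]
  simp only [map_smul, hα, hβ, hγ, zero_smul, Finset.sum_const_zero, add_zero]

lemma linearIndependent_class (m : Z →ₗ[ℂ] C) (d : R →ₗ[ℂ] C) (cl : Z →ₗ[ℂ] H)
    (c : Basis (α ⊕ β ⊕ γ) ℂ C) (x : Basis α ℂ R) (z : β → Z) (hα : ∀ a, c (.inl a) = d (x a))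
    (hβ : ∀ b, c (.inr (.inl b)) = m (z b)) (hcl : ∀ x, cl x = 0 → ∃ y, d y = m x) :
    LinearIndependent ℂ fun k => cl (z k) := by
  rw [linearIndependent_iff]
  intro l hl
  have h1 : cl (Finsupp.linearCombination ℂ z l) = 0 := by
    rw [Finsupp.apply_linearCombination]
    exact hl
  obtain ⟨y, hy⟩ := hcl _ h1
  have h2 : m (Finsupp.linearCombination ℂ z l) =
      Finsupp.linearCombination ℂ c (l.mapDomain (Sum.inr ∘ Sum.inl)) := by
    rw [Finsupp.apply_linearCombination, Finsupp.linearCombination_mapDomain]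
    congr 2
    exact funext fun k => (hβ k).symm
  have h0 : d y = Finsupp.linearCombination ℂ c ((x.repr y).mapDomain Sum.inl) := by
    conv_lhs => rw [← x.linearCombination_repr y]
    rw [Finsupp.apply_linearCombination, Finsupp.linearCombination_mapDomain]
    congr 2
    exact funext fun k => (hα k).symm
  rw [h2, h0] at hy
  have h3 := congrArg c.repr hy
  rw [Basis.repr_linearCombination, Basis.repr_linearCombination] at h3
  ext k
  have h4 := DFunLike.congr_fun h3 (.inr (.inl k))
  rw [Finsupp.mapDomain_of_notMem_range _ _ (by simp)] at h4
  exact (Finsupp.mapDomain_apply (f := (Sum.inr ∘ Sum.inl : β → α ⊕ β ⊕ γ))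
    (Sum.inr_injective.comp Sum.inl_injective) l k).symm.trans h4.symm

/-- Multiplicativity of determinants for a three-step filtration. -/
lemma det_filtered [Fintype α] [Fintype β] [Fintype γ] [DecidableEq α] [DecidableEq β]
    [DecidableEq γ] {j : R →ₗ[ℂ] C} {m : Z →ₗ[ℂ] C} {q : C →ₗ[ℂ] Q} {cl : Z →ₗ[ℂ] H}
    (hqj : ∀ t, q (j t) = 0) (hqm : ∀ z, q (m z) = 0)
    (c : Basis (α ⊕ β ⊕ γ) ℂ C) (x : Basis α ℂ R) (h : Basis β ℂ H) (y : Basis γ ℂ Q)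
    (hα : ∀ a, c (.inl a) = j (x a)) (hβ : ∀ b, q (c (.inr (.inl b))) = 0)
    (hγ : ∀ k, q (c (.inr (.inr k))) = y k)
    (hcl : ∀ z b, c.repr (m z) (.inr (.inl b)) = h.repr (cl z) b)
    (x' : α' → R) (z' : β' → Z) (y' : γ' → Q) (c' : α' ⊕ β' ⊕ γ' → C)
    (hα' : ∀ a, c' (.inl a) = j (x' a)) (hβ' : ∀ b, c' (.inr (.inl b)) = m (z' b))
    (hγ' : ∀ k, q (c' (.inr (.inr k))) = y' k) (ea : α ≃ α') (eb : β ≃ β') (eg : γ ≃ γ') :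
    c.det (c' ∘ (ea.sumCongr (eb.sumCongr eg))) =
      x.det (x' ∘ ea) * (h.det (fun b => cl (z' (eb b))) * y.det (y' ∘ eg)) := by
  have hγr := repr_quotient (c := c) (y := y) (fun a => by rw [hα, hqj]) hβ hγ
  have hj : ∀ t, c.repr (j t) = (x.repr t).mapDomain Sum.inl := by
    intro t
    have : c.repr.toLinearMap ∘ₗ j = Finsupp.lmapDomain ℂ ℂ Sum.inl ∘ₗ x.repr.toLinearMap :=
      x.ext fun a => by simp [← hα]
    exact LinearMap.congr_fun this t
  have hjn : ∀ t k, c.repr (j t) (.inr k) = 0 := fun t k => by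
    rw [hj, Finsupp.mapDomain_of_notMem_range]
    simp
  have hM : c.toMatrix (c' ∘ (ea.sumCongr (eb.sumCongr eg))) =
      Matrix.fromBlocks (x.toMatrix (x' ∘ ea))
        (Matrix.of fun a k => c.repr (c' (.inr (eb.sumCongr eg k))) (.inl a)) 0
        (Matrix.fromBlocks (h.toMatrix fun b => cl (z' (eb b)))
          (Matrix.of fun b k => c.repr (c' (.inr (.inr (eg k)))) (.inr (.inl b))) 0
          (y.toMatrix (y' ∘ eg))) := by
    ext i k
    rcases i with i | i | i <;> rcases k with k | k | k <;>
      simp only [Basis.toMatrix_apply, Function.comp_apply, Equiv.sumCongr_apply, Sum.map_inl,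
        Sum.map_inr, Matrix.fromBlocks_apply₁₁, Matrix.fromBlocks_apply₁₂,
        Matrix.fromBlocks_apply₂₁, Matrix.fromBlocks_apply₂₂, Matrix.of_apply, Matrix.zero_apply,
        hα', hβ', hjn, hcl, hγr, hqm, hγ', map_zero, Finsupp.zero_apply]
    rw [hj, Finsupp.mapDomain_apply Sum.inl_injective]
  rw [Basis.det_apply, hM, Matrix.det_fromBlocks_zero₂₁, Matrix.det_fromBlocks_zero₂₁]
  rfl

end Filtered

section DetEquiv

open Module

variable {E ι κ μ : Type*} [AddCommGroup E] [Module ℂ E]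

/-- The determinant of the change of basis from `c` to `b`. -/
def detEquiv (c : Basis ι ℂ E) (b : Basis κ ℂ E) (e : ι ≃ κ) : ℂ :=
  LinearMap.det ((c.equiv b e : E ≃ₗ[ℂ] E) : E →ₗ[ℂ] E)

lemma detEquiv_eq [Fintype ι] [DecidableEq ι] (c : Basis ι ℂ E) (b : Basis κ ℂ E)
    (e : ι ≃ κ) : detEquiv c b e = c.det (b ∘ e) := det_basis_equiv c b e

lemma vol_eq_norm_detEquiv [Finite ι] (c : Basis ι ℂ E) (b : Basis κ ℂ E) (e : ι ≃ κ) :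
    vol c b = ‖detEquiv c b e‖ := vol_eq c b e

lemma detEquiv_ne_zero (c : Basis ι ℂ E) (b : Basis κ ℂ E) (e : ι ≃ κ) : detEquiv c b e ≠ 0 :=
  (LinearEquiv.isUnit_det' _).ne_zero

lemma detEquiv_trans (a : Basis ι ℂ E) (b : Basis κ ℂ E) (c : Basis μ ℂ E) (e : ι ≃ κ)
    (e' : κ ≃ μ) : detEquiv a b e * detEquiv b c e' = detEquiv a c (e.trans e') := by
  rw [detEquiv, detEquiv, detEquiv, mul_comm, ← LinearMap.det_comp]
  congr 1
  exact a.ext fun i => by simp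

lemma detEquiv_of_subsingleton [Subsingleton E] (c : Basis ι ℂ E) (b : Basis κ ℂ E) (e : ι ≃ κ) :
    detEquiv c b e = 1 := by
  rw [detEquiv, Subsingleton.elim ((c.equiv b e : E ≃ₗ[ℂ] E) : E →ₗ[ℂ] E) LinearMap.id,
    LinearMap.det_id]

lemma det_blockDiagonal_sigma {T : Type*} [Fintype T] [LinearOrder T] {α : T → Type*}
    [∀ t, Fintype (α t)] [∀ t, DecidableEq (α t)] (M : ∀ t, Matrix (α t) (α t) ℂ) :
    (Matrix.blockDiagonal' M).det = ∏ t, (M t).det := by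
  rw [(Matrix.blockTriangular_blockDiagonal' M).det_fintype]
  refine Finset.prod_congr rfl fun t _ => ?_
  rw [← Matrix.det_submatrix_equiv_self (Equiv.sigmaSubtype t).symm]
  congr 1
  ext k l
  exact Matrix.blockDiagonal'_apply_eq M t k l

/-- The determinant of the comparison of bases of a direct sum, where all but finitely many summands
vanish. -/
lemma detEquiv_sigma {J : Type*} [LinearOrder J] {α α' : J → Type*} [∀ j, Finite (α j)]
    {D : J → Type*} [∀ j, AddCommGroup (D j)] [∀ j, Module ℂ (D j)]
    (b : Basis (Σ j, α j) ℂ E) (b' : Basis (Σ j, α' j) ℂ E) (d : ∀ j, Basis (α j) ℂ (D j))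
    (d' : ∀ j, Basis (α' j) ℂ (D j)) (l : ∀ j, D j →ₗ[ℂ] E) (m : ∀ j, E →ₗ[ℂ] D j)
    (hb' : ∀ x, b' x = l x.1 (d' x.1 x.2))
    (hb : ∀ x j k, b.repr x ⟨j, k⟩ = (d j).repr (m j x) k) (hself : ∀ j x, m j (l j x) = x)
    (hne : ∀ i j, i ≠ j → ∀ x, m j (l i x) = 0) (e : ∀ j, α j ≃ α' j) (T : Finset J)
    (hT : ∀ j, j ∉ T → IsEmpty (α j)) :
    detEquiv b b' (Equiv.sigmaCongrRight e) = ∏ j ∈ T, detEquiv (d j) (d' j) (e j) := by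
  classical
  have := fun i => Fintype.ofFinite (α i)
  let e0 : (Σ t : T, α t) ≃ Σ j, α j :=
    Equiv.ofBijective (fun x => ⟨x.1, x.2⟩) (by
      constructor
      · rintro ⟨⟨i, hi⟩, k⟩ ⟨⟨j, hj⟩, l⟩ h
        simp only [Sigma.mk.injEq] at h
        obtain ⟨rfl, h⟩ := h
        rw [heq_eq_eq] at h
        rw [h]
      · rintro ⟨i, k⟩
        have : i ∈ T := by
          by_contra hc
          exact (hT i hc).elim k
        exact ⟨⟨⟨i, this⟩, k⟩, rfl⟩)
  have := Fintype.ofEquiv _ e0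
  rw [detEquiv_eq, ← Finset.prod_coe_sort]
  simp only [detEquiv_eq]
  have h2 : (b.toMatrix (b' ∘ (Equiv.sigmaCongrRight e))).submatrix e0 e0 =
      Matrix.blockDiagonal' fun t : T => (d t).toMatrix (d' t ∘ e t) := by
    ext ⟨i, k⟩ ⟨j, k'⟩
    rw [Matrix.submatrix_apply, Basis.toMatrix_apply]
    change b.repr (b' ⟨j, e j k'⟩) ⟨i, k⟩ = _
    rw [hb, hb']
    by_cases hij : j = i
    · subst hij
      rw [hself, Matrix.blockDiagonal'_apply_eq, Basis.toMatrix_apply]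
      rfl
    · rw [hne _ _ (fun h => hij (Subtype.ext h)), map_zero,
        Matrix.blockDiagonal'_apply_ne _ _ _ (Ne.symm hij)]
      rfl
  rw [Basis.det_apply, ← Matrix.det_submatrix_equiv_self e0, h2]
  convert det_blockDiagonal_sigma fun t : T => (d t).toMatrix (d' t ∘ e t)
  exact Basis.det_apply _ _

end DetEquiv

lemma finprod_telescope {K : Type*} [Field K] {D β h : ℤ → K} {N : ℤ}
    (hD : ∀ i, D i = β (i - 1) * (h i * β i)) (hβ0 : ∀ i, β i ≠ 0)
    (hβ : ∀ i, N < |i| → β i = 1) (hh : ∀ i, N < |i| → h i = 1) :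
    ∏ᶠ i : ℤ, D i ^ (i.negOnePow : ℤ) =
      (∏ i ∈ (Finset.Icc (-N) N).filter Even, h i) *
        (∏ i ∈ (Finset.Icc (-N) N).filter Odd, h i)⁻¹ := by
  have hsub : ∀ f : ℤ → K, (∀ i, N < |i| → f i = 1) →
      f.mulSupport ⊆ (Finset.Icc (-N) N : Finset ℤ) := by
    intro f hf i hi
    rw [Finset.coe_Icc, Set.mem_Icc, ← abs_le]
    by_contra hc
    exact hi (hf i (not_le.mp hc))
  set γ : ℤ → K := fun i => β i ^ (i.negOnePow : ℤ) with hγ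
  have hγs := hsub γ fun i hi => by simp [hγ, hβ i hi]
  have hγf : γ.mulSupport.Finite := (Finset.finite_toSet _).subset hγs
  have hhs := hsub (fun i => h i ^ (i.negOnePow : ℤ)) fun i hi => by simp [hh i hi]
  have hhf := (Finset.finite_toSet _).subset hhs
  have h1 : ∀ i, D i ^ (i.negOnePow : ℤ) =
      (γ (Equiv.subRight 1 i))⁻¹ * (h i ^ (i.negOnePow : ℤ) * γ i) := by
    intro i
    rw [hD, mul_zpow, mul_zpow]
    congr 1
    simp only [hγ, Equiv.subRight_apply]
    rw [← zpow_neg, Int.negOnePow_sub, Int.negOnePow_one]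
    simp
  have hγf' : (fun i => (γ (Equiv.subRight 1 i))⁻¹).mulSupport.Finite := by
    rw [Function.mulSupport_fun_inv]
    exact hγf.preimage (Equiv.injective _).injOn
  rw [finprod_congr h1, finprod_mul_distrib hγf' ((hhf.union hγf).subset
    (Function.mulSupport_mul _ _)), finprod_mul_distrib hhf hγf, finprod_inv_distrib,
    finprod_comp_equiv (Equiv.subRight (1 : ℤ)) (f := γ), mul_left_comm, inv_mul_cancel₀, mul_one,
    finprod_eq_prod_of_mulSupport_subset _ hhs]
  · rw [Finset.prod_filter, Finset.prod_filter, ← Finset.prod_inv_distrib,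
      ← Finset.prod_mul_distrib]
    refine Finset.prod_congr rfl fun i _ => ?_
    rcases Int.even_or_odd i with hi | hi
    · have : ¬ Odd i := by simpa using hi
      simp [hi, this, Int.negOnePow_even]
    · have : ¬ Even i := by simpa using hi
      simp [hi, this, Int.negOnePow_odd]
  · rw [finprod_eq_prod_of_mulSupport_subset _ hγs]
    exact Finset.prod_ne_zero_iff.mpr fun i _ => zpow_ne_zero _ (hβ0 i)

/-! ### Splittings -/

section Splitting

open Module CategoryTheory

universe u v

variable {G : Type v} [Group G] {P : CochainComplex (ModuleCat.{u} (MonoidAlgebra ℤ G)) ℤ}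
  {W : Type*} [AddCommGroup W] [Module ℂ W] {ρ : Representation ℂ G W}

variable (P ρ) in
/-- A variant of `Splitting` with arbitrary index sets. -/
structure GSplitting (IU IH : ℤ → Type) where
  /-- the basis of `U^i` -/
  u : ∀ i, IU i → inv ρ (termRep ℝ (P.X i))
  /-- the basis of `H^i` -/
  z : ∀ i, IH i → inv ρ (cocyclesRep P i)
  /-- the basis of `C^i` -/
  c : ∀ i, Basis (IU (i - 1) ⊕ IH i ⊕ IU i) ℂ (inv ρ (termRep ℝ (P.X i)))
  c_B : ∀ i j, c i (.inl j) = diffW P ρ (i - 1) i (u (i - 1) j)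
  c_H : ∀ i j, c i (.inr (.inl j)) = cocyclesW P ρ i (z i j)
  c_U : ∀ i j, c i (.inr (.inr j)) = u i j

/-- The splitting, with the index sets made explicit. -/
def Splitting.toG {F : Type} (S : Splitting P ρ F) :
    GSplitting P ρ (fun i => Fin (S.nU i) × F) (fun i => Fin (S.nH i) × F) where
  u := S.u
  z := S.z
  c i := (S.c i).reindex ((Equiv.sumProdDistrib _ _ F).trans
    ((Equiv.refl _).sumCongr (Equiv.sumProdDistrib _ _ F)))
  c_B i j := by rw [Basis.reindex_apply]; exact S.c_B i j.1 j.2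
  c_H i j := by rw [Basis.reindex_apply]; exact S.c_H i j.1 j.2
  c_U i j := by rw [Basis.reindex_apply]; exact S.c_U i j.1 j.2

/-- The converse of `Splitting.toG`. -/
def GSplitting.toSplitting {F : Type} {nU nH : ℤ → ℕ}
    (S : GSplitting P ρ (fun i => Fin (nU i) × F) (fun i => Fin (nH i) × F)) :
    Splitting P ρ F where
  nU := nU
  nH := nH
  u := S.u
  z := S.z
  c i := (S.c i).reindex ((Equiv.sumProdDistrib _ _ F).trans
    ((Equiv.refl _).sumCongr (Equiv.sumProdDistrib _ _ F))).symm
  c_B i j f := by rw [Basis.reindex_apply]; exact S.c_B i (j, f)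
  c_H i j f := by rw [Basis.reindex_apply]; exact S.c_H i (j, f)
  c_U i j f := by rw [Basis.reindex_apply]; exact S.c_U i (j, f)

variable (P ρ) in
/-- The quotient of `C^i = (P^i ⊗ W)^G` by the cocycles. -/
abbrev QW (i : ℤ) : Type _ := inv ρ (termRep ℝ (P.X i)) ⧸ LinearMap.ker (diffW P ρ i (i + 1))

lemma ker_diffW_congr {i j k : ℤ} (h : j = k) :
    LinearMap.ker (diffW P ρ i j) = LinearMap.ker (diffW P ρ i k) := by rw [h]

variable (P ρ) in
/-- The differential on the quotient by the cocycles. -/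
def diffQ (i : ℤ) : QW P ρ (i - 1) →ₗ[ℂ] inv ρ (termRep ℝ (P.X i)) :=
  Submodule.liftQ _ (diffW P ρ (i - 1) i) (ker_diffW_congr (by ring)).le

lemma diffW_diffW (i j k : ℤ) (x : inv ρ (termRep ℝ (P.X i))) :
    diffW P ρ j k (diffW P ρ i j x) = 0 :=
  (invMap_invMap _ _ _ _ (0 : ℝ ⊗[ℤ] P.X i →ₗ[ℝ] ℝ ⊗[ℤ] P.X k) (fun _ _ => by simp)
    (LinearMap.ext fun y => diff_diff i j k y) x).trans (invMap_zero _ _ rfl x)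

lemma diffW_cocyclesW (i : ℤ) (j : ℤ) (x : inv ρ (cocyclesRep P i)) (h : j = i + 1) :
    diffW P ρ i j (cocyclesW P ρ i x) = 0 := by
  subst h
  have h : diff P i (i + 1) ∘ₗ (cocycles P i).subtype = 0 :=
    LinearMap.ext fun y => LinearMap.mem_ker.mp y.2
  exact (invMap_invMap _ _ _ _ (0 : cocycles P i →ₗ[ℝ] ℝ ⊗[ℤ] P.X (i + 1)) (fun _ _ => by simp)
    h x).trans (invMap_zero _ _ rfl x)

lemma diffQ_mk (i : ℤ) (x : inv ρ (termRep ℝ (P.X (i - 1)))) :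
    diffQ P ρ i (Submodule.Quotient.mk x) = diffW P ρ (i - 1) i x := rfl

lemma mk_diffQ (i : ℤ) (t : QW P ρ (i - 1)) :
    (Submodule.Quotient.mk (diffQ P ρ i t) : QW P ρ i) = 0 := by
  obtain ⟨x, rfl⟩ := Submodule.Quotient.mk_surjective _ t
  rw [diffQ_mk, Submodule.Quotient.mk_eq_zero, LinearMap.mem_ker, diffW_diffW]

namespace GSplitting

variable {IU IH IU' IH' : ℤ → Type} (S : GSplitting P ρ IU IH) (S' : GSplitting P ρ IU' IH')

lemma linearIndependent_diffW {i j : ℤ} (h : i = j - 1) :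
    LinearIndependent ℂ fun k => diffW P ρ i j (S.u i k) := by
  subst h
  have : (fun k => diffW P ρ (j - 1) j (S.u (j - 1) k)) = S.c j ∘ Sum.inl :=
    funext fun k => (S.c_B j k).symm
  rw [this]
  exact (S.c j).linearIndependent.comp _ Sum.inl_injective

lemma mk_cocyclesW (i : ℤ) (x : inv ρ (cocyclesRep P i)) :
    (Submodule.Quotient.mk (cocyclesW P ρ i x) : QW P ρ i) = 0 := by
  rw [Submodule.Quotient.mk_eq_zero, LinearMap.mem_ker, diffW_cocyclesW _ _ _ rfl]

/-- The basis of `C^i` modulo cocycles. -/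
def basisQ (i : ℤ) : Basis (IU i) ℂ (QW P ρ i) :=
  Basis.mk (linearIndependent_mk_ker (diffW P ρ i (i + 1)) (S.u i)
      (S.linearIndependent_diffW (by ring)))
    (span_mk_ker (diffW P ρ i (i + 1)) (S.c i) (fun a => by rw [S.c_B, diffW_diffW])
      (fun b => by rw [S.c_H, diffW_cocyclesW _ _ _ rfl]) (S.u i) (S.c_U i))

lemma basisQ_apply (i : ℤ) (k : IU i) : S.basisQ i k = Submodule.Quotient.mk (S.u i k) := by
  simp [basisQ]

lemma mk_c_B (i : ℤ) (a : IU (i - 1)) :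
    (LinearMap.ker (diffW P ρ i (i + 1))).mkQ (S.c i (.inl a)) = 0 := by
  rw [S.c_B]
  exact mk_diffQ i (Submodule.Quotient.mk _)

lemma mk_c_H (i : ℤ) (b : IH i) :
    (LinearMap.ker (diffW P ρ i (i + 1))).mkQ (S.c i (.inr (.inl b))) = 0 := by
  rw [S.c_H]
  exact mk_cocyclesW i _

lemma mk_c_U (i : ℤ) (k : IU i) :
    (LinearMap.ker (diffW P ρ i (i + 1))).mkQ (S.c i (.inr (.inr k))) = S.basisQ i k := by
  rw [S.c_U, S.basisQ_apply]
  rfl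

lemma c_B_basisQ (i : ℤ) (a : IU (i - 1)) :
    S.c i (.inl a) = diffQ P ρ i (S.basisQ (i - 1) a) := by
  rw [S.c_B, basisQ_apply, diffQ_mk]

lemma repr_cocyclesW_U (i : ℤ) (x : inv ρ (cocyclesRep P i)) (k : IU i) :
    (S.c i).repr (cocyclesW P ρ i x) (.inr (.inr k)) = 0 := by
  rw [repr_quotient (S.mk_c_B i) (S.mk_c_H i) (S.mk_c_U i), Submodule.mkQ_apply, mk_cocyclesW,
    map_zero]
  rfl

variable [Fintype G] [∀ i, Finite (IU i)]

lemma cohW_eq_sum (i : ℤ) [Fintype (IH i)] (x : inv ρ (cocyclesRep P i)) :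
    cohW P ρ i x =
      ∑ k, (S.c i).repr (cocyclesW P ρ i x) (.inr (.inl k)) • cohW P ρ i (S.z i k) := by
  have := fun i => Fintype.ofFinite (IU i)
  obtain ⟨y, hy⟩ := exists_sub_sum_eq (cocyclesW P ρ i) (diffW P ρ (i - 1) i) (S.c i)
    (S.u (i - 1)) (S.z i) (S.c_B i) (S.c_H i) x (S.repr_cocyclesW_U i x)
  have h := (cohW_eq_zero_iff i _).mpr ⟨y, hy⟩
  rw [map_sub, sub_eq_zero, map_sum] at h
  rw [h]
  exact Finset.sum_congr rfl fun k _ => map_smul _ _ _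

variable [∀ i, Finite (IH i)]

/-- The basis of the cohomology given by the splitting. -/
def basisH (i : ℤ) : Basis (IH i) ℂ (inv ρ (cohRep P i)) :=
  Basis.mk (linearIndependent_class (cocyclesW P ρ i) (diffQ P ρ i) (cohW P ρ i) (S.c i)
      (S.basisQ (i - 1)) (S.z i) (S.c_B_basisQ i) (S.c_H i) fun x hx => by
        obtain ⟨y, hy⟩ := (cohW_eq_zero_iff i x).mp hx
        exact ⟨Submodule.Quotient.mk y, hy⟩)
    (by
      have := Fintype.ofFinite (IH i)
      rintro x -
      obtain ⟨x, rfl⟩ := cohW_surjective i x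
      rw [S.cohW_eq_sum]
      exact sum_mem fun k _ => Submodule.smul_mem _ _ (Submodule.subset_span ⟨k, rfl⟩))

lemma basisH_apply (i : ℤ) (k : IH i) : S.basisH i k = cohW P ρ i (S.z i k) := by
  simp [basisH]

lemma repr_c_H (i : ℤ) (x : inv ρ (cocyclesRep P i)) (k : IH i) :
    (S.c i).repr (cocyclesW P ρ i x) (.inr (.inl k)) = (S.basisH i).repr (cohW P ρ i x) k := by
  have := Fintype.ofFinite (IH i)
  rw [S.cohW_eq_sum i x]
  simp only [← S.basisH_apply]
  rw [Basis.repr_sum_self]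

variable [∀ i, Finite (IU' i)] [∀ i, Finite (IH' i)]

/-- The determinant of the comparison of two splittings, in degree `i`. -/
lemma det_c_equiv (i : ℤ) (eU : ∀ i, IU i ≃ IU' i) (eH : IH i ≃ IH' i) :
    detEquiv (S.c i) (S'.c i) ((eU (i - 1)).sumCongr (eH.sumCongr (eU i))) =
      detEquiv (S.basisQ (i - 1)) (S'.basisQ (i - 1)) (eU (i - 1)) *
        (detEquiv (S.basisH i) (S'.basisH i) eH * detEquiv (S.basisQ i) (S'.basisQ i) (eU i)) := by
  classical
  have := fun i => Fintype.ofFinite (IU i)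
  have := fun i => Fintype.ofFinite (IH i)
  rw [detEquiv_eq, detEquiv_eq, detEquiv_eq, detEquiv_eq]
  have h := det_filtered (j := diffQ P ρ i) (m := cocyclesW P ρ i)
    (q := (LinearMap.ker (diffW P ρ i (i + 1))).mkQ) (cl := cohW P ρ i)
    (fun t => mk_diffQ i t) (fun z => mk_cocyclesW i z) (S.c i) (S.basisQ (i - 1)) (S.basisH i)
    (S.basisQ i) (S.c_B_basisQ i) (S.mk_c_H i) (S.mk_c_U i) (S.repr_c_H i)
    (S'.basisQ (i - 1)) (S'.z i) (S'.basisQ i) (S'.c i) (S'.c_B_basisQ i) (S'.c_H i) (S'.mk_c_U i)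
    (eU (i - 1)) eH (eU i)
  rw [h]
  simp only [← S'.basisH_apply]
  rfl

/-- The basis of `(H ⊗ W)^G` consisting of the classes of the `z^i`. -/
def basisCls (p : ℤ → Prop) : Basis (Σ i : {i : ℤ // p i}, IH i) ℂ (inv ρ (cohSumRep P p)) :=
  Basis.mk (v := fun x => lofW P ρ p x.1 (S.basisH x.1 x.2))
    (by
      classical
      let φ : (Σ i : {i : ℤ // p i}, IH i) → inv ρ (cohSumRep P p) →ₗ[ℂ] ℂ :=
        fun x => (S.basisH x.1).coord x.2 ∘ₗ componentW P ρ p x.1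
      have hφ : ∀ x y : Σ i : {i : ℤ // p i}, IH i,
          φ x (lofW P ρ p y.1 (S.basisH y.1 y.2)) = if y = x then 1 else 0 := by
        rintro ⟨i, k⟩ ⟨j, l⟩
        simp only [φ, LinearMap.comp_apply]
        by_cases hij : j = i
        · subst hij
          rw [componentW_lofW_self]
          simp [Finsupp.single_apply]
        · rw [componentW_lofW_of_ne p j i hij, map_zero, if_neg]
          intro h
          exact hij (congrArg Sigma.fst h)
      rw [linearIndependent_iff]
      intro l hl
      ext x
      have := congrArg (φ x) hl
      rw [Finsupp.apply_linearCombination, map_zero, Finsupp.linearCombination_apply,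
        Finsupp.sum] at this
      simp only [Function.comp_apply, hφ, smul_eq_mul, mul_ite, mul_one, mul_zero,
        Finset.sum_ite_eq'] at this
      by_contra hx
      rw [if_pos (Finsupp.mem_support_iff.mpr hx)] at this
      exact hx this)
    (by
      rw [← iSup_range_lofW p, iSup_le_iff]
      rintro i _ ⟨x, rfl⟩
      have := Fintype.ofFinite (IH i)
      rw [← (S.basisH i).sum_repr x, map_sum]
      refine sum_mem fun k _ => ?_
      rw [map_smul]
      exact Submodule.smul_mem _ _ (Submodule.subset_span ⟨⟨i, k⟩, rfl⟩))

lemma basisCls_apply (p : ℤ → Prop) (x : Σ i : {i : ℤ // p i}, IH i) :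
    S.basisCls p x = lofW P ρ p x.1 (S.basisH x.1 x.2) := by
  simp [basisCls]

lemma basisCls_eq (p : ℤ → Prop) (x : Σ i : {i : ℤ // p i}, IH i) :
    S.basisCls p x = classW P ρ p x.1 (S.z x.1 x.2) := by
  rw [basisCls_apply, basisH_apply, lofW_cohW]

lemma repr_basisCls (p : ℤ → Prop) (x : inv ρ (cohSumRep P p)) (i : {i : ℤ // p i}) (k : IH i) :
    (S.basisCls p).repr x ⟨i, k⟩ = (S.basisH i).repr (componentW P ρ p i x) k := by
  classical
  have : Finsupp.lapply (⟨i, k⟩ : Σ i : {i : ℤ // p i}, IH i) ∘ₗ (S.basisCls p).repr.toLinearMap =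
      Finsupp.lapply k ∘ₗ (S.basisH i).repr.toLinearMap ∘ₗ componentW P ρ p i := by
    refine (S.basisCls p).ext ?_
    rintro ⟨j, l⟩
    simp only [LinearMap.comp_apply, LinearEquiv.coe_coe, Basis.repr_self, Finsupp.lapply_apply]
    rw [basisCls_apply]
    by_cases hij : j = i
    · subst hij
      rw [componentW_lofW_self]
      simp [Finsupp.single_apply]
    · rw [componentW_lofW_of_ne p j i hij, map_zero, Finsupp.single_apply, if_neg]
      · rfl
      · intro h
        exact hij (congrArg Sigma.fst h)
  exact LinearMap.congr_fun this x

/-- The determinant of the comparison of two splittings on cohomology. -/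
lemma det_basisCls_equiv (p : ℤ → Prop) [DecidablePred p] {N : ℤ}
    (hN : ∀ i, N < |i| → IsEmpty (IH i)) (eH : ∀ i, IH i ≃ IH' i) :
    detEquiv (S.basisCls p) (S'.basisCls p)
        (Equiv.sigmaCongrRight fun i : {i : ℤ // p i} => eH i) =
      ∏ i ∈ (Finset.Icc (-N) N).filter p, detEquiv (S.basisH i) (S'.basisH i) (eH i) := by
  classical
  rw [detEquiv_sigma (S.basisCls p) (S'.basisCls p) (fun i => S.basisH i) (fun i => S'.basisH i)
    (lofW P ρ p) (componentW P ρ p) (S'.basisCls_apply p) (S.repr_basisCls p)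
    (componentW_lofW_self p) (componentW_lofW_of_ne p) (fun i => eH i)
    ((Finset.Icc (-N) N).subtype p)]
  · exact Finset.prod_subtype_eq_prod_filter (fun i => detEquiv (S.basisH i) (S'.basisH i) (eH i))
  · intro i hi
    rw [Finset.mem_subtype, Finset.mem_Icc, ← abs_le, not_le] at hi
    exact hN i hi

end GSplitting

end Splitting

end

end HermClass

namespace HermClass

noncomputable section

section Aux

open Module

variable {E : Type*} [AddCommGroup E] [Module ℂ E] {ι κ μ : Type*}

lemma vol_of_subsingleton [Subsingleton E] (c : Basis ι ℂ E) (b : Basis κ ℂ E) : vol c b = 1 := by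
  rw [vol, Subsingleton.elim ((c.equiv b _ : E ≃ₗ[ℂ] E) : E →ₗ[ℂ] E) LinearMap.id,
    LinearMap.det_id, norm_one]

open Classical in
/-- The absolute value of the Gram determinant of a finite basis. -/
def grB (η : E →ₗ[ℂ] E →ₗ⋆[ℂ] ℂ) (b : Basis ι ℂ E) : ℝ :=
  if h : Nonempty (Fintype ι) then @gr E _ _ ι h.some _ η b else 1

lemma grB_eq [Fintype ι] [DecidableEq ι] (η : E →ₗ[ℂ] E →ₗ⋆[ℂ] ℂ) (b : Basis ι ℂ E) :
    grB η b = gr η b := by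
  have h : Nonempty (Fintype ι) := ⟨inferInstance⟩
  rw [grB, dif_pos h]
  convert rfl

lemma grB_basis [Finite ι] (η : E →ₗ[ℂ] E →ₗ⋆[ℂ] ℂ) (b : Basis ι ℂ E) (c : Basis κ ℂ E) :
    grB η c = vol b c ^ 2 * grB η b := by
  classical
  have := Fintype.ofFinite ι
  have := Fintype.ofEquiv _ (b.indexEquiv c)
  rw [grB_eq η c, grB_eq η b]
  exact gr_basis η b c

lemma grB_pos [Finite ι] {η : E →ₗ[ℂ] E →ₗ⋆[ℂ] ℂ} (b : Basis ι ℂ E)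
    (h : ∀ x, (∀ y, η x y = 0) → x = 0) : 0 < grB η b := by
  classical
  have := Fintype.ofFinite ι
  rw [grB_eq]
  exact lt_of_le_of_ne (norm_nonneg _) (gr_ne_zero b h).symm

lemma grB_reindex [Finite ι] (η : E →ₗ[ℂ] E →ₗ⋆[ℂ] ℂ) (b : Basis ι ℂ E) (e : ι ≃ κ) :
    grB η (b.reindex e) = grB η b := by
  rw [grB_basis η b, vol_reindex_right, vol_self, one_pow, one_mul]

variable {Z H Q R : Type*} [AddCommGroup Z] [Module ℂ Z] [AddCommGroup H] [Module ℂ H]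
  [AddCommGroup Q] [Module ℂ Q] [AddCommGroup R] [Module ℂ R] {α β γ : Type*}

/-- A basis adapted to a three-step filtration. -/
lemma exists_filtered_basis [Finite α] [Finite β] [Finite γ] {j : R →ₗ[ℂ] E} {m : Z →ₗ[ℂ] E}
    {q : E →ₗ[ℂ] Q} {cl : Z →ₗ[ℂ] H} (hj : Function.Injective j) (hmq : Function.Exact m q)
    (hqj : ∀ t, q (j t) = 0)
    (hcl : ∀ z, cl z = 0 ↔ ∃ t, j t = m z) (x : Basis α ℂ R) (h : Basis β ℂ H) (y : Basis γ ℂ Q)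
    (z : β → Z) (hz : ∀ b, cl (z b) = h b) (u : γ → E) (hu : ∀ k, q (u k) = y k) :
    ∃ c : Basis (α ⊕ β ⊕ γ) ℂ E, (∀ a, c (.inl a) = j (x a)) ∧
      (∀ b, c (.inr (.inl b)) = m (z b)) ∧ ∀ k, c (.inr (.inr k)) = u k := by
  have := Fintype.ofFinite α
  have := Fintype.ofFinite β
  have := Fintype.ofFinite γ
  set f : α ⊕ β ⊕ γ → E := Sum.elim (fun a => j (x a)) (Sum.elim (fun b => m (z b)) u) with hf
  have hqm : ∀ z, q (m z) = 0 := fun z => hmq.apply_apply_eq_zero z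
  have hli : LinearIndependent ℂ f := by
    rw [Fintype.linearIndependent_iff]
    intro g hg
    rw [Fintype.sum_sum_type, Fintype.sum_sum_type] at hg
    simp only [hf, Sum.elim_inl, Sum.elim_inr, ← map_smul, ← map_sum] at hg
    have h1 := congrArg q hg
    simp only [map_add, hqj, hqm, smul_zero, Finset.sum_const_zero, zero_add, map_zero, map_sum,
      map_smul, hu] at h1
    have h2 := Fintype.linearIndependent_iff.mp y.linearIndependent _ h1
    simp only [h2, zero_smul, Finset.sum_const_zero, add_zero] at hg
    have h3 : cl (∑ b, g (.inr (.inl b)) • z b) = 0 := by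
      rw [hcl]
      refine ⟨-∑ a, g (.inl a) • x a, ?_⟩
      rw [map_neg, neg_eq_iff_add_eq_zero]
      exact hg
    simp only [map_sum, map_smul, hz] at h3
    have h4 := Fintype.linearIndependent_iff.mp h.linearIndependent _ h3
    simp only [h4, zero_smul, Finset.sum_const_zero, add_zero, map_zero] at hg
    have h5 := Fintype.linearIndependent_iff.mp x.linearIndependent _
      (hj (hg.trans (map_zero j).symm))
    rintro (a | b | k)
    exacts [h5 a, h4 b, h2 k]
  have hsp : ⊤ ≤ Submodule.span ℂ (Set.range f) := by
    rintro w -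
    have hα : ∀ a, j (x a) ∈ Submodule.span ℂ (Set.range f) := fun a =>
      Submodule.subset_span ⟨.inl a, rfl⟩
    have hβ : ∀ b, m (z b) ∈ Submodule.span ℂ (Set.range f) := fun b =>
      Submodule.subset_span ⟨.inr (.inl b), rfl⟩
    have hγ : ∀ k, u k ∈ Submodule.span ℂ (Set.range f) := fun k =>
      Submodule.subset_span ⟨.inr (.inr k), rfl⟩
    have h1 : q (w - ∑ k, y.repr (q w) k • u k) = 0 := by
      simp only [map_sub, map_sum, map_smul, hu, y.sum_repr, sub_self]
    obtain ⟨z', hz'⟩ := (hmq _).mp h1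
    have h2 : cl (z' - ∑ b, h.repr (cl z') b • z b) = 0 := by
      simp only [map_sub, map_sum, map_smul, hz, h.sum_repr, sub_self]
    obtain ⟨t, ht⟩ := (hcl _).mp h2
    have h3 : j t ∈ Submodule.span ℂ (Set.range f) := by
      rw [← x.sum_repr t, map_sum]
      exact sum_mem fun a _ => by
        rw [map_smul]
        exact Submodule.smul_mem _ _ (hα a)
    rw [map_sub, map_sum] at ht
    rw [← sub_add_cancel w (∑ k, y.repr (q w) k • u k), ← hz',
      ← sub_add_cancel (m z') (∑ b, m (h.repr (cl z') b • z b)), ← ht]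
    refine add_mem (add_mem h3 (sum_mem fun b _ => ?_)) (sum_mem fun k _ => ?_)
    · rw [map_smul]
      exact Submodule.smul_mem _ _ (hβ b)
    · exact Submodule.smul_mem _ _ (hγ k)
  exact ⟨Basis.mk hli hsp, fun a => by simp [hf], fun b => by simp [hf], fun k => by simp [hf]⟩

end Aux

section Metric

open Module CategoryTheory

universe u v

variable {G : Type v} [Group G] {P : CochainComplex (ModuleCat.{u} (MonoidAlgebra ℤ G)) ℤ}
  {W : Type*} [AddCommGroup W] [Module ℂ W] {ρ : Representation ℂ G W} {IU IH IU' IH' : ℤ → Type}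

lemma diffQ_injective (i : ℤ) : Function.Injective (diffQ P ρ i) := by
  rw [← LinearMap.ker_eq_bot, diffQ, Submodule.ker_liftQ, ker_diffW_congr (j := i) (k := i - 1 + 1)
    (by ring), Submodule.mkQ_map_self]

variable [Fintype G]

/-- The splitting given by lifts of bases. -/
lemma exists_gsplitting [∀ i, Finite (IU i)] [∀ i, Finite (IH i)]
    (y : ∀ i, Basis (IU i) ℂ (QW P ρ i)) (h : ∀ i, Basis (IH i) ℂ (inv ρ (cohRep P i)))
    (u : ∀ i, IU i → inv ρ (termRep ℝ (P.X i)))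
    (hu : ∀ i k, (Submodule.Quotient.mk (u i k) : QW P ρ i) = y i k)
    (z : ∀ i, IH i → inv ρ (cocyclesRep P i)) (hz : ∀ i k, cohW P ρ i (z i k) = h i k) :
    ∃ S : GSplitting P ρ IU IH, S.u = u ∧ S.z = z := by
  have hex : ∀ i, Function.Exact (cocyclesW P ρ i) (LinearMap.ker (diffW P ρ i (i + 1))).mkQ := by
    intro i x
    rw [Submodule.mkQ_apply, Submodule.Quotient.mk_eq_zero, LinearMap.mem_ker]
    exact diffW_cocyclesW_exact i x
  have hcl : ∀ i x, cohW P ρ i x = 0 ↔ ∃ t, diffQ P ρ i t = cocyclesW P ρ i x := by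
    intro i x
    rw [cohW_eq_zero_iff]
    constructor
    · rintro ⟨y, hy⟩
      exact ⟨Submodule.Quotient.mk y, hy⟩
    · rintro ⟨t, ht⟩
      obtain ⟨y, rfl⟩ := Submodule.Quotient.mk_surjective _ t
      exact ⟨y, ht⟩
  choose c h1 h2 h3 using fun i => exists_filtered_basis (diffQ_injective i) (hex i)
    (fun t => mk_diffQ i t) (hcl i) (y (i - 1)) (h i) (y i) (z i) (hz i) (u i) (hu i)
  exact ⟨⟨u, z, c, fun i a => by rw [h1, ← hu, diffQ_mk], h2, h3⟩, rfl, rfl⟩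

variable [FiniteDimensional ℂ W]

lemma IsPerfect.finite_inv (hP : IsPerfect P) (i : ℤ) :
    FiniteDimensional ℂ (inv ρ (termRep ℝ (P.X i))) := by
  have := hP.finite i
  infer_instance

lemma IsPerfect.finite_inv_coh (hP : IsPerfect P) (i : ℤ) :
    FiniteDimensional ℂ (inv ρ (cohRep P i)) := by
  have := hP.finite_coh i
  infer_instance

lemma IsPerfect.finite_inv_cohSum (hP : IsPerfect P) (p : ℤ → Prop) :
    FiniteDimensional ℂ (inv ρ (cohSumRep P p)) := by
  have := hP.finite_cohSum p
  infer_instance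

lemma exists_splitting (hP : IsPerfect P) : Nonempty (Splitting P ρ Unit) := by
  have := hP.finite_inv (ρ := ρ)
  have := hP.finite_inv_coh (ρ := ρ)
  let y : ∀ i, Basis (Fin (finrank ℂ (QW P ρ i)) × Unit) ℂ (QW P ρ i) := fun i =>
    (finBasis ℂ (QW P ρ i)).reindex (Equiv.prodPUnit _).symm
  let h : ∀ i, Basis (Fin (finrank ℂ (inv ρ (cohRep P i))) × Unit) ℂ (inv ρ (cohRep P i)) :=
    fun i => (finBasis ℂ _).reindex (Equiv.prodPUnit _).symm
  choose u hu using fun i k => Submodule.Quotient.mk_surjective _ (y i k)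
  choose z hz using fun i k => cohW_surjective (P := P) (ρ := ρ) i (h i k)
  obtain ⟨S, -⟩ := exists_gsplitting y h u hu z hz
  exact ⟨S.toSplitting⟩

omit [FiniteDimensional ℂ W] [Fintype G] in
variable (ρ) in
lemma IsPerfect.bound (hP : IsPerfect P) : ∃ N : ℤ, ∀ i, N < |i| →
    Subsingleton (inv ρ (termRep ℝ (P.X i))) ∧ Subsingleton (QW P ρ i) ∧
      Subsingleton (inv ρ (cohRep P i)) := by
  obtain ⟨N, hN⟩ := hP.1
  refine ⟨N, fun i hi => ?_⟩
  have := hN i hi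
  have := subsingleton_inv (ρ := ρ) (termRep ℝ (P.X i))
  have := subsingleton_coh (P := P) (i := i)
  have h2 := subsingleton_inv (ρ := ρ) (cohRep P i)
  exact ⟨inferInstance, inferInstance, h2⟩

variable {ι κ : Type*}

/-- The basis of `(P^i ⊗ W)^G` consisting of all `r_G(a₀_j ⊗ w_n)`. -/
def LocalBases.basisW (L : LocalBases P) (ρ : Representation ℂ G W) (w : Basis ι ℂ W) (i : ℤ) :
    Basis (Fin (L.q i) × ι) ℂ (inv ρ (termRep ℝ (P.X i))) :=
  (piBasis (Fin (L.q i)) w).map (orbitEquiv ρ (termRep ℝ (P.X i))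
    (fun j => changeCoeff (algebraMap ℚ ℝ) (P.X i) (L.a₀ i j))
    ((L.a₀_basis i).changeCoeff (algebraMap ℚ ℝ)).basis
    ((L.a₀_basis i).changeCoeff (algebraMap ℚ ℝ)).basis_apply)

omit [FiniteDimensional ℂ W] in
lemma LocalBases.basisW_apply (L : LocalBases P) (w : Basis ι ℂ W) (i : ℤ)
    (x : Fin (L.q i) × ι) : L.basisW ρ w i x = rG ρ i (L.a₀ i x.1) (w x.2) := by
  rw [basisW, Basis.map_apply, orbitEquiv_piBasis]
  rfl

/-- The length of `ξ(⊗_i (∧_{jn} r_G(a₀_j ⊗ w_n))^{(-1)^i})` for the metric given by the forms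
`σ` on cohomology and a hermitian form `ν` on `W`. -/
def met (σ : SymForms P) (L : LocalBases P) [∀ i, Finite (IU i)] [∀ i, Finite (IH i)]
    (S : GSplitting P ρ IU IH) (ν : W →ₗ[ℂ] W →ₗ⋆[ℂ] ℂ) (w : Basis ι ℂ W) : ℝ :=
  (∏ᶠ i : ℤ, vol (S.c i) (L.basisW ρ w i) ^ (i.negOnePow : ℤ)) *
    √(grB (hermInv ρ (cohSumRep P Even) ν σ.ev) (S.basisCls Even) /
      grB (hermInv ρ (cohSumRep P Odd) ν σ.odd) (S.basisCls Odd))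

omit [Fintype G] [FiniteDimensional ℂ W] in
lemma mulSupport_zpow_finite {N : ℤ} {f : ℤ → ℂ} (hf : ∀ i, N < |i| → f i = 1) :
    (fun i => f i ^ (i.negOnePow : ℤ)).mulSupport.Finite := by
  refine (Finset.finite_toSet (Finset.Icc (-N) N)).subset fun i hi => ?_
  rw [Finset.coe_Icc, Set.mem_Icc, ← abs_le]
  by_contra hc
  exact hi (by simp [hf i (not_le.mp hc)])

omit [Fintype G] [FiniteDimensional ℂ W] in
lemma mulSupport_zpow_finite' {N : ℤ} {f : ℤ → ℝ} (hf : ∀ i, N < |i| → f i = 1) :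
    (fun i => f i ^ (i.negOnePow : ℤ)).mulSupport.Finite := by
  refine (Finset.finite_toSet (Finset.Icc (-N) N)).subset fun i hi => ?_
  rw [Finset.coe_Icc, Set.mem_Icc, ← abs_le]
  by_contra hc
  exact hi (by simp [hf i (not_le.mp hc)])

variable [∀ i, Finite (IU i)] [∀ i, Finite (IH i)] [∀ i, Finite (IU' i)] [∀ i, Finite (IH' i)]

omit [FiniteDimensional ℂ W] in
/-- Comparison of the volumes for two splittings. -/
lemma finprod_detEquiv (hP : IsPerfect P) (S : GSplitting P ρ IU IH) (S' : GSplitting P ρ IU' IH')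
    (eU : ∀ i, IU i ≃ IU' i) (eH : ∀ i, IH i ≃ IH' i) :
    ∏ᶠ i : ℤ, detEquiv (S.c i) (S'.c i) ((eU (i - 1)).sumCongr ((eH i).sumCongr (eU i))) ^
        (i.negOnePow : ℤ) =
      detEquiv (S.basisCls Even) (S'.basisCls Even)
          (Equiv.sigmaCongrRight fun i : {i : ℤ // Even i} => eH i) *
        (detEquiv (S.basisCls Odd) (S'.basisCls Odd)
          (Equiv.sigmaCongrRight fun i : {i : ℤ // Odd i} => eH i))⁻¹ := by
  obtain ⟨N, hN⟩ := hP.bound ρ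
  have hH : ∀ i, N < |i| → IsEmpty (IH i) := fun i hi =>
    have := (hN i hi).2.2
    ⟨fun k => (S.basisH i).ne_zero k (Subsingleton.elim _ _)⟩
  rw [S.det_basisCls_equiv S' Even hH eH, S.det_basisCls_equiv S' Odd hH eH]
  refine finprod_telescope (β := fun i => detEquiv (S.basisQ i) (S'.basisQ i) (eU i))
    (fun i => S.det_c_equiv S' i eU (eH i)) (fun i => detEquiv_ne_zero _ _ _)
    (fun i hi => ?_) (fun i hi => ?_)
  · have := (hN i hi).2.1
    exact detEquiv_of_subsingleton _ _ _
  · have := (hN i hi).2.2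
    exact detEquiv_of_subsingleton _ _ _

omit [FiniteDimensional ℂ W] in
lemma GSplitting.exists_equiv (S : GSplitting P ρ IU IH) (S' : GSplitting P ρ IU' IH') :
    ∃ (_ : ∀ i, IU i ≃ IU' i) (_ : ∀ i, IH i ≃ IH' i), True :=
  ⟨fun i => (S.basisQ i).indexEquiv (S'.basisQ i), fun i => (S.basisH i).indexEquiv (S'.basisH i),
    trivial⟩

lemma finite_cls (hP : IsPerfect P) (S : GSplitting P ρ IU IH) (p : ℤ → Prop) :
    Finite (Σ i : {i : ℤ // p i}, IH i) :=
  have := hP.finite_inv_cohSum (ρ := ρ) p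
  Module.Finite.finite_basis (S.basisCls p)

lemma norm_finprod_zpow {N : ℤ} {f : ℤ → ℂ} (hf : ∀ i, N < |i| → f i = 1) :
    ‖∏ᶠ i : ℤ, f i ^ (i.negOnePow : ℤ)‖ = ∏ᶠ i : ℤ, ‖f i‖ ^ (i.negOnePow : ℤ) := by
  have h := MonoidHom.map_finprod (normHom (α := ℂ) : ℂ →* ℝ) (mulSupport_zpow_finite hf)
  refine h.trans (finprod_congr fun i => ?_)
  exact norm_zpow (f i) _

omit [Fintype G] [FiniteDimensional ℂ W] in
lemma vol_c_of_bound {N : ℤ} (hN : ∀ i, N < |i| → Subsingleton (inv ρ (termRep ℝ (P.X i))) ∧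
      Subsingleton (QW P ρ i) ∧ Subsingleton (inv ρ (cohRep P i))) {α β : ℤ → Type*}
    (c : ∀ i, Basis (α i) ℂ (inv ρ (termRep ℝ (P.X i))))
    (b : ∀ i, Basis (β i) ℂ (inv ρ (termRep ℝ (P.X i)))) :
    (fun i => vol (c i) (b i) ^ (i.negOnePow : ℤ)).mulSupport.Finite :=
  mulSupport_zpow_finite' fun i hi =>
    have := (hN i hi).1
    vol_of_subsingleton _ _

/-- The length does not depend on the splitting. -/
lemma met_splitting (hP : IsPerfect P) (σ : SymForms P) (L : LocalBases P)
    (S : GSplitting P ρ IU IH) (S' : GSplitting P ρ IU' IH') (ν : W →ₗ[ℂ] W →ₗ⋆[ℂ] ℂ)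
    [Finite ι] (w : Basis ι ℂ W) : met σ L S ν w = met σ L S' ν w := by
  obtain ⟨eU, eH, -⟩ := S.exists_equiv S'
  obtain ⟨N, hN⟩ := hP.bound ρ
  have := finite_cls hP S Even
  have := finite_cls hP S Odd
  have h1 := congrArg norm (finprod_detEquiv hP S S' eU eH)
  rw [norm_finprod_zpow (N := N) fun i hi => have := (hN i hi).1; detEquiv_of_subsingleton _ _ _,
    norm_mul, norm_inv] at h1
  simp only [← vol_eq_norm_detEquiv] at h1
  have h2 : ∀ i, vol (S.c i) (L.basisW ρ w i) ^ (i.negOnePow : ℤ) =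
      vol (S.c i) (S'.c i) ^ (i.negOnePow : ℤ) *
        vol (S'.c i) (L.basisW ρ w i) ^ (i.negOnePow : ℤ) := by
    intro i
    rw [← mul_zpow, vol_trans]
  rw [met, met, finprod_congr h2, finprod_mul_distrib (vol_c_of_bound hN _ _)
    (vol_c_of_bound hN _ _), h1, grB_basis _ (S.basisCls Even) (S'.basisCls Even),
    grB_basis _ (S.basisCls Odd) (S'.basisCls Odd), mul_div_mul_comm,
    Real.sqrt_mul (by positivity), ← div_pow,
    Real.sqrt_sq (div_nonneg (vol_pos _ _).le (vol_pos _ _).le)]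
  ring

lemma met_pos (hP : IsPerfect P) (σ : SymForms P) (L : LocalBases P)
    (S : GSplitting P ρ IU IH) {ν : W →ₗ[ℂ] W →ₗ⋆[ℂ] ℂ} (hν : IsHermPos ν)
    (hνi : ∀ g x y, ν (ρ g x) (ρ g y) = ν x y) (w : Basis ι ℂ W) : 0 < met σ L S ν w := by
  have := finite_cls hP S Even
  have := finite_cls hP S Odd
  have := hP.finite_cohSum Even
  have := hP.finite_cohSum Odd
  refine mul_pos (finprod_induction (p := fun x : ℝ => 0 < x) one_pos (fun _ _ => mul_pos)
    fun i => zpow_pos (vol_pos _ _) _) (Real.sqrt_pos.mpr (div_pos ?_ ?_))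
  · exact grB_pos _ (hermInv_nondeg hν hνi σ.ev_nondeg σ.ev_inv)
  · exact grB_pos _ (hermInv_nondeg hν hνi σ.odd_nondeg σ.odd_inv)

/-- The form `∑_x ν(f x, h x)` on `W^X`. -/
def piForm (X : Type*) [Fintype X] (ν : W →ₗ[ℂ] W →ₗ⋆[ℂ] ℂ) : (X → W) →ₗ[ℂ] (X → W) →ₗ⋆[ℂ] ℂ :=
  LinearMap.mk₂'ₛₗ (RingHom.id ℂ) (starRingEnd ℂ) (fun f h => ∑ x, ν (f x) (h x))
    (fun _ _ _ => by simp [Finset.sum_add_distrib]) (fun _ _ _ => by simp [Finset.mul_sum])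
    (fun _ _ _ => by simp [Finset.sum_add_distrib]) (fun _ _ _ => by simp [Finset.mul_sum])

omit [FiniteDimensional ℂ W] in
lemma IsOrthon.piBasis {X : Type*} [Fintype X] [DecidableEq X] {ν : W →ₗ[ℂ] W →ₗ⋆[ℂ] ℂ}
    {w : Basis ι ℂ W} (h : IsOrthon ν w) : IsOrthon (piForm X ν) (HermClass.piBasis X w) := by
  have key : ∀ x y : X × ι, piForm X ν (HermClass.piBasis X w x) (HermClass.piBasis X w y) =
      if x.1 = y.1 then ν (w x.2) (w y.2) else 0 := by
    intro x y
    rw [piBasis_apply, piBasis_apply]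
    change ∑ k, ν ((Pi.single x.1 (w x.2) : X → W) k) ((Pi.single y.1 (w y.2) : X → W) k) = _
    rw [Finset.sum_eq_single x.1]
    · by_cases hxy : x.1 = y.1
      · rw [if_pos hxy, hxy]; simp
      · rw [if_neg hxy, Pi.single_eq_of_ne hxy]; simp
    · intro k _ hk
      rw [Pi.single_eq_of_ne hk]; simp
    · simp
  refine ⟨fun x => ?_, fun x y hxy => ?_⟩
  · rw [key, if_pos rfl, h.1]
  · rw [key]
    split_ifs with h1
    · exact h.2 _ _ fun h2 => hxy (Prod.ext h1 h2)
    · rfl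

omit [FiniteDimensional ℂ W] in
/-- The length does not depend on the orthonormal basis of `W`. -/
lemma met_orthon (σ : SymForms P) (L : LocalBases P) (S : GSplitting P ρ IU IH)
    {ν : W →ₗ[ℂ] W →ₗ⋆[ℂ] ℂ} [Finite ι] [Finite κ] {w : Basis ι ℂ W} {w' : Basis κ ℂ W}
    (hw : IsOrthon ν w) (hw' : IsOrthon ν w') : met σ L S ν w = met σ L S ν w' := by
  rw [met, met]
  congr 1
  refine finprod_congr fun i => ?_
  congr 1
  have h1 : vol (L.basisW ρ w i) (L.basisW ρ w' i) = 1 := by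
    rw [LocalBases.basisW, LocalBases.basisW, vol_map]
    exact IsOrthon.vol_eq_one hw.piBasis hw'.piBasis
  have := Finite.of_equiv _ ((L.basisW ρ w i).indexEquiv (S.c i))
  rw [← vol_trans _ _ (L.basisW ρ w' i), h1, mul_one]

end Metric

end

end HermClass

namespace HermClass

noncomputable section

section Transport

open Module CategoryTheory

universe u v

variable {G : Type v} [Group G] {P : CochainComplex (ModuleCat.{u} (MonoidAlgebra ℤ G)) ℤ}
  {W W' W₁ W₂ : Type*} [AddCommGroup W] [Module ℂ W] [AddCommGroup W'] [Module ℂ W']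
  [AddCommGroup W₁] [Module ℂ W₁] [AddCommGroup W₂] [Module ℂ W₂]
  {ρ : Representation ℂ G W} {ρ' : Representation ℂ G W'} {ρ₁ : Representation ℂ G W₁}
  {ρ₂ : Representation ℂ G W₂} {M : Type*} [AddCommGroup M] [Module ℝ M]
  {IU IH IU' IH' : ℤ → Type} {ι κ : Type*}

lemma mapW_mapW {W'' : Type*} [AddCommGroup W''] [Module ℂ W''] {ρ'' : Representation ℂ G W''}
    (Φ : W →ₗ[ℂ] W') (h : ∀ g x, Φ (ρ g x) = ρ' g (Φ x)) (Ψ : W' →ₗ[ℂ] W'')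
    (h' : ∀ g x, Ψ (ρ' g x) = ρ'' g (Ψ x)) (Χ : W →ₗ[ℂ] W'') (h'' : ∀ g x, Χ (ρ g x) = ρ'' g (Χ x))
    (e : ∀ x, Ψ (Φ x) = Χ x) (a : Representation ℝ G M) (x : inv ρ a) :
    mapW Ψ h' a (mapW Φ h a x) = mapW Χ h'' a x := by
  refine Subtype.ext ?_
  rw [mapW_coe, mapW_coe, mapW_coe]
  generalize (x : W ⊗[ℝ] M) = y
  induction y with
  | zero => simp
  | add x y hx hy => simp only [map_add, hx, hy]
  | tmul w m => simp [e]

lemma mapW_id (Φ : W →ₗ[ℂ] W) (h : ∀ g x, Φ (ρ g x) = ρ g (Φ x)) (e : ∀ x, Φ x = x)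
    (a : Representation ℝ G M) (x : inv ρ a) : mapW Φ h a x = x := by
  obtain rfl : Φ = LinearMap.id := LinearMap.ext e
  refine Subtype.ext ?_
  rw [mapW_coe, TensorProduct.AlgebraTensorModule.map_id]
  rfl

lemma symm_comm (Φ : W ≃ₗ[ℂ] W') (h : ∀ g x, Φ (ρ g x) = ρ' g (Φ x)) (g : G) (x : W') :
    Φ.symm.toLinearMap (ρ' g x) = ρ g (Φ.symm.toLinearMap x) := by
  rw [LinearEquiv.coe_coe, LinearEquiv.symm_apply_eq, h, LinearEquiv.apply_symm_apply]

/-- The equivalence `(M ⊗ W)^G ≃ (M ⊗ W')^G` induced by an isomorphism `W ≃ W'`. -/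
def mapWEquiv (Φ : W ≃ₗ[ℂ] W') (h : ∀ g x, Φ (ρ g x) = ρ' g (Φ x)) (a : Representation ℝ G M) :
    inv ρ a ≃ₗ[ℂ] inv ρ' a :=
  LinearEquiv.ofLinearMap (mapW Φ.toLinearMap h a) (mapW Φ.symm.toLinearMap (symm_comm Φ h) a)
    (LinearMap.ext fun x => (mapW_mapW Φ.symm.toLinearMap (symm_comm Φ h) Φ.toLinearMap h
      LinearMap.id (fun _ _ => rfl) (by simp) a x).trans (mapW_id _ _ (fun _ => rfl) a x))
    (LinearMap.ext fun x => (mapW_mapW Φ.toLinearMap h Φ.symm.toLinearMap (symm_comm Φ h)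
      LinearMap.id (fun _ _ => rfl) (by simp) a x).trans (mapW_id _ _ (fun _ => rfl) a x))

lemma mapWEquiv_apply (Φ : W ≃ₗ[ℂ] W') (h : ∀ g x, Φ (ρ g x) = ρ' g (Φ x))
    (a : Representation ℝ G M) (x : inv ρ a) :
    mapWEquiv Φ h a x = mapW Φ.toLinearMap h a x := rfl

lemma mapW_diffW (Φ : W →ₗ[ℂ] W') (h : ∀ g x, Φ (ρ g x) = ρ' g (Φ x)) (i j : ℤ)
    (x : inv ρ (termRep ℝ (P.X i))) :
    mapW Φ h _ (diffW P ρ i j x) = diffW P ρ' i j (mapW Φ h _ x) :=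
  mapW_invMap Φ h (diff P i j) (diff_comm P i j) x

lemma mapW_cocyclesW (Φ : W →ₗ[ℂ] W') (h : ∀ g x, Φ (ρ g x) = ρ' g (Φ x)) (i : ℤ)
    (x : inv ρ (cocyclesRep P i)) :
    mapW Φ h _ (cocyclesW P ρ i x) = cocyclesW P ρ' i (mapW Φ h _ x) :=
  mapW_invMap Φ h (cocycles P i).subtype (fun _ _ => rfl) x

lemma mapW_classW (Φ : W →ₗ[ℂ] W') (h : ∀ g x, Φ (ρ g x) = ρ' g (Φ x)) (p : ℤ → Prop)
    (i : {i : ℤ // p i}) (x : inv ρ (cocyclesRep P i)) :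
    mapW Φ h _ (classW P ρ p i x) = classW P ρ' p i (mapW Φ h _ x) :=
  mapW_invMap Φ h (toCohSum P p i) (toCohSum_comm P p i) x

lemma mapW_rG [Fintype G] (Φ : W →ₗ[ℂ] W') (h : ∀ g x, Φ (ρ g x) = ρ' g (Φ x)) (i : ℤ)
    (a : ℚ ⊗[ℤ] P.X i) (w : W) : mapW Φ h _ (rG ρ i a w) = rG ρ' i a (Φ w) :=
  mapW_sumOrbit Φ h (termRep ℝ (P.X i)) _ w

/-- Transport of a splitting along an isomorphism of representations. -/
def GSplitting.map (S : GSplitting P ρ IU IH) (Φ : W ≃ₗ[ℂ] W')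
    (h : ∀ g x, Φ (ρ g x) = ρ' g (Φ x)) : GSplitting P ρ' IU IH where
  u i k := mapW Φ.toLinearMap h _ (S.u i k)
  z i k := mapW Φ.toLinearMap h _ (S.z i k)
  c i := (S.c i).map (mapWEquiv Φ h _)
  c_B i k := by
    rw [Basis.map_apply, S.c_B, mapWEquiv_apply, mapW_diffW]
  c_H i k := by
    rw [Basis.map_apply, S.c_H, mapWEquiv_apply, mapW_cocyclesW]
  c_U i k := by
    rw [Basis.map_apply, S.c_U]
    rfl

lemma grB_map {E F : Type*} [AddCommGroup E] [Module ℂ E] [AddCommGroup F] [Module ℂ F]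
    (η : E →ₗ[ℂ] E →ₗ⋆[ℂ] ℂ) (η' : F →ₗ[ℂ] F →ₗ⋆[ℂ] ℂ) (f : E ≃ₗ[ℂ] F)
    (h : ∀ x y, η' (f x) (f y) = η x y) [Finite ι] (b : Basis ι ℂ E) :
    grB η' (b.map f) = grB η b := by
  classical
  have := Fintype.ofFinite ι
  rw [grB_eq, grB_eq, gr, gr]
  simp only [Basis.map_apply, h]

lemma grB_nonneg {E : Type*} [AddCommGroup E] [Module ℂ E] (η : E →ₗ[ℂ] E →ₗ⋆[ℂ] ℂ)
    (b : Basis ι ℂ E) : 0 ≤ grB η b := by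
  unfold grB
  split_ifs
  exacts [norm_nonneg _, zero_le_one]

lemma grB_prod {E F : Type*} [AddCommGroup E] [Module ℂ E] [AddCommGroup F] [Module ℂ F]
    (η : E →ₗ[ℂ] E →ₗ⋆[ℂ] ℂ) (η' : F →ₗ[ℂ] F →ₗ⋆[ℂ] ℂ) (θ : (E × F) →ₗ[ℂ] (E × F) →ₗ⋆[ℂ] ℂ)
    (h : ∀ x y, θ (x, 0) (y, 0) = η x y) (h' : ∀ x y, θ (0, x) (0, y) = η' x y)
    (h0 : ∀ x y, θ (x, 0) (0, y) = 0) (h0' : ∀ x y, θ (0, x) (y, 0) = 0)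
    [Finite ι] [Finite κ] (b : Basis ι ℂ E) (b' : Basis κ ℂ F) :
    grB θ (b.prod b') = grB η b * grB η' b' := by
  classical
  have := Fintype.ofFinite ι
  have := Fintype.ofFinite κ
  rw [grB_eq, grB_eq, grB_eq, gr, gr, gr, ← norm_mul, ← Matrix.det_fromBlocks_zero₂₁ _ 0]
  congr 2
  ext i j
  rcases i with i | i <;> rcases j with j | j <;> simp [h, h', h0, h0', Basis.prod_apply]

variable [Fintype G] [∀ i, Finite (IU i)] [∀ i, Finite (IH i)]

lemma basisW_map (L : LocalBases P) (Φ : W ≃ₗ[ℂ] W') (h : ∀ g x, Φ (ρ g x) = ρ' g (Φ x))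
    (w : Basis ι ℂ W) (i : ℤ) :
    L.basisW ρ' (w.map Φ) i = (L.basisW ρ w i).map (mapWEquiv Φ h _) := by
  refine Basis.eq_of_apply_eq fun x => ?_
  rw [Basis.map_apply, LocalBases.basisW_apply, LocalBases.basisW_apply, Basis.map_apply,
    mapWEquiv_apply, mapW_rG]
  rfl

lemma basisCls_map (S : GSplitting P ρ IU IH) (Φ : W ≃ₗ[ℂ] W')
    (h : ∀ g x, Φ (ρ g x) = ρ' g (Φ x)) (p : ℤ → Prop) :
    (S.map Φ h).basisCls p = (S.basisCls p).map (mapWEquiv Φ h _) := by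
  refine Basis.eq_of_apply_eq fun x => ?_
  rw [Basis.map_apply, GSplitting.basisCls_eq, GSplitting.basisCls_eq, mapWEquiv_apply,
    mapW_classW]
  rfl

omit [Fintype G] in
lemma hermInv_mapWEquiv (Φ : W ≃ₗ[ℂ] W') (h : ∀ g x, Φ (ρ g x) = ρ' g (Φ x))
    {ν : W →ₗ[ℂ] W →ₗ⋆[ℂ] ℂ} {ν' : W' →ₗ[ℂ] W' →ₗ⋆[ℂ] ℂ}
    (hν : ∀ x y, ν' (Φ x) (Φ y) = ν x y) (a : Representation ℝ G M) (σ : LinearMap.BilinForm ℝ M)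
    (x y : inv ρ a) :
    hermInv ρ' a ν' σ (mapWEquiv Φ h a x) (mapWEquiv Φ h a y) = hermInv ρ a ν σ x y := by
  rw [hermInv_apply, hermInv_apply]
  exact tensHerm_isometry ν ν' Φ.toLinearMap hν σ _ _

/-- The length is invariant under equivariant isometries. -/
lemma met_map [FiniteDimensional ℂ W] (hP : IsPerfect P) (σ : SymForms P) (L : LocalBases P)
    (S : GSplitting P ρ IU IH) (Φ : W ≃ₗ[ℂ] W') (h : ∀ g x, Φ (ρ g x) = ρ' g (Φ x))
    {ν : W →ₗ[ℂ] W →ₗ⋆[ℂ] ℂ} {ν' : W' →ₗ[ℂ] W' →ₗ⋆[ℂ] ℂ}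
    (hν : ∀ x y, ν' (Φ x) (Φ y) = ν x y) (w : Basis ι ℂ W) :
    met σ L (S.map Φ h) ν' (w.map Φ) = met σ L S ν w := by
  have := finite_cls hP S Even
  have := finite_cls hP S Odd
  rw [met, met, basisCls_map, basisCls_map, grB_map _ _ _ (hermInv_mapWEquiv Φ h hν _ _),
    grB_map _ _ _ (hermInv_mapWEquiv Φ h hν _ _)]
  congr 1
  refine finprod_congr fun i => ?_
  rw [basisW_map L Φ h]
  congr 1
  exact vol_map _ _ _

/-! ### Direct sums -/

section Prod

variable {IU₁ IH₁ IU₂ IH₂ : ℤ → Type}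

omit [Fintype G] in
lemma inl_comm (g : G) (x : W₁) : LinearMap.inl ℂ W₁ W₂ (ρ₁ g x) =
    (ρ₁.prod ρ₂) g (LinearMap.inl ℂ W₁ W₂ x) := by simp

omit [Fintype G] in
lemma inr_comm (g : G) (x : W₂) : LinearMap.inr ℂ W₁ W₂ (ρ₂ g x) =
    (ρ₁.prod ρ₂) g (LinearMap.inr ℂ W₁ W₂ x) := by simp

omit [Fintype G] in
lemma fst_comm (g : G) (x : W₁ × W₂) : LinearMap.fst ℂ W₁ W₂ ((ρ₁.prod ρ₂) g x) =
    ρ₁ g (LinearMap.fst ℂ W₁ W₂ x) := by simp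

omit [Fintype G] in
lemma snd_comm (g : G) (x : W₁ × W₂) : LinearMap.snd ℂ W₁ W₂ ((ρ₁.prod ρ₂) g x) =
    ρ₂ g (LinearMap.snd ℂ W₁ W₂ x) := by simp

omit [Fintype G] in
lemma mapW_zero (Φ : W →ₗ[ℂ] W') (h : ∀ g x, Φ (ρ g x) = ρ' g (Φ x)) (e : ∀ x, Φ x = 0)
    (a : Representation ℝ G M) (x : inv ρ a) : mapW Φ h a x = 0 := by
  refine Subtype.ext ?_
  rw [mapW_coe]
  generalize (x : W ⊗[ℝ] M) = y
  induction y with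
  | zero => simp
  | add x y hx hy => rw [map_add, hx, hy]; simp
  | tmul w m => simp [e]

variable (ρ₁ ρ₂) in
/-- `(M ⊗ W₁)^G × (M ⊗ W₂)^G ≃ (M ⊗ (W₁ × W₂))^G`. -/
def prodInv (a : Representation ℝ G M) :
    (inv ρ₁ a × inv ρ₂ a) ≃ₗ[ℂ] inv (ρ₁.prod ρ₂) a :=
  LinearEquiv.ofLinearMap
    (LinearMap.coprod (mapW (LinearMap.inl ℂ W₁ W₂) inl_comm a)
      (mapW (LinearMap.inr ℂ W₁ W₂) inr_comm a))
    (LinearMap.prod (mapW (LinearMap.fst ℂ W₁ W₂) fst_comm a)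
      (mapW (LinearMap.snd ℂ W₁ W₂) snd_comm a))
    (LinearMap.ext fun x => Subtype.ext (by
      change ((mapW (LinearMap.inl ℂ W₁ W₂) inl_comm a (mapW (LinearMap.fst ℂ W₁ W₂) fst_comm a x) +
        mapW (LinearMap.inr ℂ W₁ W₂) inr_comm a (mapW (LinearMap.snd ℂ W₁ W₂) snd_comm a x) :
          inv (ρ₁.prod ρ₂) a) : (W₁ × W₂) ⊗[ℝ] M) = x
      rw [Submodule.coe_add, mapW_coe, mapW_coe, mapW_coe, mapW_coe]
      generalize (x : (W₁ × W₂) ⊗[ℝ] M) = y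
      induction y with
      | zero => simp
      | add x y hx hy =>
        conv_rhs => rw [← hx, ← hy]
        simp only [map_add]
        abel
      | tmul w m => simp [← TensorProduct.add_tmul]))
    (LinearMap.ext fun x => by
      have h1 : ∀ y, mapW (LinearMap.fst ℂ W₁ W₂) fst_comm a
          (mapW (LinearMap.inl ℂ W₁ W₂) (inl_comm (ρ₁ := ρ₁) (ρ₂ := ρ₂)) a y) = y := fun y =>
        (mapW_mapW _ _ _ _ LinearMap.id (fun _ _ => rfl) (by simp) a y).trans
          (mapW_id _ _ (fun _ => rfl) a y)
      have h2 : ∀ y, mapW (LinearMap.snd ℂ W₁ W₂) snd_comm a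
          (mapW (LinearMap.inr ℂ W₁ W₂) (inr_comm (ρ₁ := ρ₁) (ρ₂ := ρ₂)) a y) = y := fun y =>
        (mapW_mapW _ _ _ _ LinearMap.id (fun _ _ => rfl) (by simp) a y).trans
          (mapW_id _ _ (fun _ => rfl) a y)
      have h3 : ∀ y, mapW (LinearMap.fst ℂ W₁ W₂) fst_comm a
          (mapW (LinearMap.inr ℂ W₁ W₂) (inr_comm (ρ₁ := ρ₁) (ρ₂ := ρ₂)) a y) = 0 := fun y =>
        (mapW_mapW _ _ _ _ (0 : W₂ →ₗ[ℂ] W₁) (by simp) (by simp) a y).trans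
          (mapW_zero _ _ (fun _ => rfl) a y)
      have h4 : ∀ y, mapW (LinearMap.snd ℂ W₁ W₂) snd_comm a
          (mapW (LinearMap.inl ℂ W₁ W₂) (inl_comm (ρ₁ := ρ₁) (ρ₂ := ρ₂)) a y) = 0 := fun y =>
        (mapW_mapW _ _ _ _ (0 : W₁ →ₗ[ℂ] W₂) (by simp) (by simp) a y).trans
          (mapW_zero _ _ (fun _ => rfl) a y)
      simp only [LinearMap.comp_apply, LinearMap.coprod_apply, LinearMap.prod_apply, Function.prod,
        map_add, h1, h2, h3, h4, LinearMap.id_apply]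
      exact Prod.ext (add_zero _) (zero_add _))

omit [Fintype G] in
lemma prodInv_apply (a : Representation ℝ G M) (x : inv ρ₁ a × inv ρ₂ a) :
    prodInv ρ₁ ρ₂ a x = mapW (LinearMap.inl ℂ W₁ W₂) inl_comm a x.1 +
      mapW (LinearMap.inr ℂ W₁ W₂) inr_comm a x.2 := rfl

/-- Rearrangement of the index sets of a direct sum of splittings. -/
def sumShuffle (α β γ α' β' γ' : Type*) :
    (α ⊕ β ⊕ γ) ⊕ (α' ⊕ β' ⊕ γ') ≃ (α ⊕ α') ⊕ (β ⊕ β') ⊕ (γ ⊕ γ') where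
  toFun := Sum.elim (Sum.elim (.inl ∘ .inl) (Sum.elim (.inr ∘ .inl ∘ .inl) (.inr ∘ .inr ∘ .inl)))
    (Sum.elim (.inl ∘ .inr) (Sum.elim (.inr ∘ .inl ∘ .inr) (.inr ∘ .inr ∘ .inr)))
  invFun := Sum.elim (Sum.map .inl .inl) (Sum.elim (Sum.map (.inr ∘ .inl) (.inr ∘ .inl))
    (Sum.map (.inr ∘ .inr) (.inr ∘ .inr)))
  left_inv := by rintro ((_ | _ | _) | (_ | _ | _)) <;> rfl
  right_inv := by rintro ((_ | _) | (_ | _) | (_ | _)) <;> rfl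

/-- The direct sum of splittings. -/
def GSplitting.prod (S₁ : GSplitting P ρ₁ IU₁ IH₁) (S₂ : GSplitting P ρ₂ IU₂ IH₂) :
    GSplitting P (ρ₁.prod ρ₂) (fun i => IU₁ i ⊕ IU₂ i) (fun i => IH₁ i ⊕ IH₂ i) where
  u i := Sum.elim (fun k => mapW (LinearMap.inl ℂ W₁ W₂) inl_comm _ (S₁.u i k))
    (fun k => mapW (LinearMap.inr ℂ W₁ W₂) inr_comm _ (S₂.u i k))
  z i := Sum.elim (fun k => mapW (LinearMap.inl ℂ W₁ W₂) inl_comm _ (S₁.z i k))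
    (fun k => mapW (LinearMap.inr ℂ W₁ W₂) inr_comm _ (S₂.z i k))
  c i := (((S₁.c i).prod (S₂.c i)).map (prodInv ρ₁ ρ₂ _)).reindex (sumShuffle _ _ _ _ _ _)
  c_B i k := by
    rcases k with k | k <;>
    simp only [Basis.reindex_apply, sumShuffle, Equiv.coe_fn_symm_mk, Sum.elim_inl, Sum.map_inl,
      Sum.map_inr, Sum.elim_inr, Basis.map_apply, Basis.prod_apply, Function.comp_apply,
      LinearMap.coe_inl, LinearMap.coe_inr, prodInv_apply, map_zero, add_zero, zero_add,
      S₁.c_B, S₂.c_B, mapW_diffW]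
  c_H i k := by
    rcases k with k | k <;>
    simp only [Basis.reindex_apply, sumShuffle, Equiv.coe_fn_symm_mk, Sum.elim_inl, Sum.map_inl,
      Sum.map_inr, Sum.elim_inr, Basis.map_apply, Basis.prod_apply, Function.comp_apply,
      LinearMap.coe_inl, LinearMap.coe_inr, prodInv_apply, map_zero, add_zero, zero_add,
      S₁.c_H, S₂.c_H, mapW_cocyclesW]
  c_U i k := by
    rcases k with k | k <;>
    simp only [Basis.reindex_apply, sumShuffle, Equiv.coe_fn_symm_mk, Sum.elim_inl, Sum.map_inl,
      Sum.map_inr, Sum.elim_inr, Basis.map_apply, Basis.prod_apply, Function.comp_apply,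
      LinearMap.coe_inl, LinearMap.coe_inr, prodInv_apply, map_zero, add_zero, zero_add,
      S₁.c_U, S₂.c_U]

/-- The orthogonal sum of hermitian forms. -/
def prodForm (ν₁ : W₁ →ₗ[ℂ] W₁ →ₗ⋆[ℂ] ℂ) (ν₂ : W₂ →ₗ[ℂ] W₂ →ₗ⋆[ℂ] ℂ) :
    (W₁ × W₂) →ₗ[ℂ] (W₁ × W₂) →ₗ⋆[ℂ] ℂ :=
  LinearMap.mk₂'ₛₗ (RingHom.id ℂ) (starRingEnd ℂ) (fun x y => ν₁ x.1 y.1 + ν₂ x.2 y.2)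
    (fun _ _ _ => by simp; ring) (fun _ _ _ => by simp; ring)
    (fun _ _ _ => by simp; ring) (fun _ _ _ => by simp; ring)

lemma prodForm_apply (ν₁ : W₁ →ₗ[ℂ] W₁ →ₗ⋆[ℂ] ℂ) (ν₂ : W₂ →ₗ[ℂ] W₂ →ₗ⋆[ℂ] ℂ) (x y : W₁ × W₂) :
    prodForm ν₁ ν₂ x y = ν₁ x.1 y.1 + ν₂ x.2 y.2 := rfl

lemma IsHermPos.prod {ν₁ : W₁ →ₗ[ℂ] W₁ →ₗ⋆[ℂ] ℂ} {ν₂ : W₂ →ₗ[ℂ] W₂ →ₗ⋆[ℂ] ℂ}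
    (h₁ : IsHermPos ν₁) (h₂ : IsHermPos ν₂) : IsHermPos (prodForm ν₁ ν₂) where
  symm x y := by rw [prodForm_apply, prodForm_apply, h₁.symm, h₂.symm, map_add]
  pos x hx := by
    rw [prodForm_apply, Complex.add_re]
    have n1 : 0 ≤ (ν₁ x.1 x.1).re := by
      by_cases h : x.1 = 0
      · simp [h]
      · exact (h₁.pos _ h).le
    have n2 : 0 ≤ (ν₂ x.2 x.2).re := by
      by_cases h : x.2 = 0
      · simp [h]
      · exact (h₂.pos _ h).le
    by_cases h : x.1 = 0
    · have h2 : x.2 ≠ 0 := fun h' => hx (Prod.ext h h')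
      linarith [h₂.pos _ h2]
    · linarith [h₁.pos _ h]

lemma IsOrthon.prod {ν₁ : W₁ →ₗ[ℂ] W₁ →ₗ⋆[ℂ] ℂ} {ν₂ : W₂ →ₗ[ℂ] W₂ →ₗ⋆[ℂ] ℂ}
    {w₁ : Basis ι ℂ W₁} {w₂ : Basis κ ℂ W₂} (h₁ : IsOrthon ν₁ w₁) (h₂ : IsOrthon ν₂ w₂) :
    IsOrthon (prodForm ν₁ ν₂) (w₁.prod w₂) := by
  refine ⟨?_, ?_⟩
  · rintro (i | i) <;> simp [prodForm_apply, Basis.prod_apply, h₁.1, h₂.1]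
  · rintro (i | i) (j | j) hij
    · simpa [prodForm_apply, Basis.prod_apply] using h₁.2 i j fun h => hij (by rw [h])
    · simp [prodForm_apply, Basis.prod_apply]
    · simp [prodForm_apply, Basis.prod_apply]
    · simpa [prodForm_apply, Basis.prod_apply] using h₂.2 i j fun h => hij (by rw [h])

omit [Fintype G] in
lemma grB_prodInv (a : Representation ℝ G M) (σ : LinearMap.BilinForm ℝ M)
    (ν₁ : W₁ →ₗ[ℂ] W₁ →ₗ⋆[ℂ] ℂ) (ν₂ : W₂ →ₗ[ℂ] W₂ →ₗ⋆[ℂ] ℂ) [Finite ι] [Finite κ]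
    (b₁ : Basis ι ℂ (inv ρ₁ a)) (b₂ : Basis κ ℂ (inv ρ₂ a)) :
    grB (hermInv (ρ₁.prod ρ₂) a (prodForm ν₁ ν₂) σ) ((b₁.prod b₂).map (prodInv ρ₁ ρ₂ a)) =
      grB (hermInv ρ₁ a ν₁ σ) b₁ * grB (hermInv ρ₂ a ν₂ σ) b₂ := by
  let η : (inv ρ₁ a × inv ρ₂ a) →ₗ[ℂ] (inv ρ₁ a × inv ρ₂ a) →ₗ⋆[ℂ] ℂ :=
    LinearMap.mk₂'ₛₗ (RingHom.id ℂ) (starRingEnd ℂ)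
      (fun x y => hermInv (ρ₁.prod ρ₂) a (prodForm ν₁ ν₂) σ (prodInv ρ₁ ρ₂ a x) (prodInv ρ₁ ρ₂ a y))
      (fun _ _ _ => by simp only [map_add, LinearMap.add_apply])
      (fun _ _ _ => by simp only [map_smul, LinearMap.smul_apply, RingHom.id_apply])
      (fun _ _ _ => by simp only [map_add])
      (fun _ _ _ => by simp only [map_smul, LinearMap.map_smulₛₗ])
  have hη : ∀ x y, η x y = tensHerm (prodForm ν₁ ν₂) σ
      (prodInv ρ₁ ρ₂ a x : (W₁ × W₂) ⊗[ℝ] M) (prodInv ρ₁ ρ₂ a y) := fun x y => rfl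
  rw [grB_map η _ (prodInv ρ₁ ρ₂ a) (fun x y => rfl)]
  refine grB_prod _ _ _ (fun x y => ?_) (fun x y => ?_) (fun x y => ?_) (fun x y => ?_) _ _
  all_goals
    rw [hη, prodInv_apply, prodInv_apply]
    simp only [map_zero, add_zero, zero_add, mapW_coe]
  · exact tensHerm_isometry _ _ _ (fun x y => by simp [prodForm_apply]) _ _ _
  · exact tensHerm_isometry _ _ _ (fun x y => by simp [prodForm_apply]) _ _ _
  · exact tensHerm_mapW _ _ _ _ _ _ (fun x y => by simp [prodForm_apply])
  · exact tensHerm_mapW _ _ _ _ _ _ (fun x y => by simp [prodForm_apply])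

/-- The length is multiplicative for direct sums. -/
lemma met_prod [FiniteDimensional ℂ W₁] [FiniteDimensional ℂ W₂] [∀ i, Finite (IU₁ i)]
    [∀ i, Finite (IH₁ i)] [∀ i, Finite (IU₂ i)] [∀ i, Finite (IH₂ i)]
    (hP : IsPerfect P) (σ : SymForms P) (L : LocalBases P)
    (S₁ : GSplitting P ρ₁ IU₁ IH₁) (S₂ : GSplitting P ρ₂ IU₂ IH₂) (ν₁ : W₁ →ₗ[ℂ] W₁ →ₗ⋆[ℂ] ℂ)
    (ν₂ : W₂ →ₗ[ℂ] W₂ →ₗ⋆[ℂ] ℂ) [Finite ι] [Finite κ] (w₁ : Basis ι ℂ W₁) (w₂ : Basis κ ℂ W₂) :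
    met σ L (S₁.prod S₂) (prodForm ν₁ ν₂) (w₁.prod w₂) = met σ L S₁ ν₁ w₁ * met σ L S₂ ν₂ w₂ := by
  have hf₁ := finite_cls hP S₁
  have hf₂ := finite_cls hP S₂
  have h1 : ∀ p, (S₁.prod S₂).basisCls p =
      (((S₁.basisCls p).prod (S₂.basisCls p)).map (prodInv ρ₁ ρ₂ _)).reindex
        (Equiv.sigmaSumDistrib _ _).symm := by
    intro p
    refine Basis.eq_of_apply_eq ?_
    rintro ⟨i, k | k⟩ <;>
    · rw [GSplitting.basisCls_eq, Basis.reindex_apply, Basis.map_apply, prodInv_apply]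
      simp only [Equiv.symm_symm, Equiv.sigmaSumDistrib_apply, Sum.map_inl, Sum.map_inr,
        Basis.prod_apply, Sum.elim_inl, Sum.elim_inr, Function.comp_apply, LinearMap.coe_inl,
        LinearMap.coe_inr, map_zero, add_zero, zero_add, GSplitting.basisCls_eq,
        mapW_classW]
      rfl
  have h2 : ∀ i, L.basisW (ρ₁.prod ρ₂) (w₁.prod w₂) i =
      (((L.basisW ρ₁ w₁ i).prod (L.basisW ρ₂ w₂ i)).map (prodInv ρ₁ ρ₂ _)).reindex
        (Equiv.prodSumDistrib _ _ _).symm := by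
    intro i
    refine Basis.eq_of_apply_eq ?_
    rintro ⟨j, k | k⟩ <;>
    · rw [LocalBases.basisW_apply, Basis.reindex_apply, Basis.map_apply, prodInv_apply]
      simp only [Equiv.symm_symm, Equiv.prodSumDistrib_apply_left, Equiv.prodSumDistrib_apply_right,
        Basis.prod_apply, Sum.elim_inl, Sum.elim_inr, Function.comp_apply, LinearMap.coe_inl,
        LinearMap.coe_inr, map_zero, add_zero, zero_add, LocalBases.basisW_apply,
        mapW_rG]
  have h3 : ∀ i, vol ((S₁.prod S₂).c i) (L.basisW (ρ₁.prod ρ₂) (w₁.prod w₂) i) =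
      vol (S₁.c i) (L.basisW ρ₁ w₁ i) * vol (S₂.c i) (L.basisW ρ₂ w₂ i) := by
    intro i
    rw [h2, GSplitting.prod, vol_reindex_left, vol_reindex_right, vol_map, vol_prod]
  obtain ⟨N₁, hN₁⟩ := hP.bound ρ₁
  obtain ⟨N₂, hN₂⟩ := hP.bound ρ₂
  rw [met, met, met, h1, h1, grB_reindex, grB_reindex, grB_prodInv, grB_prodInv, mul_div_mul_comm]
  simp only [h3, mul_zpow]
  rw [finprod_mul_distrib (vol_c_of_bound hN₁ _ _) (vol_c_of_bound hN₂ _ _), Real.sqrt_mul]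
  · ring
  · exact div_nonneg (grB_nonneg _ _) (grB_nonneg _ _)

end Prod

end Transport

end

end HermClass

namespace HermClass

noncomputable section

section MetRep

open Module CategoryTheory

universe u v

variable {G : Type v} [Group G] [Fintype G]
  {P : CochainComplex (ModuleCat.{u} (MonoidAlgebra ℤ G)) ℤ}
  {W W' W₁ W₂ : Type*} [AddCommGroup W] [Module ℂ W] [AddCommGroup W'] [Module ℂ W']
  [AddCommGroup W₁] [Module ℂ W₁] [AddCommGroup W₂] [Module ℂ W₂]
  [FiniteDimensional ℂ W] [FiniteDimensional ℂ W'] [FiniteDimensional ℂ W₁]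
  [FiniteDimensional ℂ W₂]
  {ρ : Representation ℂ G W} {ρ' : Representation ℂ G W'} {ρ₁ : Representation ℂ G W₁}
  {ρ₂ : Representation ℂ G W₂}
  {IU IH IU' IH' : ℤ → Type} {ι κ : Type*}

/-- The length is invariant under isomorphisms of representations, and independent of the choice
of the splitting, the invariant hermitian form and the orthonormal basis. -/
lemma met_eq_met [∀ i, Finite (IU i)] [∀ i, Finite (IH i)] [∀ i, Finite (IU' i)]
    [∀ i, Finite (IH' i)] (hP : IsPerfect P) (σ : SymForms P) (L : LocalBases P)
    (S : GSplitting P ρ IU IH) (S' : GSplitting P ρ' IU' IH') (Φ : W ≃ₗ[ℂ] W')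
    (h : ∀ g x, Φ (ρ g x) = ρ' g (Φ x)) {ν : W →ₗ[ℂ] W →ₗ⋆[ℂ] ℂ} {ν' : W' →ₗ[ℂ] W' →ₗ⋆[ℂ] ℂ}
    (hν : IsHermPos ν) (hν' : IsHermPos ν') (hi : ∀ g x y, ν (ρ g x) (ρ g y) = ν x y)
    (hi' : ∀ g x y, ν' (ρ' g x) (ρ' g y) = ν' x y) [Finite ι] [Finite κ]
    {w : Basis ι ℂ W} {w' : Basis κ ℂ W'} (hw : IsOrthon ν w) (hw' : IsOrthon ν' w') :
    met σ L S ν w = met σ L S' ν' w' := by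
  let μ : W →ₗ[ℂ] W →ₗ⋆[ℂ] ℂ := LinearMap.mk₂'ₛₗ (RingHom.id ℂ) (starRingEnd ℂ)
    (fun x y => ν' (Φ x) (Φ y)) (fun _ _ _ => by simp) (fun _ _ _ => by simp)
    (fun _ _ _ => by simp) (fun _ _ _ => by simp [LinearMap.map_smulₛₗ])
  have hμ : ∀ x y, ν' (Φ x) (Φ y) = μ x y := fun _ _ => rfl
  have hμp : IsHermPos μ := ⟨fun x y => hν'.symm _ _, fun x hx => hν'.pos _ (by simpa using hx)⟩
  obtain ⟨C, hC, hCν⟩ := exists_equivariant_isometry ρ hμp hν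
    (fun g x y => by rw [← hμ, ← hμ, h, h, hi']) hi
  have hΨ : ∀ g x, (C.trans Φ) (ρ g x) = ρ' g ((C.trans Φ) x) := fun g x => by
    rw [LinearEquiv.trans_apply, hC, h, LinearEquiv.trans_apply]
  have hΨν : ∀ x y, ν' ((C.trans Φ) x) ((C.trans Φ) y) = ν x y := fun x y => by
    rw [LinearEquiv.trans_apply, LinearEquiv.trans_apply, hμ, hCν]
  have hw2 : IsOrthon ν' (w.map (C.trans Φ)) := by
    refine ⟨fun x => ?_, fun x y hxy => ?_⟩
    · rw [Basis.map_apply, hΨν, hw.1]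
    · rw [Basis.map_apply, Basis.map_apply, hΨν, hw.2 x y hxy]
  rw [← met_map hP σ L S (C.trans Φ) hΨ hΨν w, met_splitting hP σ L _ S' ν',
    met_orthon σ L S' hw2 hw']

variable (σ : SymForms P) (L : LocalBases P) (hP : IsPerfect P)

variable (ρ) in
/-- The length of `ξ(⊗_i (∧_{jn} r_G(a₀_j ⊗ w_n))^{(-1)^i})` for an orthonormal basis `w` of a
representation `W` with respect to an invariant hermitian form. -/
def metRep : ℝ :=
  met σ L (exists_splitting (ρ := ρ) hP).some.toG (exists_invariant_hermPos ρ).choose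
    (exists_invariant_hermPos ρ).choose_spec.1.exists_orthon_basis.choose

lemma metRep_eq [∀ i, Finite (IU i)] [∀ i, Finite (IH i)] (S : GSplitting P ρ IU IH)
    {ν : W →ₗ[ℂ] W →ₗ⋆[ℂ] ℂ} (hν : IsHermPos ν) (hi : ∀ g x y, ν (ρ g x) (ρ g y) = ν x y)
    [Finite ι] {w : Basis ι ℂ W} (hw : IsOrthon ν w) : met σ L S ν w = metRep ρ σ L hP :=
  met_eq_met hP σ L S _ (LinearEquiv.refl ℂ W) (fun _ _ => rfl) hν
    (exists_invariant_hermPos ρ).choose_spec.1 hi (exists_invariant_hermPos ρ).choose_spec.2 hw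
    (exists_invariant_hermPos ρ).choose_spec.1.exists_orthon_basis.choose_spec

lemma metRep_pos : 0 < metRep ρ σ L hP :=
  met_pos hP σ L _ (exists_invariant_hermPos ρ).choose_spec.1
    (exists_invariant_hermPos ρ).choose_spec.2 _

lemma metRep_congr (Φ : W ≃ₗ[ℂ] W') (h : ∀ g x, Φ (ρ g x) = ρ' g (Φ x)) :
    metRep ρ σ L hP = metRep ρ' σ L hP :=
  met_eq_met hP σ L _ _ Φ h (exists_invariant_hermPos ρ).choose_spec.1
    (exists_invariant_hermPos ρ').choose_spec.1 (exists_invariant_hermPos ρ).choose_spec.2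
    (exists_invariant_hermPos ρ').choose_spec.2
    (exists_invariant_hermPos ρ).choose_spec.1.exists_orthon_basis.choose_spec
    (exists_invariant_hermPos ρ').choose_spec.1.exists_orthon_basis.choose_spec

lemma metRep_prod : metRep (ρ₁.prod ρ₂) σ L hP = metRep ρ₁ σ L hP * metRep ρ₂ σ L hP := by
  obtain ⟨S₁⟩ := exists_splitting (ρ := ρ₁) hP
  obtain ⟨S₂⟩ := exists_splitting (ρ := ρ₂) hP
  obtain ⟨ν₁, hν₁, hi₁⟩ := exists_invariant_hermPos ρ₁
  obtain ⟨ν₂, hν₂, hi₂⟩ := exists_invariant_hermPos ρ₂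
  obtain ⟨w₁, hw₁⟩ := hν₁.exists_orthon_basis
  obtain ⟨w₂, hw₂⟩ := hν₂.exists_orthon_basis
  rw [← metRep_eq σ L hP S₁.toG hν₁ hi₁ hw₁, ← metRep_eq σ L hP S₂.toG hν₂ hi₂ hw₂,
    ← met_prod hP σ L S₁.toG S₂.toG ν₁ ν₂ w₁ w₂,
    metRep_eq σ L hP (S₁.toG.prod S₂.toG) (hν₁.prod hν₂) (fun g x y => by
      rw [prodForm_apply, prodForm_apply]
      simp [hi₁, hi₂]) (hw₁.prod hw₂)]

/-- The comparison of two choices of bases of the complex. -/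
lemma metRep_localBases (L' : LocalBases P) {ν : W →ₗ[ℂ] W →ₗ⋆[ℂ] ℂ} (hν : IsHermPos ν)
    (hi : ∀ g x y, ν (ρ g x) (ρ g y) = ν x y) [Finite ι] {w : Basis ι ℂ W} (hw : IsOrthon ν w) :
    metRep ρ σ L' hP = metRep ρ σ L hP *
      ∏ᶠ i : ℤ, vol (L.basisW ρ w i) (L'.basisW ρ w i) ^ (i.negOnePow : ℤ) := by
  obtain ⟨S⟩ := exists_splitting (ρ := ρ) hP
  obtain ⟨N, hN⟩ := hP.bound ρ
  have hms : ∀ f : ℤ → ℝ, (∀ i, N < |i| → f i = 1) →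
      (fun i => f i ^ (i.negOnePow : ℤ)).mulSupport.Finite := fun f hf => by
    refine (Finset.finite_toSet (Finset.Icc (-N) N)).subset fun i hi => ?_
    rw [Finset.coe_Icc, Set.mem_Icc, ← abs_le]
    by_contra hc
    exact hi (by simp [hf i (not_le.mp hc)])
  rw [← metRep_eq σ L hP S.toG hν hi hw, ← metRep_eq σ L' hP S.toG hν hi hw, met, met,
    mul_right_comm]
  congr 1
  rw [← finprod_mul_distrib
    (hms (fun i => vol (S.toG.c i) (L.basisW ρ w i)) fun i h => have := (hN i h).1
      have := hP.finite_inv (ρ := ρ) i; vol_of_subsingleton _ _)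
    (hms (fun i => vol (L.basisW ρ w i) (L'.basisW ρ w i)) fun i h => have := (hN i h).1
      have := hP.finite_inv (ρ := ρ) i; vol_of_subsingleton _ _)]
  refine finprod_congr fun i => ?_
  have := Finite.of_equiv _ ((L.basisW ρ w i).indexEquiv (S.toG.c i))
  rw [← mul_zpow, vol_trans]

end MetRep

end

end HermClass

namespace HermClass

noncomputable section

/-! ### Determinants of matrices over group rings -/

section GroupRingDet

open Module

variable {G : Type*} [Group G] {k l R S : Type*} [CommRing k] [CommRing l] [CommRing R]
  [CommRing S] {n m : Type*} [Fintype n] [DecidableEq n] [Fintype m] [DecidableEq m]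
  {ι κ : Type*} [Fintype ι] [DecidableEq ι] [Fintype κ] [DecidableEq κ]

/-- The ring homomorphism `∑ x_g g ↦ ∑ φ(x_g) T(g)`. -/
def gEval (φ : k →+* R) (T : G →* Matrix n n R) : MonoidAlgebra k G →+* Matrix n n R :=
  MonoidAlgebra.liftNCRingHom ((Matrix.scalar n).comp φ) T
    (fun _ _ => Matrix.scalar_commute _ (fun r => Commute.all _ r) _)

lemma gEval_single (φ : k →+* R) (T : G →* Matrix n n R) (g : G) (c : k) :
    gEval φ T (MonoidAlgebra.single g c) = φ c • T g := by
  change MonoidAlgebra.liftNC _ _ _ = _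
  rw [MonoidAlgebra.liftNC_single]
  simp [Matrix.smul_eq_diagonal_mul]

lemma gEval_eq [Fintype G] (φ : k →+* R) (T : G →* Matrix n n R) (x : MonoidAlgebra k G) :
    gEval φ T x = ∑ g, φ (x.coeff g) • T g := by
  classical
  induction x using MonoidAlgebra.induction_linear with
  | zero => simp
  | add x y hx hy => simp only [map_add, hx, hy, MonoidAlgebra.coeff_add, Finsupp.add_apply,
      add_smul, Finset.sum_add_distrib]
  | single g c =>
    rw [gEval_single, Finset.sum_eq_single g]
    · simp
    · intro h _ hh
      simp [MonoidAlgebra.coeff_single, Ne.symm hh]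
    · simp

/-- The block matrix `(T(M_{ij}))` of a matrix `M` over a group ring. -/
def gMat (φ : k →+* R) (T : G →* Matrix n n R) :
    Matrix ι ι (MonoidAlgebra k G) →+* Matrix (ι × n) (ι × n) R :=
  (Matrix.compRingEquiv ι n R).toRingHom.comp (gEval φ T).mapMatrix

lemma gMat_apply (φ : k →+* R) (T : G →* Matrix n n R) (M : Matrix ι ι (MonoidAlgebra k G))
    (x y : ι × n) : gMat φ T M x y = gEval φ T (M x.1 y.1) x.2 y.2 := rfl

/-- The determinant `det T(M)` of a matrix `M` over a group ring. -/
def gDet (φ : k →+* R) (T : G →* Matrix n n R) : Matrix ι ι (MonoidAlgebra k G) →* R :=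
  Matrix.detMonoidHom.comp (gMat φ T).toMonoidHom

lemma gDet_apply (φ : k →+* R) (T : G →* Matrix n n R) (M : Matrix ι ι (MonoidAlgebra k G)) :
    gDet φ T M = (gMat φ T M).det := rfl

lemma map_gEval (f : R →+* S) (φ : k →+* R) (T : G →* Matrix n n R) (x : MonoidAlgebra k G) :
    f.mapMatrix (gEval φ T x) =
      gEval (f.comp φ) (f.mapMatrix.toMonoidHom.comp T) x := by
  induction x using MonoidAlgebra.induction_linear with
  | zero => simp
  | add x y hx hy => simp only [map_add, hx, hy]
  | single g c =>
    rw [gEval_single, gEval_single]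
    ext i j
    simp

lemma map_gDet (f : R →+* S) (φ : k →+* R) (T : G →* Matrix n n R)
    (M : Matrix ι ι (MonoidAlgebra k G)) :
    f (gDet φ T M) = gDet (f.comp φ) (f.mapMatrix.toMonoidHom.comp T) M := by
  rw [gDet_apply, gDet_apply, RingHom.map_det]
  congr 1
  ext x y
  rw [gMat_apply, ← map_gEval]
  rfl

lemma gEval_mapRingHom (h : l →+* k) (φ : k →+* R) (T : G →* Matrix n n R)
    (x : MonoidAlgebra l G) :
    gEval φ T (MonoidAlgebra.mapRingHom G h x) = gEval (φ.comp h) T x := by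
  induction x using MonoidAlgebra.induction_linear with
  | zero => simp
  | add x y hx hy => simp only [map_add, hx, hy]
  | single g c =>
    rw [MonoidAlgebra.mapRingHom_single, gEval_single, gEval_single, RingHom.comp_apply]

lemma gDet_mapRingHom (h : l →+* k) (φ : k →+* R) (T : G →* Matrix n n R)
    (M : Matrix ι ι (MonoidAlgebra l G)) :
    gDet φ T ((MonoidAlgebra.mapRingHom G h).mapMatrix M) = gDet (φ.comp h) T M := by
  rw [gDet_apply, gDet_apply]
  congr 1
  ext x y
  rw [gMat_apply, gMat_apply, ← gEval_mapRingHom]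
  rfl

lemma gDet_conj (φ : k →+* R) (T : G →* Matrix n n R) (T' : G →* Matrix m m R)
    (X : Matrix m n R) (Y : Matrix n m R) (hXY : X * Y = 1) (hYX : Y * X = 1)
    (h : ∀ g, X * T g = T' g * X) (M : Matrix ι ι (MonoidAlgebra k G)) :
    gDet φ T M = gDet φ T' M := by
  have h1 : ∀ x, gEval φ T' x = X * gEval φ T x * Y := fun x => by
    induction x using MonoidAlgebra.induction_linear with
    | zero => simp
    | add x y hx hy => simp only [map_add, hx, hy, Matrix.mul_add, Matrix.add_mul]
    | single g c =>
      rw [gEval_single, gEval_single, Matrix.mul_smul, Matrix.smul_mul, h, Matrix.mul_assoc, hXY,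
        Matrix.mul_one]
  have h2 : gMat φ T' M = Matrix.kroneckerMap (· * ·) (1 : Matrix ι ι R) X * gMat φ T M *
      Matrix.kroneckerMap (· * ·) (1 : Matrix ι ι R) Y := by
    ext ⟨i, a⟩ ⟨j, b⟩
    rw [gMat_apply, h1]
    simp [Matrix.mul_apply, Fintype.sum_prod_type, Matrix.one_apply, gMat_apply]
  rw [gDet_apply, gDet_apply, h2, Matrix.det_conj_of_mul_eq_one]
  · rw [← Matrix.mul_kronecker_mul, hXY, Matrix.one_mul, Matrix.one_kronecker_one]
  · rw [← Matrix.mul_kronecker_mul, hYX, Matrix.one_mul, Matrix.one_kronecker_one]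

/-- The direct sum of two matrix representations. -/
def sumMat (T : G →* Matrix n n R) (T' : G →* Matrix m m R) : G →* Matrix (n ⊕ m) (n ⊕ m) R where
  toFun g := Matrix.fromBlocks (T g) 0 0 (T' g)
  map_one' := by simp [Matrix.fromBlocks_one]
  map_mul' g h := by simp [Matrix.fromBlocks_multiply]

lemma gDet_sumMat (φ : k →+* R) (T : G →* Matrix n n R) (T' : G →* Matrix m m R)
    (M : Matrix ι ι (MonoidAlgebra k G)) :
    gDet φ (sumMat T T') M = gDet φ T M * gDet φ T' M := by
  have h1 : ∀ x, gEval φ (sumMat T T') x = Matrix.fromBlocks (gEval φ T x) 0 0 (gEval φ T' x) := by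
    intro x
    induction x using MonoidAlgebra.induction_linear with
    | zero => simp
    | add x y hx hy => simp [map_add, hx, hy, Matrix.fromBlocks_add]
    | single g c =>
      rw [gEval_single, gEval_single, gEval_single]
      change φ c • Matrix.fromBlocks (T g) 0 0 (T' g) = _
      simp [Matrix.fromBlocks_smul]
  have h2 : gMat φ (sumMat T T') M = (Matrix.fromBlocks (gMat φ T M) 0 0 (gMat φ T' M)).submatrix
      (Equiv.prodSumDistrib ι n m) (Equiv.prodSumDistrib ι n m) := by
    ext ⟨i, a⟩ ⟨j, b⟩
    rw [gMat_apply, h1]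
    rcases a with a | a <;> rcases b with b | b <;> simp [gMat_apply]
  rw [gDet_apply, h2, Matrix.det_submatrix_equiv_self, Matrix.det_fromBlocks_zero₂₁]
  rfl

/-- The representation on matrices with another index set. -/
def reindexMat (e : n ≃ m) (T : G →* Matrix n n R) : G →* Matrix m m R :=
  (Matrix.reindexRingEquiv R e).toRingHom.toMonoidHom.comp T

lemma reindexMat_apply (e : n ≃ m) (T : G →* Matrix n n R) (g : G) :
    reindexMat e T g = (T g).submatrix e.symm e.symm := rfl

lemma trace_reindexMat (e : n ≃ m) (T : G →* Matrix n n R) (g : G) :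
    (reindexMat e T g).trace = (T g).trace := by
  simp only [reindexMat_apply, Matrix.trace, Matrix.diag_apply, Matrix.submatrix_apply]
  exact e.symm.sum_comp fun i => T g i i

lemma gDet_reindexMat (φ : k →+* R) (e : n ≃ m) (T : G →* Matrix n n R)
    (M : Matrix ι ι (MonoidAlgebra k G)) : gDet φ (reindexMat e T) M = gDet φ T M := by
  have h1 : ∀ x, gEval φ (reindexMat e T) x = (gEval φ T x).submatrix e.symm e.symm := by
    intro x
    induction x using MonoidAlgebra.induction_linear with
    | zero => simp
    | add x y hx hy => simp [map_add, hx, hy, Matrix.submatrix_add]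
    | single g c =>
      rw [gEval_single, gEval_single]
      rfl
  have h2 : gMat φ (reindexMat e T) M = (gMat φ T M).submatrix
      ((Equiv.refl ι).prodCongr e.symm) ((Equiv.refl ι).prodCongr e.symm) := by
    ext ⟨i, a⟩ ⟨j, b⟩
    rw [gMat_apply, h1]
    rfl
  rw [gDet_apply, h2, Matrix.det_submatrix_equiv_self, gDet_apply]

/-- The family `∑_k M_{jk} a_k`, for a matrix `M` over the group ring. -/
def comb {V : Type*} [AddCommGroup V] [Module k V] (ρ : Representation k G V)
    (M : Matrix κ ι (MonoidAlgebra k G)) (a : ι → V) (j : κ) : V :=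
  ∑ i, ρ.asAlgebraHom (M j i) (a i)

variable {V : Type*} [AddCommGroup V] [Module k V] (ρ : Representation k G V)

lemma asAlgebraHom_eq [Fintype G] (x : MonoidAlgebra k G) (v : V) :
    ρ.asAlgebraHom x v = ∑ g, x.coeff g • ρ g v := by
  classical
  induction x using MonoidAlgebra.induction_linear with
  | zero => simp
  | add x y hx hy => simp only [map_add, hx, hy, MonoidAlgebra.coeff_add, Finsupp.add_apply,
      add_smul, Finset.sum_add_distrib, LinearMap.add_apply]
  | single g c =>
    rw [Representation.asAlgebraHom_single, Finset.sum_eq_single g]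
    · simp
    · intro h _ hh
      simp [MonoidAlgebra.coeff_single, Ne.symm hh]
    · simp

omit [DecidableEq ι] [Fintype κ] [DecidableEq κ] in
lemma comb_eq [Fintype G] (M : Matrix κ ι (MonoidAlgebra k G)) (a : ι → V) (j : κ) :
    comb ρ M a j = ∑ i, ∑ g, (M j i).coeff g • ρ g (a i) :=
  Finset.sum_congr rfl fun _ _ => asAlgebraHom_eq ρ _ _

omit [DecidableEq ι] [DecidableEq κ] in
lemma comb_mul {μ : Type*} (N : Matrix μ κ (MonoidAlgebra k G)) (M : Matrix κ ι (MonoidAlgebra k G))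
    (a : ι → V) : comb ρ (N * M) a = comb ρ N (comb ρ M a) := by
  ext j
  simp only [comb, Matrix.mul_apply, map_sum, map_mul, LinearMap.sum_apply, Module.End.mul_apply]
  exact Finset.sum_comm

lemma comb_one (a : ι → V) : comb ρ (1 : Matrix ι ι (MonoidAlgebra k G)) a = a := by
  ext j
  simp only [comb]
  rw [Finset.sum_eq_single j]
  · simp
  · intro i _ hi
    simp [Matrix.one_apply_ne hi.symm]
  · simp

omit [DecidableEq ι] [Fintype κ] [DecidableEq κ] in
lemma group_comb_injective [Fintype G] {a : ι → V}
    (ha : LinearIndependent k fun x : G × ι => ρ x.1 (a x.2)) {M N : Matrix κ ι (MonoidAlgebra k G)}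
    (h : comb ρ M a = comb ρ N a) : M = N := by
  ext j i g
  have h1 := congrFun h j
  rw [comb_eq, comb_eq, Finset.sum_comm, ← Fintype.sum_prod_type', Finset.sum_comm,
    ← Fintype.sum_prod_type'] at h1
  have h2 := sub_eq_zero.mpr h1
  rw [← Finset.sum_sub_distrib] at h2
  simp_rw [← sub_smul] at h2
  exact sub_eq_zero.mp (Fintype.linearIndependent_iff.mp ha
    (fun x => (M j x.2).coeff x.1 - (N j x.2).coeff x.1) h2 (g, i))

omit [DecidableEq ι] [Fintype κ] [DecidableEq κ] in
lemma exists_group_comb [Fintype G] {a : ι → V}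
    (ha : Submodule.span k (Set.range fun x : G × ι => ρ x.1 (a x.2)) = ⊤) (b : κ → V) :
    ∃ M : Matrix κ ι (MonoidAlgebra k G), comb ρ M a = b := by
  have h : ∀ j, ∃ c : G × ι → k, ∑ x, c x • ρ x.1 (a x.2) = b j := fun j =>
    (Submodule.mem_span_range_iff_exists_fun k).mp (ha ▸ Submodule.mem_top)
  choose c hc using h
  refine ⟨Matrix.of fun j i => MonoidAlgebra.ofCoeff (Finsupp.equivFunOnFinite.symm fun g => c j (g, i)),
    funext fun j => ?_⟩
  rw [comb_eq, ← hc, Fintype.sum_prod_type, Finset.sum_comm]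
  rfl

/-- The matrix between two bases over the group ring is invertible. -/
lemma isUnit_of_group_comb [Fintype G] {a b : ι → V}
    (ha : LinearIndependent k fun x : G × ι => ρ x.1 (a x.2))
    (hb : Submodule.span k (Set.range fun x : G × ι => ρ x.1 (b x.2)) = ⊤)
    (hb' : LinearIndependent k fun x : G × ι => ρ x.1 (b x.2))
    {M : Matrix ι ι (MonoidAlgebra k G)} (h : comb ρ M a = b) : IsUnit M := by
  obtain ⟨N, hN⟩ := exists_group_comb ρ hb a
  refine ⟨⟨M, N, group_comb_injective ρ hb' ?_, group_comb_injective ρ ha ?_⟩, rfl⟩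
  · rw [comb_mul, hN, h, comb_one]
  · rw [comb_mul, h, hN, comb_one]

end GroupRingDet

end

end HermClass

namespace HermClass

noncomputable section

section BaseComparison

open Module CategoryTheory

universe u v

variable {G : Type v} [Group G] {W : Type*} [AddCommGroup W] [Module ℂ W]
  (ρ : Representation ℂ G W) {ι : Type*} [Fintype ι] [DecidableEq ι]

/-- The matrices of the representation dual to `ρ`. -/
def dualMat (w : Basis ι ℂ W) : G →* Matrix ι ι ℂ where
  toFun g := (LinearMap.toMatrix w w (ρ g⁻¹)).transpose
  map_one' := by
    rw [inv_one, map_one]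
    change (LinearMap.toMatrix w w LinearMap.id).transpose = 1
    rw [LinearMap.toMatrix_id, Matrix.transpose_one]
  map_mul' g h := by
    rw [mul_inv_rev, map_mul, ← Matrix.transpose_mul, ← LinearMap.toMatrix_mul]

lemma trace_dualMat (w : Basis ι ℂ W) (g : G) :
    (dualMat ρ w g).trace = LinearMap.trace ℂ W (ρ g⁻¹) := by
  rw [LinearMap.trace_eq_matrix_trace ℂ w]
  exact Matrix.trace_transpose _

variable [Fintype G]

lemma sumOrbit_sum_smul {M : Type*} [AddCommGroup M] [Module ℝ M] (a : Representation ℝ G M)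
    {κ : Type*} [Fintype κ] (r : κ → ℝ) (m : κ → M) (x : W) :
    sumOrbit ρ a (∑ k, r k • m k) x = ∑ k, (r k : ℂ) • sumOrbit ρ a (m k) x := by
  refine Subtype.ext ?_
  rw [AddSubmonoidClass.coe_finsetSum]
  simp only [Submodule.coe_smul, sumOrbit_coe, map_sum, map_smul, TensorProduct.tmul_sum,
    TensorProduct.tmul_smul, Complex.coe_smul, Finset.smul_sum]
  exact Finset.sum_comm

variable {P : CochainComplex (ModuleCat.{u} (MonoidAlgebra ℤ G)) ℤ}

lemma rG_asAlgebraHom (i : ℤ) (x : MonoidAlgebra ℚ G) (a : ℚ ⊗[ℤ] P.X i) (w : Basis ι ℂ W)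
    (n : ι) :
    rG ρ i ((termRep ℚ (P.X i)).asAlgebraHom x a) (w n) =
      ∑ m, gEval (algebraMap ℚ ℂ) (dualMat ρ w) x n m • rG ρ i a (w m) := by
  change sumOrbit ρ (termRep ℝ (P.X i)) _ _ = ∑ m, _ • sumOrbit ρ (termRep ℝ (P.X i)) _ _
  rw [asAlgebraHom_eq, map_sum]
  simp_rw [changeCoeff_smul, changeCoeff_termRep]
  rw [sumOrbit_sum_smul]
  simp_rw [sumOrbit_smul_left]
  have h : ∀ g, sumOrbit ρ (termRep ℝ (P.X i)) (changeCoeff (algebraMap ℚ ℝ) (P.X i) a)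
      (ρ g⁻¹ (w n)) = ∑ m, dualMat ρ w g n m •
        sumOrbit ρ (termRep ℝ (P.X i)) (changeCoeff (algebraMap ℚ ℝ) (P.X i) a) (w m) := by
    intro g
    have h1 : ∀ y : W, sumOrbit ρ (termRep ℝ (P.X i)) (changeCoeff (algebraMap ℚ ℝ) (P.X i) a) y =
        sumOrbits ρ (termRep ℝ (P.X i)) (fun _ : Unit => changeCoeff (algebraMap ℚ ℝ) (P.X i) a)
          (fun _ => y) := fun y => by
      change _ = ∑ j : Unit, _
      simp
    rw [h1]
    simp_rw [h1, ← map_smul, ← map_sum]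
    congr 1
    ext
    rw [Finset.sum_apply]
    conv_lhs => rw [← w.sum_repr (ρ g⁻¹ (w n))]
    refine Finset.sum_congr rfl fun m _ => ?_
    rw [Pi.smul_apply, dualMat]
    simp [LinearMap.toMatrix_apply]
  simp_rw [h, Finset.smul_sum, smul_smul]
  rw [Finset.sum_comm]
  refine Finset.sum_congr rfl fun m _ => ?_
  rw [← Finset.sum_smul, gEval_eq, Matrix.sum_apply]
  congr 1

/-- The volume of one basis of `(P^i ⊗ W)^G` with respect to another one. -/
lemma vol_basisW (L L' : LocalBases P) (i : ℤ) (e : Fin (L.q i) ≃ Fin (L'.q i))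
    (μ : Matrix (Fin (L.q i)) (Fin (L.q i)) (MonoidAlgebra ℚ G))
    (hμ : comb (termRep ℚ (P.X i)) μ (L.a₀ i) = L'.a₀ i ∘ e) (w : Basis ι ℂ W) :
    vol (L.basisW ρ w i) (L'.basisW ρ w i) =
      ‖gDet (algebraMap ℚ ℂ) (dualMat ρ w) μ‖ := by
  rw [vol_eq_det _ _ (e.prodCongr (Equiv.refl ι)), gDet_apply, ← Matrix.det_transpose,
    Basis.det_apply]
  congr 2
  ext x y
  rw [Matrix.transpose_apply, gMat_apply, Basis.toMatrix_apply, Function.comp_apply,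
    LocalBases.basisW_apply]
  change (L.basisW ρ w i).repr (rG ρ i ((L'.a₀ i ∘ e) y.1) (w y.2)) x = _
  rw [← hμ, comb]
  have h1 : rG ρ i (∑ k, (termRep ℚ (P.X i)).asAlgebraHom (μ y.1 k) (L.a₀ i k)) (w y.2) =
      ∑ z : Fin (L.q i) × ι, gEval (algebraMap ℚ ℂ) (dualMat ρ w) (μ y.1 z.1) y.2 z.2 •
        L.basisW ρ w i z := by
    have h2 : ∀ m : Fin (L.q i) → ℚ ⊗[ℤ] P.X i, rG ρ i (∑ k, m k) (w y.2) =
        ∑ k, rG ρ i (m k) (w y.2) := fun m => by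
      change sumOrbit ρ _ _ _ = ∑ k, sumOrbit ρ _ _ _
      rw [map_sum]
      simpa using sumOrbit_sum_smul ρ (termRep ℝ (P.X i)) (fun _ => 1)
        (fun k => changeCoeff (algebraMap ℚ ℝ) (P.X i) (m k)) (w y.2)
    rw [h2, Fintype.sum_prod_type]
    refine Finset.sum_congr rfl fun k _ => ?_
    rw [rG_asAlgebraHom]
    simp_rw [LocalBases.basisW_apply]
  rw [h1, map_sum, Finsupp.finsetSum_apply, Finset.sum_eq_single x]
  · simp
  · intro z _ hz
    simp [hz]
  · simp

end BaseComparison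

/-! ### Existence and comparison of local bases -/

section LocalBases

open Module CategoryTheory

universe u v

variable {G : Type v} [Group G] [Fintype G] {M : ModuleCat.{u} (MonoidAlgebra ℤ G)}

lemma IsGroupRingBasis.card_eq {k : Type*} [CommRing k] [Nontrivial k] {q q' : ℕ}
    {a : Fin q → k ⊗[ℤ] M} {a' : Fin q' → k ⊗[ℤ] M} (h : IsGroupRingBasis k M a)
    (h' : IsGroupRingBasis k M a') : q = q' := by
  have h1 := Fintype.card_congr (h.basis.indexEquiv h'.basis)
  simp only [Fintype.card_prod, Fintype.card_fin] at h1
  exact Nat.eq_of_mul_eq_mul_left Fintype.card_pos h1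

omit [Fintype G] in
lemma IsGroupRingBasis.comp_equiv {k : Type*} [CommRing k] {q q' : ℕ}
    {a : Fin q' → k ⊗[ℤ] M} (h : IsGroupRingBasis k M a) (e : Fin q ≃ Fin q') :
    IsGroupRingBasis k M (a ∘ e) :=
  .of_basis (h.basis.reindex ((Equiv.refl G).prodCongr e.symm)) fun x => by
    rw [Basis.reindex_apply, h.basis_apply]
    rfl

lemma IsGroupRingBasis.exists_comb {k : Type*} [CommRing k] {q q' : ℕ}
    {a : Fin q → k ⊗[ℤ] M} (ha : IsGroupRingBasis k M a) (b : Fin q' → k ⊗[ℤ] M) :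
    ∃ μ : Matrix (Fin q') (Fin q) (MonoidAlgebra k G), comb (termRep k M) μ a = b :=
  exists_group_comb _ ha.2 b

lemma IsGroupRingBasis.comb_injective {k : Type*} [CommRing k] {q q' : ℕ}
    {a : Fin q → k ⊗[ℤ] M} (ha : IsGroupRingBasis k M a)
    {μ η : Matrix (Fin q') (Fin q) (MonoidAlgebra k G)}
    (h : comb (termRep k M) μ a = comb (termRep k M) η a) : μ = η :=
  group_comb_injective _ ha.1 h

lemma IsGroupRingBasis.isUnit_of_comb {k : Type*} [CommRing k] {q : ℕ}
    {a b : Fin q → k ⊗[ℤ] M} (ha : IsGroupRingBasis k M a) (hb : IsGroupRingBasis k M b)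
    {μ : Matrix (Fin q) (Fin q) (MonoidAlgebra k G)} (h : comb (termRep k M) μ a = b) :
    IsUnit μ :=
  isUnit_of_group_comb _ ha.1 hb.2 hb.1 h

lemma IsGroupRingBasis.exists_isUnit {k : Type*} [CommRing k] {q : ℕ}
    {a b : Fin q → k ⊗[ℤ] M} (ha : IsGroupRingBasis k M a) (hb : IsGroupRingBasis k M b) :
    ∃ μ : Matrix (Fin q) (Fin q) (MonoidAlgebra k G), IsUnit μ ∧ comb (termRep k M) μ a = b := by
  obtain ⟨μ, hμ⟩ := ha.exists_comb b
  exact ⟨μ, ha.isUnit_of_comb hb hμ, hμ⟩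

lemma changeCoeff_comb {k l : Type*} [CommRing k] [CommRing l] (f : k →+* l) {q q' : ℕ}
    (μ : Matrix (Fin q') (Fin q) (MonoidAlgebra k G)) (a : Fin q → k ⊗[ℤ] M) (j : Fin q') :
    changeCoeff f M (comb (termRep k M) μ a j) =
      comb (termRep l M) (μ.map (MonoidAlgebra.mapRingHom G f)) (fun i => changeCoeff f M (a i)) j := by
  rw [comb_eq, comb_eq, map_sum]
  refine Finset.sum_congr rfl fun i _ => ?_
  rw [map_sum]
  refine Finset.sum_congr rfl fun g _ => ?_
  rw [changeCoeff_smul, changeCoeff_termRep]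
  simp

variable {P : CochainComplex (ModuleCat.{u} (MonoidAlgebra ℤ G)) ℤ}

lemma LocalBases.comb_lam (L : LocalBases P) (i : ℤ) :
    comb (termRep AQ (P.X i)) (L.lam i) (fun j => changeCoeff zhatToAQ (P.X i) (L.a i j)) =
      fun j => changeCoeff ratToAQ (P.X i) (L.a₀ i j) := by
  ext j
  rw [comb_eq, L.lam_spec]

lemma LocalBases.isUnit_lam (L : LocalBases P) (i : ℤ) : IsUnit (L.lam i) :=
  IsGroupRingBasis.isUnit_of_comb ((L.a_basis i).changeCoeff zhatToAQ)
    ((L.a₀_basis i).changeCoeff ratToAQ) (L.comb_lam i)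

lemma exists_localBases (hP : IsPerfect P) : Nonempty (LocalBases P) := by
  have h : ∀ i, ∃ q : ℕ, (∃ a : Fin q → Zhat ⊗[ℤ] P.X i, IsGroupRingBasis Zhat (P.X i) a) ∧
      ∃ a : Fin q → ℚ ⊗[ℤ] P.X i, IsGroupRingBasis ℚ (P.X i) a := fun i => (hP.2 i).2
  choose q a' a₀' using h
  choose a ha using a'
  choose a₀ ha₀ using a₀'
  have hμ : ∀ i, ∃ μ : Matrix (Fin (q i)) (Fin (q i)) (MonoidAlgebra AQ G),
      comb (termRep AQ (P.X i)) μ (fun j => changeCoeff zhatToAQ (P.X i) (a i j)) =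
        fun j => changeCoeff ratToAQ (P.X i) (a₀ i j) := fun i =>
    IsGroupRingBasis.exists_comb ((ha i).changeCoeff zhatToAQ) _
  choose μ hμ using hμ
  refine ⟨⟨q, a, a₀, ha, ha₀, μ, fun i j => ?_⟩⟩
  have h := congrFun (hμ i) j
  rw [comb_eq] at h
  exact h.symm

/-- Two choices of local bases are related by invertible matrices over `ℚ[G]` and `Ẑ[G]`. -/
lemma LocalBases.exists_comparison (L L' : LocalBases P) (i : ℤ) :
    ∃ (e : Fin (L.q i) ≃ Fin (L'.q i))
      (μ : Matrix (Fin (L.q i)) (Fin (L.q i)) (MonoidAlgebra ℚ G))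
      (η : Matrix (Fin (L.q i)) (Fin (L.q i)) (MonoidAlgebra Zhat G)),
      IsUnit μ ∧ IsUnit η ∧ comb (termRep ℚ (P.X i)) μ (L.a₀ i) = L'.a₀ i ∘ e ∧
      (L'.lam i).submatrix e e * (MonoidAlgebra.mapRingHom G zhatToAQ).mapMatrix η =
        (MonoidAlgebra.mapRingHom G ratToAQ).mapMatrix μ * L.lam i := by
  have e : Fin (L.q i) ≃ Fin (L'.q i) := finCongr ((L.a₀_basis i).card_eq (L'.a₀_basis i))
  obtain ⟨μ, hμ, hμ'⟩ := (L.a₀_basis i).exists_isUnit ((L'.a₀_basis i).comp_equiv e)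
  obtain ⟨η, hη, hη'⟩ := (L.a_basis i).exists_isUnit ((L'.a_basis i).comp_equiv e)
  refine ⟨e, μ, η, hμ, hη, hμ', ?_⟩
  refine IsGroupRingBasis.comb_injective ((L.a_basis i).changeCoeff zhatToAQ) ?_
  rw [comb_mul, comb_mul, L.comb_lam]
  have h1 : comb (termRep AQ (P.X i)) ((MonoidAlgebra.mapRingHom G zhatToAQ).mapMatrix η)
      (fun j => changeCoeff zhatToAQ (P.X i) (L.a i j)) =
      fun j => changeCoeff zhatToAQ (P.X i) (L'.a i (e j)) := by
    ext j
    rw [RingHom.mapMatrix_apply, ← changeCoeff_comb, hη']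
    rfl
  have h2 : comb (termRep AQ (P.X i)) ((MonoidAlgebra.mapRingHom G ratToAQ).mapMatrix μ)
      (fun j => changeCoeff ratToAQ (P.X i) (L.a₀ i j)) =
      fun j => changeCoeff ratToAQ (P.X i) (L'.a₀ i (e j)) := by
    ext j
    rw [RingHom.mapMatrix_apply, ← changeCoeff_comb, hμ']
    rfl
  rw [h1, h2]
  have h3 := L'.comb_lam i
  ext j
  have h4 := congrFun h3 (e j)
  rw [← h4, comb, comb]
  exact e.sum_comp fun k => (termRep AQ (P.X i)).asAlgebraHom (L'.lam i (e j) k)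
    (changeCoeff zhatToAQ (P.X i) (L'.a i k))

lemma LocalBases.q_eq_zero (L : LocalBases P) (i : ℤ) [Subsingleton (P.X i)] : L.q i = 0 := by
  by_contra h
  have : Subsingleton (ℚ ⊗[ℤ] P.X i) := by
    refine ⟨fun x y => ?_⟩
    have h0 : ∀ z : ℚ ⊗[ℤ] P.X i, z = 0 := fun z => by
      induction z with
      | zero => rfl
      | add x y hx hy => rw [hx, hy, add_zero]
      | tmul a m => rw [Subsingleton.elim m 0, TensorProduct.tmul_zero]
    rw [h0 x, h0 y]
  exact (L.a₀_basis i).1.ne_zero (1, ⟨0, Nat.pos_of_ne_zero h⟩) (Subsingleton.elim _ _)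

end LocalBases

end

end HermClass

namespace HermClass

noncomputable section

/-! ### Rings of stable range one -/

section StableRange

/-- A ring has stable range one if `a u + b = 1` implies that some `a + b t` is a unit. -/
def StableRangeOne (R : Type*) [Ring R] : Prop :=
  ∀ a u b : R, a * u + b = 1 → ∃ t, IsUnit (a + b * t)

lemma isUnit_of_inverses {R : Type*} [Monoid R] {a b c : R} (h : a * b = 1) (h' : c * a = 1) :
    IsUnit a :=
  ⟨⟨a, b, h, by rw [← left_inv_eq_right_inv h' h]; exact h'⟩, rfl⟩

lemma StableRangeOne.of_ringEquiv {R S : Type*} [Ring R] [Ring S] (e : R ≃+* S)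
    (h : StableRangeOne S) : StableRangeOne R := by
  intro a u b hab
  obtain ⟨t, ht⟩ := h (e a) (e u) (e b) (by rw [← map_mul, ← map_add, hab, map_one])
  refine ⟨e.symm t, ?_⟩
  have h2 := ht.map e.symm
  simpa using h2

lemma StableRangeOne.pi {ι : Type*} {R : ι → Type*} [∀ i, Ring (R i)]
    (h : ∀ i, StableRangeOne (R i)) : StableRangeOne (∀ i, R i) := by
  intro a u b hab
  choose t ht using fun i => h i (a i) (u i) (b i) (congrFun hab i)
  exact ⟨t, Pi.isUnit_iff.mpr ht⟩

lemma stableRangeOne_matrix (D : Type*) [DivisionRing D] (n : ℕ) :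
    StableRangeOne (Matrix (Fin n) (Fin n) D) := by
  intro a u b hab
  let A := Matrix.toLinearMapRight' (R := D) a
  let U := Matrix.toLinearMapRight' (R := D) u
  let B := Matrix.toLinearMapRight' (R := D) b
  have h1 : ∀ x, U (A x) + B x = x := fun x => by
    have h2 := congrArg (fun c => Matrix.toLinearMapRight' (R := D) c x) hab
    simp only [map_add, Matrix.toLinearMapRight'_mul, Matrix.toLinearMapRight'_one] at h2
    exact h2
  obtain ⟨C, hC⟩ := (LinearMap.range A).exists_isCompl
  have h3 : Module.finrank D (LinearMap.ker A) = Module.finrank D C := by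
    have e1 := LinearMap.finrank_range_add_finrank_ker A
    have e2 := Submodule.finrank_add_eq_of_isCompl hC
    omega
  obtain ⟨g, hg⟩ := (LinearMap.ker A).subtype.exists_leftInverse_of_injective
    (Submodule.ker_subtype _)
  let T := C.subtype ∘ₗ (LinearEquiv.ofFinrankEq _ _ h3).toLinearMap ∘ₗ g
  have hT : ∀ x (hx : x ∈ LinearMap.ker A), T x = (LinearEquiv.ofFinrankEq _ _ h3 ⟨x, hx⟩ : C) :=
    fun x hx => by
      have := LinearMap.congr_fun hg ⟨x, hx⟩
      change ((LinearEquiv.ofFinrankEq _ _ h3 (g x) : C) : Fin n → D) = _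
      rw [show g x = ⟨x, hx⟩ from this]
  have hinj : Function.Injective (A + T ∘ₗ B) := by
    refine (injective_iff_map_eq_zero _).mpr fun x hx => ?_
    have hTC : T (B x) ∈ C := (LinearEquiv.ofFinrankEq _ _ h3 (g (B x))).2
    have hx' : A x + T (B x) = 0 := hx
    have h5 : A x = 0 := by
      refine Submodule.disjoint_def.mp hC.disjoint _ ⟨x, rfl⟩ ?_
      rw [eq_neg_of_add_eq_zero_left hx']
      exact C.neg_mem hTC
    have h6 : B x = x := by simpa [h5] using h1 x
    rw [h5, zero_add, h6, hT x h5] at hx'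
    have h7 := (LinearEquiv.ofFinrankEq _ _ h3).map_eq_zero_iff.mp (Subtype.ext hx')
    exact congrArg Subtype.val h7
  let e := LinearEquiv.ofInjectiveEndo _ hinj
  obtain ⟨t, ht⟩ := (Matrix.toLinearMapRight' (R := D) (m := Fin n) (n := Fin n)).surjective T
  obtain ⟨y, hy⟩ := (Matrix.toLinearMapRight' (R := D) (m := Fin n) (n := Fin n)).surjective
    e.symm.toLinearMap
  have h8 : Matrix.toLinearMapRight' (R := D) (a + b * t) = e.toLinearMap := by
    rw [map_add, Matrix.toLinearMapRight'_mul, ht]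
    rfl
  refine ⟨t, isUnit_of_inverses (b := y) (c := y) ?_ ?_⟩ <;>
    refine (Matrix.toLinearMapRight' (R := D) (m := Fin n) (n := Fin n)).injective ?_
  · rw [Matrix.toLinearMapRight'_mul, h8, hy, Matrix.toLinearMapRight'_one]
    ext1
    simp
  · rw [Matrix.toLinearMapRight'_mul, h8, hy, Matrix.toLinearMapRight'_one]
    ext1
    simp

lemma stableRangeOne_of_isSemisimpleRing (R : Type*) [Ring R] [IsSemisimpleRing R] :
    StableRangeOne R := by
  obtain ⟨n, D, d, _, _, ⟨e⟩⟩ := IsSemisimpleRing.exists_ringEquiv_pi_matrix_divisionRing R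
  exact .of_ringEquiv e (.pi fun i => stableRangeOne_matrix _ _)

lemma stableRangeOne_of_isArtinianRing (R : Type*) [Ring R] [IsArtinianRing R] :
    StableRangeOne R := by
  intro a u b hab
  let π := Ideal.Quotient.mk (Ring.jacobson R)
  have hπ : ∀ x, π x = 0 → IsNilpotent x := fun x hx => by
    obtain ⟨n, hn⟩ := IsSemiprimaryRing.isNilpotent (R := R)
    refine ⟨n, ?_⟩
    have : x ^ n ∈ Ring.jacobson R ^ n := Ideal.pow_mem_pow (Ideal.Quotient.eq_zero_iff_mem.mp hx) n
    rw [hn] at this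
    exact this
  have hone : ∀ x, π x = 1 → IsUnit x := fun x hx => by
    have := (hπ (x - 1) (by rw [map_sub, hx, map_one, sub_self])).isUnit_one_add
    simpa using this
  have : IsSemisimpleRing (R ⧸ Ring.jacobson R) := IsSemiprimaryRing.isSemisimpleRing
  obtain ⟨t, ht⟩ := stableRangeOne_of_isSemisimpleRing (R ⧸ Ring.jacobson R) (π a) (π u) (π b)
    (by rw [← map_mul, ← map_add, hab, map_one])
  obtain ⟨t, rfl⟩ := Ideal.Quotient.mk_surjective t
  refine ⟨t, ?_⟩
  obtain ⟨v, hv⟩ := ht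
  obtain ⟨z, hz⟩ := Ideal.Quotient.mk_surjective (v⁻¹).val
  have h1 : π (a + b * t) = v := by rw [hv, map_add, map_mul]
  obtain ⟨x, hx⟩ := hone ((a + b * t) * z) (by
    rw [map_mul, h1]; exact (congrArg (v.val * ·) hz).trans v.mul_inv)
  obtain ⟨y, hy⟩ := hone (z * (a + b * t)) (by
    rw [map_mul, h1]; exact (congrArg (· * v.val) hz).trans v.inv_mul)
  refine isUnit_of_inverses (b := z * x⁻¹.val) (c := y⁻¹.val * z) ?_ ?_
  · rw [← mul_assoc, ← hx, Units.mul_inv]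
  · rw [mul_assoc, ← hy, Units.inv_mul]

end StableRange

/-! ### Reduction of invertible matrices to units -/

section Reduction

variable {R S : Type*} [Ring R] [CommRing S] {n : Type*} [Fintype n] [DecidableEq n]
  {ι κ : Type*} [Fintype ι] [DecidableEq ι] [Fintype κ] [DecidableEq κ]

/-- The determinant of the block matrix `(ε(M_{ij}))`. -/
def blockDet (ε : R →+* Matrix n n S) : Matrix ι ι R →* S :=
  Matrix.detMonoidHom.comp ((Matrix.compRingEquiv ι n S).toRingHom.comp ε.mapMatrix).toMonoidHom

lemma blockDet_apply (ε : R →+* Matrix n n S) (M : Matrix ι ι R) : blockDet ε M =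
    (Matrix.of fun x y : ι × n => ε (M x.1 y.1) x.2 y.2).det := rfl

lemma blockDet_submatrix (ε : R →+* Matrix n n S) (e : ι ≃ κ) (M : Matrix κ κ R) :
    blockDet ε (M.submatrix e e) = blockDet ε M := by
  rw [blockDet_apply, blockDet_apply,
    ← Matrix.det_submatrix_equiv_self (e.prodCongr (Equiv.refl n))]
  rfl

lemma blockDet_upper (ε : R →+* Matrix n n S) (A : Matrix ι ι R) (B : Matrix ι κ R)
    (D : Matrix κ κ R) :
    blockDet ε (Matrix.fromBlocks A B 0 D) = blockDet ε A * blockDet ε D := by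
  rw [blockDet_apply, blockDet_apply, blockDet_apply, ← Matrix.det_fromBlocks_zero₂₁ _
    (Matrix.of fun (x : ι × n) (y : κ × n) => ε (B x.1 y.1) x.2 y.2),
    ← Matrix.det_submatrix_equiv_self (Equiv.sumProdDistrib ι κ n)]
  congr 1
  ext ⟨x | x, a⟩ ⟨y | y, b⟩ <;> simp

lemma blockDet_lower (ε : R →+* Matrix n n S) (A : Matrix ι ι R) (C : Matrix κ ι R)
    (D : Matrix κ κ R) :
    blockDet ε (Matrix.fromBlocks A 0 C D) = blockDet ε A * blockDet ε D := by
  rw [blockDet_apply, blockDet_apply, blockDet_apply, ← Matrix.det_fromBlocks_zero₁₂ _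
    (Matrix.of fun (x : κ × n) (y : ι × n) => ε (C x.1 y.1) x.2 y.2),
    ← Matrix.det_submatrix_equiv_self (Equiv.sumProdDistrib ι κ n)]
  congr 1
  ext ⟨x | x, a⟩ ⟨y | y, b⟩ <;> simp

lemma blockDet_unit (ε : R →+* Matrix n n S) (M : Matrix Unit Unit R) :
    blockDet ε M = (ε (M () ())).det := by
  rw [blockDet_apply, ← Matrix.det_submatrix_equiv_self (Equiv.punitProd n).symm]
  rfl

/-- Over a ring of stable range one, an invertible matrix has the same determinants as a unit. -/
lemma StableRangeOne.exists_unit (hR : StableRangeOne R) (q : ℕ) (M : Matrix (Fin q) (Fin q) R)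
    (hM : IsUnit M) : ∃ x : Rˣ, ∀ (n : ℕ) (ε : R →+* Matrix (Fin n) (Fin n) S),
      blockDet ε M = (ε x).det := by
  induction q with
  | zero => exact ⟨1, fun n ε => by
      rw [Subsingleton.elim M 1, map_one, Units.val_one, map_one, Matrix.det_one]⟩
  | succ q ih =>
    let f : Unit ⊕ Fin q ≃ Fin (q + 1) :=
      (Equiv.sumComm _ _).trans ((Equiv.optionEquivSumPUnit (Fin q)).symm.trans
        (finSuccEquiv q).symm)
    let M₁ : Matrix (Unit ⊕ Fin q) (Unit ⊕ Fin q) R := M.submatrix f f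
    have hM₁ : IsUnit M₁ := by
      obtain ⟨N, hN⟩ := hM.exists_right_inv
      obtain ⟨N', hN'⟩ := hM.exists_left_inv
      refine isUnit_of_inverses (b := N.submatrix f f) (c := N'.submatrix f f) ?_ ?_
      · rw [Matrix.submatrix_mul_equiv, hN, Matrix.submatrix_one_equiv]
      · rw [Matrix.submatrix_mul_equiv, hN', Matrix.submatrix_one_equiv]
    have hblock : ∀ (n : ℕ) (ε : R →+* Matrix (Fin n) (Fin n) S), blockDet ε M = blockDet ε M₁ :=
      fun n ε => (blockDet_submatrix ε f M).symm
    obtain ⟨N, hN⟩ := hM₁.exists_right_inv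
    have h00 := congrFun (congrFun hN (.inl ())) (.inl ())
    rw [Matrix.mul_apply, Fintype.sum_sum_type, Matrix.one_apply_eq, Fintype.sum_unique] at h00
    obtain ⟨t, y, hy⟩ := hR _ _ _ h00
    let c : Matrix (Fin q) Unit R := Matrix.of fun j _ => N (.inr j) (.inl ()) * t
    let E : Matrix (Unit ⊕ Fin q) (Unit ⊕ Fin q) R := Matrix.fromBlocks 1 0 c 1
    have hE : IsUnit E := by
      refine isUnit_of_inverses (b := Matrix.fromBlocks 1 0 (-c) 1)
        (c := Matrix.fromBlocks 1 0 (-c) 1) ?_ ?_ <;>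
      simp [E, Matrix.fromBlocks_multiply, Matrix.fromBlocks_one]
    let M₂ := M₁ * E
    have hM₂ : IsUnit M₂ := hM₁.mul hE
    have h2 : ∀ (n : ℕ) (ε : R →+* Matrix (Fin n) (Fin n) S), blockDet ε M₂ = blockDet ε M₁ :=
      fun n ε => by
        rw [map_mul, blockDet_lower, map_one, map_one, mul_one, mul_one]
    have hy' : M₂ (.inl ()) (.inl ()) = y := by
      rw [hy]
      change (M₁ * E) _ _ = _
      rw [Matrix.mul_apply, Fintype.sum_sum_type]
      simp [E, c, Finset.sum_mul, mul_assoc]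
    let B := M₂.toBlocks₁₂
    let C := M₂.toBlocks₂₁
    let D := M₂.toBlocks₂₂
    let Y : Matrix Unit Unit R := Matrix.of fun _ _ => y.val
    let Y' : Matrix Unit Unit R := Matrix.of fun _ _ => (y⁻¹).val
    have hYY : Y' * Y = 1 := by
      ext
      simp [Y, Y', Matrix.mul_apply]
    let F : Matrix (Unit ⊕ Fin q) (Unit ⊕ Fin q) R := Matrix.fromBlocks 1 0 (-(C * Y')) 1
    have hF : IsUnit F := by
      refine isUnit_of_inverses (b := Matrix.fromBlocks 1 0 (C * Y') 1)
        (c := Matrix.fromBlocks 1 0 (C * Y') 1) ?_ ?_ <;>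
      simp [F, Matrix.fromBlocks_multiply, Matrix.fromBlocks_one]
    have hM₂' : M₂ = Matrix.fromBlocks Y B C D := by
      rw [← Matrix.fromBlocks_toBlocks M₂]
      congr 1
      ext
      exact hy'
    have h3 : F * M₂ = Matrix.fromBlocks Y B 0 (D - C * Y' * B) := by
      rw [hM₂', Matrix.fromBlocks_multiply]
      congr 1
      · simp
      · simp
      · rw [Matrix.neg_mul, Matrix.mul_assoc, hYY]
        simp
      · simp [sub_eq_add_neg, add_comm]
    have hD : IsUnit (D - C * Y' * B) := by
      have h4 : IsUnit (F * M₂) := hF.mul hM₂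
      rw [h3] at h4
      obtain ⟨N₁, hN₁⟩ := h4.exists_right_inv
      have hN₂ : N₁ * Matrix.fromBlocks Y B 0 (D - C * Y' * B) = 1 := by
        obtain ⟨N₂, hN₂⟩ := h4.exists_left_inv
        rw [← left_inv_eq_right_inv hN₂ hN₁]
        exact hN₂
      rw [← Matrix.fromBlocks_toBlocks N₁, Matrix.fromBlocks_multiply, ← Matrix.fromBlocks_one]
        at hN₁ hN₂
      obtain ⟨-, -, -, e1⟩ := Matrix.fromBlocks_inj.mp hN₁
      obtain ⟨-, -, e2, e3⟩ := Matrix.fromBlocks_inj.mp hN₂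
      have hYY' : Y * Y' = 1 := by
        ext
        simp [Y, Y', Matrix.mul_apply]
      have e4 : N₁.toBlocks₂₁ = 0 := by
        rw [Matrix.mul_zero, add_zero] at e2
        have := congrArg (· * Y') e2
        simpa [Matrix.mul_assoc, hYY'] using this
      rw [e4, Matrix.zero_mul, zero_add] at e3
      rw [Matrix.zero_mul, zero_add] at e1
      exact isUnit_of_inverses e1 e3
    obtain ⟨x, hx⟩ := ih _ hD
    refine ⟨y * x, fun n ε => ?_⟩
    have h5 : blockDet ε (F * M₂) = blockDet ε M₂ := by
      rw [map_mul, blockDet_lower, map_one, map_one, one_mul, one_mul]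
    rw [hblock, ← h2, ← h5, h3, blockDet_upper, hx, blockDet_unit, Units.val_mul, map_mul,
      Matrix.det_mul]
    rfl

end Reduction

/-! ### The group ring of `G` over `Ẑ` -/

section Zhat

variable {G : Type*} [Group G]

/-- The regular representation, by permutation matrices. -/
def regMat (G : Type*) [Group G] [Fintype G] [DecidableEq G] (R : Type*) [CommRing R] :
    G →* Matrix G G R where
  toFun g := Matrix.of fun x y => if x = g * y then 1 else 0
  map_one' := by ext x y; simp [Matrix.one_apply]
  map_mul' g h := by
    ext x y
    simp [Matrix.mul_apply, mul_assoc]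

variable [Fintype G] [DecidableEq G]

lemma gEval_regMat {k R : Type*} [CommRing k] [CommRing R] (φ : k →+* R) (x : MonoidAlgebra k G)
    (g h : G) : gEval φ (regMat G R) x g h = φ (x.coeff (g * h⁻¹)) := by
  rw [gEval_eq, Matrix.sum_apply, Finset.sum_eq_single (g * h⁻¹)]
  · simp [regMat]
  · intro b _ hb
    have : g ≠ b * h := fun e => hb (by rw [e]; group)
    simp [regMat, this]
  · simp

lemma gEval_regMat_injective {k : Type*} [CommRing k] {x y : MonoidAlgebra k G}
    (h : ∀ g, gEval (RingHom.id k) (regMat G k) x g 1 = gEval (RingHom.id k) (regMat G k) y g 1) :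
    x = y := by
  ext g
  simpa [gEval_regMat] using h g

lemma isUnit_of_isUnit_det_regMat {k : Type*} [CommRing k] (y : MonoidAlgebra k G)
    (h : IsUnit (gEval (RingHom.id k) (regMat G k) y).det) : IsUnit y := by
  set N := gEval (RingHom.id k) (regMat G k) y with hN
  let z : MonoidAlgebra k G :=
    MonoidAlgebra.ofCoeff (Finsupp.equivFunOnFinite.symm fun g => N⁻¹ g 1)
  have hz : ∀ g, gEval (RingHom.id k) (regMat G k) z g 1 = N⁻¹ g 1 := fun g => by
    rw [gEval_regMat]
    simp [z]
  have h1 : y * z = 1 := gEval_regMat_injective fun g => by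
    rw [map_mul, map_one, ← hN, Matrix.mul_apply]
    simp_rw [hz]
    rw [← Matrix.mul_apply, Matrix.mul_nonsing_inv _ h]
  refine isUnit_of_inverses h1 (gEval_regMat_injective (x := z * y) fun g => ?_)
  have h2 := congrArg (gEval (RingHom.id k) (regMat G k)) h1
  rw [map_mul, map_one] at h2
  rw [map_mul, map_one, mul_eq_one_comm.mp h2]

/-- The reduction `Ẑ → 𝔽_p`. -/
def redZ (p : Nat.Primes) : Zhat →+* ZMod p :=
  have : Fact (p : ℕ).Prime := ⟨p.2⟩
  (PadicInt.toZMod (p := p)).comp (Pi.evalRingHom _ p)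

lemma isUnit_zhat {z : Zhat} (h : ∀ p, redZ p z ≠ 0) : IsUnit z := by
  refine Pi.isUnit_iff.mpr fun p => ?_
  have : Fact (p : ℕ).Prime := ⟨p.2⟩
  have h1 := h p
  by_contra hc
  have h2 : z p ∈ IsLocalRing.maximalIdeal (PadicInt p) := hc
  rw [← PadicInt.ker_toZMod] at h2
  exact h1 h2

lemma exists_redZ (c : ∀ p : Nat.Primes, ZMod p) : ∃ z : Zhat, ∀ p, redZ p z = c p := by
  have : ∀ p : Nat.Primes, ∃ x : @PadicInt p ⟨p.2⟩,
      haveI : Fact (p : ℕ).Prime := ⟨p.2⟩; PadicInt.toZMod x = c p := fun p => by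
    have : Fact (p : ℕ).Prime := ⟨p.2⟩
    exact ZMod.ringHom_surjective _ (c p)
  choose x hx using this
  exact ⟨x, hx⟩

lemma isUnit_groupRing_zhat (y : MonoidAlgebra Zhat G)
    (h : ∀ p, IsUnit (MonoidAlgebra.mapRingHom G (redZ p) y)) : IsUnit y := by
  refine isUnit_of_isUnit_det_regMat y (isUnit_zhat fun p => ?_)
  have : Fact (p : ℕ).Prime := ⟨p.2⟩
  have h1 : redZ p (gEval (RingHom.id Zhat) (regMat G Zhat) y).det =
      (gEval (RingHom.id (ZMod p)) (regMat G (ZMod p))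
        (MonoidAlgebra.mapRingHom G (redZ p) y)).det := by
    rw [RingHom.map_det]
    congr 1
    ext g h
    rw [gEval_regMat]
    simp [gEval_regMat]
  rw [h1]
  exact (Matrix.isUnit_iff_isUnit_det _ |>.mp ((h p).map _)).ne_zero

lemma stableRangeOne_zhat : StableRangeOne (MonoidAlgebra Zhat G) := by
  intro a u b hab
  have h : ∀ p : Nat.Primes, ∃ t : MonoidAlgebra (ZMod p) G,
      IsUnit (MonoidAlgebra.mapRingHom G (redZ p) a + MonoidAlgebra.mapRingHom G (redZ p) b * t) := by
    intro p
    have : Fact (p : ℕ).Prime := ⟨p.2⟩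
    have : Finite (MonoidAlgebra (ZMod p) G) :=
      Finite.of_injective (fun x : MonoidAlgebra (ZMod p) G => fun g => x.coeff g)
        fun x y h => by ext g; exact congrFun h g
    exact stableRangeOne_of_isArtinianRing _ _ (MonoidAlgebra.mapRingHom G (redZ p) u) _
      (by rw [← map_mul, ← map_add, hab, map_one])
  choose t ht using h
  choose c hc using fun g => exists_redZ fun p => (t p).coeff g
  refine ⟨MonoidAlgebra.ofCoeff (Finsupp.equivFunOnFinite.symm c), isUnit_groupRing_zhat _
    fun p => ?_⟩
  rw [map_add, map_mul]
  convert! ht p using 3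
  ext g
  simp [hc]

end Zhat

end

end HermClass

namespace HermClass

noncomputable section

/-! ### Representations with the same character -/

section SameCharacter

open Module

variable {G : Type*} [Group G]

/-- The representation on `ℂⁿ` given by a matrix representation. -/
def matRep {n : Type*} [Fintype n] [DecidableEq n] (T : G →* Matrix n n ℂ) :
    Representation ℂ G (n → ℂ) :=
  (Matrix.toLinAlgEquiv' : Matrix n n ℂ ≃ₐ[ℂ] _).toRingEquiv.toRingHom.toMonoidHom.comp T

lemma matRep_apply {n : Type*} [Fintype n] [DecidableEq n] (T : G →* Matrix n n ℂ) (g : G) :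
    matRep T g = Matrix.toLin' (T g) := rfl

lemma trace_matRep {n : Type*} [Fintype n] [DecidableEq n] (T : G →* Matrix n n ℂ) (g : G) :
    LinearMap.trace ℂ _ (matRep T g) = (T g).trace := by
  rw [matRep_apply, Matrix.trace_toLin'_eq]

/-- The matrices of a representation with respect to a basis. -/
def repMat {W : Type*} [AddCommGroup W] [Module ℂ W] (ρ : Representation ℂ G W) {n : Type*}
    [Fintype n] [DecidableEq n] (b : Basis n ℂ W) : G →* Matrix n n ℂ :=
  (LinearMap.toMatrixAlgEquiv b).toRingEquiv.toRingHom.toMonoidHom.comp ρ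

lemma repMat_apply {W : Type*} [AddCommGroup W] [Module ℂ W] (ρ : Representation ℂ G W) {n : Type*}
    [Fintype n] [DecidableEq n] (b : Basis n ℂ W) (g : G) :
    repMat ρ b g = LinearMap.toMatrix b b (ρ g) := rfl

lemma trace_repMat {W : Type*} [AddCommGroup W] [Module ℂ W] (ρ : Representation ℂ G W) {n : Type*}
    [Fintype n] [DecidableEq n] (b : Basis n ℂ W) (g : G) :
    (repMat ρ b g).trace = LinearMap.trace ℂ W (ρ g) := by
  rw [repMat_apply, ← LinearMap.trace_eq_matrix_trace]

variable [Fintype G]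

lemma exists_invariant_isCompl {W : Type*} [AddCommGroup W] [Module ℂ W] (ρ : Representation ℂ G W)
    (N : Submodule ℂ W) (hN : ∀ g, N ≤ N.comap (ρ g)) :
    ∃ N' : Submodule ℂ W, (∀ g, N' ≤ N'.comap (ρ g)) ∧ IsCompl N N' := by
  have : NeZero (Nat.card G : ℂ) := ⟨by simp⟩
  have : ComplementedLattice (Subrepresentation ρ) :=
    ρ.isSemisimpleRepresentation_iff_isSemisimpleModule_asModule.mpr inferInstance
  obtain ⟨N', h⟩ := exists_isCompl (⟨N, fun g _ hx => hN g hx⟩ : Subrepresentation ρ)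
  refine ⟨N'.toSubmodule, fun g x hx => N'.apply_mem_toSubmodule g hx, ?_, ?_⟩
  · rw [disjoint_iff]
    exact congrArg Subrepresentation.toSubmodule h.inf_eq_bot
  · rw [codisjoint_iff]
    exact congrArg Subrepresentation.toSubmodule h.sup_eq_top

omit [Fintype G] in
lemma trace_subrep_add {W : Type*} [AddCommGroup W] [Module ℂ W] [FiniteDimensional ℂ W]
    (ρ : Representation ℂ G W) {N N' : Submodule ℂ W} (hN : ∀ g, N ≤ N.comap (ρ g))
    (hN' : ∀ g, N' ≤ N'.comap (ρ g)) (h : IsCompl N N') (g : G) :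
    LinearMap.trace ℂ W (ρ g) = LinearMap.trace ℂ N (ρ.subrepresentation N hN g) +
      LinearMap.trace ℂ N' (ρ.subrepresentation N' hN' g) := by
  rw [← LinearMap.trace_prodMap', ← LinearMap.trace_conj' _ (Submodule.prodEquivOfIsCompl N N' h)]
  congr 1
  ext x
  obtain ⟨⟨y, z⟩, rfl⟩ := (Submodule.prodEquivOfIsCompl N N' h).surjective x
  rw [LinearEquiv.conj_apply_apply, LinearEquiv.symm_apply_apply]
  simp only [Submodule.coe_prodEquivOfIsCompl', LinearMap.prodMap_apply, map_add]
  rfl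

universe w

lemma exists_equiv_of_trace_eq_aux (n : ℕ) : ∀ {W : Type*} {W' : Type*} [AddCommGroup W]
    [Module ℂ W] [FiniteDimensional ℂ W] [AddCommGroup W'] [Module ℂ W'] [FiniteDimensional ℂ W']
    (ρ : Representation ℂ G W) (ρ' : Representation ℂ G W') (_ : finrank ℂ W = n)
    (_ : ∀ g, LinearMap.trace ℂ W (ρ g) = LinearMap.trace ℂ W' (ρ' g)),
    ∃ Φ : W ≃ₗ[ℂ] W', ∀ g x, Φ (ρ g x) = ρ' g (Φ x) := by
  induction n using Nat.strong_induction_on with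
  | _ n ih =>
  intro W W' _ _ _ _ _ _ ρ ρ' hn htr
  have hdim : finrank ℂ W = finrank ℂ W' := by
    have := htr 1
    rw [show ρ 1 = 1 from map_one ρ, show ρ' 1 = 1 from map_one ρ', LinearMap.trace_one,
      LinearMap.trace_one] at this
    exact_mod_cast this
  rcases Nat.eq_zero_or_pos n with h0 | hpos
  · have h1 := finrank_zero_iff.mp (hn.trans h0)
    have h2 := finrank_zero_iff.mp (hdim.symm.trans (hn.trans h0))
    exact ⟨LinearEquiv.ofFinrankEq _ _ hdim, fun g x => Subsingleton.elim _ _⟩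
  have hnt : Nontrivial W := finrank_pos_iff.mp (hn ▸ hpos)
  have : Invertible (Nat.card G : ℂ) := invertibleOfNonzero (by simp)
  have hff : finrank ℂ (Representation.IntertwiningMap ρ ρ) =
      finrank ℂ (Representation.IntertwiningMap ρ ρ') := by
    have h1 := Representation.card_inv_mul_sum_char_mul_char_eq_finrank ρ ρ
    have h2 := Representation.card_inv_mul_sum_char_mul_char_eq_finrank ρ ρ'
    have h3 : ρ'.character = ρ.character := funext fun g => (htr g).symm
    rw [h3, h1] at h2
    exact_mod_cast h2
  obtain ⟨f, hf⟩ : ∃ f : Representation.IntertwiningMap ρ ρ', f ≠ 0 := by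
    by_contra! hc
    have : Subsingleton (Representation.IntertwiningMap ρ ρ') :=
      ⟨fun a b => (hc a).trans (hc b).symm⟩
    have hfin : FiniteDimensional ℂ (Representation.IntertwiningMap ρ ρ) :=
      FiniteDimensional.of_injective
        ({ toFun := fun f => f.toLinearMap
           map_add' := fun _ _ => rfl
           map_smul' := fun _ _ => rfl } : Representation.IntertwiningMap ρ ρ →ₗ[ℂ] W →ₗ[ℂ] W)
        (fun a b h => Representation.IntertwiningMap.ext h)
    have := finrank_zero_iff.mp (hff.trans finrank_zero_of_subsingleton)
    obtain ⟨x, hx⟩ := exists_ne (0 : W)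
    have h5 : Representation.IntertwiningMap.id ρ = 0 := Subsingleton.elim _ _
    exact hx (by simpa using congrArg (fun f => f x) h5)
  have hfeq : ∀ g x, f (ρ g x) = ρ' g (f x) := fun g x =>
    Representation.IntertwiningMap.isIntertwining _ _ f g x
  have hK : ∀ g, LinearMap.ker f.toLinearMap ≤ (LinearMap.ker f.toLinearMap).comap (ρ g) :=
    fun g x hx => by
      change f (ρ g x) = 0
      rw [hfeq, show f x = 0 from hx, map_zero]
  have hI : ∀ g, LinearMap.range f.toLinearMap ≤ (LinearMap.range f.toLinearMap).comap (ρ' g) := by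
    rintro g _ ⟨x, rfl⟩
    exact ⟨ρ g x, hfeq g x⟩
  obtain ⟨C, hC, hKC⟩ := exists_invariant_isCompl ρ _ hK
  obtain ⟨D, hD, hID⟩ := exists_invariant_isCompl ρ' _ hI
  have hinj : Function.Injective (f.toLinearMap.domRestrict C) := by
    refine (injective_iff_map_eq_zero _).mpr fun x hx => Subtype.ext ?_
    exact Submodule.disjoint_def.mp hKC.disjoint _ hx x.2
  let e : C ≃ₗ[ℂ] LinearMap.range f.toLinearMap := LinearEquiv.ofBijective
    (f.toLinearMap.domRestrict C |>.codRestrict (LinearMap.range f.toLinearMap)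
      fun x => ⟨x, rfl⟩) (by
    refine ⟨fun a b h => hinj (congrArg Subtype.val h), ?_⟩
    rintro ⟨_, x, rfl⟩
    obtain ⟨⟨y, z⟩, rfl⟩ := (Submodule.prodEquivOfIsCompl _ _ hKC).surjective x
    refine ⟨z, Subtype.ext ?_⟩
    change f.toLinearMap z = f.toLinearMap (Submodule.prodEquivOfIsCompl _ _ hKC (y, z))
    rw [Submodule.coe_prodEquivOfIsCompl', map_add, show f.toLinearMap y = 0 from y.2, zero_add])
  have he : ∀ g x, e (ρ.subrepresentation C hC g x) = ρ'.subrepresentation _ hI g (e x) :=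
    fun g x => Subtype.ext (hfeq g x)
  have htr2 : ∀ g, LinearMap.trace ℂ _ (ρ.subrepresentation _ hK g) =
      LinearMap.trace ℂ D (ρ'.subrepresentation D hD g) := fun g => by
    have h1 := htr g
    rw [trace_subrep_add ρ hK hC hKC, trace_subrep_add ρ' hI hD hID] at h1
    have h2 : LinearMap.trace ℂ C (ρ.subrepresentation C hC g) =
        LinearMap.trace ℂ _ (ρ'.subrepresentation _ hI g) := by
      rw [← LinearMap.trace_conj' _ e]
      congr 1
      ext x
      rw [LinearEquiv.conj_apply_apply, he, LinearEquiv.apply_symm_apply]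
    rw [h2] at h1
    linear_combination h1
  have hlt : finrank ℂ (LinearMap.ker f.toLinearMap) < n := by
    rw [← hn]
    refine Submodule.finrank_lt ?_
    intro h
    rw [LinearMap.ker_eq_top] at h
    exact hf (Representation.IntertwiningMap.ext h)
  obtain ⟨Ψ, hΨ⟩ := ih _ hlt (ρ.subrepresentation _ hK) (ρ'.subrepresentation D hD) rfl htr2
  refine ⟨((Submodule.prodEquivOfIsCompl _ _ hKC).symm.trans
    ((Ψ.prodCongr e).trans (LinearEquiv.prodComm ℂ _ _))).trans
      (Submodule.prodEquivOfIsCompl _ _ hID), fun g x => ?_⟩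
  obtain ⟨⟨y, z⟩, rfl⟩ := (Submodule.prodEquivOfIsCompl _ _ hKC).surjective x
  have h1 : ρ g (Submodule.prodEquivOfIsCompl _ _ hKC (y, z)) =
      Submodule.prodEquivOfIsCompl _ _ hKC
        (ρ.subrepresentation _ hK g y, ρ.subrepresentation C hC g z) := by
    simp only [Submodule.coe_prodEquivOfIsCompl', map_add]
    rfl
  rw [h1]
  simp only [LinearEquiv.trans_apply, LinearEquiv.symm_apply_apply, LinearEquiv.prodCongr_apply,
    LinearEquiv.prodComm_apply, Prod.swap_prod_mk]
  rw [hΨ, he]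
  simp only [Submodule.coe_prodEquivOfIsCompl', map_add]
  rfl

/-- Two representations with the same character are isomorphic. -/
lemma exists_equiv_of_trace_eq {W W' : Type*} [AddCommGroup W]
    [Module ℂ W] [FiniteDimensional ℂ W] [AddCommGroup W'] [Module ℂ W'] [FiniteDimensional ℂ W']
    (ρ : Representation ℂ G W) (ρ' : Representation ℂ G W')
    (h : ∀ g, LinearMap.trace ℂ W (ρ g) = LinearMap.trace ℂ W' (ρ' g)) :
    ∃ Φ : W ≃ₗ[ℂ] W', ∀ g x, Φ (ρ g x) = ρ' g (Φ x) :=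
  exists_equiv_of_trace_eq_aux _ ρ ρ' rfl h

/-- The determinant `det T(M)` depends only on the character of `T`. -/
lemma gDet_congr {k R : Type*} [CommRing k] [CommRing R] (f : ℂ →+* R) (φ : k →+* R) {n m : Type*}
    [Fintype n] [DecidableEq n] [Fintype m] [DecidableEq m] (T : G →* Matrix n n ℂ)
    (T' : G →* Matrix m m ℂ) (h : ∀ g, (T g).trace = (T' g).trace) {ι : Type*} [Fintype ι]
    [DecidableEq ι] (M : Matrix ι ι (MonoidAlgebra k G)) :
    gDet φ (f.mapMatrix.toMonoidHom.comp T) M = gDet φ (f.mapMatrix.toMonoidHom.comp T') M := by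
  obtain ⟨Φ, hΦ⟩ := exists_equiv_of_trace_eq (matRep T) (matRep T') fun g => by
    rw [trace_matRep, trace_matRep, h]
  refine gDet_conj φ _ _ ((LinearMap.toMatrix' Φ.toLinearMap).map f)
    ((LinearMap.toMatrix' Φ.symm.toLinearMap).map f) ?_ ?_ (fun g => ?_) M
  · rw [← Matrix.map_mul, ← LinearMap.toMatrix'_comp, LinearEquiv.comp_symm,
      LinearMap.toMatrix'_id, Matrix.map_one _ (map_zero f) (map_one f)]
  · rw [← Matrix.map_mul, ← LinearMap.toMatrix'_comp, LinearEquiv.symm_comp,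
      LinearMap.toMatrix'_id, Matrix.map_one _ (map_zero f) (map_one f)]
  · change _ * (T g).map f = (T' g).map f * _
    rw [← Matrix.map_mul, ← Matrix.map_mul]
    congr 1
    have h1 : Φ.toLinearMap ∘ₗ Matrix.toLin' (T g) = Matrix.toLin' (T' g) ∘ₗ Φ.toLinearMap :=
      LinearMap.ext fun x => hΦ g x
    have h2 := congrArg LinearMap.toMatrix' h1
    rwa [LinearMap.toMatrix'_comp, LinearMap.toMatrix'_comp, LinearMap.toMatrix'_toLin',
      LinearMap.toMatrix'_toLin'] at h2

end SameCharacter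

/-! ### Realizations over the algebraic numbers -/

section Realization

variable {G : Type*} [Group G]

instance : IsAlgClosed Qbar := (@algebraicClosure.isAlgClosure ℚ ℂ _ _ _ _).isAlgClosed

/-- A finitely generated algebra over an algebraically closed field has a rational point. -/
lemma exists_rational_point (k B : Type*) [Field k] [IsAlgClosed k] [CommRing B] [Nontrivial B]
    [Algebra k B] [Algebra.FiniteType k B] : Nonempty (B →ₐ[k] k) := by
  obtain ⟨m, hm⟩ := Ideal.exists_maximal B
  let := Ideal.Quotient.field m
  have hfin : Module.Finite k (B ⧸ m) := finite_of_finite_type_of_isJacobsonRing _ _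
  have hbij : Function.Bijective (algebraMap k (B ⧸ m)) :=
    IsAlgClosed.algebraMap_bijective_of_isIntegral
  exact ⟨((AlgEquiv.ofBijective (Algebra.ofId k (B ⧸ m)) hbij).symm :
    (B ⧸ m) →ₐ[k] k).comp (Ideal.Quotient.mkₐ k m)⟩

lemma exists_qbar_point (s : Set ℂ) (hs : s.Finite) :
    Nonempty (Algebra.adjoin Qbar s →ₐ[Qbar] Qbar) := by
  have hft : Algebra.FiniteType Qbar (Algebra.adjoin Qbar s) :=
    (Subalgebra.fg_iff_finiteType _).mp ⟨hs.toFinset, by simp⟩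
  exact exists_rational_point _ _

lemma isAlgebraic_trace [Finite G] {n : ℕ} (T : G →* Matrix (Fin n) (Fin n) ℂ) (g : G) :
    (T g).trace ∈ algebraicClosure ℚ ℂ := by
  rw [Matrix.trace_eq_sum_roots_charpoly]
  refine multiset_sum_mem _ fun r hr => ?_
  have h1 : r ∈ spectrum ℂ (T g) :=
    Matrix.mem_spectrum_iff_isRoot_charpoly.mpr (Polynomial.isRoot_of_mem_roots hr)
  have hN : 0 < orderOf g := orderOf_pos g
  have h2 : r ^ orderOf g ∈ spectrum ℂ (T g ^ orderOf g) := spectrum.pow_mem_pow _ _ h1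
  rw [← map_pow, pow_orderOf_eq_one, map_one] at h2
  rcases subsingleton_or_nontrivial (Matrix (Fin n) (Fin n) ℂ) with hs | hs
  · rw [spectrum.of_subsingleton] at h2
    exact h2.elim
  rw [spectrum.one_eq, Set.mem_singleton_iff] at h2
  rw [mem_algebraicClosure_iff']
  exact IsIntegral.of_pow hN (h2 ▸ isIntegral_one)

/-- Transport of matrices with entries in a subalgebra of `ℂ` to `Q̄`. -/
lemma exists_qbar_realization_aux [Finite G] {n : ℕ} (T : G →* Matrix (Fin n) (Fin n) ℂ)
    (J J' : Matrix (Fin n) (Fin n) ℂ) :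
    ∃ (A : Subalgebra Qbar ℂ) (_ : A →ₐ[Qbar] Qbar) (T₀ : G →* Matrix (Fin n) (Fin n) A)
      (J₀ J₀' : Matrix (Fin n) (Fin n) A),
      (∀ g, A.val.toRingHom.mapMatrix (T₀ g) = T g) ∧ A.val.toRingHom.mapMatrix J₀ = J ∧
        A.val.toRingHom.mapMatrix J₀' = J' := by
  let s : Set ℂ := (Set.range fun x : G × Fin n × Fin n => T x.1 x.2.1 x.2.2) ∪
    ((Set.range fun x : Fin n × Fin n => J x.1 x.2) ∪ Set.range fun x : Fin n × Fin n => J' x.1 x.2)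
  have hs : s.Finite := (Set.finite_range _).union ((Set.finite_range _).union (Set.finite_range _))
  obtain ⟨φ⟩ := exists_qbar_point s hs
  have hT : ∀ g i j, T g i j ∈ Algebra.adjoin Qbar s := fun g i j =>
    Algebra.subset_adjoin (.inl ⟨(g, i, j), rfl⟩)
  have hJ : ∀ i j, J i j ∈ Algebra.adjoin Qbar s := fun i j =>
    Algebra.subset_adjoin (.inr (.inl ⟨(i, j), rfl⟩))
  have hJ' : ∀ i j, J' i j ∈ Algebra.adjoin Qbar s := fun i j =>
    Algebra.subset_adjoin (.inr (.inr ⟨(i, j), rfl⟩))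
  refine ⟨Algebra.adjoin Qbar s, φ,
    { toFun := fun g => Matrix.of fun i j => ⟨T g i j, hT g i j⟩
      map_one' := ?_, map_mul' := fun g h => ?_ }, Matrix.of fun i j => ⟨J i j, hJ i j⟩,
      Matrix.of fun i j => ⟨J' i j, hJ' i j⟩, fun g => rfl, rfl, rfl⟩
  · ext i j
    simp [Matrix.one_apply, apply_ite]
  · ext i j
    simp [Matrix.mul_apply]

/-- The complex matrices of a representation over `Q̄`. -/
def qbarToC {n : ℕ} (T : G →* Matrix (Fin n) (Fin n) Qbar) : G →* Matrix (Fin n) (Fin n) ℂ :=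
  (algebraMap Qbar ℂ).mapMatrix.toMonoidHom.comp T

lemma trace_qbarToC {n : ℕ} (T : G →* Matrix (Fin n) (Fin n) Qbar) (g : G) :
    (qbarToC T g).trace = ((T g).trace : Qbar) := by
  change ((T g).map (algebraMap Qbar ℂ)).trace = algebraMap Qbar ℂ (T g).trace
  rw [← AddMonoidHom.map_trace]

lemma trace_map_point [Finite G] {n : ℕ} {T : G →* Matrix (Fin n) (Fin n) ℂ}
    {A : Subalgebra Qbar ℂ} (φ : A →ₐ[Qbar] Qbar) (T₀ : G →* Matrix (Fin n) (Fin n) A)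
    (h : ∀ g, A.val.toRingHom.mapMatrix (T₀ g) = T g) (g : G) :
    (((φ.toRingHom.mapMatrix (T₀ g)).trace : Qbar) : ℂ) = (T g).trace := by
  have h1 : A.val (T₀ g).trace = (T g).trace := by
    rw [← h]
    exact AddMonoidHom.map_trace A.val.toRingHom.toAddMonoidHom (T₀ g)
  have h2 : (T₀ g).trace = algebraMap Qbar A ⟨(T g).trace, isAlgebraic_trace T g⟩ :=
    Subtype.ext h1
  have h3 : (φ.toRingHom.mapMatrix (T₀ g)).trace = φ (T₀ g).trace :=
    (AddMonoidHom.map_trace φ.toRingHom.toAddMonoidHom (T₀ g)).symm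
  rw [h3, h2, AlgHom.commutes]
  rfl

lemma exists_qbar_realization [Finite G] {n : ℕ} (T : G →* Matrix (Fin n) (Fin n) ℂ) :
    ∃ T' : G →* Matrix (Fin n) (Fin n) Qbar, ∀ g, (((T' g).trace : Qbar) : ℂ) = (T g).trace := by
  obtain ⟨A, φ, T₀, -, -, h, -, -⟩ := exists_qbar_realization_aux T 0 0
  exact ⟨φ.toRingHom.mapMatrix.toMonoidHom.comp T₀, trace_map_point φ T₀ h⟩

lemma exists_qbar_realization_symplectic [Finite G] {n : ℕ} (T : G →* Matrix (Fin n) (Fin n) ℂ)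
    (J : Matrix (Fin n) (Fin n) ℂ) (hJ : J.transpose = -J) (hJu : IsUnit J.det)
    (hT : ∀ g, (T g).transpose * J * T g = J) :
    ∃ (T' : G →* Matrix (Fin n) (Fin n) Qbar) (J' : Matrix (Fin n) (Fin n) Qbar),
      (∀ g, (((T' g).trace : Qbar) : ℂ) = (T g).trace) ∧ J'.transpose = -J' ∧ IsUnit J'.det ∧
      ∀ g, (T' g).transpose * J' * T' g = J' := by
  obtain ⟨A, φ, T₀, J₀, J₀', h, hJ₀, hJ₀'⟩ := exists_qbar_realization_aux T J J⁻¹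
  have hinj : Function.Injective (A.val.toRingHom.mapMatrix : Matrix (Fin n) (Fin n) A →+* _) :=
    fun X Y h => by
      ext i j
      exact congrFun (congrFun h i) j
  have htr : ∀ X : Matrix (Fin n) (Fin n) A, A.val.toRingHom.mapMatrix X.transpose =
    (A.val.toRingHom.mapMatrix X).transpose := fun X => rfl
  have htr' : ∀ X : Matrix (Fin n) (Fin n) A, φ.toRingHom.mapMatrix X.transpose =
    (φ.toRingHom.mapMatrix X).transpose := fun X => rfl
  refine ⟨φ.toRingHom.mapMatrix.toMonoidHom.comp T₀, φ.toRingHom.mapMatrix J₀,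
    trace_map_point φ T₀ h, ?_, ?_, fun g => ?_⟩
  · rw [← htr', ← map_neg]
    congr 1
    refine hinj ?_
    rw [htr, map_neg, hJ₀, hJ]
  · have h1 : J₀ * J₀' = 1 := hinj (by rw [map_mul, hJ₀, hJ₀', map_one, Matrix.mul_nonsing_inv _ hJu])
    rw [← Matrix.isUnit_iff_isUnit_det]
    refine .of_mul_eq_one (φ.toRingHom.mapMatrix J₀') ?_
    rw [← map_mul, h1, map_one]
  · change (φ.toRingHom.mapMatrix (T₀ g)).transpose * _ * φ.toRingHom.mapMatrix (T₀ g) = _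
    rw [← htr', ← map_mul, ← map_mul]
    congr 1
    refine hinj ?_
    rw [map_mul, map_mul, htr, h, hJ₀, hT]

end Realization

end

end HermClass

namespace HermClass

noncomputable section

/-! ### Homomorphisms on character groups -/

section CharacterGroups

open Module

variable {G : Type*} [Group G]

lemma isChar_of_mat {n : Type*} [Fintype n] [DecidableEq n] (T : G →* Matrix n n ℂ) :
    IsChar G fun g => (T g).trace :=
  ⟨Fintype.card n, reindexMat (Fintype.equivFin n) T, fun g => (trace_reindexMat _ T g).symm⟩

lemma trace_sumMat {n m R : Type*} [Fintype n] [DecidableEq n] [Fintype m] [DecidableEq m]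
    [CommRing R] (T : G →* Matrix n n R) (T' : G →* Matrix m m R) (g : G) :
    (sumMat T T' g).trace = (T g).trace + (T' g).trace := by
  simp [Matrix.trace, sumMat]

lemma IsChar.add {χ χ' : G → ℂ} (h : IsChar G χ) (h' : IsChar G χ') : IsChar G (χ + χ') := by
  obtain ⟨n, T, hT⟩ := h
  obtain ⟨m, T', hT'⟩ := h'
  have := isChar_of_mat (sumMat T T')
  convert this using 1
  ext g
  rw [trace_sumMat, Pi.add_apply, hT, hT']

lemma isChar_zero : IsChar G 0 := ⟨0, 1, fun g => by simp⟩

lemma exists_isChar_sub {ψ : G → ℂ} (h : ψ ∈ RG G) :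
    ∃ χ χ', IsChar G χ ∧ IsChar G χ' ∧ ψ = χ - χ' := by
  induction h using AddSubgroup.closure_induction with
  | mem χ hχ => exact ⟨χ, 0, hχ, isChar_zero, (sub_zero χ).symm⟩
  | zero => exact ⟨0, 0, isChar_zero, isChar_zero, (sub_zero 0).symm⟩
  | add x y _ _ hx hy =>
    obtain ⟨a, b, ha, hb, rfl⟩ := hx
    obtain ⟨c, d, hc, hd, rfl⟩ := hy
    exact ⟨a + c, b + d, ha.add hc, hb.add hd, by abel⟩
  | neg x _ hx =>
    obtain ⟨a, b, ha, hb, rfl⟩ := hx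
    exact ⟨b, a, hb, ha, by abel⟩

lemma IsChar.mem {χ : G → ℂ} (h : IsChar G χ) : χ ∈ RG G := AddSubgroup.subset_closure h

/-- A homomorphism on `R_G` is determined by its values on characters. -/
lemma hom_eq_div {A : Type*} [CommGroup A] (f : Multiplicative (RG G) →* A) (ψ : RG G)
    {χ χ' : G → ℂ} (hχ : IsChar G χ) (hχ' : IsChar G χ') (h : (ψ : G → ℂ) = χ - χ') :
    f (.ofAdd ψ) = f (.ofAdd ⟨χ, hχ.mem⟩) / f (.ofAdd ⟨χ', hχ'.mem⟩) := by
  rw [← map_div, ← ofAdd_sub]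
  congr 2
  exact Subtype.ext h

lemma hom_ext {A : Type*} [CommGroup A] {f f' : Multiplicative (RG G) →* A}
    (h : ∀ ψ : RG G, IsChar G (ψ : G → ℂ) → f (.ofAdd ψ) = f' (.ofAdd ψ)) : f = f' := by
  refine MonoidHom.ext fun ψ => ?_
  obtain ⟨χ, χ', hχ, hχ', e⟩ := exists_isChar_sub ψ.toAdd.2
  have h1 := hom_eq_div f ψ.toAdd hχ hχ' e
  have h2 := hom_eq_div f' ψ.toAdd hχ hχ' e
  rw [h ⟨χ, _⟩ hχ, h ⟨χ', _⟩ hχ', ← h2] at h1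
  exact h1

/-- A function on characters which is multiplicative on sums extends to `R_G`. -/
lemma exists_hom_extension {A : Type*} [CommGroup A] (F : (G → ℂ) → A)
    (hF : ∀ χ χ', IsChar G χ → IsChar G χ' → F (χ + χ') = F χ * F χ') :
    ∃ f : Multiplicative (RG G) →* A, ∀ ψ : RG G, IsChar G (ψ : G → ℂ) → f (.ofAdd ψ) = F ψ := by
  choose a b ha hb hab using fun ψ : RG G => exists_isChar_sub ψ.2
  have key : ∀ (ψ : RG G) (χ χ' : G → ℂ), IsChar G χ → IsChar G χ' → (ψ : G → ℂ) = χ - χ' →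
      F (a ψ) / F (b ψ) = F χ / F χ' := fun ψ χ χ' hχ hχ' h => by
    rw [div_eq_div_iff_mul_eq_mul, ← hF _ _ (ha ψ) hχ', ← hF _ _ hχ (hb ψ)]
    congr 1
    have := (hab ψ).symm.trans h
    rw [sub_eq_sub_iff_add_eq_add] at this
    exact this
  have h0 : F 0 = 1 := by
    have := hF 0 0 isChar_zero isChar_zero
    rw [add_zero] at this
    exact mul_left_cancel (this.symm.trans (mul_one _).symm)
  refine ⟨MonoidHom.mk' (fun ψ => F (a ψ.toAdd) / F (b ψ.toAdd)) fun ψ ψ' => ?_, fun ψ hψ => ?_⟩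
  · rw [toAdd_mul, key (ψ.toAdd + ψ'.toAdd) (a ψ.toAdd + a ψ'.toAdd) (b ψ.toAdd + b ψ'.toAdd)
      ((ha _).add (ha _)) ((hb _).add (hb _)), hF _ _ (ha _) (ha _), hF _ _ (hb _) (hb _),
      mul_div_mul_comm]
    rw [AddSubgroup.coe_add, hab ψ.toAdd, hab ψ'.toAdd]
    abel
  · change F (a ψ) / F (b ψ) = F ψ
    rw [key ψ ψ 0 hψ isChar_zero (sub_zero _).symm, h0, div_one]

variable [Fintype G]

/-- The homomorphisms on `R_G` given by the determinants of an invertible matrix over a group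
ring. -/
lemma exists_det_hom {k B C : Type*} [CommRing k] [CommRing B] [CommRing C] (φ : k →+* B)
    (f : Qbar →+* B) (i : B →+* C) (hi : Function.Injective i) (fC : ℂ →+* C)
    (hf : i.comp f = fC.comp (algebraMap Qbar ℂ)) {q : ℕ}
    (M : (Matrix (Fin q) (Fin q) (MonoidAlgebra k G))ˣ) :
    ∃ h : Multiplicative (RG G) →* Bˣ,
      (∀ (n : ℕ) (T : G →* Matrix (Fin n) (Fin n) ℂ) (ψ : RG G),
        (∀ g, (ψ : G → ℂ) g = (T g).trace) → i (h (.ofAdd ψ) : B) =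
          gDet (i.comp φ) (fC.mapMatrix.toMonoidHom.comp T) M.val) ∧
      ∀ (ω : Omega) (γ : B →+* B), γ.comp f = f.comp (ω : Qbar ≃+* Qbar).toRingHom →
        γ.comp φ = φ → ∀ χ χ' : RG G, IsGalConj ω (χ : G → ℂ) χ' →
          h (.ofAdd χ') = Units.map (γ : B →* B) (h (.ofAdd χ)) := by
  classical
  let D : ∀ {n : ℕ}, (G →* Matrix (Fin n) (Fin n) Qbar) → Bˣ := fun T =>
    Units.map (gDet φ (f.mapMatrix.toMonoidHom.comp T)) M
  have hcomp : ∀ {n : ℕ} (T : G →* Matrix (Fin n) (Fin n) Qbar),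
      i.mapMatrix.toMonoidHom.comp (f.mapMatrix.toMonoidHom.comp T) =
        fC.mapMatrix.toMonoidHom.comp (qbarToC T) := fun T => by
    ext g x y
    exact RingHom.congr_fun hf (T g x y)
  have hD : ∀ {n m : ℕ} (T : G →* Matrix (Fin n) (Fin n) Qbar) (T' : G →* Matrix (Fin m) (Fin m) ℂ),
      (∀ g, (((T g).trace : Qbar) : ℂ) = (T' g).trace) →
      i (D T : B) = gDet (i.comp φ) (fC.mapMatrix.toMonoidHom.comp T') M.val := fun T T' h => by
    change i (gDet φ (f.mapMatrix.toMonoidHom.comp T) M.val) = _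
    rw [map_gDet, hcomp]
    exact gDet_congr fC _ _ _ (fun g => by rw [trace_qbarToC, h]) _
  have hreal : ∀ χ : G → ℂ, ∃ x : Bˣ, IsChar G χ → ∃ (n : ℕ) (T : G →* Matrix (Fin n) (Fin n) Qbar),
      (∀ g, χ g = ((T g).trace : Qbar)) ∧ x = D T := fun χ => by
    by_cases h : IsChar G χ
    · obtain ⟨n, T, hT⟩ := h
      obtain ⟨T', hT'⟩ := exists_qbar_realization T
      exact ⟨D T', fun _ => ⟨n, T', fun g => by rw [hT, hT'], rfl⟩⟩
    · exact ⟨1, fun h' => (h h').elim⟩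
  choose F hF using hreal
  have hF' : ∀ (χ : G → ℂ) {n : ℕ} (T : G →* Matrix (Fin n) (Fin n) ℂ),
      (∀ g, χ g = (T g).trace) →
      i (F χ : B) = gDet (i.comp φ) (fC.mapMatrix.toMonoidHom.comp T) M.val := fun χ n T hT => by
    obtain ⟨m, T', hT', e⟩ := hF χ ⟨n, T, hT⟩
    rw [e]
    exact hD T' T fun g => by rw [← hT, ← hT']
  obtain ⟨h, hh⟩ := exists_hom_extension F fun χ χ' hχ hχ' => by
    refine Units.ext (hi ?_)
    rw [Units.val_mul, map_mul]
    obtain ⟨n, T, hT⟩ := hχ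
    obtain ⟨m, T', hT'⟩ := hχ'
    rw [hF' χ T hT, hF' χ' T' hT', hF' (χ + χ') (reindexMat finSumFinEquiv (sumMat T T')) fun g => by
      rw [trace_reindexMat, trace_sumMat, Pi.add_apply, hT, hT'], ← gDet_sumMat]
    rw [← gDet_reindexMat _ finSumFinEquiv]
    congr 2
    ext g x y
    simp only [MonoidHom.comp_apply, reindexMat_apply]
    change fC (Matrix.fromBlocks (T g) 0 0 (T' g) _ _) = Matrix.fromBlocks
      ((T g).map fC) 0 0 ((T' g).map fC) _ _
    rcases finSumFinEquiv.symm x with a | a <;> rcases finSumFinEquiv.symm y with b | b <;> simp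
  refine ⟨h, fun n T ψ hT => ?_, fun ω γ hγf hγφ χ χ' hc => ?_⟩
  · rw [hh ψ ⟨n, T, hT⟩]
    exact hF' ψ T hT
  -- Galois conjugates of characters
  have hconj : ∀ χ : G → ℂ, IsChar G χ → ∃ χ', IsChar G χ' ∧ IsGalConj ω χ χ' ∧
      F χ' = Units.map (γ : B →* B) (F χ) := fun χ hχ => by
    obtain ⟨n, T, hT, e⟩ := hF χ hχ
    let T' : G →* Matrix (Fin n) (Fin n) Qbar :=
      ((ω : Qbar ≃+* Qbar).toRingHom).mapMatrix.toMonoidHom.comp T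
    have htr : ∀ g, (T' g).trace = ω (T g).trace := fun g =>
      (AddMonoidHom.map_trace ((ω : Qbar ≃+* Qbar).toRingHom).toAddMonoidHom (T g)).symm
    refine ⟨fun g => ((T' g).trace : Qbar), ⟨n, qbarToC T', fun g => (trace_qbarToC T' g).symm⟩,
      fun g => ⟨(T g).trace, (hT g).symm, congrArg _ (htr g).symm⟩, Units.ext (hi ?_)⟩
    rw [hF' _ (qbarToC T') fun g => (trace_qbarToC T' g).symm, e, ← hcomp, ← map_gDet]
    congr 1
    change _ = γ (gDet φ (f.mapMatrix.toMonoidHom.comp T) M.val)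
    rw [map_gDet, hγφ]
    refine congrArg (fun X => gDet φ X M.val) ?_
    ext g x y
    exact (RingHom.congr_fun hγf (T g x y)).symm
  have huniq : ∀ {χ χ₁ χ₂ : G → ℂ}, IsGalConj ω χ χ₁ → IsGalConj ω χ χ₂ → χ₁ = χ₂ :=
    fun h1 h2 => by
      ext g
      obtain ⟨z, hz, e⟩ := h1 g
      obtain ⟨z', hz', e'⟩ := h2 g
      rw [← e, ← e', show z = z' from Subtype.ext (hz.trans hz'.symm)]
  obtain ⟨a, b, ha, hb, hab⟩ := exists_isChar_sub χ.2
  obtain ⟨a', ha', hca, hFa⟩ := hconj a ha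
  obtain ⟨b', hb', hcb, hFb⟩ := hconj b hb
  have h1 : (χ' : G → ℂ) = a' - b' := huniq hc fun g => by
    obtain ⟨z, hz, e⟩ := hca g
    obtain ⟨z', hz', e'⟩ := hcb g
    refine ⟨z - z', ?_, ?_⟩
    · rw [hab, Pi.sub_apply, ← hz, ← hz']
      rfl
    · rw [map_sub, Pi.sub_apply, ← e, ← e']
      rfl
  rw [hom_eq_div h χ ha hb hab, hom_eq_div h χ' ha' hb' h1, hh ⟨a', _⟩ ha', hh ⟨b', _⟩ hb',
    hh ⟨a, _⟩ ha, hh ⟨b, _⟩ hb, hFa, hFb, map_div]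

/-! ### The homomorphisms `Det` -/

/-- The inclusion `Ẑ ⊗ ℚ → Ẑ ⊗ Q̄`. -/
def inclQbar : AQ →+* AQbar :=
  (Algebra.TensorProduct.map (AlgHom.id ℤ Zhat) (algebraMap ℚ Qbar).toIntAlgHom).toRingHom

lemma inclC_comp_inclQbar : inclC.comp inclQbar = inclQ := by
  ext x
  change Zhat ⊗[ℤ] ℚ at x
  induction x with
  | zero => exact (map_zero (inclC.comp inclQbar)).trans (map_zero inclQ).symm
  | add x y hx hy =>
    exact (map_add (inclC.comp inclQbar) x y).trans
      ((congrArg₂ (· + ·) hx hy).trans (map_add inclQ x y).symm)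
  | tmul a b => rfl

lemma galA_comp_inclQbar (ω : Omega) : (galA ω).comp inclQbar = inclQbar := by
  ext x
  change Zhat ⊗[ℤ] ℚ at x
  induction x with
  | zero => exact (map_zero ((galA ω).comp inclQbar)).trans (map_zero inclQbar).symm
  | add x y hx hy =>
    exact (map_add ((galA ω).comp inclQbar) x y).trans
      ((congrArg₂ (· + ·) hx hy).trans (map_add inclQbar x y).symm)
  | tmul a b =>
    change a ⊗ₜ[ℤ] (ω (algebraMap ℚ Qbar b)) = a ⊗ₜ[ℤ] algebraMap ℚ Qbar b
    rw [ω.commutes b]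

lemma inclC_comp_diagQbar : inclC.comp diagQbar = diagC.comp (algebraMap Qbar ℂ) := by
  ext x
  rfl

lemma galA_comp_diagQbar (ω : Omega) :
    (galA ω).comp diagQbar = diagQbar.comp (ω : Qbar ≃+* Qbar).toRingHom := by
  ext x
  rfl

lemma inclC_injective : Function.Injective inclC := by
  obtain ⟨r, hr⟩ := (Algebra.linearMap Qbar ℂ).exists_leftInverse_of_injective
    (LinearMap.ker_eq_bot.mpr (algebraMap Qbar ℂ).injective)
  let R : Zhat ⊗[ℤ] ℂ →ₗ[ℤ] Zhat ⊗[ℤ] Qbar := r.toAddMonoidHom.toIntLinearMap.lTensor Zhat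
  refine Function.LeftInverse.injective (g := R) fun x => ?_
  change Zhat ⊗[ℤ] Qbar at x
  induction x with
  | zero => exact (congrArg R (map_zero inclC)).trans (map_zero R)
  | add x y hx hy =>
    exact (congrArg R (map_add inclC x y)).trans
      ((map_add R (inclC x) (inclC y)).trans (congrArg₂ (· + ·) hx hy))
  | tmul a b =>
    change a ⊗ₜ[ℤ] r (algebraMap Qbar ℂ b) = a ⊗ₜ[ℤ] b
    rw [show r (algebraMap Qbar ℂ b) = b from LinearMap.congr_fun hr b]

omit [Fintype G] in
lemma detRep_eq {n q : ℕ} (T : G →* Matrix (Fin n) (Fin n) ℂ)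
    (lam : Matrix (Fin q) (Fin q) (MonoidAlgebra AQ G)) :
    detRep T lam = gDet inclQ (diagC.mapMatrix.toMonoidHom.comp T) lam := rfl

lemma exists_detHom {q : ℕ} (M : (Matrix (Fin q) (Fin q) (MonoidAlgebra AQ G))ˣ) :
    ∃ h : HomOmega (RG G), ∀ (n : ℕ) (T : G →* Matrix (Fin n) (Fin n) ℂ) (ψ : RG G),
      (∀ g, (ψ : G → ℂ) g = (T g).trace) → inclC (h.1 (.ofAdd ψ) : AQbar) = detRep T M.val := by
  obtain ⟨h, h1, h2⟩ := exists_det_hom inclQbar diagQbar inclC inclC_injective diagC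
    inclC_comp_diagQbar M
  rw [inclC_comp_inclQbar] at h1
  exact ⟨⟨h, fun ω χ χ' hc => h2 ω (galA ω) (galA_comp_diagQbar ω) (galA_comp_inclQbar ω) χ χ' hc⟩,
    h1⟩

/-- The homomorphism `Det(M)`. -/
def detHom {q : ℕ} (M : (Matrix (Fin q) (Fin q) (MonoidAlgebra AQ G))ˣ) : HomOmega (RG G) :=
  (exists_detHom M).choose

lemma inclC_detHom {q : ℕ} (M : (Matrix (Fin q) (Fin q) (MonoidAlgebra AQ G))ˣ) {n : ℕ}
    (T : G →* Matrix (Fin n) (Fin n) ℂ) (ψ : RG G) (h : ∀ g, (ψ : G → ℂ) g = (T g).trace) :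
    inclC ((detHom M).1 (.ofAdd ψ) : AQbar) = detRep T M.val :=
  (exists_detHom M).choose_spec n T ψ h

omit [Fintype G] in
lemma homOmega_ext {f f' : HomOmega (RG G)}
    (h : ∀ (n : ℕ) (T : G →* Matrix (Fin n) (Fin n) ℂ) (ψ : RG G),
      (∀ g, (ψ : G → ℂ) g = (T g).trace) →
        inclC (f.1 (.ofAdd ψ) : AQbar) = inclC (f'.1 (.ofAdd ψ) : AQbar)) : f = f' := by
  refine Subtype.ext (hom_ext fun ψ ⟨n, T, hT⟩ => Units.ext (inclC_injective (h n T ψ hT)))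

lemma detHom_mul {q : ℕ} (M N : (Matrix (Fin q) (Fin q) (MonoidAlgebra AQ G))ˣ) :
    detHom (M * N) = detHom M * detHom N := by
  refine homOmega_ext fun n T ψ hT => ?_
  rw [inclC_detHom _ T ψ hT]
  change _ = inclC (((detHom M).1 (.ofAdd ψ) : AQbar) * ((detHom N).1 (.ofAdd ψ) : AQbar))
  rw [map_mul, inclC_detHom _ T ψ hT, inclC_detHom _ T ψ hT, detRep_eq, detRep_eq, detRep_eq,
    Units.val_mul, map_mul]

lemma detHom_submatrix {q q' : ℕ} (M : (Matrix (Fin q) (Fin q) (MonoidAlgebra AQ G))ˣ)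
    (M' : (Matrix (Fin q') (Fin q') (MonoidAlgebra AQ G))ˣ) (e : Fin q ≃ Fin q')
    (h : M.val = M'.val.submatrix e e) : detHom M = detHom M' := by
  refine homOmega_ext fun n T ψ hT => ?_
  rw [inclC_detHom _ T ψ hT, inclC_detHom _ T ψ hT, h]
  exact blockDet_submatrix (evalRep inclQ T) e M'.val

/-- `Det(GL_q(Ẑ[G]))` is contained in `Det(Ẑ[G]ˣ)`. -/
lemma detHom_mem_DetZhat {q : ℕ} (M : (Matrix (Fin q) (Fin q) (MonoidAlgebra Zhat G))ˣ) :
    detHom (Units.map ((MonoidAlgebra.mapRingHom G zhatToAQ).mapMatrix.toMonoidHom) M) ∈ DetZhat := by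
  classical
  obtain ⟨x, hx⟩ := (stableRangeOne_zhat (G := G)).exists_unit (S := AC) q M.val M.isUnit
  refine ⟨x, fun n T ψ hT => ?_⟩
  rw [inclC_detHom _ T ψ hT, ← hx n (evalRep inclZ T), detRep_eq]
  have h1 : inclQ.comp zhatToAQ = inclZ := by
    ext z
    change z ⊗ₜ[ℤ] algebraMap ℚ ℂ 1 = z ⊗ₜ[ℤ] (1 : ℂ)
    rw [map_one]
  rw [← h1]
  exact gDet_mapRingHom zhatToAQ inclQ _ M.val

end CharacterGroups

end

end HermClass

namespace HermClass

noncomputable section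

/-! ### Positivity of determinants at symplectic characters -/

section Positivity

open Module

variable {G : Type*} [Group G] [Fintype G]

lemma gDet_pos_of_symplectic {n : ℕ} (T : G →* Matrix (Fin n) (Fin n) ℂ)
    (A : Matrix (Fin n) (Fin n) ℂ) (hA : A.transpose = -A) (hAu : IsUnit A.det)
    (hT : ∀ g, (T g).transpose * A * T g = A) {q : ℕ}
    (M : (Matrix (Fin q) (Fin q) (MonoidAlgebra ℚ G))ˣ) :
    ∃ r : ℝ, 0 < r ∧ gDet (algebraMap ℚ ℂ) T M.val = r := by
  have hκ : ∀ x y, Matrix.toBilin' A x y = x ⬝ᵥ A.mulVec y := fun x y => Matrix.toBilin'_apply' A x y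
  obtain ⟨J, ν, hJ, hJT, -, -⟩ := exists_quaternionic (matRep T) (Matrix.toBilin' A) (fun x => by
      have h : x ⬝ᵥ A.mulVec x = -(x ⬝ᵥ A.mulVec x) := by
        conv_lhs => rw [Matrix.dotProduct_mulVec, ← Matrix.mulVec_transpose, hA, dotProduct_comm,
          Matrix.neg_mulVec, dotProduct_neg]
      rw [hκ]
      linear_combination (1 / 2 : ℂ) * h) (fun y hy => by
      have h : A.mulVec y = 0 := by
        ext i
        have := hy (Pi.single i 1)
        rwa [hκ, single_one_dotProduct] at this
      rw [← Matrix.one_mulVec y, ← Matrix.nonsing_inv_mul A hAu, ← Matrix.mulVec_mulVec, h,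
        Matrix.mulVec_zero]) (fun g x y => by
      rw [hκ, hκ, matRep_apply, Matrix.toLin'_apply, Matrix.toLin'_apply, Matrix.mulVec_mulVec,
        Matrix.dotProduct_mulVec, Matrix.vecMul_mulVec, ← Matrix.dotProduct_mulVec,
        ← Matrix.mul_assoc, hT])
  have hJx : ∀ (x : MonoidAlgebra ℚ G) (v : Fin n → ℂ),
      J ((gEval (algebraMap ℚ ℂ) T x).mulVec v) = (gEval (algebraMap ℚ ℂ) T x).mulVec (J v) := by
    intro x v
    induction x using MonoidAlgebra.induction_linear with
    | zero => simp
    | add x y hx hy => simp only [map_add, Matrix.add_mulVec, hx, hy]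
    | single g c =>
      rw [gEval_single, Matrix.smul_mulVec, Matrix.smul_mulVec, map_smulₛₗ]
      congr 1
      · exact map_ratCast (starRingEnd ℂ) c
      · exact hJT g v
  let JE : (Fin q × Fin n → ℂ) →ₛₗ[starRingEnd ℂ] (Fin q × Fin n → ℂ) :=
    { toFun := fun v x => J (fun b => v (x.1, b)) x.2
      map_add' := fun v w => by
        ext x
        exact congrFun (map_add J (fun b => v (x.1, b)) (fun b => w (x.1, b))) x.2
      map_smul' := fun c v => by
        ext x
        exact congrFun (map_smulₛₗ J c (fun b => v (x.1, b))) x.2 }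
  obtain ⟨r, hr, hr'⟩ := det_eq_nonneg (J := JE) (fun v => by
      ext x
      exact congrFun (hJ (fun b => v (x.1, b))) x.2)
    (Matrix.toLin' (gMat (algebraMap ℚ ℂ) T M.val)) (fun v => by
      have key : ∀ (v : Fin q × Fin n → ℂ) (i : Fin q),
          (fun b => Matrix.toLin' (gMat (algebraMap ℚ ℂ) T M.val) v (i, b)) =
            ∑ j, (gEval (algebraMap ℚ ℂ) T (M.val i j)).mulVec fun b => v (j, b) := fun v i => by
        ext b
        rw [Matrix.toLin'_apply, Finset.sum_apply]
        simp only [Matrix.mulVec, dotProduct, Fintype.sum_prod_type, gMat_apply]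
      ext x
      refine (congrFun (key _ x.1) x.2).trans ?_
      refine Eq.trans ?_ (congrFun (congrArg J (key v x.1)) x.2).symm
      rw [map_sum, Finset.sum_apply, Finset.sum_apply]
      refine Finset.sum_congr rfl fun j _ => ?_
      rw [hJx]
      rfl)
  rw [LinearMap.det_toLin'] at hr'
  have hu : IsUnit (gDet (algebraMap ℚ ℂ) T M.val) := M.isUnit.map (gDet (algebraMap ℚ ℂ) T)
  refine ⟨r, lt_of_le_of_ne hr fun h => hu.ne_zero ?_, hr'⟩
  rw [gDet_apply, hr', ← h, Complex.ofReal_zero]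

lemma diagC_comp_rat : inclQ.comp ratToAQ = diagC.comp (algebraMap ℚ ℂ) := by
  ext x
  rfl

/-- The determinants of an invertible matrix over `ℚ[G]` define an element of
`Hom_Ω⁺(R_G^s, Q̄ˣ)`. -/
lemma exists_detPlus {q : ℕ} (M : (Matrix (Fin q) (Fin q) (MonoidAlgebra ℚ G))ˣ) :
    ∃ g : HomOmegaPlus (RGs G), toHomOmega g = restrictHom
        (detHom (Units.map ((MonoidAlgebra.mapRingHom G ratToAQ).mapMatrix.toMonoidHom) M)) ∧
      ∃ h : Multiplicative (RG G) →* Qbarˣ, g.1 = h.comp inclR ∧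
        ∀ (n : ℕ) (T : G →* Matrix (Fin n) (Fin n) ℂ) (ψ : RG G),
          (∀ g, (ψ : G → ℂ) g = (T g).trace) →
            ((h (.ofAdd ψ) : Qbar) : ℂ) = gDet (algebraMap ℚ ℂ) T M.val := by
  obtain ⟨h, h1, h2⟩ := exists_det_hom (algebraMap ℚ Qbar) (RingHom.id Qbar) (algebraMap Qbar ℂ)
    (algebraMap Qbar ℂ).injective (RingHom.id ℂ) (by ext; rfl) M
  have h1' : ∀ (n : ℕ) (T : G →* Matrix (Fin n) (Fin n) ℂ) (ψ : RG G),
      (∀ g, (ψ : G → ℂ) g = (T g).trace) →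
        ((h (.ofAdd ψ) : Qbar) : ℂ) = gDet (algebraMap ℚ ℂ) T M.val := fun n T ψ hT => by
    refine (h1 n T ψ hT).trans ?_
    congr 2
  have hpos : ∀ (ω : Omega) (χ : RGs G), ∃ r : ℝ, 0 < r ∧
      ((galQ ω (h.comp inclR (.ofAdd χ)) : Qbar) : ℂ) = r := by
    rintro ω ⟨χ, hχ⟩
    have main : ∀ ψ : RG G, (ψ : G → ℂ) ∈ RGs G → ∃ r : ℝ, 0 < r ∧
        ((galQ ω (h (.ofAdd ψ)) : Qbar) : ℂ) = r := by
      rintro ⟨ψ, hψ'⟩ hψ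
      change ψ ∈ RGs G at hψ
      revert hψ'
      induction hψ using AddSubgroup.closure_induction with
      | mem ψ hψ =>
        intro hψ'
        obtain ⟨n, T, A, hA, hAu, hT, htr⟩ := hψ
        obtain ⟨T', A', htr', hA', hAu', hT'⟩ := exists_qbar_realization_symplectic T A hA hAu hT
        let e : Qbar →+* ℂ := (algebraMap Qbar ℂ).comp (ω : Qbar ≃+* Qbar).toRingHom
        have hz : (h (.ofAdd ⟨ψ, hψ'⟩) : Qbar) = gDet (algebraMap ℚ Qbar) T' M.val := by
          refine (algebraMap Qbar ℂ).injective ?_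
          rw [map_gDet, Subsingleton.elim ((algebraMap Qbar ℂ).comp _) (algebraMap ℚ ℂ)]
          exact h1' n (qbarToC T') ⟨ψ, hψ'⟩ fun g => by rw [trace_qbarToC, htr']; exact htr g
        obtain ⟨r, hr, hr'⟩ := gDet_pos_of_symplectic (e.mapMatrix.toMonoidHom.comp T')
          (e.mapMatrix A') (by
            rw [RingHom.mapMatrix_apply, ← Matrix.transpose_map, hA']
            ext i j
            simp) (by
            rw [← RingHom.map_det]
            exact hAu'.map e) (fun g => by
            have := congrArg e.mapMatrix (hT' g)
            rw [map_mul, map_mul] at this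
            exact this) M
        refine ⟨r, hr, ?_⟩
        rw [← hr', ← Subsingleton.elim (e.comp (algebraMap ℚ Qbar)) (algebraMap ℚ ℂ), ← map_gDet,
          ← hz]
        rfl
      | zero =>
        intro hψ'
        refine ⟨1, one_pos, ?_⟩
        rw [show (⟨0, hψ'⟩ : RG G) = 0 from rfl, ofAdd_zero, map_one, map_one]
        simp
      | add x y hx hy ihx ihy =>
        intro hψ'
        obtain ⟨r, hr, e⟩ := ihx (RGs_le_RG G hx)
        obtain ⟨r', hr', e'⟩ := ihy (RGs_le_RG G hy)
        refine ⟨r * r', mul_pos hr hr', ?_⟩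
        rw [show (⟨x + y, hψ'⟩ : RG G) = ⟨x, RGs_le_RG G hx⟩ + ⟨y, RGs_le_RG G hy⟩ from rfl,
          ofAdd_add, map_mul, map_mul, Units.val_mul, Complex.ofReal_mul, ← e, ← e']
        rfl
      | neg x hx ihx =>
        intro hψ'
        obtain ⟨r, hr, e⟩ := ihx (RGs_le_RG G hx)
        refine ⟨r⁻¹, inv_pos.mpr hr, ?_⟩
        rw [show (⟨-x, hψ'⟩ : RG G) = -⟨x, RGs_le_RG G hx⟩ from rfl,
          ofAdd_neg, map_inv, map_inv, Units.val_inv_eq_inv_val]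
        push_cast
        rw [e]
    exact main (AddSubgroup.inclusion (RGs_le_RG G) ⟨χ, hχ⟩) hχ
  refine ⟨⟨h.comp inclR, fun ω χ χ' hc => ?_, hpos⟩, ?_, h, rfl, h1'⟩
  · exact h2 ω ((ω : Qbar ≃+* Qbar).toRingHom) (by ext; rfl) (RingHom.ext fun x => ω.commutes x)
      (AddSubgroup.inclusion (RGs_le_RG G) χ) (AddSubgroup.inclusion (RGs_le_RG G) χ') hc
  · have h3 : (Units.map (diagQbar : Qbar →* AQbar)).comp h = (detHom (Units.map
        ((MonoidAlgebra.mapRingHom G ratToAQ).mapMatrix.toMonoidHom) M)).1 := by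
      refine hom_ext fun ψ ⟨n, T, hT⟩ => Units.ext (inclC_injective ?_)
      rw [inclC_detHom _ T ψ hT, detRep_eq]
      refine Eq.trans ?_ (gDet_mapRingHom ratToAQ inclQ _ M.val).symm
      rw [diagC_comp_rat, ← map_gDet, ← h1' n T ψ hT]
      exact RingHom.congr_fun inclC_comp_diagQbar (h (.ofAdd ψ) : Qbar)
    refine Subtype.ext ?_
    change (Units.map (diagQbar : Qbar →* AQbar)).comp (h.comp inclR) = _
    rw [← MonoidHom.comp_assoc, h3]
    rfl

end Positivity

end

end HermClass

namespace HermClass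

noncomputable section

/-! ### Determinants of bases consisting of pairs -/

section PairDet

open Module

variable {E F : Type*} [AddCommGroup E] [Module ℂ E] [AddCommGroup F] [Module ℂ F]
  {ι κ μ : Type*} {X Y Z : Type*}

lemma detEquiv_reindex_left (c : Basis ι ℂ E) (b : Basis κ ℂ E) (f : ι ≃ μ) (e : μ ≃ κ) :
    detEquiv (c.reindex f) b e = detEquiv c b (f.trans e) := by
  rw [detEquiv, detEquiv]
  congr 1
  exact c.ext fun i => by
    have := (c.reindex f).equiv_apply (f i) b e
    rw [Basis.reindex_apply, Equiv.symm_apply_apply] at this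
    simpa using this

lemma detEquiv_reindex_right (c : Basis ι ℂ E) (b : Basis κ ℂ E) (f : κ ≃ μ) (e : ι ≃ μ) :
    detEquiv c (b.reindex f) e = detEquiv c b (e.trans f.symm) := by
  rw [detEquiv, detEquiv]
  congr 1
  exact c.ext fun i => by simp

lemma exists_pair_equiv [Finite X] (c : Basis (X × Fin 2) ℂ E) (b : Basis (Y × Fin 2) ℂ E) :
    Nonempty (X ≃ Y) := by
  have : Finite (Y × Fin 2) := Finite.of_equiv _ (c.indexEquiv b)
  have : Finite Y := Finite.prod_left (Fin 2)
  have h := Nat.card_congr (c.indexEquiv b)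
  rw [Nat.card_prod, Nat.card_prod] at h
  exact Finite.card_eq.mp (Nat.eq_of_mul_eq_mul_right (by simp) h)

/-- For bases which consist of pairs the determinant does not depend on the order of the pairs. -/
lemma detEquiv_pair [Finite X] (c : Basis (X × Fin 2) ℂ E) (b : Basis (Y × Fin 2) ℂ E)
    (e e' : X ≃ Y) : detEquiv c b (e.prodCongr (Equiv.refl _)) =
      detEquiv c b (e'.prodCongr (Equiv.refl _)) := by
  classical
  have := Fintype.ofFinite X
  rw [detEquiv_eq, detEquiv_eq]
  let π : Equiv.Perm X := e.trans e'.symm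
  have hsign : Equiv.Perm.sign (Equiv.prodCongrLeft fun _ : Fin 2 => π) = 1 := by
    rw [Equiv.Perm.sign_prodCongrLeft, Fin.prod_univ_two, Int.units_mul_self]
  have : (b ∘ (e.prodCongr (Equiv.refl (Fin 2)))) =
      (b ∘ (e'.prodCongr (Equiv.refl (Fin 2)))) ∘ (Equiv.prodCongrLeft fun _ : Fin 2 => π) := by
    ext ⟨x, k⟩
    simp [π]
  rw [this, AlternatingMap.map_perm, hsign, one_smul]

/-- The determinant of a basis consisting of pairs with respect to another one. -/
def pdet (c : Basis (X × Fin 2) ℂ E) (b : Basis (Y × Fin 2) ℂ E) : ℂ :=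
  open Classical in
  if h : Nonempty (X ≃ Y) then detEquiv c b (h.some.prodCongr (Equiv.refl _)) else 1

lemma pdet_eq [Finite X] (c : Basis (X × Fin 2) ℂ E) (b : Basis (Y × Fin 2) ℂ E) (e : X ≃ Y) :
    pdet c b = detEquiv c b (e.prodCongr (Equiv.refl _)) := by
  rw [pdet, dif_pos ⟨e⟩]
  exact detEquiv_pair c b _ _

lemma pdet_trans [Finite X] (a : Basis (X × Fin 2) ℂ E) (b : Basis (Y × Fin 2) ℂ E)
    (c : Basis (Z × Fin 2) ℂ E) : pdet a b * pdet b c = pdet a c := by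
  obtain ⟨e⟩ := exists_pair_equiv a b
  have : Finite Y := Finite.of_equiv _ e
  obtain ⟨e'⟩ := exists_pair_equiv b c
  rw [pdet_eq a b e, pdet_eq b c e', pdet_eq a c (e.trans e'), detEquiv_trans]
  rfl

lemma pdet_eq_det [Fintype X] [DecidableEq X] (c : Basis (X × Fin 2) ℂ E)
    (b : Basis (Y × Fin 2) ℂ E) (e : X ≃ Y) : pdet c b = c.det fun x => b (e x.1, x.2) := by
  rw [pdet_eq c b e, detEquiv_eq]
  rfl

lemma norm_pdet [Finite X] (c : Basis (X × Fin 2) ℂ E) (b : Basis (Y × Fin 2) ℂ E) :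
    ‖pdet c b‖ = vol c b := by
  obtain ⟨e⟩ := exists_pair_equiv c b
  rw [pdet_eq c b e, ← vol_eq_norm_detEquiv]

lemma pdet_of_subsingleton [Subsingleton E] (c : Basis (X × Fin 2) ℂ E)
    (b : Basis (Y × Fin 2) ℂ E) : pdet c b = 1 := by
  rw [pdet]
  split_ifs
  · exact detEquiv_of_subsingleton _ _ _
  · rfl

lemma pdet_map [Finite X] (c : Basis (X × Fin 2) ℂ E) (b : Basis (Y × Fin 2) ℂ E)
    (f : E ≃ₗ[ℂ] F) : pdet (c.map f) (b.map f) = pdet c b := by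
  classical
  have := Fintype.ofFinite X
  obtain ⟨e⟩ := exists_pair_equiv c b
  rw [pdet_eq_det _ _ e, pdet_eq_det _ _ e, Basis.det_map]
  congr 1
  ext x
  simp

lemma pdet_adapted_pos [Finite X] {J : E →ₛₗ[starRingEnd ℂ] E} (hJ : ∀ x, J (J x) = -x)
    (c : Basis (X × Fin 2) ℂ E) (b : Basis (Y × Fin 2) ℂ E) (hc : IsAdapted J c)
    (hb : IsAdapted J b) : ∃ r : ℝ, 0 < r ∧ pdet c b = r := by
  classical
  have := Fintype.ofFinite X
  obtain ⟨e⟩ := exists_pair_equiv c b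
  obtain ⟨r, hr, hr'⟩ := adapted_det_pos hJ c (b.reindex (e.prodCongr (Equiv.refl _)).symm) hc
    (fun x => by simpa using hb (e x))
  refine ⟨r, hr, ?_⟩
  rw [pdet_eq_det c b e, ← hr']
  congr 1
  ext ⟨x, k⟩
  simp

lemma IsHyperbolic.reindex [DecidableEq X] [DecidableEq Y] {h : LinearMap.BilinForm ℂ E}
    {b : Basis (X × Fin 2) ℂ E} (hb : IsHyperbolic h b) (e : X ≃ Y) :
    IsHyperbolic h (b.reindex (e.prodCongr (Equiv.refl _))) where
  alt := hb.alt
  zero_zero i j := by simpa using hb.zero_zero (e.symm i) (e.symm j)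
  one_one i j := by simpa using hb.one_one (e.symm i) (e.symm j)
  zero_one i j := by simpa using hb.zero_one (e.symm i) (e.symm j)

lemma pdet_hyperbolic [Finite X] [DecidableEq X] [DecidableEq Y] {h : LinearMap.BilinForm ℂ E}
    {c : Basis (X × Fin 2) ℂ E} {b : Basis (Y × Fin 2) ℂ E} (hc : IsHyperbolic h c)
    (hb : IsHyperbolic h b) : pdet c b = 1 := by
  have := Fintype.ofFinite X
  obtain ⟨e⟩ := exists_pair_equiv c b
  rw [pdet_eq_det c b e, ← hc.det_eq_one (hb.reindex e.symm)]
  congr 1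
  ext ⟨x, k⟩
  simp

/-- The basis of `W^X` given by pairs. -/
lemma IsHyperbolic.piBasis [Fintype X] [DecidableEq X] [DecidableEq Y]
    {κ : LinearMap.BilinForm ℂ E} {w : Basis (Y × Fin 2) ℂ E} (hw : IsHyperbolic κ w) :
    ∃ h : LinearMap.BilinForm ℂ (X → E), (∀ u v, h u v = ∑ x, κ (u x) (v x)) ∧
      IsHyperbolic h ((HermClass.piBasis X w).reindex (Equiv.prodAssoc X Y (Fin 2)).symm) := by
  let h : LinearMap.BilinForm ℂ (X → E) := LinearMap.mk₂ ℂ (fun u v => ∑ x, κ (u x) (v x))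
    (fun _ _ _ => by simp [Finset.sum_add_distrib]) (fun _ _ _ => by simp [Finset.mul_sum])
    (fun _ _ _ => by simp [Finset.sum_add_distrib]) (fun _ _ _ => by simp [Finset.mul_sum])
  have key : ∀ x y : X × (Y × Fin 2), h (HermClass.piBasis X w x) (HermClass.piBasis X w y) =
      if x.1 = y.1 then κ (w x.2) (w y.2) else 0 := by
    intro x y
    rw [piBasis_apply, piBasis_apply]
    change ∑ k, κ ((Pi.single x.1 (w x.2) : X → E) k) ((Pi.single y.1 (w y.2) : X → E) k) = _
    rw [Finset.sum_eq_single x.1]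
    · by_cases hxy : x.1 = y.1
      · rw [if_pos hxy, hxy]; simp
      · rw [if_neg hxy, Pi.single_eq_of_ne hxy]; simp
    · intro k _ hk
      rw [Pi.single_eq_of_ne hk]; simp
    · simp
  refine ⟨h, fun _ _ => rfl, fun u => Finset.sum_eq_zero fun x _ => hw.alt (u x), fun i j => ?_,
    fun i j => ?_, fun i j => ?_⟩
  all_goals
    simp only [Basis.reindex_apply, Equiv.symm_symm, Equiv.prodAssoc_apply, key]
  · rw [hw.zero_zero, ite_self]
  · rw [hw.one_one, ite_self]
  · rw [hw.zero_one, ← ite_and]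
    exact if_congr Prod.ext_iff.symm rfl rfl

lemma pdet_piBasis [Fintype X] [DecidableEq X] [Finite Y] [DecidableEq Y] [DecidableEq Z]
    {κ : LinearMap.BilinForm ℂ E} {w : Basis (Y × Fin 2) ℂ E} {w' : Basis (Z × Fin 2) ℂ E}
    (hw : IsHyperbolic κ w) (hw' : IsHyperbolic κ w') :
    pdet ((piBasis X w).reindex (Equiv.prodAssoc X Y (Fin 2)).symm)
      ((piBasis X w').reindex (Equiv.prodAssoc X Z (Fin 2)).symm) = 1 := by
  obtain ⟨h, e, hh⟩ := hw.piBasis (X := X)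
  obtain ⟨h', e', hh'⟩ := hw'.piBasis (X := X)
  obtain rfl : h = h' := LinearMap.ext₂ fun u v => by rw [e, e']
  exact pdet_hyperbolic hh hh'

lemma IsHyperbolic.nondeg [Finite X] [DecidableEq X] {h : LinearMap.BilinForm ℂ E}
    {e : Basis (X × Fin 2) ℂ E} (he : IsHyperbolic h e) (y : E) (hy : ∀ x, h x y = 0) : y = 0 := by
  have := Fintype.ofFinite X
  refine e.ext_elem_iff.mpr fun ⟨i, k⟩ => ?_
  have key : ∀ x : X × Fin 2, h (e x) y = ∑ z, e.repr y z * h (e x) (e z) := fun x => by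
    conv_lhs => rw [← e.sum_repr y, map_sum]
    simp
  rw [map_zero, Finsupp.zero_apply]
  fin_cases k
  · have h1 := key (i, 1)
    rw [hy, Finset.sum_eq_single (i, 0)] at h1
    · rw [he.gram] at h1
      simpa using h1.symm
    · rintro ⟨j, l⟩ - hjl
      rw [he.gram]
      by_cases hij : i = j
      · subst hij
        fin_cases l
        · exact (hjl rfl).elim
        · simp
      · simp [hij]
    · simp
  · have h1 := key (i, 0)
    rw [hy, Finset.sum_eq_single (i, 1)] at h1
    · rw [he.gram] at h1
      simpa using h1.symm
    · rintro ⟨j, l⟩ - hjl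
      rw [he.gram]
      by_cases hij : i = j
      · subst hij
        fin_cases l
        · simp
        · exact (hjl rfl).elim
      · simp [hij]
    · simp

/-- An orthonormal basis which is adapted to a quaternionic structure is hyperbolic. -/
lemma IsOrthon.isHyperbolic [DecidableEq X] {J : E →ₛₗ[starRingEnd ℂ] E} (hJ : ∀ x, J (J x) = -x)
    {ν : E →ₗ[ℂ] E →ₗ⋆[ℂ] ℂ} {κ : LinearMap.BilinForm ℂ E} (halt : κ.IsAlt)
    (h : ∀ x y, ν x y = κ x (J y)) {e : Basis (X × Fin 2) ℂ E} (he : IsOrthon ν e)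
    (hJe : IsAdapted J e) : IsHyperbolic κ e where
  alt := halt
  zero_zero i j := by
    have := he.2 (i, 0) (j, 1) (by simp)
    rw [h, hJe j, hJ, map_neg, neg_eq_zero] at this
    exact this
  one_one i j := by
    rw [hJe j, ← h]
    exact he.2 (i, 1) (j, 0) (by simp)
  zero_one i j := by
    rw [hJe j, ← h]
    split_ifs with hij
    · rw [hij]
      exact he.1 _
    · exact he.2 _ _ (by simp [hij])

end PairDet

end

end HermClass

namespace HermClass

noncomputable section

/-! ### Hyperbolic bases and signatures -/

section SignBases

open Module

variable {G : Type*} [Group G] {W M N N' : Type*} [AddCommGroup W] [Module ℂ W]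
  [AddCommGroup M] [Module ℝ M] [AddCommGroup N] [Module ℝ N] [AddCommGroup N'] [Module ℝ N']
  {ρ : Representation ℂ G W} {a : Representation ℝ G M}

/-- The complement of the negative part may be chosen orthogonal to it. -/
lemma SignDecomposition.exists_orthogonal [FiniteDimensional ℝ M] {σ : LinearMap.BilinForm ℝ M}
    (D : SignDecomposition a σ) (hs : σ.IsSymm) (hinv : ∀ g x y, σ (a g x) (a g y) = σ x y) :
    ∃ U : Submodule ℝ M, (∀ g, U ≤ U.comap (a g)) ∧ U ⊔ D.neg = ⊤ ∧
      (∀ x ∈ U, x ≠ 0 → 0 < σ x x) ∧ ∀ x ∈ U, ∀ y ∈ D.neg, σ x y = 0 := by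
  let U : Submodule ℝ M := σ.orthogonal D.neg
  have horth : ∀ x ∈ U, ∀ y ∈ D.neg, σ x y = 0 := fun x hx y hy => by
    rw [hs.eq]
    exact LinearMap.BilinForm.mem_orthogonal_iff.mp hx y hy
  refine ⟨U, fun g x hx => ?_, ?_, fun x hx h0 => ?_, horth⟩
  · rw [Submodule.mem_comap]
    refine LinearMap.BilinForm.mem_orthogonal_iff.mpr fun y hy => ?_
    have h1 : a g (a g⁻¹ y) = y := by rw [← Module.End.mul_apply, ← map_mul]; simp
    change σ y (a g x) = 0
    rw [← h1, hinv]
    exact LinearMap.BilinForm.mem_orthogonal_iff.mp hx _ (D.neg_stable g⁻¹ hy)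
  · have hn : (σ.restrict D.neg).Nondegenerate := by
      have h1 : ∀ x : D.neg, (∀ y, σ.restrict D.neg x y = 0) → x = 0 := fun x hx => by
        by_contra h0
        exact (D.neg_def x x.2 (fun h => h0 (Subtype.ext h))).ne (hx x)
      exact ⟨h1, fun x hx => h1 x fun y => (hs.eq _ _).trans (hx y)⟩
    have := LinearMap.BilinForm.isCompl_orthogonal_of_restrict_nondegenerate hs.isRefl hn
    exact this.symm.sup_eq_top
  · by_contra hc
    obtain ⟨p, hp, n, hn, hpn⟩ := Submodule.mem_sup.mp (D.isCompl.sup_eq_top ▸ Submodule.mem_top :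
      x ∈ D.pos ⊔ D.neg)
    have hp' : p = x - n := by rw [← hpn]; abel
    have hnn : σ n n ≤ 0 := by
      by_cases h : n = 0
      · simp [h]
      · exact (D.neg_def n hn h).le
    have h1 : σ p p ≤ 0 := by
      rw [hp']
      have h2 := horth x hx n hn
      have h3 : σ n x = 0 := by rw [hs.eq, h2]
      simp only [map_sub, LinearMap.sub_apply, h2, h3]
      linarith [not_lt.mp hc]
    have hp0 : p = 0 := by
      by_contra h
      exact (D.pos_def p hp h).not_ge h1
    have hxn : x = n := by rw [← hpn, hp0, zero_add]
    have h2 := D.neg_def x (hxn ▸ hn) h0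
    rw [horth x hx x (hxn ▸ hn)] at h2
    exact lt_irrefl _ h2

lemma tensHerm_lTensor (ν : W →ₗ[ℂ] W →ₗ⋆[ℂ] ℂ) (σ : LinearMap.BilinForm ℝ M)
    (τ : LinearMap.BilinForm ℝ N) (φ : N →ₗ[ℝ] M) (c : ℝ)
    (h : ∀ x y, σ (φ x) (φ y) = c * τ x y) (x : W ⊗[ℝ] N) (y : W ⊗[ℝ] N) :
    tensHerm ν σ (LinearMap.lTensor W φ x) (LinearMap.lTensor W φ y) = c * tensHerm ν τ x y := by
  refine tensor_induction₂ (p := fun x y => tensHerm ν σ (LinearMap.lTensor W φ x)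
    (LinearMap.lTensor W φ y) = c * tensHerm ν τ x y)
    (fun y => ?_) (fun x => ?_) (fun x x' y h h' => ?_) (fun x y y' h h' => ?_)
    (fun w m w' m' => ?_) x y
  · rw [map_zero, tensHerm_zero_left, tensHerm_zero_left, mul_zero]
  · rw [map_zero, tensHerm_zero_right, tensHerm_zero_right, mul_zero]
  · rw [map_add, tensHerm_add_left, h, h', tensHerm_add_left, mul_add]
  · rw [map_add, tensHerm_add_right, h, h', tensHerm_add_right, mul_add]
  · rw [LinearMap.lTensor_tmul, LinearMap.lTensor_tmul, tensHerm_tmul, tensHerm_tmul, h]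
    simp [mul_assoc]

lemma tensHerm_lTensor_eq_zero (ν : W →ₗ[ℂ] W →ₗ⋆[ℂ] ℂ) (σ : LinearMap.BilinForm ℝ M)
    (φ : N →ₗ[ℝ] M) (φ' : N' →ₗ[ℝ] M) (h : ∀ x y, σ (φ x) (φ' y) = 0) (x : W ⊗[ℝ] N)
    (y : W ⊗[ℝ] N') :
    tensHerm ν σ (LinearMap.lTensor W φ x) (LinearMap.lTensor W φ' y) = 0 := by
  refine tensor_induction₂ (p := fun x y => tensHerm ν σ (LinearMap.lTensor W φ x)
    (LinearMap.lTensor W φ' y) = 0)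
    (fun y => ?_) (fun x => ?_) (fun x x' y h h' => ?_) (fun x y y' h h' => ?_)
    (fun w m w' m' => ?_) x y
  · rw [map_zero, tensHerm_zero_left]
  · rw [map_zero, tensHerm_zero_right]
  · rw [map_add, tensHerm_add_left, h, h', add_zero]
  · rw [map_add, tensHerm_add_right, h, h', add_zero]
  · rw [LinearMap.lTensor_tmul, LinearMap.lTensor_tmul, tensHerm_tmul, h, zero_smul]

lemma tensForm_isAlt {κ : LinearMap.BilinForm ℂ W} (halt : κ.IsAlt) {σ : LinearMap.BilinForm ℝ M}
    (hs : σ.IsSymm) : (tensForm ρ a κ σ).IsAlt := by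
  have key : ∀ x y : W ⊗[ℝ] M, LinearMap.BilinForm.tmul κ σ x y =
      -LinearMap.BilinForm.tmul κ σ y x := fun x y => by
    refine tensor_induction₂ (p := fun x y : W ⊗[ℝ] M => LinearMap.BilinForm.tmul κ σ x y =
      -LinearMap.BilinForm.tmul κ σ y x)
      (fun y => ?_) (fun x => ?_) (fun x x' y h h' => ?_) (fun x y y' h h' => ?_)
      (fun w m w' m' => ?_) x y
    · simp
    · simp
    · rw [map_add, LinearMap.add_apply, h, h', map_add, neg_add]
    · rw [map_add, map_add, LinearMap.add_apply, h, h', neg_add]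
    · have e1 := LinearMap.BilinForm.tensorDistrib_tmul ℝ ℂ κ σ w m w' m'
      have e2 := LinearMap.BilinForm.tensorDistrib_tmul ℝ ℂ κ σ w' m' w m
      refine e1.trans (Eq.trans ?_ (congrArg _ e2).symm)
      rw [hs.eq m m', ← LinearMap.IsAlt.neg halt w' w, smul_neg]
  intro x
  have h := key (x : W ⊗[ℝ] M) x
  change LinearMap.BilinForm.tmul κ σ (x : W ⊗[ℝ] M) x = 0
  linear_combination (1 / 2 : ℂ) * h

variable [Fintype G] [FiniteDimensional ℂ W] [FiniteDimensional ℝ M]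
  {J : W →ₛₗ[starRingEnd ℂ] W} {ν : W →ₗ[ℂ] W →ₗ⋆[ℂ] ℂ} {κ : LinearMap.BilinForm ℂ W}

/-- A basis of `(M ⊗ W)^G` which is adapted to the quaternionic structure and orthonormal up to
signs. -/
lemma SignDecomposition.exists_adapted {σ : LinearMap.BilinForm ℝ M} (D : SignDecomposition a σ)
    (hs : σ.IsSymm) (hinv : ∀ g x y, σ (a g x) (a g y) = σ x y) (hJ2 : ∀ x, J (J x) = -x)
    (hJ : ∀ g x, J (ρ g x) = ρ g (J x)) (hν : IsHermPos ν)
    (hνJ : ∀ x y, ν (J x) (J y) = conj (ν x y)) :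
    ∃ (n m : ℕ) (f : Basis ((Fin n ⊕ Fin m) × Fin 2) ℂ (inv ρ a)), D.nMinus ρ = 2 * m ∧
      IsAdapted (invJ hJ a) f ∧ ∀ x y, hermInv ρ a ν σ (f x) (f y) =
        if x = y then Sum.elim (fun _ => 1) (fun _ => -1) x.1 else 0 := by
  obtain ⟨U, hU, hUN, hUp, horth⟩ := D.exists_orthogonal hs hinv
  have herm : ∀ (V : Submodule ℝ M) (hV : ∀ g, V ≤ V.comap (a g)) (τ : LinearMap.BilinForm ℝ V),
      τ.IsSymm → (∀ x, x ≠ 0 → 0 < τ x x) →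
      ∃ (n : ℕ) (e : Basis (Fin n × Fin 2) ℂ (inv ρ (a.subrepresentation V hV))),
        IsOrthon (hermInv ρ (a.subrepresentation V hV) ν τ) e ∧
          IsAdapted (invJ hJ (a.subrepresentation V hV)) e := fun V hV τ hτ hτp =>
    IsHermPos.exists_adapted_basis
      ⟨fun x y => tensHerm_symm hν hτ _ _, fun x hx => tensHerm_pos hν hτ hτp
        (fun h => hx (Subtype.ext h))⟩ (invJ_invJ hJ2 hJ _) fun x y => tensHerm_tensJ hνJ τ _ _
  obtain ⟨n, e, he, heJ⟩ := herm U hU (σ.restrict U) ⟨fun x y => hs.eq _ _⟩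
    fun x hx => hUp x x.2 fun h => hx (Subtype.ext h)
  obtain ⟨m, e', he', heJ'⟩ := herm D.neg D.neg_stable (-σ.restrict D.neg)
    ⟨fun x y => congrArg Neg.neg (hs.eq _ _)⟩
    fun x hx => neg_pos.mpr (D.neg_def x x.2 fun h => hx (Subtype.ext h))
  let iU : inv ρ (a.subrepresentation U hU) →ₗ[ℂ] inv ρ a := invMap ρ U.subtype fun _ _ => rfl
  let iN : inv ρ (a.subrepresentation D.neg D.neg_stable) →ₗ[ℂ] inv ρ a :=
    invMap ρ D.neg.subtype fun _ _ => rfl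
  let v : (Fin n ⊕ Fin m) × Fin 2 → inv ρ a := fun x =>
    Sum.elim (fun i => iU (e (i, x.2))) (fun i => iN (e' (i, x.2))) x.1
  have hUU : ∀ x y, hermInv ρ a ν σ (iU x) (iU y) =
      hermInv ρ (a.subrepresentation U hU) ν (σ.restrict U) x y := fun x y => by
    refine (tensHerm_lTensor ν σ (σ.restrict U) U.subtype 1 (fun x y => (one_mul _).symm) _ _).trans
      ?_
    rw [Complex.ofReal_one, one_mul]
    rfl
  have hNN : ∀ x y, hermInv ρ a ν σ (iN x) (iN y) =
      -hermInv ρ (a.subrepresentation D.neg D.neg_stable) ν (-σ.restrict D.neg) x y :=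
    fun x y => by
    refine (tensHerm_lTensor ν σ (-σ.restrict D.neg) D.neg.subtype (-1) (fun x y => ?_) _ _).trans
      ?_
    · rw [neg_one_mul]
      exact (neg_neg _).symm
    · push_cast
      rw [neg_one_mul]
      rfl
  have hUN0 : ∀ x y, hermInv ρ a ν σ (iU x) (iN y) = 0 := fun x y =>
    tensHerm_lTensor_eq_zero ν σ U.subtype D.neg.subtype (fun x y => horth x x.2 y y.2) _ _
  have hNU0 : ∀ x y, hermInv ρ a ν σ (iN x) (iU y) = 0 := fun x y =>
    tensHerm_lTensor_eq_zero ν σ D.neg.subtype U.subtype (fun x y => by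
      rw [hs.eq]
      exact horth y y.2 x x.2) _ _
  have gram : ∀ x y, hermInv ρ a ν σ (v x) (v y) =
      if x = y then Sum.elim (fun _ => 1) (fun _ => -1) x.1 else 0 := by
    rintro ⟨x | x, k⟩ ⟨y | y, l⟩
    · change hermInv ρ a ν σ (iU (e (x, k))) (iU (e (y, l))) = _
      rw [hUU]
      by_cases h : (x, k) = (y, l)
      · rw [h, he.1]
        obtain ⟨rfl, rfl⟩ := Prod.mk.inj h
        simp
      · rw [he.2 _ _ h, if_neg]
        simpa using h
    · rw [if_neg (by simp)]
      exact hUN0 _ _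
    · rw [if_neg (by simp)]
      exact hNU0 _ _
    · change hermInv ρ a ν σ (iN (e' (x, k))) (iN (e' (y, l))) = _
      rw [hNN]
      by_cases h : (x, k) = (y, l)
      · rw [h, he'.1]
        obtain ⟨rfl, rfl⟩ := Prod.mk.inj h
        simp
      · rw [he'.2 _ _ h, if_neg, neg_zero]
        simpa using h
  have hli : LinearIndependent ℂ v := by
    rw [Fintype.linearIndependent_iff]
    intro c hc y
    have h1 := congrArg (fun z => hermInv ρ a ν σ z (v y)) hc
    simp only [map_sum, LinearMap.sum_apply, map_smul, LinearMap.smul_apply, gram, map_zero,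
      LinearMap.zero_apply, smul_eq_mul] at h1
    rw [Finset.sum_eq_single y (fun x _ hx => by rw [if_neg hx, mul_zero]) (by simp)] at h1
    rw [if_pos rfl] at h1
    rcases y with ⟨y | y, l⟩ <;> simpa using h1
  have hsplit : ∀ x : W ⊗[ℝ] M, ∃ (u : W ⊗[ℝ] U) (w : W ⊗[ℝ] D.neg),
      x = LinearMap.lTensor W U.subtype u + LinearMap.lTensor W D.neg.subtype w := fun x => by
    induction x with
    | zero => exact ⟨0, 0, by simp⟩
    | add x y hx hy =>
      obtain ⟨u, w, rfl⟩ := hx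
      obtain ⟨u', w', rfl⟩ := hy
      exact ⟨u + u', w + w', by rw [map_add, map_add]; abel⟩
    | tmul z t =>
      obtain ⟨p, hp, q, hq, rfl⟩ := Submodule.mem_sup.mp (hUN ▸ Submodule.mem_top : t ∈ U ⊔ D.neg)
      exact ⟨z ⊗ₜ ⟨p, hp⟩, z ⊗ₜ ⟨q, hq⟩, by
        rw [LinearMap.lTensor_tmul, LinearMap.lTensor_tmul, ← TensorProduct.tmul_add]
        rfl⟩
  have hspan : ⊤ ≤ Submodule.span ℂ (Set.range v) := by
    rintro x -
    obtain ⟨u, w, hx⟩ := hsplit (x : W ⊗[ℝ] M)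
    have h1 : x = iU (avg ρ _ u) + iN (avg ρ _ w) := by
      rw [← avg_coe x, hx, avg_add]
      exact congrArg₂ (· + ·) (invMap_avg _ _ _).symm (invMap_avg _ _ _).symm
    rw [h1, ← e.sum_repr (avg ρ _ u), ← e'.sum_repr (avg ρ _ w), map_sum, map_sum]
    refine add_mem (sum_mem fun k _ => ?_) (sum_mem fun k _ => ?_)
    · rw [map_smul]
      exact Submodule.smul_mem _ _ (Submodule.subset_span ⟨(.inl k.1, k.2), rfl⟩)
    · rw [map_smul]
      exact Submodule.smul_mem _ _ (Submodule.subset_span ⟨(.inr k.1, k.2), rfl⟩)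
  refine ⟨n, m, Basis.mk hli hspan, ?_, ?_, fun x y => ?_⟩
  · rw [SignDecomposition.nMinus, finrank_eq_card_basis e']
    simp [mul_comm]
  · rintro (x | x)
    · rw [Basis.mk_apply, Basis.mk_apply]
      refine Eq.trans ?_ (invJ_invMap hJ U.subtype (fun _ _ => rfl) (e (x, 0))).symm
      exact congrArg iU (heJ x)
    · rw [Basis.mk_apply, Basis.mk_apply]
      refine Eq.trans ?_ (invJ_invMap hJ D.neg.subtype (fun _ _ => rfl) (e' (x, 0))).symm
      exact congrArg iN (heJ' x)
  · rw [Basis.mk_apply, Basis.mk_apply, gram]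

/-- A hyperbolic basis of `(M ⊗ W)^G`, together with an adapted one. -/
lemma SignDecomposition.exists_hyperbolic {σ : LinearMap.BilinForm ℝ M} (D : SignDecomposition a σ)
    (hs : σ.IsSymm) (hinv : ∀ g x y, σ (a g x) (a g y) = σ x y) (hJ2 : ∀ x, J (J x) = -x)
    (hJ : ∀ g x, J (ρ g x) = ρ g (J x)) (hν : IsHermPos ν) (halt : κ.IsAlt)
    (hκ : ∀ x y, ν x y = κ x (J y)) :
    ∃ (n m : ℕ) (f f' : Basis ((Fin n ⊕ Fin m) × Fin 2) ℂ (inv ρ a)), D.nMinus ρ = 2 * m ∧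
      IsAdapted (invJ hJ a) f ∧ IsHyperbolic (tensForm ρ a κ σ) f' ∧ pdet f f' = (-1) ^ m ∧
      grB (hermInv ρ a ν σ) f' = 1 := by
  have hνJ : ∀ x y, ν (J x) (J y) = conj (ν x y) := fun x y => by
    rw [← hν.symm x y, hκ, hκ, hJ2, map_neg, LinearMap.IsAlt.neg halt]
  obtain ⟨n, m, f, hn, hf, gram⟩ := D.exists_adapted hs hinv hJ2 hJ hν hνJ
  let s : (Fin n ⊕ Fin m) × Fin 2 → ℂˣ := fun x =>
    if x.2 = 0 then 1 else Sum.elim (fun _ => 1) (fun _ => -1) x.1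
  have htf : ∀ x y, hermInv ρ a ν σ x y = tensForm ρ a κ σ x (invJ hJ a y) := fun x y =>
    tensHerm_eq_tmul hκ σ _ _
  have h0 : ∀ i, (f.unitsSMul s) (i, 0) = f (i, 0) := fun i => by
    rw [Basis.unitsSMul_apply]
    simp [s]
  have h1 : ∀ i, (f.unitsSMul s) (i, 1) =
      ((Sum.elim (fun _ => 1) (fun _ => -1) i : ℂˣ) : ℂ) • f (i, 1) := fun i => by
    rw [Basis.unitsSMul_apply]
    simp [s, Units.smul_def]
  have hd : pdet f (f.unitsSMul s) = (-1) ^ m := by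
    rw [pdet_eq_det _ _ (Equiv.refl _)]
    change f.det (f.unitsSMul s) = _
    rw [Basis.det_unitsSMul_self, Fintype.prod_prod_type]
    simp [s]
  refine ⟨n, m, f, f.unitsSMul s, hn, hf, ⟨tensForm_isAlt halt hs, fun i j => ?_, fun i j => ?_,
    fun i j => ?_⟩, hd, ?_⟩
  · have := gram (i, 0) (j, 1)
    rw [htf, hf j, invJ_invJ hJ2, map_neg, if_neg (by simp), neg_eq_zero] at this
    rw [h0, h0, this]
  · have := gram (i, 1) (j, 0)
    rw [htf, ← hf j, if_neg (by simp)] at this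
    rw [h1, h1, map_smul, map_smul, LinearMap.smul_apply, this, smul_zero, smul_zero]
  · have := gram (i, 0) (j, 0)
    rw [htf, ← hf j] at this
    rw [h0, h1, map_smul, this]
    by_cases hij : i = j
    · subst hij
      rcases i with i | i <;> simp
    · simp [hij]
  · rw [grB_basis _ f, ← norm_pdet, hd, grB_eq, gr]
    have : (Matrix.of fun x y => hermInv ρ a ν σ (f x) (f y)) =
        Matrix.diagonal fun x => Sum.elim (fun _ => 1) (fun _ => -1) x.1 := by
      ext x y
      rw [Matrix.of_apply, gram, Matrix.diagonal_apply]
    rw [this, Matrix.det_diagonal, Fintype.prod_prod_type]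
    simp

end SignBases

end

end HermClass

namespace HermClass

noncomputable section

/-! ### Pfaffians -/

section Pfaffian

open Module CategoryTheory

universe u v

variable {G : Type v} [Group G] [Fintype G]
  {P : CochainComplex (ModuleCat.{u} (MonoidAlgebra ℤ G)) ℤ}
  {W : Type*} [AddCommGroup W] [Module ℂ W] [FiniteDimensional ℂ W]
  {ρ : Representation ℂ G W} {X₀ X₁ Y₀ Y₁ Y Y' : Type*} [Finite X₀] [Finite X₁] [Finite Y₀]
  [Finite Y₁] [Finite Y] [Finite Y']

/-- The basis of `(H ⊗ W)^G` given by a splitting consisting of pairs. -/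
def Splitting.cls (S : Splitting P ρ (Fin 2)) (p : ℤ → Prop) :
    Basis ((Σ i : {i : ℤ // p i}, Fin (S.nH i)) × Fin 2) ℂ (inv ρ (cohSumRep P p)) :=
  (S.toG.basisCls p).reindex
    (Equiv.sigmaProdDistrib (fun i : {i : ℤ // p i} => Fin (S.nH i)) (Fin 2)).symm

omit [FiniteDimensional ℂ W] in
lemma Splitting.cls_apply (S : Splitting P ρ (Fin 2)) (p : ℤ → Prop)
    (x : (Σ i : {i : ℤ // p i}, Fin (S.nH i)) × Fin 2) :
    S.cls p x = classW P ρ p x.1.1 (S.z x.1.1 (x.1.2, x.2)) := by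
  rw [Splitting.cls, Basis.reindex_apply]
  exact S.toG.basisCls_eq p _

/-- The basis of `(P^i ⊗ W)^G` given by a basis of `W` consisting of pairs. -/
def LocalBases.basisPair (L : LocalBases P) (ρ : Representation ℂ G W) (w : Basis (Y × Fin 2) ℂ W)
    (i : ℤ) : Basis ((Fin (L.q i) × Y) × Fin 2) ℂ (inv ρ (termRep ℝ (P.X i))) :=
  (L.basisW ρ w i).reindex (Equiv.prodAssoc _ _ _).symm

omit [FiniteDimensional ℂ W] [Finite Y] in
lemma LocalBases.basisPair_apply (L : LocalBases P) (w : Basis (Y × Fin 2) ℂ W) (i : ℤ)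
    (x : (Fin (L.q i) × Y) × Fin 2) :
    L.basisPair ρ w i x = rG ρ i (L.a₀ i x.1.1) (w (x.1.2, x.2)) := by
  rw [LocalBases.basisPair, Basis.reindex_apply, LocalBases.basisW_apply]
  rfl

/-- The Pfaffian of `ξ(⊗_i (∧_{jn} r_G(a₀_j ⊗ w_n))^{(-1)^i})` for the forms with the hyperbolic
bases `e₀`, `e₁`. -/
def pfaff (L : LocalBases P) (S : Splitting P ρ (Fin 2)) (w : Basis (Y × Fin 2) ℂ W)
    (e₀ : Basis (X₀ × Fin 2) ℂ (inv ρ (cohSumRep P Even)))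
    (e₁ : Basis (X₁ × Fin 2) ℂ (inv ρ (cohSumRep P Odd))) : ℂ :=
  (∏ᶠ i : ℤ, pdet (S.c i) (L.basisPair ρ w i) ^ (i.negOnePow : ℤ)) *
    (pdet e₀ (S.cls Even) * (pdet e₁ (S.cls Odd))⁻¹)

omit [Finite Y] in
lemma pfaff_splitting (hP : IsPerfect P) (L : LocalBases P) (S S' : Splitting P ρ (Fin 2))
    (w : Basis (Y × Fin 2) ℂ W) (e₀ : Basis (X₀ × Fin 2) ℂ (inv ρ (cohSumRep P Even)))
    (e₁ : Basis (X₁ × Fin 2) ℂ (inv ρ (cohSumRep P Odd))) :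
    pfaff L S w e₀ e₁ = pfaff L S' w e₀ e₁ := by
  have hU : ∀ i, Nonempty (Fin (S.nU i) ≃ Fin (S'.nU i)) := fun i =>
    exists_pair_equiv (S.toG.basisQ i) (S'.toG.basisQ i)
  have hH : ∀ i, Nonempty (Fin (S.nH i) ≃ Fin (S'.nH i)) := fun i =>
    exists_pair_equiv (S.toG.basisH i) (S'.toG.basisH i)
  let eU := fun i => (hU i).some
  let eH := fun i => (hH i).some
  obtain ⟨N, hN⟩ := hP.bound ρ
  have hcls : ∀ p : ℤ → Prop, Finite (Σ i : {i : ℤ // p i}, Fin (S.nH i)) := fun p =>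
    have : Finite ((Σ i : {i : ℤ // p i}, Fin (S.nH i)) × Fin 2) :=
      have := hP.finite_inv_cohSum (ρ := ρ) p
      Module.Finite.finite_basis (S.cls p)
    Finite.prod_left (Fin 2)
  have hclsd : ∀ p : ℤ → Prop, detEquiv (S.toG.basisCls p) (S'.toG.basisCls p)
      (Equiv.sigmaCongrRight fun i : {i : ℤ // p i} => (eH i).prodCongr (Equiv.refl (Fin 2))) =
        pdet (S.cls p) (S'.cls p) := fun p => by
    have := hcls p
    rw [pdet_eq _ _ (Equiv.sigmaCongrRight fun i : {i : ℤ // p i} => eH i), Splitting.cls,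
      Splitting.cls, detEquiv_reindex_left, detEquiv_reindex_right]
    rfl
  have h1 := finprod_detEquiv hP S.toG S'.toG (fun i => (eU i).prodCongr (Equiv.refl (Fin 2)))
    (fun i => (eH i).prodCongr (Equiv.refl (Fin 2)))
  rw [hclsd, hclsd] at h1
  have h2 : ∀ i, pdet (S.c i) (L.basisPair ρ w i) ^ (i.negOnePow : ℤ) =
      detEquiv (S.toG.c i) (S'.toG.c i) (((eU (i - 1)).prodCongr (Equiv.refl (Fin 2))).sumCongr
        (((eH i).prodCongr (Equiv.refl (Fin 2))).sumCongr ((eU i).prodCongr (Equiv.refl _)))) ^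
          (i.negOnePow : ℤ) * pdet (S'.c i) (L.basisPair ρ w i) ^ (i.negOnePow : ℤ) := by
    intro i
    rw [← mul_zpow, ← pdet_trans (S.c i) (S'.c i),
      pdet_eq (S.c i) (S'.c i) ((eU (i - 1)).sumCongr ((eH i).sumCongr (eU i)))]
    congr 2
    change _ = detEquiv ((S.c i).reindex _) ((S'.c i).reindex _) _
    rw [detEquiv_reindex_left, detEquiv_reindex_right]
    congr 1
    ext ⟨x | x | x, k⟩ <;> rfl
  have := hcls Even
  have := hcls Odd
  rw [pfaff, pfaff, finprod_congr h2, finprod_mul_distrib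
    (mulSupport_zpow_finite (N := N) fun i hi => have := (hN i hi).1; detEquiv_of_subsingleton _ _ _)
    (mulSupport_zpow_finite (N := N) fun i hi => have := (hN i hi).1; pdet_of_subsingleton _ _), h1,
    ← pdet_trans e₀ (S.cls Even) (S'.cls Even), ← pdet_trans e₁ (S.cls Odd) (S'.cls Odd)]
  ring

omit [Finite Y'] [FiniteDimensional ℂ W] [Finite X₀] [Finite X₁] in
lemma pfaff_hyperbolic [DecidableEq Y] [DecidableEq Y'] (L : LocalBases P)
    (S : Splitting P ρ (Fin 2)) {κ : LinearMap.BilinForm ℂ W} {w : Basis (Y × Fin 2) ℂ W}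
    {w' : Basis (Y' × Fin 2) ℂ W} (hw : IsHyperbolic κ w) (hw' : IsHyperbolic κ w')
    (e₀ : Basis (X₀ × Fin 2) ℂ (inv ρ (cohSumRep P Even)))
    (e₁ : Basis (X₁ × Fin 2) ℂ (inv ρ (cohSumRep P Odd))) :
    pfaff L S w e₀ e₁ = pfaff L S w' e₀ e₁ := by
  rw [pfaff, pfaff]
  congr 1
  refine finprod_congr fun i => ?_
  congr 1
  have h : pdet (L.basisPair ρ w i) (L.basisPair ρ w' i) = 1 := by
    have h1 := pdet_piBasis (X := Fin (L.q i)) hw hw'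
    rw [← pdet_map _ _ (orbitEquiv ρ (termRep ℝ (P.X i))
      (fun j => changeCoeff (algebraMap ℚ ℝ) (P.X i) (L.a₀ i j))
      ((L.a₀_basis i).changeCoeff (algebraMap ℚ ℝ)).basis
      ((L.a₀_basis i).changeCoeff (algebraMap ℚ ℝ)).basis_apply)] at h1
    rw [← h1]
    congr 1
  rw [← pdet_trans (S.c i) (L.basisPair ρ w i) (L.basisPair ρ w' i), h, mul_one]

section Adapted

variable {J : W →ₛₗ[starRingEnd ℂ] W}

/-- A splitting adapted to a quaternionic structure. -/
lemma exists_adapted_splitting (hP : IsPerfect P) (hJ2 : ∀ x, J (J x) = -x)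
    (hJ : ∀ g x, J (ρ g x) = ρ g (J x)) : ∃ S : Splitting P ρ (Fin 2),
      (∀ i, IsAdapted (invJ hJ (termRep ℝ (P.X i))) (S.c i)) ∧
        ∀ p, IsAdapted (invJ hJ (cohSumRep P p)) (S.cls p) := by
  have := hP.finite_inv (ρ := ρ)
  have := hP.finite_inv_coh (ρ := ρ)
  have hd : ∀ i j x, invJ hJ _ (diffW P ρ i j x) = diffW P ρ i j (invJ hJ _ x) := fun i j x =>
    invJ_invMap hJ _ _ x
  let jQ : ∀ i, QW P ρ i →ₛₗ[starRingEnd ℂ] QW P ρ i := fun i =>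
    Submodule.mapQ _ _ (invJ hJ (termRep ℝ (P.X i))) fun x hx => by
      rw [Submodule.mem_comap, LinearMap.mem_ker, ← hd, LinearMap.mem_ker.mp hx, map_zero]
  have hjQ : ∀ i x, jQ i (jQ i x) = -x := fun i x => by
    obtain ⟨x, rfl⟩ := Submodule.Quotient.mk_surjective _ x
    exact congrArg (Submodule.Quotient.mk) (invJ_invJ hJ2 hJ _ x)
  choose nU y hy using fun i => exists_adapted_basis (hjQ i)
  choose nH h hh using fun i => exists_adapted_basis (invJ_invJ hJ2 hJ (cohRep P i))
  choose u hu using fun i k => Submodule.Quotient.mk_surjective _ (y i (k, 0))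
  choose z hz using fun i k => cohW_surjective (P := P) (ρ := ρ) i (h i (k, 0))
  have hcoh : ∀ i x, cohW P ρ i (invJ hJ _ x) = invJ hJ _ (cohW P ρ i x) := fun i x =>
    (invJ_invMap hJ _ _ x).symm
  obtain ⟨S, hSu, hSz⟩ := exists_gsplitting y h
    (fun i k => if k.2 = 0 then u i k.1 else invJ hJ _ (u i k.1)) (fun i k => by
      obtain ⟨k, l⟩ := k
      fin_cases l
      · exact hu i k
      · exact ((congrArg (jQ i) (hu i k)).trans (hy i k).symm))
    (fun i k => if k.2 = 0 then z i k.1 else invJ hJ _ (z i k.1)) (fun i k => by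
      obtain ⟨k, l⟩ := k
      fin_cases l
      · exact hz i k
      · exact (hcoh i (z i k)).trans ((congrArg _ (hz i k)).trans (hh i k).symm))
  have hSu' : ∀ i k, S.u i (k, 1) = invJ hJ _ (S.u i (k, 0)) := fun i k => by rw [hSu]; rfl
  have hSz' : ∀ i k, S.z i (k, 1) = invJ hJ _ (S.z i (k, 0)) := fun i k => by rw [hSz]; rfl
  have hcoc : ∀ i x, invJ hJ _ (cocyclesW P ρ i x) = cocyclesW P ρ i (invJ hJ _ x) := fun i x =>
    invJ_invMap hJ (cocycles P i).subtype (fun _ _ => rfl) x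
  have hcl : ∀ (p : ℤ → Prop) (i : {i : ℤ // p i}) (x : inv ρ (cocyclesRep P i)),
      invJ hJ _ (classW P ρ p i x) = classW P ρ p i (invJ hJ _ x) := fun p i x =>
    invJ_invMap hJ (toCohSum P p i) (toCohSum_comm P p i) x
  refine ⟨S.toSplitting, fun i x => ?_, fun p x => ?_⟩
  · obtain x | x | x := x
    · rw [S.toSplitting.c_B, S.toSplitting.c_B, hd]
      exact congrArg _ (hSu' _ _)
    · rw [S.toSplitting.c_H, S.toSplitting.c_H, hcoc]
      exact congrArg _ (hSz' _ _)
    · rw [S.toSplitting.c_U, S.toSplitting.c_U]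
      exact hSu' _ _
  · rw [Splitting.cls_apply, Splitting.cls_apply, hcl]
    exact congrArg _ (hSz' _ _)

variable {ν : W →ₗ[ℂ] W →ₗ⋆[ℂ] ℂ} {κ : LinearMap.BilinForm ℂ W}

omit [FiniteDimensional ℂ W] [Finite Y] in
lemma LocalBases.isAdapted_basisPair (L : LocalBases P) (hJ : ∀ g x, J (ρ g x) = ρ g (J x))
    {w : Basis (Y × Fin 2) ℂ W} (hw : IsAdapted J w) (i : ℤ) :
    IsAdapted (invJ hJ (termRep ℝ (P.X i))) (L.basisPair ρ w i) := fun x => by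
  rw [LocalBases.basisPair_apply, LocalBases.basisPair_apply]
  refine Eq.trans ?_ (invJ_sumOrbit hJ _ _ _).symm
  exact congrArg (fun v => rG ρ i (L.a₀ i x.1) v) (hw x.2)

omit [FiniteDimensional ℂ W] in
lemma pdet_cls_eq (S : Splitting P ρ (Fin 2)) {p : ℤ → Prop} [DecidableEq X₀]
    {σ : LinearMap.BilinForm ℝ (cohSum P p)} {n m : ℕ} (hJ2 : ∀ x, J (J x) = -x)
    (hJ : ∀ g x, J (ρ g x) = ρ g (J x)) {e : Basis (X₀ × Fin 2) ℂ (inv ρ (cohSumRep P p))}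
    {f f' : Basis ((Fin n ⊕ Fin m) × Fin 2) ℂ (inv ρ (cohSumRep P p))}
    (he : IsHyperbolic (tensForm ρ (cohSumRep P p) κ σ) e)
    (hf : IsAdapted (invJ hJ (cohSumRep P p)) f) (hS : IsAdapted (invJ hJ (cohSumRep P p)) (S.cls p))
    (hf' : IsHyperbolic (tensForm ρ (cohSumRep P p) κ σ) f') (hd : pdet f f' = (-1) ^ m)
    (hg : grB (hermInv ρ (cohSumRep P p) ν σ) f' = 1) : pdet e (S.cls p) =
      (-1) ^ m * ((√(grB (hermInv ρ (cohSumRep P p) ν σ) (S.toG.basisCls p)) : ℝ) : ℂ) := by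
  obtain ⟨r, hr, hr'⟩ := pdet_adapted_pos (invJ_invJ hJ2 hJ _) f (S.cls p) hf hS
  have h1 : pdet f' f = (-1) ^ m := by
    have h2 := pdet_trans f' f f'
    rw [pdet_hyperbolic hf' hf', hd] at h2
    calc pdet f' f = pdet f' f * ((-1) ^ m * (-1) ^ m) := by
          rw [← mul_pow]; simp
      _ = (-1) ^ m := by rw [← mul_assoc, h2, one_mul]
  have h2 : pdet e (S.cls p) = (-1) ^ m * r := by
    rw [← pdet_trans e f' (S.cls p), pdet_hyperbolic he hf', one_mul,
      ← pdet_trans f' f (S.cls p), h1, hr']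
  have h3 : grB (hermInv ρ (cohSumRep P p) ν σ) (S.toG.basisCls p) = r ^ 2 := by
    rw [grB_basis _ f', hg, mul_one]
    congr 1
    have : vol f' (S.cls p) = vol f' (S.toG.basisCls p) := vol_reindex_right _ _ _
    rw [← this, ← norm_pdet, ← pdet_trans f' f (S.cls p), h1, hr', norm_mul, norm_pow, norm_neg,
      norm_one, one_pow, one_mul, Complex.norm_real, Real.norm_of_nonneg hr.le]
  rw [h2, h3, Real.sqrt_sq hr.le]

/-- The Pfaffian as a signed length. -/
lemma pfaff_eq (hP : IsPerfect P) (σ : SymForms P) (L : LocalBases P) (S : Splitting P ρ (Fin 2))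
    [DecidableEq Y] [DecidableEq X₀] [DecidableEq X₁]
    (hJ2 : ∀ x, J (J x) = -x) (hJ : ∀ g x, J (ρ g x) = ρ g (J x)) (hν : IsHermPos ν)
    (halt : κ.IsAlt) (hκ : ∀ x y, ν x y = κ x (J y)) (hi : ∀ g x y, κ (ρ g x) (ρ g y) = κ x y)
    {w : Basis (Y × Fin 2) ℂ W} (hw : IsHyperbolic κ w)
    {e₀ : Basis (X₀ × Fin 2) ℂ (inv ρ (cohSumRep P Even))}
    {e₁ : Basis (X₁ × Fin 2) ℂ (inv ρ (cohSumRep P Odd))}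
    (he₀ : IsHyperbolic (tensForm ρ (cohSumRep P Even) κ σ.ev) e₀)
    (he₁ : IsHyperbolic (tensForm ρ (cohSumRep P Odd) κ σ.odd) e₁)
    (D₀ : SignDecomposition (cohSumRep P Even) σ.ev)
    (D₁ : SignDecomposition (cohSumRep P Odd) σ.odd) :
    pfaff L S w e₀ e₁ = Complex.I ^ ((D₀.nMinus ρ : ℤ) - (D₁.nMinus ρ : ℤ)) *
      metRep ρ σ L hP := by
  have := hP.finite_cohSum Even
  have := hP.finite_cohSum Odd
  have hνJ : ∀ x y, ν (J x) (J y) = conj (ν x y) := fun x y => by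
    rw [← hν.symm x y, hκ, hκ, hJ2, map_neg, LinearMap.IsAlt.neg halt]
  have hνi : ∀ g x y, ν (ρ g x) (ρ g y) = ν x y := fun g x y => by rw [hκ, hJ, hi, hκ]
  obtain ⟨n, w', hw', hw'J⟩ := hν.exists_adapted_basis hJ2 hνJ
  obtain ⟨S', hc, hcls⟩ := exists_adapted_splitting hP hJ2 hJ
  obtain ⟨n₀, m₀, f₀, f₀', hn₀, hf₀, hf₀', hd₀, hg₀⟩ :=
    D₀.exists_hyperbolic σ.ev_symm σ.ev_inv hJ2 hJ hν halt hκ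
  obtain ⟨n₁, m₁, f₁, f₁', hn₁, hf₁, hf₁', hd₁, hg₁⟩ :=
    D₁.exists_hyperbolic σ.odd_symm σ.odd_inv hJ2 hJ hν halt hκ
  have hfin : ∀ p : ℤ → Prop, Finite (Σ i : {i : ℤ // p i}, Fin (S'.nH i)) := fun p =>
    have : Finite ((Σ i : {i : ℤ // p i}, Fin (S'.nH i)) × Fin 2) :=
      have := hP.finite_inv_cohSum (ρ := ρ) p
      Module.Finite.finite_basis (S'.cls p)
    Finite.prod_left (Fin 2)
  have := hfin Even
  have := hfin Odd
  rw [pfaff_splitting hP L S S', pfaff_hyperbolic L S' hw (hw'.isHyperbolic hJ2 halt hκ hw'J),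
    ← metRep_eq σ L hP S'.toG hν hνi hw', pfaff, met]
  rw [pdet_cls_eq S' hJ2 hJ he₀ hf₀ (hcls Even) hf₀' hd₀ hg₀,
    pdet_cls_eq S' hJ2 hJ he₁ hf₁ (hcls Odd) hf₁' hd₁ hg₁, hn₀, hn₁]
  have hI : ∀ m : ℕ, Complex.I ^ ((2 * m : ℕ) : ℤ) = (-1) ^ m := fun m => by
    rw [zpow_natCast, pow_mul, Complex.I_sq]
  rw [zpow_sub₀ Complex.I_ne_zero, hI, hI, Real.sqrt_div (by
    rw [grB_basis _ f₀', hg₀]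
    positivity)]
  obtain ⟨N, hN⟩ := hP.bound ρ
  have hterm : ∀ i, pdet (S'.c i) (L.basisPair ρ w' i) =
      ((vol (S'.toG.c i) (L.basisW ρ w' i) : ℝ) : ℂ) := fun i => by
    obtain ⟨r, hr, hr'⟩ := pdet_adapted_pos (invJ_invJ hJ2 hJ _) (S'.c i) (L.basisPair ρ w' i)
      (hc i) (L.isAdapted_basisPair hJ hw'J i)
    have h1 : vol (S'.c i) (L.basisPair ρ w' i) = vol (S'.toG.c i) (L.basisW ρ w' i) := by
      change _ = vol ((S'.c i).reindex _) _
      rw [vol_reindex_left]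
      exact vol_reindex_right _ _ _
    rw [← h1, ← norm_pdet, hr', Complex.norm_real, Real.norm_of_nonneg hr.le]
  have hprod : (∏ᶠ i : ℤ, pdet (S'.c i) (L.basisPair ρ w' i) ^ (i.negOnePow : ℤ)) =
      ((∏ᶠ i : ℤ, vol (S'.toG.c i) (L.basisW ρ w' i) ^ (i.negOnePow : ℤ) : ℝ) : ℂ) := by
    refine Eq.trans ?_ (MonoidHom.map_finprod (Complex.ofRealHom : ℝ →* ℂ)
      (mulSupport_zpow_finite' (N := N) fun i hi => have := (hN i hi).1
        vol_of_subsingleton _ _)).symm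
    refine finprod_congr fun i => ?_
    rw [hterm]
    exact (map_zpow₀ Complex.ofRealHom _ _).symm
  rw [hprod]
  push_cast
  rw [mul_inv]
  ring

end Adapted

/-- Uniqueness of the Pfaffian. -/
lemma IsPfaffianValue.eq (hP : IsPerfect P) {σ : SymForms P} {L : LocalBases P} {r : ℂ}
    (h : IsPfaffianValue σ L ρ r) (D₀ : SignDecomposition (cohSumRep P Even) σ.ev)
    (D₁ : SignDecomposition (cohSumRep P Odd) σ.odd) :
    r = Complex.I ^ ((D₀.nMinus ρ : ℤ) - (D₁.nMinus ρ : ℤ)) * metRep ρ σ L hP := by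
  obtain ⟨κ, hi, n, w, hw, S, ε, N₀, N₁, τ₀, τ₁, e₀, e₁, he₀, he₁, rfl⟩ := h
  obtain ⟨J, ν, hJ2, hJ, hν, hκ⟩ := exists_quaternionic ρ κ hw.alt hw.nondeg hi
  rw [← pfaff_eq hP σ L S hJ2 hJ hν hw.alt hκ hi hw he₀ he₁ D₀ D₁, pfaff]
  congr 1
  · refine finprod_congr fun i => ?_
    rw [pdet_eq_det _ _ (ε i), Splitting.delta]
    congr 2
    ext x
    rw [LocalBases.basisPair_apply]
  · rw [pdet_eq_det _ _ τ₀, pdet_eq_det _ _ τ₁]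
    congr 3
    · ext x
      rw [Splitting.cls_apply]
      rfl
    · ext x
      rw [Splitting.cls_apply]
      rfl

/-- Existence of the Pfaffian. -/
lemma exists_isPfaffianValue (hP : IsPerfect P) (σ : SymForms P) (L : LocalBases P)
    (h : IsSymplectic ρ) : ∃ r, IsPfaffianValue σ L ρ r := by
  have := hP.finite_cohSum Even
  have := hP.finite_cohSum Odd
  obtain ⟨κ, halt, hn, hi⟩ := h
  obtain ⟨J, ν, hJ2, hJ, hν, hκ⟩ := exists_quaternionic ρ κ halt hn.2 hi
  have hνJ : ∀ x y, ν (J x) (J y) = conj (ν x y) := fun x y => by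
    rw [← hν.symm x y, hκ, hκ, hJ2, map_neg, LinearMap.IsAlt.neg halt]
  obtain ⟨n, w, hw, hwJ⟩ := hν.exists_adapted_basis hJ2 hνJ
  obtain ⟨S, -, -⟩ := exists_adapted_splitting hP hJ2 hJ
  obtain ⟨D₀⟩ := signDecomposition_nonempty _ _ σ.ev_symm σ.ev_nondeg σ.ev_inv
  obtain ⟨D₁⟩ := signDecomposition_nonempty _ _ σ.odd_symm σ.odd_nondeg σ.odd_inv
  obtain ⟨n₀, m₀, -, f₀, -, -, hf₀, -, -⟩ :=
    D₀.exists_hyperbolic σ.ev_symm σ.ev_inv hJ2 hJ hν halt hκ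
  obtain ⟨n₁, m₁, -, f₁, -, -, hf₁, -, -⟩ :=
    D₁.exists_hyperbolic σ.odd_symm σ.odd_inv hJ2 hJ hν halt hκ
  let e₀ := f₀.reindex (finSumFinEquiv.prodCongr (Equiv.refl (Fin 2)))
  let e₁ := f₁.reindex (finSumFinEquiv.prodCongr (Equiv.refl (Fin 2)))
  exact ⟨_, κ, hi, n, w, hw.isHyperbolic hJ2 halt hκ hwJ, S,
    fun i => (exists_pair_equiv (S.c i) (L.basisPair ρ w i)).some, _, _,
    (exists_pair_equiv e₀ (S.cls Even)).some, (exists_pair_equiv e₁ (S.cls Odd)).some, e₀, e₁,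
    hf₀.reindex _, hf₁.reindex _, rfl⟩

end Pfaffian

end

end HermClass

namespace HermClass

noncomputable section

/-! ### Simple ideals of the group ring -/

section SimpleIdeals

open Module

variable {R : Type*} [Ring R] [IsSemisimpleRing R]

omit [IsSemisimpleRing R] in
lemma isotypicComponent_isTwoSided (S : Ideal R) [IsSimpleModule R S] :
    Ideal.IsTwoSided (isotypicComponent R R S) :=
  isFullyInvariant_iff_isTwoSided.mp (.isotypicComponent R R S)

lemma TwoSidedIdeal.isotypicComponent_le (V : TwoSidedIdeal R) {S : Ideal R} (hS : IsAtom S)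
    (h : S ≤ V.asIdeal) : isotypicComponent R R S ≤ V.asIdeal :=
  have := isSimpleModule_iff_isAtom.mpr hS
  isFullyInvariant_iff_le_imp_isotypicComponent_le.mp
    (isFullyInvariant_iff_isTwoSided.mpr inferInstance) S h

omit [IsSemisimpleRing R] in
lemma TwoSidedIdeal.le_of_asIdeal_le {V V' : TwoSidedIdeal R} (h : V.asIdeal ≤ V'.asIdeal) :
    V ≤ V' := fun _ hx => TwoSidedIdeal.mem_asIdeal.mp (h (TwoSidedIdeal.mem_asIdeal.mpr hx))

lemma asIdeal_eq_isotypicComponent {V : TwoSidedIdeal R} (hV : IsAtom V) {S : Ideal R}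
    (hS : IsAtom S) (h : S ≤ V.asIdeal) : V.asIdeal = isotypicComponent R R S := by
  have := isSimpleModule_iff_isAtom.mpr hS
  have := isotypicComponent_isTwoSided S
  have hle := TwoSidedIdeal.isotypicComponent_le V hS h
  have h1 : Ideal.toTwoSided (isotypicComponent R R S) ≤ V :=
    TwoSidedIdeal.le_of_asIdeal_le (by rwa [Ideal.asIdeal_toTwoSided])
  rcases hV.le_iff.mp h1 with h2 | h2
  · have h3 := congrArg TwoSidedIdeal.asIdeal h2
    rw [Ideal.asIdeal_toTwoSided] at h3
    exact ((bot_lt_isotypicComponent S).ne' h3).elim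
  · have h3 := congrArg TwoSidedIdeal.asIdeal h2
    rw [Ideal.asIdeal_toTwoSided] at h3
    exact h3.symm

/-- Every simple left ideal is contained in a simple two-sided ideal. -/
lemma exists_isAtom_twoSidedIdeal {S : Ideal R} (hS : IsAtom S) :
    ∃ V : TwoSidedIdeal R, IsAtom V ∧ S ≤ V.asIdeal := by
  have := isSimpleModule_iff_isAtom.mpr hS
  have := isotypicComponent_isTwoSided S
  refine ⟨Ideal.toTwoSided (isotypicComponent R R S), ⟨fun h => ?_, fun b hb => ?_⟩, ?_⟩
  · have h3 := congrArg TwoSidedIdeal.asIdeal h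
    rw [Ideal.asIdeal_toTwoSided] at h3
    exact (bot_lt_isotypicComponent S).ne' h3
  · rcases IsSemisimpleModule.eq_bot_or_exists_simple_le b.asIdeal with h | ⟨T, hT, hTs⟩
    · exact le_bot_iff.mp (TwoSidedIdeal.le_of_asIdeal_le h.le)
    · have hTI : T ≤ isotypicComponent R R S := by
        refine hT.trans ?_
        rw [← Ideal.asIdeal_toTwoSided (isotypicComponent R R S)]
        exact TwoSidedIdeal.asIdeal.monotone hb.le
      obtain ⟨e⟩ := isIsotypicOfType_submodule_iff.mp (.isotypicComponent R R S) T hTI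
      have h1 := TwoSidedIdeal.isotypicComponent_le b (isSimpleModule_iff_isAtom.mp hTs) hT
      rw [e.isotypicComponent_eq] at h1
      refine (hb.not_ge (TwoSidedIdeal.le_of_asIdeal_le ?_)).elim
      rwa [Ideal.asIdeal_toTwoSided]
  · rw [Ideal.asIdeal_toTwoSided]
    exact S.le_isotypicComponent

variable {G : Type*} [Group G] [Fintype G]

instance : IsSemisimpleRing (MonoidAlgebra ℂ G) :=
  have : NeZero (Nat.card G : ℂ) := ⟨by simp⟩
  inferInstance

omit [Fintype G] in
lemma idealRep_apply (V : Ideal (MonoidAlgebra ℂ G)) (g : G) (x : V) :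
    idealRep V g x = MonoidAlgebra.single g (1 : ℂ) • x := rfl

instance (V : Ideal (MonoidAlgebra ℂ G)) : FiniteDimensional ℂ V :=
  have : FiniteDimensional ℂ (MonoidAlgebra ℂ G) := inferInstance
  inferInstanceAs (FiniteDimensional ℂ (V.restrictScalars ℂ))

omit [Fintype G] in
lemma finrank_end_simple [Finite G] (S : Ideal (MonoidAlgebra ℂ G))
    [IsSimpleModule (MonoidAlgebra ℂ G) S] :
    finrank ℂ (Module.End (MonoidAlgebra ℂ G) S) = 1 := by
  have := Fintype.ofFinite G
  have h := IsSimpleModule.algebraMap_end_bijective_of_isAlgClosed (A := MonoidAlgebra ℂ G)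
    (V := S) ℂ
  rw [← (LinearEquiv.ofBijective (Algebra.linearMap ℂ (Module.End (MonoidAlgebra ℂ G) S))
    h).finrank_eq, finrank_self]

lemma finrank_eq_of_isotypic {S : Ideal (MonoidAlgebra ℂ G)} (hS : IsAtom S)
    {V : Ideal (MonoidAlgebra ℂ G)} (hV : V = isotypicComponent _ _ S) {n : ℕ}
    (e : V ≃ₗ[MonoidAlgebra ℂ G] (Fin n → S)) : n = finrank ℂ S := by
  have := isSimpleModule_iff_isAtom.mpr hS
  let φ : S →ₗ[ℂ] (V →ₗ[MonoidAlgebra ℂ G] S) :=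
    { toFun := fun s => (LinearMap.toSpanSingleton _ _ s).comp V.subtype
      map_add' := fun s t => by ext x; simp
      map_smul' := fun c s => by
        ext x
        simp only [LinearMap.comp_apply, LinearMap.smul_apply, LinearMap.toSpanSingleton_apply,
          RingHom.id_apply]
        rw [smul_comm] }
  have hφ : ∀ s x, φ s x = (x : MonoidAlgebra ℂ G) • s := fun _ _ => rfl
  obtain ⟨C, hC⟩ := exists_isCompl V
  have hinj : Function.Injective φ := by
    refine (injective_iff_map_eq_zero φ).mpr fun s hs => ?_
    let f : C →ₗ[MonoidAlgebra ℂ G] S := (LinearMap.toSpanSingleton _ _ s).comp C.subtype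
    have hf : f = 0 := by
      by_contra h0
      obtain ⟨K, hK⟩ := exists_isCompl (LinearMap.ker f)
      have hsurj : LinearMap.range f = ⊤ :=
        (eq_bot_or_eq_top _).resolve_left fun h => h0 (LinearMap.range_eq_bot.mp h)
      let e₁ : K ≃ₗ[MonoidAlgebra ℂ G] S := (Submodule.quotientEquivOfIsCompl _ _ hK).symm.trans
        (f.quotKerEquivOfSurjective (LinearMap.range_eq_top.mp hsurj))
      let e₂ := K.equivMapOfInjective C.subtype C.subtype_injective
      have h1 : K.map C.subtype ≤ V := by
        rw [hV]
        exact le_sSup ⟨e₂.symm.trans e₁⟩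
      have h2 : K.map C.subtype = ⊥ := le_bot_iff.mp (hC.inf_eq_bot ▸
        le_inf h1 (Submodule.map_subtype_le _ _))
      have h3 : Subsingleton (K.map C.subtype) := by rw [h2]; infer_instance
      have h4 : Subsingleton S := (e₂.symm.trans e₁).symm.toEquiv.subsingleton
      have := IsSimpleModule.nontrivial (MonoidAlgebra ℂ G) S
      exact not_subsingleton S h4
    obtain ⟨v, hv, c, hc, hvc⟩ := Submodule.mem_sup.mp
      (hC.sup_eq_top ▸ Submodule.mem_top : (1 : MonoidAlgebra ℂ G) ∈ V ⊔ C)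
    rw [← one_smul (MonoidAlgebra ℂ G) s, ← hvc, add_smul]
    have h1 : v • s = 0 := LinearMap.congr_fun hs ⟨v, hv⟩
    have h2 : c • s = 0 := LinearMap.congr_fun hf ⟨c, hc⟩
    rw [h1, h2, add_zero]
  have hsur : Function.Surjective φ := fun f => by
    obtain ⟨h, hh⟩ := IsSemisimpleModule.extension_property V.subtype V.subtype_injective f
    refine ⟨h 1, LinearMap.ext fun x => ?_⟩
    rw [hφ, ← map_smul, smul_eq_mul, mul_one, ← hh]
    rfl
  have h1 := (LinearEquiv.ofBijective φ ⟨hinj, hsur⟩).finrank_eq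
  have h2 := (LinearEquiv.congrLeft S ℂ e).finrank_eq
  have h3 := (LinearMap.lsum (MonoidAlgebra ℂ G) (fun _ : Fin n => S) (M := S) ℂ).finrank_eq
  have h4 : finrank ℂ (S →ₗ[MonoidAlgebra ℂ G] S) = 1 := finrank_end_simple S
  have hfree : Module.Free ℂ (S →ₗ[MonoidAlgebra ℂ G] S) :=
    Module.Free.of_divisionRing ℂ (S →ₗ[MonoidAlgebra ℂ G] S)
  have : Module.Finite ℂ (S →ₗ[MonoidAlgebra ℂ G] S) := Module.finite_of_finrank_eq_succ h4
  rw [finrank_pi_fintype, Finset.sum_const, h4] at h3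
  simp only [Finset.card_univ, Fintype.card_fin, smul_eq_mul, mul_one] at h3
  rw [h1, h2, ← h3]

omit [Fintype G] in
lemma trace_pi {S : Type*} [AddCommGroup S] [Module ℂ S] [FiniteDimensional ℂ S] {n : ℕ}
    (f : S →ₗ[ℂ] S) : LinearMap.trace ℂ (Fin n → S)
      (LinearMap.pi fun i => f ∘ₗ LinearMap.proj i) = n * LinearMap.trace ℂ S f := by
  have h : (LinearMap.pi fun i => f ∘ₗ LinearMap.proj i : (Fin n → S) →ₗ[ℂ] (Fin n → S)) =
      ∑ i, LinearMap.single ℂ (fun _ : Fin n => S) i ∘ₗ (f ∘ₗ LinearMap.proj i) := by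
    ext i x j
    simp [Pi.single_apply, apply_ite f]
  rw [h, map_sum]
  have h2 : ∀ i, LinearMap.trace ℂ (Fin n → S)
      (LinearMap.single ℂ (fun _ : Fin n => S) i ∘ₗ (f ∘ₗ LinearMap.proj i)) =
        LinearMap.trace ℂ S f := fun i => by
    rw [LinearMap.trace_comp_comm', LinearMap.comp_assoc, LinearMap.proj_comp_single_same,
      LinearMap.comp_id]
  simp [h2]

/-- The character of a simple two-sided ideal. -/
lemma trace_idealRep_asIdeal {V : TwoSidedIdeal (MonoidAlgebra ℂ G)} (hV : IsAtom V)
    {S : Ideal (MonoidAlgebra ℂ G)} (hS : IsAtom S) (h : S ≤ V.asIdeal) (g : G) :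
    LinearMap.trace ℂ V.asIdeal (idealRep V.asIdeal g) =
      finrank ℂ S * LinearMap.trace ℂ S (idealRep S g) := by
  have := isSimpleModule_iff_isAtom.mpr hS
  have hVS := asIdeal_eq_isotypicComponent hV hS h
  have : Module.Finite (MonoidAlgebra ℂ G) V.asIdeal := inferInstance
  have hiso : IsIsotypicOfType (MonoidAlgebra ℂ G) V.asIdeal S := by
    rw [hVS]
    exact .isotypicComponent _ _ S
  obtain ⟨n, ⟨e⟩⟩ := hiso.linearEquiv_fun
  rw [← finrank_eq_of_isotypic hS hVS e, ← trace_pi,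
    ← LinearMap.trace_conj' _ (e.restrictScalars ℂ)]
  congr 1
  refine LinearMap.ext fun x => funext fun i => ?_
  rw [LinearEquiv.conj_apply_apply]
  simp only [LinearEquiv.restrictScalars_apply, idealRep_apply, LinearMap.pi_apply,
    LinearMap.comp_apply, LinearMap.proj_apply]
  change e (_ • e.symm (_ : Fin n → S)) i = _
  rw [map_smul, e.apply_symm_apply]
  rfl

/-- A homomorphism on `R_G` is determined by its values on the complex conjugates of the
characters of the simple left ideals of `ℂ[G]`. -/
lemma hom_ext_simple {A : Type*} [CommGroup A] {f f' : Multiplicative (RG G) →* A}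
    (h : ∀ (S : Ideal (MonoidAlgebra ℂ G)) (ψ : RG G), IsAtom S →
      (∀ g, (ψ : G → ℂ) g = conj (LinearMap.trace ℂ S (idealRep S g))) →
        f (.ofAdd ψ) = f' (.ofAdd ψ)) : f = f' := by
  have hmem : ∀ {W : Type} [AddCommGroup W] [Module ℂ W] [FiniteDimensional ℂ W]
      (ρ : Representation ℂ G W), IsChar G fun g => conj (LinearMap.trace ℂ W (ρ g)) :=
    fun {W} _ _ _ ρ => by
      have := isChar_of_mat ((starRingEnd ℂ).mapMatrix.toMonoidHom.comp
        (repMat ρ (finBasis ℂ W)))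
      convert this using 2 with g
      rw [← trace_repMat ρ (finBasis ℂ W)]
      exact AddMonoidHom.map_trace (starRingEnd ℂ).toAddMonoidHom _
  have main : ∀ (n : ℕ) {W : Type} [AddCommGroup W] [Module ℂ W] [FiniteDimensional ℂ W]
      (ρ : Representation ℂ G W) (ψ : RG G), finrank ℂ W = n →
      (∀ g, (ψ : G → ℂ) g = conj (LinearMap.trace ℂ W (ρ g))) → f (.ofAdd ψ) = f' (.ofAdd ψ) := by
    intro n
    induction n using Nat.strong_induction_on with
    | _ n ih =>
    intro W _ _ _ ρ ψ hn hψ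
    have : IsSemisimpleModule (MonoidAlgebra ℂ G) ρ.asModule := inferInstance
    rcases IsSemisimpleModule.eq_bot_or_exists_simple_le (R := MonoidAlgebra ℂ G)
      (⊤ : Submodule (MonoidAlgebra ℂ G) ρ.asModule) with h0 | ⟨N, -, hN⟩
    · have hW : Subsingleton W :=
        (Submodule.subsingleton_iff (MonoidAlgebra ℂ G) (M := ρ.asModule)).mp
          (subsingleton_of_bot_eq_top h0.symm)
      have : ψ = 0 := by
        refine Subtype.ext (funext fun g => ?_)
        rw [hψ, Subsingleton.elim (ρ g) 0, map_zero, map_zero]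
        rfl
      rw [this, ofAdd_zero, map_one, map_one]
    · let U : Submodule ℂ W := (N.restrictScalars ℂ).map ρ.asModuleEquiv.toLinearMap
      have hg : ∀ g (x : ρ.asModule), ρ.asModuleEquiv (MonoidAlgebra.single g (1 : ℂ) • x) =
          ρ g (ρ.asModuleEquiv x) := fun g x => by
        rw [Representation.asModuleEquiv_map_smul, Representation.asAlgebraHom_single_one]
      have hU : ∀ g, U ≤ U.comap (ρ g) := by
        rintro g _ ⟨x, hx, rfl⟩
        exact ⟨MonoidAlgebra.single g (1 : ℂ) • x, N.smul_mem _ hx, hg g x⟩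
      obtain ⟨U', hU', hUU'⟩ := exists_invariant_isCompl ρ U hU
      -- the simple submodule is isomorphic to a simple left ideal
      have := IsSimpleModule.nontrivial (MonoidAlgebra ℂ G) N
      obtain ⟨x, hx⟩ := exists_ne (0 : N)
      let t := LinearMap.toSpanSingleton (MonoidAlgebra ℂ G) N x
      obtain ⟨S, hS⟩ := exists_isCompl (LinearMap.ker t)
      have ht : LinearMap.range t = ⊤ := (eq_bot_or_eq_top _).resolve_left fun h => hx (by
        have := LinearMap.congr_fun (LinearMap.range_eq_bot.mp h) 1
        simpa [t] using this)
      let e : S ≃ₗ[MonoidAlgebra ℂ G] N := (Submodule.quotientEquivOfIsCompl _ _ hS).symm.trans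
        (t.quotKerEquivOfSurjective (LinearMap.range_eq_top.mp ht))
      have hSa : IsAtom S := isSimpleModule_iff_isAtom.mp (IsSimpleModule.congr e)
      let Φ : S ≃ₗ[ℂ] U := (e.restrictScalars ℂ).trans
        (ρ.asModuleEquiv.submoduleMap (N.restrictScalars ℂ))
      have hΦ : ∀ g, LinearMap.trace ℂ S (idealRep S g) =
          LinearMap.trace ℂ U (ρ.subrepresentation U hU g) := fun g => by
        rw [← LinearMap.trace_conj' _ Φ]
        congr 1
        ext y
        obtain ⟨s, rfl⟩ := Φ.surjective y
        rw [LinearEquiv.conj_apply_apply, LinearEquiv.symm_apply_apply, idealRep_apply]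
        change ρ.asModuleEquiv (e (_ • s)) = ρ g (ρ.asModuleEquiv (e s))
        rw [map_smul, ← hg]
        rfl
      have hlt : finrank ℂ U' < n := by
        have h1 := Submodule.finrank_add_eq_of_isCompl hUU'
        have h2 : 0 < finrank ℂ U := by
          have : Nontrivial U := (e.toEquiv.symm.trans Φ.toEquiv).symm.nontrivial
          exact finrank_pos
        omega
      have h1 := h S ⟨_, (hmem (ρ.subrepresentation U hU)).mem⟩ hSa fun g => by rw [hΦ]
      have h2 := ih _ hlt (ρ.subrepresentation U' hU')
        ⟨_, (hmem (ρ.subrepresentation U' hU')).mem⟩ rfl fun g => rfl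
      have h3 : ψ = ⟨_, (hmem (ρ.subrepresentation U hU)).mem⟩ +
          ⟨_, (hmem (ρ.subrepresentation U' hU')).mem⟩ := by
        refine Subtype.ext (funext fun g => ?_)
        rw [hψ, trace_subrep_add ρ hU hU' hUU' g, map_add]
        rfl
      rw [h3, ofAdd_add, map_mul, map_mul, h1, h2]
  refine hom_ext fun ψ ⟨n, T, hT⟩ => ?_
  refine main _ (matRep ((starRingEnd ℂ).mapMatrix.toMonoidHom.comp T)) ψ rfl fun g => ?_
  rw [trace_matRep, hT]
  have : ((starRingEnd ℂ).mapMatrix (T g)).trace = conj (T g).trace :=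
    (AddMonoidHom.map_trace (starRingEnd ℂ).toAddMonoidHom _).symm
  refine Eq.trans ?_ (congrArg _ this).symm
  rw [Complex.conj_conj]

end SimpleIdeals

end

end HermClass

namespace HermClass

noncomputable section

/-! ### The lengths as a homomorphism on the character group -/

section Lengths

open Module CategoryTheory

universe u v

variable {G : Type v} [Group G] [Fintype G]

section Traces

variable {W : Type*} [AddCommGroup W] [Module ℂ W] [FiniteDimensional ℂ W]
  (ρ : Representation ℂ G W)

lemma conj_trace (g : G) :
    conj (LinearMap.trace ℂ W (ρ g)) = LinearMap.trace ℂ W (ρ g⁻¹) := by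
  obtain ⟨ν, hν, hi⟩ := exists_invariant_hermPos ρ
  obtain ⟨w, hw⟩ := hν.exists_orthon_basis
  have hr : ∀ x i, w.repr x i = ν x (w i) := fun x i => by
    conv_rhs => rw [← w.sum_repr x]
    rw [map_sum, LinearMap.sum_apply, Finset.sum_eq_single i]
    · rw [map_smul, LinearMap.smul_apply, hw.1, smul_eq_mul, mul_one]
    · intro j _ hj
      rw [map_smul, LinearMap.smul_apply, hw.2 j i hj, smul_zero]
    · exact fun h => (h (Finset.mem_univ i)).elim
  have ht : ∀ g, LinearMap.trace ℂ W (ρ g) = ∑ i, ν (ρ g (w i)) (w i) := fun g => by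
    rw [LinearMap.trace_eq_matrix_trace ℂ w, Matrix.trace]
    exact Finset.sum_congr rfl fun i _ => by
      rw [Matrix.diag_apply, LinearMap.toMatrix_apply, hr]
  rw [ht, ht, map_sum]
  refine Finset.sum_congr rfl fun i _ => ?_
  rw [← hν.symm, ← hi g (ρ g⁻¹ (w i)) (w i), Representation.self_inv_apply]

omit [Fintype G] in
lemma IsSymplectic.trace_inv (h : IsSymplectic ρ) (g : G) :
    LinearMap.trace ℂ W (ρ g⁻¹) = LinearMap.trace ℂ W (ρ g) := by
  obtain ⟨κ, -, hn, hi⟩ := h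
  rw [← LinearMap.trace_transpose' (ρ g), ← LinearMap.trace_conj' _ (κ.toDual hn)]
  congr 1
  refine LinearMap.ext fun x => ?_
  obtain ⟨x, rfl⟩ := (κ.toDual hn).surjective x
  rw [LinearEquiv.conj_apply_apply, LinearEquiv.symm_apply_apply]
  refine LinearMap.ext fun y => ?_
  change κ (ρ g⁻¹ x) y = κ x (ρ g y)
  rw [← hi g (ρ g⁻¹ x) y, Representation.self_inv_apply]

/-- The character of a symplectic representation is real. -/
lemma IsSymplectic.conj_trace (h : IsSymplectic ρ) (g : G) :
    conj (LinearMap.trace ℂ W (ρ g)) = LinearMap.trace ℂ W (ρ g) := by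
  rw [HermClass.conj_trace, h.trace_inv]

end Traces

lemma nuForm_apply (V : Ideal (MonoidAlgebra ℂ G)) (x y : V) :
    nuForm V x y = (Fintype.card G : ℂ) * ∑ g, (x : MonoidAlgebra ℂ G).coeff g *
      conj ((y : MonoidAlgebra ℂ G).coeff g) := rfl

lemma nuForm_isHermPos (V : Ideal (MonoidAlgebra ℂ G)) : IsHermPos (nuForm V) := by
  refine ⟨fun x y => ?_, fun x hx => ?_⟩
  · simp [nuForm_apply, map_sum, mul_comm]
  · have h : nuForm V x x =
        ((Fintype.card G * ∑ g, ‖(x : MonoidAlgebra ℂ G).coeff g‖ ^ 2 : ℝ) : ℂ) := by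
      rw [nuForm_apply]
      push_cast
      simp only [Complex.mul_conj, Complex.normSq_eq_norm_sq]
      push_cast
      rfl
    rw [h, Complex.ofReal_re]
    refine mul_pos (by exact_mod_cast Fintype.card_pos) ?_
    obtain ⟨g, hg⟩ : ∃ g, (x : MonoidAlgebra ℂ G).coeff g ≠ 0 := by
      by_contra! h0
      exact hx (Subtype.ext (MonoidAlgebra.ext (Finsupp.ext h0)))
    exact Finset.sum_pos' (fun _ _ => by positivity) ⟨g, Finset.mem_univ g, by positivity⟩

lemma nuForm_invariant (V : Ideal (MonoidAlgebra ℂ G)) (g : G) (x y : V) :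
    nuForm V (idealRep V g x) (idealRep V g y) = nuForm V x y := by
  rw [nuForm_apply, nuForm_apply]
  congr 1
  refine Fintype.sum_equiv (Equiv.mulLeft g⁻¹) _ _ fun h => ?_
  have hc : ∀ x : V, (idealRep V g x : MonoidAlgebra ℂ G).coeff h =
      (x : MonoidAlgebra ℂ G).coeff (g⁻¹ * h) := fun x => by
    rw [idealRep_apply, Submodule.coe_smul, smul_eq_mul]
    simp
  rw [hc, hc]
  rfl

variable {P : CochainComplex (ModuleCat.{u} (MonoidAlgebra ℤ G)) ℤ}

lemma Splitting.norm_delta {W : Type*} [AddCommGroup W] [Module ℂ W] [FiniteDimensional ℂ W]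
    {ρ : Representation ℂ G W} (S : Splitting P ρ Unit) (L : LocalBases P) {n : ℕ}
    (w : Basis (Fin n × Unit) ℂ W) (i : ℤ)
    (ε : Fin (S.nU (i - 1)) ⊕ Fin (S.nH i) ⊕ Fin (S.nU i) ≃ Fin (L.q i) × Fin n) :
    ‖S.delta L w i ε‖ = vol (S.toG.c i) (L.basisW ρ w i) := by
  change _ = vol ((S.c i).reindex _) _
  rw [vol_reindex_left, vol_eq_det _ _
    ((ε.prodCongr (Equiv.refl Unit)).trans (Equiv.prodAssoc _ _ _)), Splitting.delta]
  congr 2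
  ext x
  rw [Function.comp_apply, LocalBases.basisW_apply]
  rfl

lemma Splitting.norm_gram {W : Type*} [AddCommGroup W] [Module ℂ W] [FiniteDimensional ℂ W]
    {ρ : Representation ℂ G W} (S : Splitting P ρ Unit) (p : ℤ → Prop) {N : ℕ}
    (τ : Fin N ≃ Σ i : {i : ℤ // p i}, Fin (S.nH i)) (ν : W →ₗ[ℂ] W →ₗ⋆[ℂ] ℂ)
    (σ : LinearMap.BilinForm ℝ (cohSum P p)) (hP : IsPerfect P) :
    ‖(Matrix.of fun i j => tensHerm ν σ (S.classes p τ (i, ())) (S.classes p τ (j, ()))).det‖ =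
      grB (hermInv ρ (cohSumRep P p) ν σ) (S.toG.basisCls p) := by
  let e : (Σ i : {i : ℤ // p i}, Fin (S.nH i) × Unit) ≃ Fin N :=
    (Equiv.sigmaCongrRight fun i => Equiv.prodPUnit _).trans τ.symm
  have := finite_cls hP S.toG p
  rw [← grB_reindex _ _ e, grB_eq, gr]
  congr 3
  ext i j
  have h : ∀ i, (S.toG.basisCls p).reindex e i = S.classes p τ (i, ()) := fun i => by
    rw [Basis.reindex_apply, GSplitting.basisCls_eq]
    rfl
  rw [h, h]
  rfl

variable (σ : SymForms P) (L : LocalBases P) (hP : IsPerfect P)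

lemma isMetricValue_iff (V : TwoSidedIdeal (MonoidAlgebra ℂ G)) (r : ℝ) :
    IsMetricValue σ.metrics L V r ↔ r = metRep (idealRep V.asIdeal) σ L hP := by
  have key : ∀ {n : ℕ} (v : Basis (Fin n × Unit) ℂ V.asIdeal)
      (_ : ∀ s t, nuForm V.asIdeal (v s) (v t) = if s = t then 1 else 0)
      (S : Splitting P (idealRep V.asIdeal) Unit)
      (ε : ∀ i, Fin (S.nU (i - 1)) ⊕ Fin (S.nH i) ⊕ Fin (S.nU i) ≃ Fin (L.q i) × Fin n)
      {N₀ N₁ : ℕ} (τ₀ : Fin N₀ ≃ Σ i : {i : ℤ // Even i}, Fin (S.nH i))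
      (τ₁ : Fin N₁ ≃ Σ i : {i : ℤ // Odd i}, Fin (S.nH i)),
      (∏ᶠ i : ℤ, ‖S.delta L v i (ε i)‖ ^ (i.negOnePow : ℤ)) *
        σ.metrics V N₀ N₁ (fun x => S.classes Even τ₀ (x, ()))
          (fun x => S.classes Odd τ₁ (x, ())) = metRep (idealRep V.asIdeal) σ L hP := by
    intro n v hv S ε N₀ N₁ τ₀ τ₁
    rw [← metRep_eq σ L hP S.toG (nuForm_isHermPos V.asIdeal) (nuForm_invariant V.asIdeal)
      (w := v) ⟨fun x => by rw [hv, if_pos rfl], fun x y h => by rw [hv, if_neg h]⟩, met,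
      ← S.norm_gram Even τ₀ _ _ hP, ← S.norm_gram Odd τ₁ _ _ hP]
    congr 1
    exact finprod_congr fun i => by rw [S.norm_delta]
  constructor
  · rintro ⟨n, v, hv, S, ε, N₀, N₁, τ₀, τ₁, rfl⟩
    exact key v hv S ε τ₀ τ₁
  · rintro rfl
    obtain ⟨w, hw⟩ := (nuForm_isHermPos V.asIdeal).exists_orthon_basis
    let v := w.reindex (Equiv.prodPUnit _).symm
    have hv : ∀ s t, nuForm V.asIdeal (v s) (v t) = if s = t then 1 else 0 := by
      rintro ⟨s, -⟩ ⟨t, -⟩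
      rw [Basis.reindex_apply, Basis.reindex_apply]
      by_cases h : s = t
      · subst h
        rw [if_pos rfl]
        exact hw.1 s
      · rw [if_neg fun h' => h (congrArg Prod.fst h')]
        exact hw.2 s t h
    obtain ⟨S⟩ := exists_splitting (ρ := idealRep V.asIdeal) hP
    have hε : ∀ i, Nonempty (Fin (S.nU (i - 1)) ⊕ Fin (S.nH i) ⊕ Fin (S.nU i) ≃
        Fin (L.q i) × Fin (finrank ℂ V.asIdeal)) := fun i =>
      ⟨((Equiv.prodPUnit _).symm.trans ((S.c i).indexEquiv
        (L.basisW (idealRep V.asIdeal) w i)))⟩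
    have hτ : ∀ p : ℤ → Prop, ∃ N : ℕ, Nonempty (Fin N ≃ Σ i : {i : ℤ // p i}, Fin (S.nH i)) :=
      fun p => by
        have := finite_cls hP S.toG p
        have : Finite (Σ i : {i : ℤ // p i}, Fin (S.nH i)) := Finite.of_equiv
          (Σ i : {i : ℤ // p i}, Fin (S.nH i) × Unit)
          (Equiv.sigmaCongrRight fun i => Equiv.prodPUnit _)
        exact ⟨_, ⟨(Finite.equivFin _).symm⟩⟩
    obtain ⟨N₀, ⟨τ₀⟩⟩ := hτ Even
    obtain ⟨N₁, ⟨τ₁⟩⟩ := hτ Odd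
    exact ⟨_, v, hv, S, fun i => (hε i).some, N₀, N₁, τ₀, τ₁, (key v hv S _ τ₀ τ₁).symm⟩

omit [Fintype G] in
lemma trace_conj_mat {n : ℕ} (T : G →* Matrix (Fin n) (Fin n) ℂ) (g : G) :
    LinearMap.trace ℂ _ (matRep ((starRingEnd ℂ).mapMatrix.toMonoidHom.comp T) g) =
      conj (T g).trace := by
  rw [trace_matRep]
  exact (AddMonoidHom.map_trace (starRingEnd ℂ).toAddMonoidHom _).symm

/-- A positive real number as an element of `ℝ_{>0}`. -/
def posUnit (r : ℝ) (hr : 0 < r) : Units.posSubgroup ℝ :=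
  ⟨Units.mk0 r hr.ne', hr⟩

lemma posUnit_congr {r r' : ℝ} (hr : 0 < r) (hr' : 0 < r') (h : r = r') :
    posUnit r hr = posUnit r' hr' := by subst h; rfl

lemma exists_lenHom : ∃ f : Multiplicative (RG G) →* Units.posSubgroup ℝ,
    ∀ (n : ℕ) (T : G →* Matrix (Fin n) (Fin n) ℂ) (ψ : RG G),
      (∀ g, (ψ : G → ℂ) g = conj (T g).trace) →
        ((f (.ofAdd ψ) : ℝˣ) : ℝ) = metRep (matRep T) σ L hP := by
  classical
  let F : (G → ℂ) → Units.posSubgroup ℝ := fun χ =>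
    if h : IsChar G χ then posUnit _ (metRep_pos (ρ := matRep
      ((starRingEnd ℂ).mapMatrix.toMonoidHom.comp h.choose_spec.choose)) σ L hP) else 1
  have hF : ∀ {W : Type} [AddCommGroup W] [Module ℂ W] [FiniteDimensional ℂ W]
      (ρ : Representation ℂ G W) (χ : G → ℂ), (∀ g, χ g = conj (LinearMap.trace ℂ W (ρ g))) →
      IsChar G χ → F χ = posUnit _ (metRep_pos (ρ := ρ) σ L hP) := by
    intro W _ _ _ ρ χ hχ h
    simp only [F, dif_pos h]
    obtain ⟨Φ, hΦ⟩ := exists_equiv_of_trace_eq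
      (matRep ((starRingEnd ℂ).mapMatrix.toMonoidHom.comp h.choose_spec.choose)) ρ fun g => by
        rw [trace_conj_mat, ← h.choose_spec.choose_spec, hχ, Complex.conj_conj]
    exact posUnit_congr _ _ (metRep_congr σ L hP Φ hΦ)
  obtain ⟨f, hf⟩ := exists_hom_extension F fun χ χ' ⟨n, T, hT⟩ ⟨n', T', hT'⟩ => by
    have h : IsChar G χ := ⟨n, T, hT⟩
    have h' : IsChar G χ' := ⟨n', T', hT'⟩
    rw [hF (matRep ((starRingEnd ℂ).mapMatrix.toMonoidHom.comp T)) χ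
        (fun g => by rw [trace_conj_mat, Complex.conj_conj, hT]) h,
      hF (matRep ((starRingEnd ℂ).mapMatrix.toMonoidHom.comp T')) χ'
        (fun g => by rw [trace_conj_mat, Complex.conj_conj, hT']) h',
      hF ((matRep ((starRingEnd ℂ).mapMatrix.toMonoidHom.comp T)).prod
        (matRep ((starRingEnd ℂ).mapMatrix.toMonoidHom.comp T'))) (χ + χ') (fun g => by
          change _ = conj (LinearMap.trace ℂ _ (LinearMap.prodMap (matRep _ g) (matRep _ g)))
          rw [LinearMap.trace_prodMap', trace_conj_mat, trace_conj_mat,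
            map_add, Complex.conj_conj, Complex.conj_conj, Pi.add_apply, hT, hT']) (h.add h')]
    exact Subtype.ext (Units.ext (metRep_prod σ L hP))
  refine ⟨f, fun n T ψ hψ => ?_⟩
  have h : IsChar G (ψ : G → ℂ) :=
    ⟨n, (starRingEnd ℂ).mapMatrix.toMonoidHom.comp T, fun g => by
      rw [hψ, ← trace_conj_mat, trace_matRep]⟩
  rw [hf ψ h, hF (matRep T) ψ (fun g => by rw [hψ, trace_matRep]) h]
  rfl

/-- The homomorphism which maps the complex conjugate of the character of a representation to
its length. -/
def lenHom : Multiplicative (RG G) →* Units.posSubgroup ℝ := (exists_lenHom σ L hP).choose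

lemma lenHom_apply {W : Type*} [AddCommGroup W] [Module ℂ W] [FiniteDimensional ℂ W]
    (ρ : Representation ℂ G W) (ψ : RG G)
    (h : ∀ g, (ψ : G → ℂ) g = conj (LinearMap.trace ℂ W (ρ g))) :
    ((lenHom σ L hP (.ofAdd ψ) : ℝˣ) : ℝ) = metRep ρ σ L hP := by
  rw [lenHom, (exists_lenHom σ L hP).choose_spec _ (repMat ρ (finBasis ℂ W)) ψ fun g => by
    rw [h, trace_repMat]]
  obtain ⟨Φ, hΦ⟩ := exists_equiv_of_trace_eq (matRep (repMat ρ (finBasis ℂ W))) ρ fun g => by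
    rw [trace_matRep, trace_repMat]
  exact metRep_congr σ L hP Φ hΦ

omit [Fintype G] in
lemma exists_conj_character {W : Type*} [AddCommGroup W] [Module ℂ W] [FiniteDimensional ℂ W]
    (ρ : Representation ℂ G W) :
    ∃ ψ : RG G, ∀ g, (ψ : G → ℂ) g = conj (LinearMap.trace ℂ W (ρ g)) := by
  refine ⟨⟨_, (isChar_of_mat ((starRingEnd ℂ).mapMatrix.toMonoidHom.comp
    (repMat ρ (finBasis ℂ W)))).mem⟩, fun g => ?_⟩
  rw [← trace_repMat ρ (finBasis ℂ W), ← trace_conj_mat, trace_matRep]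

/-- The length for a simple two-sided ideal. -/
lemma metRep_asIdeal {V : TwoSidedIdeal (MonoidAlgebra ℂ G)} (hV : IsAtom V)
    {S : Ideal (MonoidAlgebra ℂ G)} (hS : IsAtom S) (h : S ≤ V.asIdeal) :
    metRep (idealRep V.asIdeal) σ L hP = metRep (idealRep S) σ L hP ^ finrank ℂ S := by
  obtain ⟨ψ, hψ⟩ := exists_conj_character (idealRep S)
  rw [← lenHom_apply σ L hP (idealRep S) ψ hψ,
    ← lenHom_apply σ L hP (idealRep V.asIdeal) (finrank ℂ S • ψ) fun g => by
      rw [trace_idealRep_asIdeal hV hS h, map_mul, ← hψ, map_natCast, AddSubgroup.coe_nsmul,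
        Pi.smul_apply, nsmul_eq_mul],
    ofAdd_nsmul, map_pow]
  rfl

lemma metRep_asIdeal_rpow {V : TwoSidedIdeal (MonoidAlgebra ℂ G)} (hV : IsAtom V)
    {S : Ideal (MonoidAlgebra ℂ G)} (hS : IsAtom S) (h : S ≤ V.asIdeal) :
    metRep (idealRep V.asIdeal) σ L hP ^ ((1 : ℝ) / finrank ℂ S) = metRep (idealRep S) σ L hP := by
  have := isSimpleModule_iff_isAtom.mpr hS
  have := IsSimpleModule.nontrivial (MonoidAlgebra ℂ G) S
  rw [metRep_asIdeal σ L hP hV hS h, one_div]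
  exact Real.pow_rpow_inv_natCast (metRep_pos σ L hP).le finrank_pos.ne'

end Lengths

end

end HermClass

namespace HermClass

noncomputable section

/-! ### The Euler characteristics -/

section EulerCharacteristics

open Module CategoryTheory

universe u v

variable {G : Type v} [Group G]

lemma toMultiplicative_hom_ext {A B I : Type*} [AddCommGroup A] [CommGroup B] (θ : Basis I ℤ A)
    {f f' : Multiplicative A →* B} (h : ∀ m, f (.ofAdd (θ m)) = f' (.ofAdd (θ m))) : f = f' := by
  have h1 : (AddMonoidHom.toMultiplicativeLeft.symm f).toIntLinearMap =
      (AddMonoidHom.toMultiplicativeLeft.symm f').toIntLinearMap := θ.ext fun m => h m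
  exact MonoidHom.ext fun x => LinearMap.congr_fun h1 x.toAdd

lemma exists_toMultiplicative_hom {A B I : Type*} [AddCommGroup A] [CommGroup B] (θ : Basis I ℤ A)
    (F : I → B) : ∃ f : Multiplicative A →* B, ∀ m, f (.ofAdd (θ m)) = F m :=
  ⟨AddMonoidHom.toMultiplicativeLeft (θ.constr ℤ fun m => Additive.ofMul (F m)).toAddMonoidHom,
    fun m => θ.constr_basis ℤ (fun m => Additive.ofMul (F m)) m⟩

lemma hermitianClass_mul (f f' : HomOmega (RGs G)) (r r' : Multiplicative (RGs G) →* ℝˣ) :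
    hermitianClass (f * f') (r * r') = hermitianClass f r * hermitianClass f' r' :=
  map_mul (QuotientGroup.mk' (DenH G)) (show NumH G from (f, r)) (show NumH G from (f', r'))

lemma arakelovClass_mul (f f' : HomOmega (RGs G))
    (r r' : Multiplicative (RGs G) →* Units.posSubgroup ℝ) :
    arakelovClass (f * f') (r * r') = arakelovClass f r * arakelovClass f' r' :=
  map_mul (QuotientGroup.mk' (DenA G)) (show NumA G from (f, r)) (show NumA G from (f', r'))

lemma arakelovClass_eq_one (g : HomOmegaPlus (RGs G)) {d : HomOmega (RGs G)} (hd : d ∈ DetZhatS) :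
    arakelovClass (toHomOmega g * d) (toHomPos g) = 1 := by
  have h1 : arakelovClass (toHomOmega g) (toHomPos g) = 1 :=
    (QuotientGroup.eq_one_iff _).mpr (Subgroup.mem_sup_left ⟨g, rfl⟩)
  have h2 : arakelovClass d 1 = 1 :=
    (QuotientGroup.eq_one_iff _).mpr (Subgroup.mem_sup_right ⟨hd, rfl⟩)
  have h3 := arakelovClass_mul (toHomOmega g) d (toHomPos g) 1
  rw [show toHomPos g * 1 = toHomPos g from MonoidHom.ext fun _ => mul_one _] at h3
  rw [h3, h1, h2, one_mul]

lemma arakelovToHermitian_apply (f : HomOmega (RGs G))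
    (r : Multiplicative (RGs G) →* Units.posSubgroup ℝ) :
    arakelovToHermitian G (arakelovClass f r) = hermitianClass f (posToReal r) := rfl

/-- Evaluation at a virtual character. -/
def evalHom (ψ : RG G) : HomOmega (RG G) →* Jf :=
  (MonoidHom.eval (Multiplicative.ofAdd ψ)).comp (HomOmega (RG G)).subtype

lemma evalHom_apply (ψ : RG G) (f : HomOmega (RG G)) : evalHom ψ f = f.1 (.ofAdd ψ) := rfl

variable [Fintype G] {P : CochainComplex (ModuleCat.{u} (MonoidAlgebra ℤ G)) ℤ}

lemma detHom_of_isEmpty {q : ℕ} (hq : q = 0)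
    (M : (Matrix (Fin q) (Fin q) (MonoidAlgebra AQ G))ˣ) : detHom M = 1 := by
  subst hq
  refine homOmega_ext fun n T ψ hT => ?_
  rw [inclC_detHom M T ψ hT, detRep, Matrix.det_isEmpty]
  exact (map_one inclC).symm

/-- The homomorphism `∏_i Det(λ^i)^{(-1)^i}`. -/
def LocalBases.finiteHom (L : LocalBases P) : HomOmega (RG G) :=
  ∏ᶠ i : ℤ, detHom (L.isUnit_lam i).unit ^ (i.negOnePow : ℤ)

lemma LocalBases.finiteHom_eq_prod (L : LocalBases P) {N : ℤ}
    (hN : ∀ i : ℤ, N < |i| → Subsingleton (P.X i)) :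
    L.finiteHom = ∏ i ∈ Finset.Icc (-N) N, detHom (L.isUnit_lam i).unit ^ (i.negOnePow : ℤ) := by
  refine finprod_eq_prod_of_mulSupport_subset _ fun i hi => ?_
  rw [Finset.coe_Icc, Set.mem_Icc, ← abs_le]
  by_contra hc
  have := hN i (not_le.mp hc)
  refine hi ?_
  change detHom _ ^ _ = 1
  rw [detHom_of_isEmpty (L.q_eq_zero i), one_zpow]

lemma isFinitePart_iff (hP : IsPerfect P) (L : LocalBases P) {ψ : RG G}
    (hψ : IsChar G (ψ : G → ℂ)) (c : Jf) :
    IsFinitePart L (ψ : G → ℂ) c ↔ c = L.finiteHom.1 (.ofAdd ψ) := by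
  obtain ⟨N, hN⟩ := hP.1
  have h : evalHom ψ L.finiteHom =
      ∏ᶠ i : ℤ, evalHom ψ (detHom (L.isUnit_lam i).unit) ^ (i.negOnePow : ℤ) := by
    rw [L.finiteHom_eq_prod hN, map_prod,
      finprod_eq_prod_of_mulSupport_subset (s := Finset.Icc (-N) N)]
    · exact Finset.prod_congr rfl fun i _ => map_zpow _ _ _
    · intro i hi
      rw [Finset.coe_Icc, Set.mem_Icc, ← abs_le]
      by_contra hc
      have := hN i (not_le.mp hc)
      refine hi ?_
      change evalHom ψ (detHom _) ^ _ = 1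
      rw [detHom_of_isEmpty (L.q_eq_zero i), map_one, one_zpow]
  have hval : ∀ {n : ℕ} (T : G →* Matrix (Fin n) (Fin n) ℂ), (∀ g, (ψ : G → ℂ) g = (T g).trace) →
      ∀ i, inclC (evalHom ψ (detHom (L.isUnit_lam i).unit) : AQbar) = detRep T (L.lam i) :=
    fun T hT i => inclC_detHom (L.isUnit_lam i).unit T ψ hT
  rw [← evalHom_apply, h]
  constructor
  · rintro ⟨n, T, D, hT, hD, rfl⟩
    refine finprod_congr fun i => ?_
    rw [show D i = evalHom ψ (detHom (L.isUnit_lam i).unit) from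
      Units.ext (inclC_injective ((hD i).trans (hval T hT i).symm))]
  · rintro rfl
    obtain ⟨n, T, hT⟩ := hψ
    exact ⟨n, T, fun i => evalHom ψ (detHom (L.isUnit_lam i).unit), hT,
      hval T hT, rfl⟩

variable (σ : SymForms P) (hP : IsPerfect P)

lemma val_prod_posSubgroup {ι : Type*} (s : Finset ι) (f : ι → Units.posSubgroup ℝ) (e : ι → ℤ) :
    (((∏ i ∈ s, f i ^ e i : Units.posSubgroup ℝ) : ℝˣ) : ℝ) =
      ∏ i ∈ s, ((f i : ℝˣ) : ℝ) ^ e i := by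
  have h := map_prod ((Units.coeHom ℝ).comp (Units.posSubgroup ℝ).subtype)
    (fun i => f i ^ e i) s
  refine h.trans (Finset.prod_congr rfl fun i _ => ?_)
  simp

/-- Another choice of bases changes the representatives by an element of the denominator. -/
lemma exists_localBases_comparison (L L' : LocalBases P) :
    ∃ (g : HomOmegaPlus (RGs G)) (d : HomOmega (RGs G)), d ∈ DetZhatS ∧
      restrictHom L'.finiteHom = toHomOmega g * d * restrictHom L.finiteHom ∧
      (lenHom σ L' hP).comp inclR = toHomPos g * (lenHom σ L hP).comp inclR := by
  obtain ⟨N, hN⟩ := hP.1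
  choose e μ η hμ hη hμa hlam using fun i => L.exists_comparison L' i
  have hdet : ∀ i, detHom (L'.isUnit_lam i).unit =
      detHom (Units.map ((MonoidAlgebra.mapRingHom G ratToAQ).mapMatrix.toMonoidHom) (hμ i).unit) *
        (detHom (Units.map ((MonoidAlgebra.mapRingHom G zhatToAQ).mapMatrix.toMonoidHom)
          (hη i).unit))⁻¹ * detHom (L.isUnit_lam i).unit := fun i => by
    let Y := Units.map ((MonoidAlgebra.mapRingHom G zhatToAQ).mapMatrix.toMonoidHom) (hη i).unit
    let Z := Units.map ((MonoidAlgebra.mapRingHom G ratToAQ).mapMatrix.toMonoidHom) (hμ i).unit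
    obtain ⟨X, hXY⟩ : ∃ X, X * Y = Z * (L.isUnit_lam i).unit := ⟨_, inv_mul_cancel_right _ _⟩
    have hX : X.val = (L'.lam i).submatrix (e i) (e i) :=
      Y.isUnit.mul_left_injective ((congrArg Units.val hXY).trans (hlam i).symm)
    have h1 := congrArg detHom hXY
    rw [detHom_mul, detHom_mul, detHom_submatrix X (L'.isUnit_lam i).unit (e i) hX] at h1
    rw [mul_right_comm, ← h1, mul_inv_cancel_right]
  choose g hg h hgh hh using fun i => exists_detPlus (hμ i).unit
  refine ⟨∏ i ∈ Finset.Icc (-N) N, g i ^ (i.negOnePow : ℤ),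
    restrictHom (∏ i ∈ Finset.Icc (-N) N,
      (detHom (Units.map ((MonoidAlgebra.mapRingHom G zhatToAQ).mapMatrix.toMonoidHom)
          (hη i).unit))⁻¹ ^ (i.negOnePow : ℤ)), ⟨_, ?_, rfl⟩, ?_, ?_⟩
  · exact prod_mem fun i _ => zpow_mem (inv_mem (detHom_mem_DetZhat _)) _
  · rw [L.finiteHom_eq_prod hN, L'.finiteHom_eq_prod hN, map_prod, map_prod, map_prod, map_prod,
      ← Finset.prod_mul_distrib, ← Finset.prod_mul_distrib]
    refine Finset.prod_congr rfl fun i _ => ?_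
    rw [hdet, map_zpow, map_zpow, map_zpow, map_zpow, hg, map_mul, map_mul, mul_zpow, mul_zpow]
  · have key : lenHom σ L' hP = (∏ i ∈ Finset.Icc (-N) N,
        (absQbar.comp (h i)) ^ (i.negOnePow : ℤ)) * lenHom σ L hP := by
      refine hom_ext fun ψ ⟨n, T, hT⟩ => Subtype.ext (Units.ext ?_)
      let ρ := matRep ((starRingEnd ℂ).mapMatrix.toMonoidHom.comp T)
      have hρ : ∀ g, (ψ : G → ℂ) g = conj (LinearMap.trace ℂ _ (ρ g)) := fun g => by
        rw [trace_conj_mat, Complex.conj_conj, hT]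
      obtain ⟨ν, hν, hi⟩ := exists_invariant_hermPos ρ
      obtain ⟨w, hw⟩ := hν.exists_orthon_basis
      have hvol : ∀ i, vol (L.basisW ρ w i) (L'.basisW ρ w i) =
          ((absQbar (h i (.ofAdd ψ)) : ℝˣ) : ℝ) := fun i => by
        rw [vol_basisW ρ L L' i (e i) (μ i) (hμa i) w]
        change _ = ‖((h i (.ofAdd ψ) : Qbar) : ℂ)‖
        rw [hh i _ (dualMat ρ w) ψ fun g => by rw [trace_dualMat, ← conj_trace, hρ]]
        rfl
      rw [lenHom_apply σ L' hP ρ ψ hρ, metRep_localBases σ L hP L' hν hi hw,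
        ← lenHom_apply σ L hP ρ ψ hρ, mul_comm, MonoidHom.mul_apply, Subgroup.coe_mul,
        Units.val_mul]
      congr 1
      have hev := map_prod (MonoidHom.eval (Multiplicative.ofAdd ψ))
        (fun i : ℤ => (absQbar.comp (h i)) ^ (i.negOnePow : ℤ)) (Finset.Icc (-N) N)
      rw [MonoidHom.eval_apply_apply] at hev
      rw [hev]
      have hev2 : ∀ i : ℤ, MonoidHom.eval (Multiplicative.ofAdd ψ)
          ((absQbar.comp (h i)) ^ (i.negOnePow : ℤ)) =
            absQbar (h i (.ofAdd ψ)) ^ (i.negOnePow : ℤ) := fun i => map_zpow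
              (MonoidHom.eval (Multiplicative.ofAdd ψ)) _ _
      simp only [hev2]
      rw [val_prod_posSubgroup, finprod_eq_prod_of_mulSupport_subset (s := Finset.Icc (-N) N)]
      · exact Finset.prod_congr rfl fun i _ => by rw [hvol]
      · intro i hi'
        rw [Finset.coe_Icc, Set.mem_Icc, ← abs_le]
        by_contra hc
        have := hN i (not_le.mp hc)
        have := subsingleton_inv (ρ := ρ) (termRep ℝ (P.X i))
        exact hi' (by simp [vol_of_subsingleton])
    rw [key]
    have h2 : toHomPos (∏ i ∈ Finset.Icc (-N) N, g i ^ (i.negOnePow : ℤ)) =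
        ∏ i ∈ Finset.Icc (-N) N, ((absQbar.comp (h i)).comp inclR) ^ (i.negOnePow : ℤ) := by
      rw [map_prod]
      refine Finset.prod_congr rfl fun i _ => ?_
      rw [map_zpow]
      congr 1
      change absQbar.comp (g i).1 = _
      rw [hgh i]
      rfl
    rw [h2]
    refine MonoidHom.ext fun x => ?_
    simp only [MonoidHom.comp_apply, MonoidHom.mul_apply, MonoidHom.finsetProd_apply]
    rfl

/-- The class of the finite parts and the lengths. -/
lemma arakelovClass_localBases (L L' : LocalBases P) :
    arakelovClass (restrictHom L'.finiteHom) ((lenHom σ L' hP).comp inclR) =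
      arakelovClass (restrictHom L.finiteHom) ((lenHom σ L hP).comp inclR) := by
  obtain ⟨g, d, hd, h1, h2⟩ := exists_localBases_comparison σ hP L L'
  rw [h1, h2, arakelovClass_mul, arakelovClass_eq_one g hd, one_mul]

lemma isChar_of_conj_trace {W : Type*} [AddCommGroup W] [Module ℂ W] [FiniteDimensional ℂ W]
    (ρ : Representation ℂ G W) {χ : G → ℂ} (h : ∀ g, χ g = conj (LinearMap.trace ℂ W (ρ g))) :
    IsChar G χ :=
  ⟨_, dualMat ρ (finBasis ℂ W), fun g => by rw [trace_dualMat, ← conj_trace, h]⟩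

lemma isArakelovEuler_iff (y : ArakelovClassGroup G) :
    IsArakelovEuler σ.metrics y ↔ ∃ L : LocalBases P,
      y = arakelovClass (restrictHom L.finiteHom) ((lenHom σ L hP).comp inclR) := by
  constructor
  · rintro ⟨L, f₁, f₂, h, rfl⟩
    refine ⟨L, ?_⟩
    have h1 : f₁ = L.finiteHom := Subtype.ext (hom_ext_simple fun S ψ hS hψ => by
      obtain ⟨V, hV, hSV⟩ := exists_isAtom_twoSidedIdeal hS
      exact (isFinitePart_iff hP L (isChar_of_conj_trace _ hψ) _).mp (h V S ψ hV hS hSV hψ).1)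
    have h2 : f₂ = lenHom σ L hP := hom_ext_simple fun S ψ hS hψ => by
      obtain ⟨V, hV, hSV⟩ := exists_isAtom_twoSidedIdeal hS
      obtain ⟨r, hr, e⟩ := (h V S ψ hV hS hSV hψ).2
      refine Subtype.ext (Units.ext ?_)
      rw [e, (isMetricValue_iff σ L hP V r).mp hr, metRep_asIdeal_rpow σ L hP hV hS hSV,
        lenHom_apply σ L hP _ ψ hψ]
    rw [h1, h2]
  · rintro ⟨L, rfl⟩
    refine ⟨L, L.finiteHom, lenHom σ L hP, fun V S ψ hV hS hSV hψ =>
      ⟨(isFinitePart_iff hP L (isChar_of_conj_trace _ hψ) _).mpr rfl, _,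
        (isMetricValue_iff σ L hP V _).mpr rfl, ?_⟩, rfl⟩
    rw [metRep_asIdeal_rpow σ L hP hV hS hSV, lenHom_apply σ L hP _ ψ hψ]

/-- The spaces `(M⁻ ⊗ W)^G` have even dimension for symplectic `W`. -/
lemma SignDecomposition.even_nMinus {M : Type*} [AddCommGroup M] [Module ℝ M]
    [FiniteDimensional ℝ M] {a : Representation ℝ G M} {τ : LinearMap.BilinForm ℝ M}
    (D : SignDecomposition a τ) {W : Type*} [AddCommGroup W] [Module ℂ W] [FiniteDimensional ℂ W]
    {ρ : Representation ℂ G W} (h : IsSymplectic ρ) : Even (D.nMinus ρ) := by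
  obtain ⟨κ, halt, hn, hi⟩ := h
  obtain ⟨J, ν, hJ2, hJ, -, -⟩ := exists_quaternionic ρ κ halt hn.2 hi
  obtain ⟨n, e, -⟩ := exists_adapted_basis
    (invJ_invJ hJ2 hJ (a.subrepresentation D.neg D.neg_stable))
  refine ⟨n, ?_⟩
  rw [SignDecomposition.nMinus, finrank_eq_card_basis e]
  simp [mul_two]

/-- The sign `(√-1)^{n⁻(σ)}`. -/
lemma exists_sign (hP : IsPerfect P) {W : Type*} [AddCommGroup W] [Module ℂ W] [FiniteDimensional ℂ W]
    {ρ : Representation ℂ G W} (h : IsSymplectic ρ) : ∃ s : ℤˣ,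
      ∀ (D₀ : SignDecomposition (cohSumRep P Even) σ.ev)
        (D₁ : SignDecomposition (cohSumRep P Odd) σ.odd),
        ((s : ℤ) : ℂ) = Complex.I ^ ((D₀.nMinus ρ : ℤ) - (D₁.nMinus ρ : ℤ)) := by
  have := hP.finite_cohSum Even
  have := hP.finite_cohSum Odd
  obtain ⟨D₀⟩ := signDecomposition_nonempty _ σ.ev σ.ev_symm σ.ev_nondeg σ.ev_inv
  obtain ⟨D₁⟩ := signDecomposition_nonempty _ σ.odd σ.odd_symm σ.odd_nondeg σ.odd_inv
  obtain ⟨L⟩ := exists_localBases hP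
  obtain ⟨r, hr⟩ := exists_isPfaffianValue hP σ L h
  obtain ⟨a, ha⟩ := D₀.even_nMinus h
  obtain ⟨b, hb⟩ := D₁.even_nMinus h
  refine ⟨(-1) ^ ((a : ℤ) - b), fun D₀' D₁' => ?_⟩
  have h0 : (metRep ρ σ L hP : ℂ) ≠ 0 := by exact_mod_cast (metRep_pos σ L hP).ne'
  rw [← mul_right_cancel₀ h0 ((hr.eq hP D₀ D₁).symm.trans (hr.eq hP D₀' D₁')), ha, hb]
  have h1 : (((a + a : ℕ) : ℤ) - ((b + b : ℕ) : ℤ)) = 2 * ((a : ℤ) - b) := by push_cast; ring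
  rw [h1, zpow_mul, zpow_ofNat, Complex.I_sq]
  rcases Int.even_or_odd ((a : ℤ) - b) with h | h
  · rw [h.neg_one_zpow, h.neg_one_zpow]
    simp
  · rw [h.neg_one_zpow, h.neg_one_zpow]
    simp

lemma isHermitianEuler_iff {I : Type*} {W : I → Type*} [∀ m, AddCommGroup (W m)]
    [∀ m, Module ℂ (W m)] [∀ m, FiniteDimensional ℂ (W m)] {ρ : ∀ m, Representation ℂ G (W m)}
    (hρ : ∀ m, IsSymplectic (ρ m)) (θ : Basis I ℤ (RGs G))
    (hθ : ∀ m g, (θ m : G → ℂ) g = LinearMap.trace ℂ (W m) (ρ m g))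
    {s : Multiplicative (RGs G) →* ℤˣ}
    (hs : ∀ (m : I) (D₀ : SignDecomposition (cohSumRep P Even) σ.ev)
      (D₁ : SignDecomposition (cohSumRep P Odd) σ.odd),
      (((s (.ofAdd (θ m)) : ℤˣ) : ℤ) : ℂ) =
        Complex.I ^ ((D₀.nMinus (ρ m) : ℤ) - (D₁.nMinus (ρ m) : ℤ)))
    (x : HermitianClassGroup G) :
    IsHermitianEuler σ ρ θ x ↔ ∃ L : LocalBases P, x = signatureClass s *
      arakelovToHermitian G
        (arakelovClass (restrictHom L.finiteHom) ((lenHom σ L hP).comp inclR)) := by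
  have := hP.finite_cohSum Even
  have := hP.finite_cohSum Odd
  obtain ⟨D₀⟩ := signDecomposition_nonempty _ σ.ev σ.ev_symm σ.ev_nondeg σ.ev_inv
  obtain ⟨D₁⟩ := signDecomposition_nonempty _ σ.odd σ.odd_symm σ.odd_nondeg σ.odd_inv
  have hcl : ∀ L : LocalBases P, signatureClass s * arakelovToHermitian G
      (arakelovClass (restrictHom L.finiteHom) ((lenHom σ L hP).comp inclR)) =
      hermitianClass (restrictHom L.finiteHom)
        (signReal s * posToReal ((lenHom σ L hP).comp inclR)) := fun L => by
    rw [arakelovToHermitian_apply]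
    change hermitianClass 1 (signReal s) * _ = _
    rw [← hermitianClass_mul, one_mul]
  let ψ : I → RG G := fun m => ⟨θ m, RGs_le_RG G (θ m).2⟩
  have hψ : ∀ m g, (ψ m : G → ℂ) g = conj (LinearMap.trace ℂ (W m) (ρ m g)) := fun m g => by
    rw [(hρ m).conj_trace, ← hθ]
  have hval : ∀ (L : LocalBases P) m,
      ((((signReal s * posToReal ((lenHom σ L hP).comp inclR)) (.ofAdd (θ m)) : ℝˣ) : ℝ) : ℂ) =
      Complex.I ^ ((D₀.nMinus (ρ m) : ℤ) - (D₁.nMinus (ρ m) : ℤ)) * metRep (ρ m) σ L hP :=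
    fun L m => by
      rw [← hs m D₀ D₁, ← lenHom_apply σ L hP (ρ m) (ψ m) (hψ m)]
      change (((((s (.ofAdd (θ m)) : ℤˣ) : ℤ) : ℝ) * _ : ℝ) : ℂ) = _
      rw [Complex.ofReal_mul]
      congr 1
  simp only [hcl]
  constructor
  · rintro ⟨L, f₁, f₂, h, rfl⟩
    refine ⟨L, ?_⟩
    have h1 : f₁ = restrictHom L.finiteHom := Subtype.ext (toMultiplicative_hom_ext θ fun m =>
      (isFinitePart_iff hP L (ψ := ψ m) (isChar_of_conj_trace _ (hψ m)) _).mp (h m).1)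
    have h2 : f₂ = signReal s * posToReal ((lenHom σ L hP).comp inclR) :=
      toMultiplicative_hom_ext θ fun m => Units.ext (Complex.ofReal_injective (by
        rw [hval, (h m).2.eq hP D₀ D₁]))
    rw [h1, h2]
  · rintro ⟨L, rfl⟩
    refine ⟨L, restrictHom L.finiteHom, signReal s * posToReal ((lenHom σ L hP).comp inclR),
      fun m => ⟨(isFinitePart_iff hP L (ψ := ψ m) (isChar_of_conj_trace _ (hψ m)) _).mpr rfl, ?_⟩,
      rfl⟩
    obtain ⟨r, hr⟩ := exists_isPfaffianValue hP σ L (hρ m)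
    rw [hval, ← hr.eq hP D₀ D₁]
    exact hr

end EulerCharacteristics

end

end HermClass

theorem theorem30 {G : Type*} [Group G] [Fintype G]
    (P : CochainComplex (ModuleCat (MonoidAlgebra ℤ G)) ℤ) (hP : IsPerfect P) (σ : SymForms P)
    {I : Type*} (W : I → Type*) [∀ m, AddCommGroup (W m)] [∀ m, Module ℂ (W m)]
    [∀ m, FiniteDimensional ℂ (W m)] (ρ : ∀ m, Representation ℂ G (W m))
    (hρ : ∀ m, IsSymplectic (ρ m)) (θ : Module.Basis I ℤ (RGs G))
    (hθ : ∀ m g, (θ m : G → ℂ) g = LinearMap.trace ℂ (W m) (ρ m g)) :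
    (∃! x, IsHermitianEuler σ ρ θ x) ∧ (∃! y, IsArakelovEuler σ.metrics y) ∧
    Nonempty (SignDecomposition (cohSumRep P Even) σ.ev) ∧
    Nonempty (SignDecomposition (cohSumRep P Odd) σ.odd) ∧
    ∀ x y, IsHermitianEuler σ ρ θ x → IsArakelovEuler σ.metrics y →
      x * (arakelovToHermitian G y)⁻¹ ∈ SInf G ∧
      ∃ s : Multiplicative (RGs G) →* ℤˣ,
        x * (arakelovToHermitian G y)⁻¹ = signatureClass s ∧
        ∀ (m : I) (D₀ : SignDecomposition (cohSumRep P Even) σ.ev)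
          (D₁ : SignDecomposition (cohSumRep P Odd) σ.odd),
          (((s (.ofAdd (θ m)) : ℤˣ) : ℤ) : ℂ) =
            Complex.I ^ ((D₀.nMinus (ρ m) : ℤ) - (D₁.nMinus (ρ m) : ℤ)) := by
  classical
  have := hP.finite_cohSum Even
  have := hP.finite_cohSum Odd
  choose F hF using fun m => exists_sign σ hP (hρ m)
  obtain ⟨s, hs⟩ := exists_toMultiplicative_hom θ F
  have hs' : ∀ (m : I) (D₀ : SignDecomposition (cohSumRep P Even) σ.ev)
      (D₁ : SignDecomposition (cohSumRep P Odd) σ.odd),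
      (((s (.ofAdd (θ m)) : ℤˣ) : ℤ) : ℂ) =
        Complex.I ^ ((D₀.nMinus (ρ m) : ℤ) - (D₁.nMinus (ρ m) : ℤ)) := fun m D₀ D₁ => by
    rw [hs, hF]
  obtain ⟨L⟩ := exists_localBases hP
  have hH := isHermitianEuler_iff σ hP hρ θ hθ hs'
  have hA := isArakelovEuler_iff σ hP
  have quotient : ∀ x y, IsHermitianEuler σ ρ θ x → IsArakelovEuler σ.metrics y →
      x * (arakelovToHermitian G y)⁻¹ = signatureClass s := fun x y hx hy => by
    obtain ⟨L₁, rfl⟩ := (hH x).mp hx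
    obtain ⟨L₂, rfl⟩ := (hA y).mp hy
    rw [arakelovClass_localBases σ hP L₂ L₁, mul_inv_cancel_right]
  refine ⟨⟨_, (hH _).mpr ⟨L, rfl⟩, fun x hx => ?_⟩, ⟨_, (hA _).mpr ⟨L, rfl⟩, fun y hy => ?_⟩,
    signDecomposition_nonempty _ σ.ev σ.ev_symm σ.ev_nondeg σ.ev_inv,
    signDecomposition_nonempty _ σ.odd σ.odd_symm σ.odd_nondeg σ.odd_inv, fun x y hx hy => ?_⟩
  · obtain ⟨L', rfl⟩ := (hH x).mp hx
    rw [arakelovClass_localBases σ hP L L']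
  · obtain ⟨L', rfl⟩ := (hA y).mp hy
    exact arakelovClass_localBases σ hP L L'
  · rw [quotient x y hx hy]
    exact ⟨⟨s, rfl⟩, s, rfl, hs'⟩
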